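/- **Theorem (complete integrability of the deformed Macdonald–Ruijsenaars operator).** Fix $n\ge 0$ and $q=e^{h}\in\mathbb C^\times$ not a root of unity; put $q^a:=e^{ha}$ and $[a]:=q^a-q^{-a}$. Let $V=\mathbb C^{n+1}$ with the bilinear form $(x,z)=\sum_i x_iz_i$ and $(T^vf)(x)=f(x+v)$. Difference operators are finite sums $\sum_{\nu\in P}a_\nu(x)T^\nu$ over the lattice $P=\mathbb Ze_1\oplus\dots\oplus\mathbb Ze_n\oplus\sqrt m\,\mathbb Ze_{n+1}$, where the $a_\nu$ are rational functions of $q^{x_1},\dots,q^{x_n},q^{\sqrt m x_{n+1}}$. For $m\in\mathbb C$ with $[m]\neq0$ the deformed Macdonald–Ruijsenaars operator is $$\widetilde D=\sum_{i=1}^n\widetilde a_iT^{e_i}+\widetilde a_{n+1}T^{\sqrt m e_{n+1}},\qquad \widetilde a_i=\frac{[x_i-\sqrt m x_{n+1}-\frac{m+1}2]}{[x_i-\sqrt m x_{n+1}-\frac{m-1}2]}\prod_{\substack{1\le j\le n\\ j\ne i}}\frac{[x_i-x_j-m]}{[x_i-x_j]},\qquad \widetilde a_{n+1}=\frac{[1]}{[m]}\prod_{j=1}^n\frac{[\sqrt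 m x_{n+1}-x_j-\frac{m+1}2]}{[\sqrt m x_{n+1}-x_j+\frac{m-1}2]} .$$ Let $\mathfrak m_s(z)=\sum_{i=1}^nq^{2sz_i}+\frac{[s]}{[sm]}q^{2s\sqrt m z_{n+1}}$ be the deformed power sums. For a positive integer $m$ let $R_+=\{e_i-e_j\}_{1\le i<j\le n}\cup\{e_i-\sqrt m e_{n+1}\}_{1\le i\le n}$ with multiplicities $m_\alpha=m$ on the first set and $m_\alpha=1$ on the second, and $\rho=\frac12\sum_{\alpha\in R_+}m_\alpha\alpha$. A normalized Baker–Akhiezer function is a function $\Psi(x,z)=q^{2(x,z)}\sum_\nu\psi_\nu(x)q^{2(\nu,z)}$ on $V\times V$ (a finite sum over $\nu\in\rho+P$ with $\nu\in\{-\rho+\sum_{\alpha\in R_+}l_\alpha\alpha: l_\alpha\in\mathbb R,\ 0\le l_\alpha\le m_\alpha\}$, and continuous $\psi_\nu$) such that $\Psi(x,z+\frac s2\alpha)=\Psi(x,z-\frac s2\alpha)$ whenever $\alpha\in R_+$, $1\le s\le m_\alpha$ and $q^{2(\alpha,z)}=1$, and such that $\psi_\rho(x)=\prod_{\alpha\in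 R_+}\prod_{j=1}^{m_\alpha}[(\alpha,\frac j2\alpha-x)]$. Then there are difference operators $D_1,\dots,D_{n+1}$ and $E_1,\dots,E_{n+1}$, depending on the parameter $m$, whose coefficients are rational functions of $t=q^m$ and of $q^{x_1},\dots,q^{x_n},q^{\sqrt m x_{n+1}}$, such that: 1. $D_s$ and $E_s$ are regular (they have a common denominator that does not vanish identically in $x$) at every $m\in\mathbb C$ with $[jm]\ne0$ for $1\le j\le s$; in particular all of them are regular whenever $\mathfrak m_1,\dots,\mathfrak m_{n+1}$ are all defined. 2. $D_1=E_1=\widetilde D$ for every $m$ with $[m]\neq 0$. 3. $D_sD_{s'}=D_{s'}D_s$ and $E_sE_{s'}=E_{s'}E_s$ for all $s,s'\le n+1$ and every $m\in\mathbb C$ such that $[jm]\ne0$ for $1\le j\le\max(s,s')$. 4. For every positive integer $m$ a normalized Baker–Akhiezer function exists, and every such function $\Psi$ satisfies $D_s\Psi=\mathfrak m_s(z)\Psi$ for $s=1,\dots,n+1$, where $D_s$ acts in $x$. 5. $D_s$ and $E_s$ are related by Newton's identities: $sE_s=\sum_{i=1}^s(-1)^{i-1}E_{s-i}D_i$ with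 $E_0=1$, for $1\le s\le n+1$ and every $m$ as in 1. 6. At $m=1$ the family $E_1,\dots,E_{n+1}$ coincides with the Macdonald–Ruijsenaars family: $E_s=\sum_{|I|=s}\prod_{i\in I,\,j\notin I}\frac{[x_i-x_j-1]}{[x_i-x_j]}\prod_{i\in I}T^{e_i}$, where $I\subseteq\{1,\dots,n+1\}$. Thus at $m=1$ the operators $D_s$ are the Newton power sums of that family. -/

import Mathlib

noncomputable section

/-! Fixed data: `n : ℕ`, and `h : ℂ`, a value of `log q`, so that `q ^ a := exp (h * a)`.
The ambient space is `V = ℂ ^ (n + 1)`; `m` is the deformation parameter. -/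

/-- `[a] = q ^ a - q ^ (-a)` for a number `a`. -/
def qnum (h a : ℂ) : ℂ := Complex.exp (h * a) - Complex.exp (-(h * a))

/-! ### Difference operators -/

/-- The torus element `ν` acts on polynomials in `X_0, …, X_n` by `X_i ↦ q ^ ν_i X_i` for `i < n`
and `X_n ↦ q ^ (m ν_n) X_n`. This is the shift by `∑_{i<n} ν_i e_i + ν_n √m e_{n+1}` when
`X_i = q ^ x_i` (`i < n`) and `X_n = q ^ (√m x_{n+1})`. -/
def shiftFactor (n : ℕ) (h m : ℂ) (ν : Fin (n + 1) → ℤ) (i : Fin (n + 1)) : ℂ :=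
  Complex.exp (h * (if i = Fin.last n then m else 1) * (ν i : ℂ))

theorem shiftFactor_add (n : ℕ) (h m : ℂ) (μ ν : Fin (n + 1) → ℤ) (i : Fin (n + 1)) :
    shiftFactor n h m (μ + ν) i = shiftFactor n h m μ i * shiftFactor n h m ν i := by
  simp only [shiftFactor, Pi.add_apply, Int.cast_add, mul_add, Complex.exp_add]

theorem shiftFactor_zero (n : ℕ) (h m : ℂ) (i : Fin (n + 1)) :
    shiftFactor n h m 0 i = 1 := by
  simp [shiftFactor]

def shiftHom (n : ℕ) (h m : ℂ) (ν : Fin (n + 1) → ℤ) :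
    MvPolynomial (Fin (n + 1)) ℂ →ₐ[ℂ] MvPolynomial (Fin (n + 1)) ℂ :=
  MvPolynomial.aeval fun i => MvPolynomial.C (shiftFactor n h m ν i) * MvPolynomial.X i

theorem shiftHom_comp (n : ℕ) (h m : ℂ) (μ ν : Fin (n + 1) → ℤ) :
    (shiftHom n h m μ).comp (shiftHom n h m ν) = shiftHom n h m (μ + ν) := by
  ext1 i
  simp only [shiftHom, AlgHom.comp_apply, MvPolynomial.aeval_X, map_mul, MvPolynomial.algHom_C,
    shiftFactor_add]
  simp only [MvPolynomial.algebraMap_eq]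
  ring

theorem shiftHom_zero (n : ℕ) (h m : ℂ) : shiftHom n h m 0 = AlgHom.id ℂ _ := by
  ext1 i
  simp [shiftHom, shiftFactor_zero]

def shiftEquiv (n : ℕ) (h m : ℂ) (ν : Fin (n + 1) → ℤ) :
    MvPolynomial (Fin (n + 1)) ℂ ≃+* MvPolynomial (Fin (n + 1)) ℂ :=
  (AlgEquiv.ofAlgHom (shiftHom n h m ν) (shiftHom n h m (-ν))
    (by rw [shiftHom_comp, add_neg_cancel, shiftHom_zero])
    (by rw [shiftHom_comp, neg_add_cancel, shiftHom_zero])).toRingEquiv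

/-- The shifts as a homomorphism from the lattice to the automorphisms of the polynomial ring. -/
def shiftAut (n : ℕ) (h m : ℂ) :
    Multiplicative (Fin (n + 1) → ℤ) →* RingAut (MvPolynomial (Fin (n + 1)) ℂ) where
  toFun ν := shiftEquiv n h m ν.toAdd
  map_one' := by
    ext1 p
    exact DFunLike.congr_fun (shiftHom_zero n h m) p
  map_mul' μ ν := by
    ext1 p
    exact (DFunLike.congr_fun (shiftHom_comp n h m μ.toAdd ν.toAdd) p).symm

/-- The coefficient field: rational functions in `X_i = q ^ x_i` (`i < n`) and
`X_n = q ^ (√m x_{n+1})`. The parameters `h m` only record which shifts act on it. -/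
@[nolint unusedArguments]
def CoeffField (n : ℕ) (_h _m : ℂ) : Type := FractionRing (MvPolynomial (Fin (n + 1)) ℂ)

instance (n : ℕ) (h m : ℂ) : Field (CoeffField n h m) :=
  inferInstanceAs (Field (FractionRing (MvPolynomial (Fin (n + 1)) ℂ)))

instance (n : ℕ) (h m : ℂ) : Algebra (MvPolynomial (Fin (n + 1)) ℂ) (CoeffField n h m) :=
  inferInstanceAs (Algebra (MvPolynomial (Fin (n + 1)) ℂ)
    (FractionRing (MvPolynomial (Fin (n + 1)) ℂ)))

instance (n : ℕ) (h m : ℂ) :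
    IsFractionRing (MvPolynomial (Fin (n + 1)) ℂ) (CoeffField n h m) :=
  inferInstanceAs (IsFractionRing (MvPolynomial (Fin (n + 1)) ℂ)
    (FractionRing (MvPolynomial (Fin (n + 1)) ℂ)))

/-- The shift action of the lattice on the coefficient field. -/
instance (n : ℕ) (h m : ℂ) :
    MulSemiringAction (Multiplicative (Fin (n + 1) → ℤ)) (CoeffField n h m) :=
  MulSemiringAction.compHom (CoeffField n h m)
    ((IsFractionRing.ringEquivOfRingEquivHom (MvPolynomial (Fin (n + 1)) ℂ)
      (CoeffField n h m)).comp (shiftAut n h m))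

/-- Difference operators `∑_ν a_ν T^ν` on the lattice
`P = ℤ e_1 ⊕ ⋯ ⊕ ℤ e_n ⊕ √m ℤ e_{n+1}`, with `(a T^μ) (b T^ν) = a (T^μ b) T^(μ + ν)`. -/
abbrev DiffOp (n : ℕ) (h m : ℂ) : Type :=
  SkewMonoidAlgebra (CoeffField n h m) (Multiplicative (Fin (n + 1) → ℤ))

/-- The operator `a T^ν`. -/
def DiffOp.term {n : ℕ} {h m : ℂ} (a : CoeffField n h m) (ν : Fin (n + 1) → ℤ) : DiffOp n h m :=
  SkewMonoidAlgebra.single (Multiplicative.ofAdd ν) a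

namespace CoeffField

variable {n : ℕ} {h m : ℂ}

/-- The coordinate function `X_i`. -/
def var (i : Fin (n + 1)) : CoeffField n h m :=
  algebraMap (MvPolynomial (Fin (n + 1)) ℂ) (CoeffField n h m) (MvPolynomial.X i)

/-- The constant `q ^ a`. -/
def qpow (a : ℂ) : CoeffField n h m :=
  algebraMap (MvPolynomial (Fin (n + 1)) ℂ) (CoeffField n h m)
    (MvPolynomial.C (Complex.exp (h * a)))

/-- `u - u⁻¹`, that is `[a]` for `u = q ^ a`. -/
def br (u : CoeffField n h m) : CoeffField n h m := u - u⁻¹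

end CoeffField

open CoeffField in
/-- The deformed Macdonald–Ruijsenaars operator. -/
def deformedOp (n : ℕ) (h m : ℂ) : DiffOp n h m :=
  (∑ i : Fin n, DiffOp.term
    (br (qpow (-((m + 1) / 2)) * (var i.castSucc / var (Fin.last n))) /
        br (qpow (-((m - 1) / 2)) * (var i.castSucc / var (Fin.last n))) *
      ∏ j ∈ Finset.univ.erase i,
        br (qpow (-m) * (var i.castSucc / var j.castSucc)) / br (var i.castSucc / var j.castSucc))
    (Pi.single i.castSucc 1)) +
  DiffOp.term
    (br (qpow 1) / br (qpow m) *
      ∏ j : Fin n,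
        br (qpow (-((m + 1) / 2)) * (var (Fin.last n) / var j.castSucc)) /
          br (qpow ((m - 1) / 2) * (var (Fin.last n) / var j.castSucc)))
    (Pi.single (Fin.last n) 1)

open CoeffField in
/-- The Macdonald–Ruijsenaars operators
`∑_{|I| = s} ∏_{i ∈ I, j ∉ I} [k + x_i - x_j] / [x_i - x_j] T^I` in `n + 1` variables
(all shifts are by unit steps, hence `m = 1` in the type). -/
def ruijsenaarsOp (n : ℕ) (h k : ℂ) (s : ℕ) : DiffOp n h 1 :=
  ∑ I ∈ Finset.powersetCard s (Finset.univ : Finset (Fin (n + 1))),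
    DiffOp.term
      (∏ i ∈ I, ∏ j ∈ Iᶜ, br (qpow k * (var i / var j)) / br (var i / var j))
      (fun i => if i ∈ I then 1 else 0)

/-- A difference operator whose coefficients are rational functions of `X_0, …, X_n` and of an
additional variable `t`, written over a common denominator. -/
structure DiffOpFamily (n : ℕ) where
  num : (Fin (n + 1) → ℤ) →₀ MvPolynomial (Fin (n + 1)) (Polynomial ℂ)
  den : MvPolynomial (Fin (n + 1)) (Polynomial ℂ)

namespace DiffOpFamily

variable {n : ℕ}

/-- Substitution `t = q ^ m` in a polynomial in `X_0, …, X_n, t`. -/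
def substParam (h m : ℂ) (p : MvPolynomial (Fin (n + 1)) (Polynomial ℂ)) :
    MvPolynomial (Fin (n + 1)) ℂ :=
  MvPolynomial.map (Polynomial.evalRingHom (Complex.exp (h * m))) p

/-- The denominator does not vanish identically at `t = q ^ m`. -/
def RegularAt (F : DiffOpFamily n) (h m : ℂ) : Prop := substParam h m F.den ≠ 0

/-- The operator at the parameter value `m` (meaningful if the family is regular there). -/
def spec (F : DiffOpFamily n) (h m : ℂ) : DiffOp n h m :=
  F.num.sum fun ν p => DiffOp.term
    (algebraMap (MvPolynomial (Fin (n + 1)) ℂ) (CoeffField n h m) (substParam h m p) /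
      algebraMap (MvPolynomial (Fin (n + 1)) ℂ) (CoeffField n h m) (substParam h m F.den)) ν

end DiffOpFamily

/-! ### The deformed root system and its Baker–Akhiezer function, for a positive integer `m` -/

/-- The `i`-th coordinate unit of the lattice `P`: `1` for `i < n`, and `√m` for the last one. -/
def unitLen (n m : ℕ) (i : Fin (n + 1)) : ℂ :=
  if i = Fin.last n then ((Real.sqrt (m : ℝ) : ℝ) : ℂ) else 1

/-- The point of `P` with integer coordinates `k`. -/
def latticePt (n m : ℕ) (k : Fin (n + 1) → ℤ) : Fin (n + 1) → ℂ :=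
  fun i => (k i : ℂ) * unitLen n m i

/-- For `i < j`, the positive root `e_i - e_j`, or `e_i - √m e_{n+1}` if `j` is the last index. -/
def posRoot (n m : ℕ) (i j : Fin (n + 1)) : Fin (n + 1) → ℂ :=
  Pi.single i (unitLen n m i) - Pi.single j (unitLen n m j)

/-- The multiplicity of `posRoot n m i j`, where `i < j`. -/
def rootMult (n m : ℕ) (j : Fin (n + 1)) : ℕ := if j = Fin.last n then 1 else m

/-- `ρ`, half the sum of the positive roots with multiplicities. -/
def rhoVec (n m : ℕ) : Fin (n + 1) → ℂ :=
  (1 / 2 : ℂ) • ∑ i : Fin (n + 1), ∑ j ∈ Finset.Ioi i, (rootMult n m j : ℂ) • posRoot n m i j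

/-- The polytope `{-ρ + ∑_{α > 0} l_α α | 0 ≤ l_α ≤ m_α}`. -/
def baPolytope (n m : ℕ) : Set (Fin (n + 1) → ℂ) :=
  {ν | ∃ l : Fin (n + 1) → Fin (n + 1) → ℝ,
    (∀ i j, i < j → 0 ≤ l i j ∧ l i j ≤ (rootMult n m j : ℝ)) ∧
    ν = -rhoVec n m + ∑ i : Fin (n + 1), ∑ j ∈ Finset.Ioi i, ((l i j : ℝ) : ℂ) • posRoot n m i j}

/-- `Ψ` is a normalized Baker–Akhiezer function of the deformed root system:
`Ψ(x, z) = q^{2(x,z)} ∑_ν ψ_ν(x) q^{2(ν,z)}`, a finite sum over points `ν` of `ρ + P = -ρ + P`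
lying in the polytope, with coefficients continuous in `x`, such that
`Ψ(x, z + sα/2) = Ψ(x, z - sα/2)` whenever `q^{2(α,z)} = 1` and `1 ≤ s ≤ m_α`, and such that
`ψ_ρ(x) = ∏_{α > 0} ∏_{l = 1}^{m_α} [(α, lα/2 - x)]`. -/
def IsNormalizedBA (n : ℕ) (h : ℂ) (m : ℕ)
    (Ψ : (Fin (n + 1) → ℂ) → (Fin (n + 1) → ℂ) → ℂ) : Prop :=
  (∃ ψ : (Fin (n + 1) → ℤ) →₀ ((Fin (n + 1) → ℂ) → ℂ),
    (∀ k ∈ ψ.support, latticePt n m k - rhoVec n m ∈ baPolytope n m) ∧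
    (∀ k, Continuous (ψ k)) ∧
    (∀ x z, Ψ x z = Complex.exp (h * (2 * dotProduct x z)) *
      ∑ k ∈ ψ.support,
        ψ k x * Complex.exp (h * (2 * dotProduct (latticePt n m k - rhoVec n m) z))) ∧
    (∀ k, latticePt n m k - rhoVec n m = rhoVec n m → ∀ x,
      ψ k x = ∏ i : Fin (n + 1), ∏ j ∈ Finset.Ioi i, ∏ l ∈ Finset.Icc 1 (rootMult n m j),
        qnum h (dotProduct (posRoot n m i j) (((l : ℂ) / 2) • posRoot n m i j - x)))) ∧
  (∀ x z, ∀ i j, i < j → ∀ s ∈ Finset.Icc 1 (rootMult n m j),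
    Complex.exp (h * (2 * dotProduct (posRoot n m i j) z)) = 1 →
    Ψ x (z + ((s : ℂ) / 2) • posRoot n m i j) = Ψ x (z - ((s : ℂ) / 2) • posRoot n m i j))

/-- The deformed power sum
`𝔪_s(z) = q^{2 s z_1} + ⋯ + q^{2 s z_n} + [s] / [s m] q^{2 s √m z_{n+1}}`. -/
def deformedPowerSum (n : ℕ) (h : ℂ) (m s : ℕ) (z : Fin (n + 1) → ℂ) : ℂ :=
  (∑ i : Fin n, Complex.exp (h * (2 * s * z i.castSucc))) +
    qnum h s / qnum h (s * m) *
      Complex.exp (h * (2 * s * ((Real.sqrt (m : ℝ) : ℝ) : ℂ) * z (Fin.last n)))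

/-- The value at `x` of a polynomial in `X_i = q^{x_i}` (`i < n`), `X_n = q^{√m x_{n+1}}`. -/
def evalAt (n : ℕ) (h : ℂ) (m : ℕ) (x : Fin (n + 1) → ℂ) (p : MvPolynomial (Fin (n + 1)) ℂ) : ℂ :=
  MvPolynomial.eval (fun i => Complex.exp (h * (unitLen n m i * x i))) p

/-- `A F = G`, where `(A F)(x) = ∑_ν a_ν(x) F(x + ν)`, with the poles of the coefficients cleared:
whenever `d a_ν = p_ν` with polynomials `d` and `p_ν`, one has
`∑_ν p_ν(x) F(x + ν) = d(x) G(x)` for all `x`. -/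
def DiffOp.MapsTo {n : ℕ} {h : ℂ} {m : ℕ} (A : DiffOp n h m)
    (F G : (Fin (n + 1) → ℂ) → ℂ) : Prop :=
  ∀ (d : MvPolynomial (Fin (n + 1)) ℂ)
    (p : Multiplicative (Fin (n + 1) → ℤ) → MvPolynomial (Fin (n + 1)) ℂ),
    (∀ ν, algebraMap (MvPolynomial (Fin (n + 1)) ℂ) (CoeffField n h m) (p ν) =
      algebraMap (MvPolynomial (Fin (n + 1)) ℂ) (CoeffField n h m) d * A.coeff ν) →
    ∀ x, ∑ ν ∈ A.coeff.support, evalAt n h m x (p ν) * F (x + latticePt n m ν.toAdd) =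
      evalAt n h m x d * G x

/-- `[m], [2m], …, [sm]` are nonzero, so that `𝔪_1, …, 𝔪_s` are all defined. -/
def PowerSumsDefined (h m : ℂ) (s : ℕ) : Prop :=
  ∀ j ∈ Finset.Icc 1 s, qnum h ((j : ℂ) * m) ≠ 0

end

/-! At a positive integer `m` everything follows from one formal object. Since `T^k` multiplies
`q^{2(x,z)}` by `q^{2(k,z)}`, the Baker–Akhiezer function is recorded as the difference operator `P
= ∑ ψ_k T^k`, and an eigenvalue equation becomes `A * P = P * f(T)` with `f` a polynomial with
constant coefficients. The conditions on the hyperplanes `q^{2(α,z)} = 1` become linear relations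
between the coefficients on each lattice line in direction `α` (`QuasiInv`). There are `m_α` of
them, of Vandermonde type, so for generic parameters every occupied line has width at least `m_α`
(`QuasiInv.hasWideStrings`). A planar sweep (`exists_width`) adds these widths up. A nonzero
quasi-invariant supported in the zonotope of the roots is therefore as wide as the zonotope in every
direction and reaches every vertex (`exists_wt_eq_suppFn`), so it is determined by one vertex
coefficient (`QuasiInv.eq_zero`).

Existence uses a dual difference operator in the spectral variables. It preserves polynomial
quasi-invariants (`dDen_dvd_dImage`, `polyQuasiInv_dImage`) and is triangular with respect to every
generic weight. Starting from a product that is zero on all walls, lower terms are removed until an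
eigenfunction remains (`exists_eigen`). Its eigenvalue determines its leading exponent in every
generic direction, and these exponents are the vertices of a translated zonotope
(`support_of_eigen`). The resulting coefficients lie in a fraction field. The ratios of coefficients
at the two ends of an edge are explicit (`edge_ends`), which gives all vertex coefficients up to one
common factor. Every prime of that factor divides all coefficients (`prime_dvd_of_quasiInv`), so the
factor can be removed, and the vertex coefficients become the explicit products `vtxProd`
(`exists_primitive`).

The operators `E_s` are written down directly: `elemOp` is a sum over subsets `A` of the first `n`
indices and a power `r` of the last shift, with `|A| + r = s`. The numerical factors are the
elementary symmetric functions attached by Newton's identities to the power sums `∑ X_i^r +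
([r]/[rm]) X_n^r`. The functions `cornerCoeff` are the quotients of a vertex coefficient of `P` by
its shift. Right multiplication by these power sums preserves quasi-invariance, and this is where
the factor `[r]/[rm]` comes from (`strSum_mul_powerOp`). Hence `E_s P - P e_s(T)` is quasi-invariant
and supported in a union of translated zonotopes. If it were nonzero, wide strings would force it to
contain one of certain corners (`exists_corner`), but its coefficients there cancel by the choice of
`cornerCoeff`. This proves `IsBakerAkhiezer.elemOp_mul`. The operators `D_s` are then defined by
Newton's identities, and they act on `P` through the power sums. Operators with the common
eigenfunction `P` commute because the ring of difference operators has no zero divisors.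

The coefficients are rational in `t = q^m`, with poles only where some `[jm]` with `j ≤ s` vanishes.
A rational family that is zero at all positive integers is zero, since the values `q^m` are
infinitely many (`IsFam.eq_zero`). So commutativity extends to all admissible complex `m`. The case
`s = 1` gives the deformed operator. At `m = 1` all numerical factors with `r ≥ 2` vanish, and the
pairs `(A, r)` that remain are the subsets of the `n + 1` indices (`elemOp_at_one`).

Finally the formal statements are moved to functions on `V × V`. Linear independence of the lattice
characters identifies the two forms of the conditions (`quasiInv_pointPar_iff`). Uniqueness at
generic `x`, together with continuity of the coefficients, gives uniqueness of the normalized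
function (`IsNormalizedBA.unique`). Evaluating the coefficients of `A * P = P * f(T)` gives the
eigenvalue equations (`DiffOp.mapsTo_latSum`). -/

noncomputable section

/-! ### Widths of finite sets along a pencil of functionals -/

/-- As the slope `c` decreases, the maximisers of `c κ + μ` move towards smaller `κ`. At each
special slope the maximal level contains two points whose `κ`-values differ by at least `w β`. These
steps do not overlap, so their lengths add, like edges along one side of a planar convex hull. -/
theorem exists_width {V ι : Type*} [DecidableEq ι] (S : Finset V) (hS : S.Nonempty) (κ μ : V → ℝ)
    (c w : ι → ℝ) (B : Finset ι) (hc : Set.InjOn c B)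
    (hB : ∀ β ∈ B, ∀ v ∈ S, ∃ v' ∈ S, ∃ v'' ∈ S, κ v' - κ v'' ≥ w β ∧
      c β * κ v' + μ v' = c β * κ v + μ v ∧ c β * κ v'' + μ v'' = c β * κ v + μ v) :
    ∃ a ∈ S, ∃ b ∈ S, κ a - κ b ≥ ∑ β ∈ B, w β := by
  have mono : ∀ c₀ c₁ : ℝ, c₁ < c₀ → ∀ a ∈ S, ∀ b ∈ S,
      (∀ v ∈ S, c₀ * κ v + μ v ≤ c₀ * κ a + μ a) →
      (∀ v ∈ S, c₁ * κ v + μ v ≤ c₁ * κ b + μ b) → κ b ≤ κ a := by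
    intro c₀ c₁ hlt a ha b hb h0 h1
    have e0 := h0 b hb
    have e1 := h1 a ha
    have : 0 ≤ (c₀ - c₁) * (κ a - κ b) := by linarith
    have h2 : 0 < c₀ - c₁ := by linarith
    nlinarith [nonneg_of_mul_nonneg_right this h2]
  -- For the induction, `b` must also bound `κ` from above on the maximisers for every slope below
  -- those already used. Slopes are inserted in decreasing order.
  suffices H : ∃ a ∈ S, ∃ b ∈ S, κ a - κ b ≥ ∑ β ∈ B, w β ∧ ∀ c', (∀ β ∈ B, c' < c β) →
      ∀ v ∈ S, (∀ u ∈ S, c' * κ u + μ u ≤ c' * κ v + μ v) → κ v ≤ κ b by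
    obtain ⟨a, ha, b, hb, h1, -⟩ := H
    exact ⟨a, ha, b, hb, h1⟩
  induction B using Finset.induction_on_max_value (fun β => -c β) with
  | empty =>
    obtain ⟨b, hb, hmax⟩ := S.exists_max_image κ hS
    exact ⟨b, hb, b, hb, by simp, fun _ _ v hv _ => hmax v hv⟩
  | insert β B hβ hmax ih =>
    obtain ⟨a, ha, b, hb, h1, h2⟩ := ih (hc.mono (by simp))
      (fun β' h' => hB β' (Finset.mem_insert_of_mem h'))
    obtain ⟨v, hv, hvmax⟩ := S.exists_max_image (fun v => c β * κ v + μ v) hS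
    obtain ⟨v', hv', v'', hv'', hw, e', e''⟩ := hB β (Finset.mem_insert_self _ _) v hv
    have hlt : ∀ β' ∈ B, c β < c β' := by
      intro β' h'
      refine lt_of_le_of_ne (by linarith [hmax β' h']) fun he => hβ ?_
      rwa [hc (by simp) (by simp [h']) he]
    have hb' : κ v' ≤ κ b := h2 (c β) hlt v' hv' (fun u hu => by rw [e']; exact hvmax u hu)
    refine ⟨a, ha, v'', hv'', ?_, ?_⟩
    · rw [Finset.sum_insert hβ]; linarith
    · intro c' hc' u hu humax
      refine mono (c β) c' (hc' β (Finset.mem_insert_self _ _)) v'' hv'' u hu ?_ humax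
      intro z hz; rw [e'']; exact hvmax z hz

/-! ### A Vandermonde argument -/

/-- Since `a b = κ` is the same for all `l`, one has `(a + b)(a^{t+1} - b^{t+1}) = (a^{t+2} -
b^{t+2}) + κ (a^t - b^t)`. The `M` hypotheses thus say that the weights `g (a - b)` at the nodes `a
+ b` annihilate all polynomials of degree below `M`. -/
theorem sum_mul_aeval_eq_zero {R ι : Type*} [CommRing R] (L : Finset ι) (g a b : ι → R) (κ : R)
    (hab : ∀ l ∈ L, a l * b l = κ) (M : ℕ)
    (hs : ∀ s ∈ Finset.Icc 1 M, ∑ l ∈ L, g l * (a l ^ s - b l ^ s) = 0)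
    (p : Polynomial R) (hp : p.natDegree < M) :
    ∑ l ∈ L, g l * (a l - b l) * p.eval (a l + b l) = 0 := by
  have key : ∀ s t : ℕ, s + t ≤ M →
      ∑ l ∈ L, g l * (a l ^ t - b l ^ t) * (a l + b l) ^ s = 0 := by
    intro s
    induction s with
    | zero =>
      intro t ht
      rcases Nat.eq_zero_or_pos t with rfl | h0
      · simp
      · simpa using hs t (by simp; omega)
    | succ s ih =>
      intro t ht
      rcases t with _ | t
      · simp
      have h1 := ih (t + 2) (by omega)
      have h2 := ih t (by omega)
      have : ∑ l ∈ L, g l * (a l ^ (t + 1) - b l ^ (t + 1)) * (a l + b l) ^ (s + 1) =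
          ∑ l ∈ L, g l * (a l ^ (t + 2) - b l ^ (t + 2)) * (a l + b l) ^ s +
          κ * ∑ l ∈ L, g l * (a l ^ t - b l ^ t) * (a l + b l) ^ s := by
        rw [Finset.mul_sum, ← Finset.sum_add_distrib]
        refine Finset.sum_congr rfl fun l hl => ?_
        rw [← hab l hl]; ring
      rw [this, h1, h2]; simp
  simp only [Polynomial.eval_eq_sum_range, Finset.mul_sum]
  rw [Finset.sum_comm]
  refine Finset.sum_eq_zero fun s hsr => ?_
  have := key s 1 (by simp at hsr; omega)
  calc _ = p.coeff s * ∑ l ∈ L, g l * (a l ^ 1 - b l ^ 1) * (a l + b l) ^ s := by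
        rw [Finset.mul_sum]; refine Finset.sum_congr rfl fun l _ => ?_; ring
    _ = 0 := by rw [this, mul_zero]

/-- The node polynomial `∏ (X - (a_l + b_l))` over a finite set. -/
theorem eval_prod_sub {R ι : Type*} [CommRing R] (L : Finset ι) (τ : ι → R) (x : R) :
    (∏ l ∈ L, (Polynomial.X - Polynomial.C (τ l))).eval x = ∏ l ∈ L, (x - τ l) := by
  simp [Polynomial.eval_prod]

theorem natDegree_prod_sub_le {R ι : Type*} [CommRing R] (L : Finset ι) (τ : ι → R) :
    (∏ l ∈ L, (Polynomial.X - Polynomial.C (τ l))).natDegree ≤ L.card := by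
  refine (Polynomial.natDegree_prod_le _ _).trans ?_
  refine (Finset.sum_le_card_nsmul _ _ 1 fun l _ => ?_).trans (by simp)
  exact Polynomial.natDegree_X_sub_C_le _

/-- With at most `M` nodes, the polynomial vanishing at all nodes but one has degree below `M` and
isolates a single weight. -/
theorem eq_zero_of_card_le {R ι : Type*} [CommRing R] [IsDomain R] [DecidableEq ι] (L : Finset ι)
    (g a b : ι → R) (κ : R)
    (hab : ∀ l ∈ L, a l * b l = κ) (M : ℕ) (hL : L.card ≤ M)
    (hs : ∀ s ∈ Finset.Icc 1 M, ∑ l ∈ L, g l * (a l ^ s - b l ^ s) = 0)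
    (hne : ∀ l ∈ L, a l ≠ b l)
    (hinj : ∀ l ∈ L, ∀ l' ∈ L, l ≠ l' → a l + b l ≠ a l' + b l') : ∀ l ∈ L, g l = 0 := by
  intro l hl
  have h := sum_mul_aeval_eq_zero L g a b κ hab M hs
    (∏ l' ∈ L.erase l, (Polynomial.X - Polynomial.C (a l' + b l')))
    (lt_of_le_of_lt (natDegree_prod_sub_le _ _)
      (by have := Finset.card_erase_lt_of_mem hl; omega))
  simp only [eval_prod_sub] at h
  rw [Finset.sum_eq_single l] at h
  · have h3 : ∏ l' ∈ L.erase l, (a l + b l - (a l' + b l')) ≠ 0 := by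
      refine Finset.prod_ne_zero_iff.2 fun l' hl' => ?_
      exact sub_ne_zero.2 (hinj l hl l' (Finset.mem_of_mem_erase hl')
        (Finset.ne_of_mem_erase hl').symm)
    have h2 := sub_ne_zero.2 (hne l hl)
    simpa [h3, h2] using h
  · intro l' hl' hne'
    rw [Finset.prod_eq_zero (Finset.mem_erase.2 ⟨hne', hl'⟩) (sub_self _), mul_zero]
  · exact fun h' => absurd hl h'

/-- With one node more than there are conditions, the test polynomial may still vanish at all nodes
but two, which leaves a proportionality between two weights. -/
theorem two_node {R ι : Type*} [CommRing R] [DecidableEq ι] (L : Finset ι)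
    (g a b : ι → R) (κ : R)
    (hab : ∀ l ∈ L, a l * b l = κ) (M : ℕ) (hL : L.card ≤ M + 1)
    (hs : ∀ s ∈ Finset.Icc 1 M, ∑ l ∈ L, g l * (a l ^ s - b l ^ s) = 0)
    (l l₀ : ι) (hl : l ∈ L) (hl₀ : l₀ ∈ L) (hne : l ≠ l₀) :
    g l * (a l - b l) * ∏ l' ∈ (L.erase l).erase l₀, (a l + b l - (a l' + b l')) +
      g l₀ * (a l₀ - b l₀) * ∏ l' ∈ (L.erase l).erase l₀, (a l₀ + b l₀ - (a l' + b l')) = 0 := by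
  have hl0' : l₀ ∈ L.erase l := Finset.mem_erase.2 ⟨hne.symm, hl₀⟩
  have h := sum_mul_aeval_eq_zero L g a b κ hab M hs
    (∏ l' ∈ (L.erase l).erase l₀, (Polynomial.X - Polynomial.C (a l' + b l')))
    (lt_of_le_of_lt (natDegree_prod_sub_le _ _)
      (by have := Finset.card_erase_lt_of_mem hl
          have := Finset.card_erase_lt_of_mem hl0'; omega))
  simp only [eval_prod_sub] at h
  rw [← Finset.add_sum_erase _ _ hl, ← Finset.add_sum_erase _ _ hl0', Finset.sum_eq_zero,
    add_zero] at h
  · exact h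
  · intro l' hl'
    rw [Finset.prod_eq_zero hl' (sub_self _), mul_zero]

end

noncomputable section

/-! ### The root lattice and the zonotope -/

/-- The scale `(unitLen n m i) ^ 2` of the `i`-th coordinate. -/
def latScale (n m : ℕ) (i : Fin (n + 1)) : ℤ := if i = Fin.last n then m else 1

/-- The root `ε_i - ε_j` in lattice coordinates. -/
def rootVec {n : ℕ} (i j : Fin (n + 1)) : Fin (n + 1) → ℤ := Pi.single i 1 - Pi.single j 1

/-- A linear functional on the lattice. -/
def wt {n : ℕ} (c : Fin (n + 1) → ℝ) (k : Fin (n + 1) → ℤ) : ℝ := ∑ a, c a * k a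

theorem wt_add {n : ℕ} (c : Fin (n + 1) → ℝ) (k k' : Fin (n + 1) → ℤ) :
    wt c (k + k') = wt c k + wt c k' := by
  simp [wt, mul_add, Finset.sum_add_distrib]

theorem wt_zsmul {n : ℕ} (c : Fin (n + 1) → ℝ) (t : ℤ) (k : Fin (n + 1) → ℤ) :
    wt c (t • k) = t * wt c k := by
  simp only [wt, Pi.smul_apply, smul_eq_mul, Int.cast_mul, Finset.mul_sum]
  exact Finset.sum_congr rfl fun _ _ => by ring

theorem wt_rootVec {n : ℕ} (c : Fin (n + 1) → ℝ) (i j : Fin (n + 1)) :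
    wt c (rootVec i j) = c i - c j := by
  simp [wt, rootVec, mul_sub, Finset.sum_sub_distrib, Pi.single_apply]

/-- `k = ∑_{i<j} l_ij (ε_i - ε_j)` with `0 ≤ l_ij ≤ m_ij`. -/
def IsZonoRep (n m : ℕ) (l : Fin (n + 1) → Fin (n + 1) → ℝ) (k : Fin (n + 1) → ℤ) : Prop :=
  (∀ i j, i < j → 0 ≤ l i j ∧ l i j ≤ (rootMult n m j : ℝ)) ∧
    ∀ a, (k a : ℝ) = ∑ i : Fin (n + 1), ∑ j ∈ Finset.Ioi i, l i j * (rootVec i j a : ℤ)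

/-- The zonotope spanned by the roots with their multiplicities. -/
def zonotope (n m : ℕ) : Set (Fin (n + 1) → ℤ) := {k | ∃ l, IsZonoRep n m l k}

theorem IsZonoRep.wt_eq {n m : ℕ} {l : Fin (n + 1) → Fin (n + 1) → ℝ} {k : Fin (n + 1) → ℤ}
    (h : IsZonoRep n m l k) (c : Fin (n + 1) → ℝ) :
    wt c k = ∑ i : Fin (n + 1), ∑ j ∈ Finset.Ioi i, l i j * (c i - c j) := by
  simp only [wt, h.2, ← wt_rootVec, Finset.mul_sum]
  rw [Finset.sum_comm]
  refine Finset.sum_congr rfl fun i _ => ?_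
  rw [Finset.sum_comm]
  exact Finset.sum_congr rfl fun j _ => Finset.sum_congr rfl fun a _ => by ring

/-- The support function of the zonotope. -/
def suppFn (n m : ℕ) (c : Fin (n + 1) → ℝ) : ℝ :=
  ∑ i : Fin (n + 1), ∑ j ∈ Finset.Ioi i, (rootMult n m j : ℝ) * max 0 (c i - c j)

theorem IsZonoRep.wt_le {n m : ℕ} {l : Fin (n + 1) → Fin (n + 1) → ℝ} {k : Fin (n + 1) → ℤ}
    (h : IsZonoRep n m l k) (c : Fin (n + 1) → ℝ) : wt c k ≤ suppFn n m c := by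
  rw [h.wt_eq]
  refine Finset.sum_le_sum fun i _ => Finset.sum_le_sum fun j hj => ?_
  have := h.1 i j (by simpa using hj)
  rcases le_total 0 (c i - c j) with h0 | h0
  · rw [max_eq_right h0]; exact mul_le_mul_of_nonneg_right this.2 h0
  · rw [max_eq_left h0, mul_zero]; exact mul_nonpos_of_nonneg_of_nonpos this.1 h0

/-- The bound by the support function holds term by term, so equality pins every coefficient whose
root is not orthogonal to `c` at an end of its interval. -/
theorem IsZonoRep.eq_of_wt_eq {n m : ℕ} {l : Fin (n + 1) → Fin (n + 1) → ℝ} {k : Fin (n + 1) → ℤ}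
    (h : IsZonoRep n m l k) (c : Fin (n + 1) → ℝ) (he : wt c k = suppFn n m c)
    {i j : Fin (n + 1)} (hij : i < j) (hne : c i ≠ c j) :
    l i j = if c j < c i then (rootMult n m j : ℝ) else 0 := by
  have hle : ∀ i, ∀ j ∈ Finset.Ioi i,
      l i j * (c i - c j) ≤ (rootMult n m j : ℝ) * max 0 (c i - c j) := by
    intro i j hj
    have := h.1 i j (by simpa using hj)
    rcases le_total 0 (c i - c j) with h0 | h0
    · rw [max_eq_right h0]; exact mul_le_mul_of_nonneg_right this.2 h0
    · rw [max_eq_left h0, mul_zero]; exact mul_nonpos_of_nonneg_of_nonpos this.1 h0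
  rw [h.wt_eq] at he
  have h1 := (Finset.sum_eq_sum_iff_of_le
    (fun i _ => Finset.sum_le_sum (hle i))).1 he i (Finset.mem_univ _)
  have h2 := (Finset.sum_eq_sum_iff_of_le (hle i)).1 h1 j (by simpa using hij)
  split_ifs with hlt
  · rw [max_eq_right (by linarith)] at h2
    exact mul_right_cancel₀ (sub_ne_zero.2 hne) h2
  · rw [max_eq_left (by linarith [not_lt.1 hlt]), mul_zero] at h2
    simpa [sub_ne_zero.2 hne] using h2

/-- The vertex of the zonotope exposed by the functional `c`. -/
def vtx (n m : ℕ) (c : Fin (n + 1) → ℝ) : Fin (n + 1) → ℤ :=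
  ∑ i : Fin (n + 1), ∑ j ∈ Finset.Ioi i, (if c j < c i then (rootMult n m j : ℤ) else 0) • rootVec i j

theorem isZonoRep_vtx (n m : ℕ) (c : Fin (n + 1) → ℝ) :
    IsZonoRep n m (fun i j => if c j < c i then (rootMult n m j : ℝ) else 0) (vtx n m c) := by
  refine ⟨fun i j _ => ?_, fun a => ?_⟩
  · dsimp only
    split_ifs <;> simp
  · simp only [vtx, Finset.sum_apply, Pi.smul_apply, smul_eq_mul, Int.cast_sum, Int.cast_mul]
    refine Finset.sum_congr rfl fun i _ => Finset.sum_congr rfl fun j _ => ?_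
    split_ifs <;> simp

/-- If `c'` arises from `c` by allowing ties, the vertex exposed by `c` lies on the face exposed by
`c'`. -/
theorem wt_vtx (n m : ℕ) {c c' : Fin (n + 1) → ℝ} (hc : Function.Injective c)
    (h : ∀ i j, c i < c j → c' i ≤ c' j) : wt c' (vtx n m c) = suppFn n m c' := by
  rw [(isZonoRep_vtx n m c).wt_eq]
  refine Finset.sum_congr rfl fun i _ => Finset.sum_congr rfl fun j hj => ?_
  have hne : c i ≠ c j := hc.ne (by simp at hj; exact hj.ne)
  split_ifs with hlt
  · rw [max_eq_right (by linarith [h j i hlt])]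
  · rw [max_eq_left (by linarith [h i j (lt_of_le_of_ne (not_lt.1 hlt) hne)])]; simp

theorem wt_vtx_self (n m : ℕ) (c : Fin (n + 1) → ℝ) : wt c (vtx n m c) = suppFn n m c := by
  rw [(isZonoRep_vtx n m c).wt_eq]
  refine Finset.sum_congr rfl fun i _ => Finset.sum_congr rfl fun j _ => ?_
  split_ifs with h
  · rw [max_eq_right (by linarith)]
  · rw [max_eq_left (by linarith)]; simp

theorem eq_vtx_of_wt_eq {n m : ℕ} {c : Fin (n + 1) → ℝ} (hc : Function.Injective c)
    {k : Fin (n + 1) → ℤ} (hk : k ∈ zonotope n m) (he : wt c k = suppFn n m c) :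
    k = vtx n m c := by
  obtain ⟨l, hl⟩ := hk
  ext a
  have : (k a : ℝ) = vtx n m c a := by
    rw [hl.2, (isZonoRep_vtx n m c).2]
    refine Finset.sum_congr rfl fun i _ => Finset.sum_congr rfl fun j hj => ?_
    rw [hl.eq_of_wt_eq c he (by simpa using hj) (hc.ne (by simp at hj; exact hj.ne))]
  exact_mod_cast this

theorem neg_suppFn_le {n m : ℕ} (c : Fin (n + 1) → ℝ) {k : Fin (n + 1) → ℤ}
    (hk : k ∈ zonotope n m) : -suppFn n m (-c) ≤ wt c k := by
  obtain ⟨l, hl⟩ := hk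
  have := hl.wt_le (-c)
  have e : wt (-c) k = - wt c k := by simp [wt]
  linarith

/-- The left side is the width of the zonotope in direction `c`; it is the sum of the widths of the
generating segments. -/
theorem suppFn_add_neg (n m : ℕ) (c : Fin (n + 1) → ℝ) :
    suppFn n m c + suppFn n m (-c) =
      ∑ i : Fin (n + 1), ∑ j ∈ Finset.Ioi i, (rootMult n m j : ℝ) * |c i - c j| := by
  simp only [suppFn, ← Finset.sum_add_distrib]
  refine Finset.sum_congr rfl fun i _ => Finset.sum_congr rfl fun j _ => ?_
  rw [← mul_add]; congr 1
  simp only [Pi.neg_apply]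
  rcases le_total 0 (c i - c j) with h0 | h0
  · rw [max_eq_right h0, max_eq_left (by linarith), abs_of_nonneg h0, add_zero]
  · rw [max_eq_left h0, max_eq_right (by linarith), abs_of_nonpos h0]; ring

/-- Every line of `S` in the direction `ε_i - ε_j` has width at least `w`. -/
def HasWideStrings {n : ℕ} (S : Finset (Fin (n + 1) → ℤ)) (i j : Fin (n + 1)) (w : ℕ) : Prop :=
  ∀ k ∈ S, ∃ t₁ t₂ : ℤ, k + t₁ • rootVec i j ∈ S ∧ k + t₂ • rootVec i j ∈ S ∧ (w : ℤ) ≤ t₁ - t₂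

/-- For pairwise distinct directions there is a functional with pairwise distinct slopes. -/
theorem exists_slopes {n : ℕ} (c : Fin (n + 1) → ℝ) :
    ∃ μ : Fin (n + 1) → ℝ, ∀ i j i' j', i < j → i' < j' → c i ≠ c j → c i' ≠ c j' →
      (μ i - μ j) / (c i - c j) = (μ i' - μ j') / (c i' - c j') → i = i' ∧ j = j' := by
  classical
  -- Candidates for `μ` are taken on the moment curve `i ↦ t^i`. The slope of a pair is then a
  -- polynomial in `t`, distinct pairs give distinct polynomials, and `t` only has to avoid finitely
  -- many roots.
  let p : Fin (n + 1) × Fin (n + 1) → Polynomial ℝ := fun β =>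
    Polynomial.C (c β.1 - c β.2)⁻¹ * (Polynomial.X ^ (β.1 : ℕ) - Polynomial.X ^ (β.2 : ℕ))
  let B : Finset (Fin (n + 1) × Fin (n + 1)) :=
    Finset.univ.filter fun β => β.1 < β.2 ∧ c β.1 ≠ c β.2
  let P : Polynomial ℝ := ∏ β ∈ B ×ˢ B, if β.1 = β.2 then 1 else p β.1 - p β.2
  have hP : P ≠ 0 := by
    refine Finset.prod_ne_zero_iff.2 ?_
    rintro ⟨β, γ⟩ hβγ
    dsimp only
    split_ifs with heq
    · exact one_ne_zero
    · intro h0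
      apply heq
      simp only [B, Finset.mem_product, Finset.mem_filter, Finset.mem_univ, true_and] at hβγ
      obtain ⟨⟨hb, hb'⟩, hg, hg'⟩ := hβγ
      obtain ⟨⟨i, hi⟩, ⟨j, hj⟩⟩ := β
      obtain ⟨⟨i', hi'⟩, ⟨j', hj'⟩⟩ := γ
      simp only [Fin.mk_lt_mk] at hb hg
      have hb0 := inv_ne_zero (sub_ne_zero.2 hb')
      have hg0 := inv_ne_zero (sub_ne_zero.2 hg')
      have hcoef : ∀ t, (p (⟨i, hi⟩, ⟨j, hj⟩)).coeff t = (p (⟨i', hi'⟩, ⟨j', hj'⟩)).coeff t := by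
        rw [sub_eq_zero.1 h0]; simp
      simp only [p, Polynomial.coeff_C_mul, Polynomial.coeff_sub, Polynomial.coeff_X_pow] at hcoef
      have h1 := hcoef i
      have h2 := hcoef j
      have h3 := hcoef i'
      have h4 := hcoef j'
      have e1 : i = i' := by
        by_contra hne
        grind
      have e2 : j = j' := by
        grind
      subst e1; subst e2; rfl
  obtain ⟨t, ht⟩ : ∃ t, P.eval t ≠ 0 := by
    by_contra! hcon
    exact hP (Polynomial.funext fun t => by simpa using hcon t)
  refine ⟨fun i => t ^ (i : ℕ), fun i j i' j' hij hij' hc hc' he => ?_⟩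
  by_contra hne
  apply ht
  simp only [P, Polynomial.eval_prod]
  refine Finset.prod_eq_zero (i := ((i, j), (i', j'))) (by simp [B, *]) ?_
  rw [if_neg (by simpa using hne)]
  simp only [p, Polynomial.eval_sub, Polynomial.eval_mul, Polynomial.eval_C, Polynomial.eval_pow,
    Polynomial.eval_X]
  rw [sub_eq_zero, inv_mul_eq_div, inv_mul_eq_div, he]

/-- In the pencil spanned by `wt c` and a generic `wt μ`, each root not orthogonal to `c` has its
own slope, and its strings contribute `m_α |c_i - c_j|`. The total is the full width of the
zonotope, so `S`, lying inside it, must touch the exposed face. -/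
theorem exists_wt_eq_suppFn {n m : ℕ} (S : Finset (Fin (n + 1) → ℤ)) (hS : S.Nonempty)
    (hZ : ∀ k ∈ S, k ∈ zonotope n m) (c : Fin (n + 1) → ℝ)
    (hw : ∀ i j, i < j → c i ≠ c j → HasWideStrings S i j (rootMult n m j)) :
    ∃ k ∈ S, wt c k = suppFn n m c := by
  classical
  obtain ⟨μ, hμ⟩ := exists_slopes c
  let B : Finset (Fin (n + 1) × Fin (n + 1)) :=
    Finset.univ.filter fun β => β.1 < β.2 ∧ c β.1 ≠ c β.2
  obtain ⟨a, ha, b, hb, hab⟩ := exists_width S hS (wt c) (wt μ)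
    -- This is the slope for which the member of the pencil is constant along the root of `β`.
    (fun β : Fin (n + 1) × Fin (n + 1) => -((μ β.1 - μ β.2) / (c β.1 - c β.2)))
    (fun β => (rootMult n m β.2 : ℝ) * |c β.1 - c β.2|) B
    (by
      rintro ⟨i, j⟩ hβ ⟨i', j'⟩ hγ he
      simp only [B, Finset.coe_filter, Finset.mem_univ, true_and, Set.mem_ofPred_eq] at hβ hγ
      have := hμ i j i' j' hβ.1 hγ.1 hβ.2 hγ.2 (neg_injective he)
      simp [this.1, this.2])
    (by
      rintro ⟨i, j⟩ hβ k hk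
      simp only [B, Finset.mem_filter, Finset.mem_univ, true_and] at hβ
      obtain ⟨t₁, t₂, h1, h2, h12⟩ := hw i j hβ.1 hβ.2 k hk
      have h12' : (rootMult n m j : ℝ) ≤ t₁ - t₂ := by exact_mod_cast h12
      have hc0 := sub_ne_zero.2 hβ.2
      have hcst : ∀ t : ℤ, -((μ i - μ j) / (c i - c j)) * wt c (k + t • rootVec i j) +
          wt μ (k + t • rootVec i j) = -((μ i - μ j) / (c i - c j)) * wt c k + wt μ k := by
        intro t
        simp only [wt_add, wt_zsmul, wt_rootVec]
        field_simp
        ring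
      rcases lt_or_gt_of_ne hβ.2 with hlt | hlt
      · refine ⟨_, h2, _, h1, ?_, hcst _, hcst _⟩
        simp only [wt_add, wt_zsmul, wt_rootVec]
        rw [abs_of_neg (by linarith)]
        nlinarith
      · refine ⟨_, h1, _, h2, ?_, hcst _, hcst _⟩
        simp only [wt_add, wt_zsmul, wt_rootVec]
        rw [abs_of_pos (by linarith)]
        nlinarith)
  have hsum : ∑ β ∈ B, (rootMult n m β.2 : ℝ) * |c β.1 - c β.2| =
      suppFn n m c + suppFn n m (-c) := by
    rw [suppFn_add_neg, Finset.sum_filter, Fintype.sum_prod_type]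
    refine Finset.sum_congr rfl fun i _ => ?_
    rw [← Finset.filter_lt_eq_Ioi, Finset.sum_filter]
    refine Finset.sum_congr rfl fun j _ => ?_
    dsimp only
    by_cases hij : i < j
    · by_cases hc : c i = c j <;> simp [hij, hc]
    · simp [hij]
  refine ⟨a, ha, le_antisymm ?_ ?_⟩
  · obtain ⟨l, hl⟩ := hZ a ha
    exact hl.wt_le c
  · have := neg_suppFn_le c (hZ b hb)
    rw [hsum] at hab
    linarith

end

noncomputable section

/-! ### Quasi-invariance -/

theorem zpow_injective_of_pow_ne_one {q : ℂ} (hq0 : q ≠ 0) (hq : ∀ k : ℕ, 0 < k → q ^ k ≠ 1) :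
    Function.Injective fun a : ℤ => q ^ a := by
  have key : ∀ a b : ℤ, a < b → q ^ a ≠ q ^ b := by
    intro a b hab he
    refine hq (b - a).toNat (by omega) ?_
    rw [← zpow_natCast, Int.toNat_of_nonneg (by omega), zpow_sub₀ hq0, ← he]
    exact div_self (zpow_ne_zero _ hq0)
  intro a b he
  by_contra hne
  rcases lt_or_gt_of_ne hne with h | h
  · exact key _ _ h he
  · exact key _ _ h he.symm

/-- The coordinates of the image of `k` in the quotient of the lattice by `ε_i - ε_j`. -/
def mergeIdx {n : ℕ} (i j : Fin (n + 1)) (k : Fin (n + 1) → ℤ) : Fin (n + 1) → ℤ :=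
  fun a => if a = j then 0 else if a = i then k i + k j else k a

theorem mergeIdx_add {n : ℕ} (i j : Fin (n + 1)) (k k' : Fin (n + 1) → ℤ) :
    mergeIdx i j (k + k') = mergeIdx i j k + mergeIdx i j k' := by
  ext a
  simp only [mergeIdx, Pi.add_apply]
  split_ifs <;> ring

theorem rootVec_apply_left {n : ℕ} {i j : Fin (n + 1)} (hij : i ≠ j) : rootVec i j i = 1 := by
  simp [rootVec, hij]

theorem rootVec_apply_right {n : ℕ} {i j : Fin (n + 1)} (hij : i ≠ j) : rootVec i j j = -1 := by
  simp [rootVec, hij.symm]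

theorem rootVec_apply_of_ne {n : ℕ} {i j a : Fin (n + 1)} (hi : a ≠ i) (hj : a ≠ j) :
    rootVec i j a = 0 := by
  simp [rootVec, hi, hj]

theorem mergeIdx_rootVec {n : ℕ} {i j : Fin (n + 1)} (hij : i ≠ j) (k : Fin (n + 1) → ℤ) (t : ℤ) :
    mergeIdx i j (k + t • rootVec i j) = mergeIdx i j k := by
  ext a
  simp only [mergeIdx, Pi.add_apply, Pi.smul_apply, smul_eq_mul]
  split_ifs with h1 h2
  · rfl
  · rw [rootVec_apply_left hij, rootVec_apply_right hij]; ring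
  · rw [rootVec_apply_of_ne h2 h1]; ring

/-- The fibres of `mergeIdx i j` are the lattice lines in the direction of the root, so the
conditions in `QuasiInv` are conditions on single lines. -/
theorem eq_add_of_mergeIdx_eq {n : ℕ} {i j : Fin (n + 1)} (hij : i ≠ j) {k k' : Fin (n + 1) → ℤ}
    (h : mergeIdx i j k' = mergeIdx i j k) : k' = k + (k' i - k i) • rootVec i j := by
  ext a
  have ha := congrFun h a
  have hi := congrFun h i
  simp only [mergeIdx, if_neg hij, if_true] at ha hi
  simp only [Pi.add_apply, Pi.smul_apply, smul_eq_mul]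
  by_cases h1 : a = j
  · subst h1; rw [rootVec_apply_right hij]; linarith
  · by_cases h2 : a = i
    · subst h2; rw [rootVec_apply_left hij]; linarith
    · rw [if_neg h1, if_neg h2, if_neg h1, if_neg h2] at ha
      rw [rootVec_apply_of_ne h2 h1]; linarith

/-- The value `(ε_i - ε_j, k)` of the form with scales `latScale`. -/
def rootForm (n m : ℕ) (i j : Fin (n + 1)) (k : Fin (n + 1) → ℤ) : ℤ :=
  latScale n m i * k i - latScale n m j * k j

theorem rootForm_add (n m : ℕ) (i j : Fin (n + 1)) (k k' : Fin (n + 1) → ℤ) :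
    rootForm n m i j (k + k') = rootForm n m i j k + rootForm n m i j k' := by
  simp only [rootForm, Pi.add_apply]; ring

theorem rootForm_rootVec (n m : ℕ) {i j : Fin (n + 1)} (hij : i ≠ j) (k : Fin (n + 1) → ℤ)
    (t : ℤ) : rootForm n m i j (k + t • rootVec i j) =
      rootForm n m i j k + t * (latScale n m i + latScale n m j) := by
  simp only [rootForm, Pi.add_apply, Pi.smul_apply, smul_eq_mul, rootVec_apply_left hij,
    rootVec_apply_right hij]
  ring

theorem latScale_pos {n m : ℕ} (hm : 0 < m) (i : Fin (n + 1)) : 0 < latScale n m i := by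
  unfold latScale; split_ifs <;> omega

section

variable {A : Type*} [CommRing A] [Algebra ℂ A]

/-- The weight of the `k`-th coefficient in the `s`-th condition for the root `ε_i - ε_j`. -/
def strWeight (q : ℂ) (n m : ℕ) (ζ : Fin (n + 1) → A) (i j : Fin (n + 1)) (s : ℕ)
    (k : Fin (n + 1) → ℤ) : A :=
  (algebraMap ℂ A (q ^ rootForm n m i j k) * ζ i) ^ s -
    (algebraMap ℂ A (q ^ (-rootForm n m i j k)) * ζ j) ^ s

open Classical in
/-- Coefficientwise form of the conditions on `∑_k F_k w^k` with spectral parameters `ζ`. -/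
def QuasiInv (q : ℂ) (n m : ℕ) (ζ : Fin (n + 1) → A) (F : (Fin (n + 1) → ℤ) →₀ A) : Prop :=
  ∀ i j, i < j → ∀ s ∈ Finset.Icc 1 (rootMult n m j), ∀ c,
    F.sum (fun k a => if mergeIdx i j k = c then a * strWeight q n m ζ i j s k else 0) = 0

/-- Base change is used in three ways: into the fraction field, modulo a prime, and to values at a
point. -/
theorem quasiInv_map {A' : Type*} [CommRing A'] [Algebra ℂ A'] (f : A →ₐ[ℂ] A') {q : ℂ} {n m : ℕ}
    {ζ : Fin (n + 1) → A} {F : (Fin (n + 1) → ℤ) →₀ A} (hF : QuasiInv q n m ζ F) :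
    QuasiInv q n m (fun i => f (ζ i)) (F.mapRange f (map_zero f)) := by
  intro i j hij s hs c
  rw [Finsupp.sum_mapRange_index (by intros; simp)]
  have := congrArg f (hF i j hij s hs c)
  rw [map_zero, Finsupp.sum, map_sum] at this
  refine Eq.trans ?_ this
  refine Finset.sum_congr rfl fun k _ => ?_
  rw [apply_ite f, map_zero]
  simp [strWeight]

theorem quasiInv_of_injective {A' : Type*} [CommRing A'] [Algebra ℂ A'] (f : A →ₐ[ℂ] A')
    (hf : Function.Injective f) {q : ℂ} {n m : ℕ}
    {ζ : Fin (n + 1) → A} {F : (Fin (n + 1) → ℤ) →₀ A}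
    (hF : QuasiInv q n m (fun i => f (ζ i)) (F.mapRange f (map_zero f))) :
    QuasiInv q n m ζ F := by
  intro i j hij s hs c
  have := hF i j hij s hs c
  rw [Finsupp.sum_mapRange_index (by intros; simp)] at this
  apply hf
  rw [map_zero, Finsupp.sum, map_sum]
  refine Eq.trans ?_ this
  refine Finset.sum_congr rfl fun k _ => ?_
  rw [apply_ite f, map_zero]
  simp [strWeight]

theorem QuasiInv.smul {q : ℂ} {n m : ℕ} {ζ : Fin (n + 1) → A} {F : (Fin (n + 1) → ℤ) →₀ A}
    (hF : QuasiInv q n m ζ F) (a : A) : QuasiInv q n m ζ (a • F) := by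
  intro i j hij s hs c
  rw [Finsupp.sum_smul_index (by intros; simp)]
  have := congrArg (a * ·) (hF i j hij s hs c)
  simp only [Finsupp.sum, Finset.mul_sum, mul_zero] at this
  refine Eq.trans ?_ this
  refine Finset.sum_congr rfl fun k _ => ?_
  simp only [mul_ite, mul_zero, mul_assoc]

theorem quasiInv_of_smul [IsDomain A] {q : ℂ} {n m : ℕ} {ζ : Fin (n + 1) → A}
    {F : (Fin (n + 1) → ℤ) →₀ A} {a : A} (ha : a ≠ 0)
    (hF : QuasiInv q n m ζ (a • F)) : QuasiInv q n m ζ F := by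
  intro i j hij s hs c
  have h := hF i j hij s hs c
  rw [Finsupp.sum_smul_index (by intros; simp)] at h
  refine (mul_eq_zero.1 (?_ : a * _ = 0)).resolve_left ha
  rw [Finsupp.sum, Finset.mul_sum]
  refine Eq.trans ?_ h
  refine Finset.sum_congr rfl fun k _ => ?_
  simp only [mul_ite, mul_zero, mul_assoc]

theorem QuasiInv.add {q : ℂ} {n m : ℕ} {ζ : Fin (n + 1) → A} {F G : (Fin (n + 1) → ℤ) →₀ A}
    (hF : QuasiInv q n m ζ F) (hG : QuasiInv q n m ζ G) : QuasiInv q n m ζ (F + G) := by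
  classical
  intro i j hij s hs c
  rw [Finsupp.sum_add_index (by intros; simp) (by intros; split_ifs <;> ring),
    hF i j hij s hs c, hG i j hij s hs c, add_zero]

theorem QuasiInv.sub {q : ℂ} {n m : ℕ} {ζ : Fin (n + 1) → A} {F G : (Fin (n + 1) → ℤ) →₀ A}
    (hF : QuasiInv q n m ζ F) (hG : QuasiInv q n m ζ G) : QuasiInv q n m ζ (F - G) := by
  have := hF.add (hG.smul (-1))
  simpa [sub_eq_add_neg] using this

/-- `ζ_i / ζ_j` is not an integral power of `q`. -/
def GenericPair (q : ℂ) {n : ℕ} (ζ : Fin (n + 1) → A) (i j : Fin (n + 1)) : Prop :=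
  ∀ a : ℤ, ζ i ≠ algebraMap ℂ A (q ^ a) * ζ j

open Classical in
theorem QuasiInv.sum_eq_zero {q : ℂ} {n m : ℕ} {ζ : Fin (n + 1) → A}
    {F : (Fin (n + 1) → ℤ) →₀ A} (hF : QuasiInv q n m ζ F) {i j : Fin (n + 1)} (hij : i < j)
    (k : Fin (n + 1) → ℤ) (L : Finset (Fin (n + 1) → ℤ))
    (hL : ∀ k' ∈ L, mergeIdx i j k' = mergeIdx i j k)
    (hL' : ∀ k' ∈ F.support, mergeIdx i j k' = mergeIdx i j k → k' ∈ L) :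
    ∀ s ∈ Finset.Icc 1 (rootMult n m j), ∑ k' ∈ L, F k' *
      ((algebraMap ℂ A (q ^ rootForm n m i j k') * ζ i) ^ s -
        (algebraMap ℂ A (q ^ (-rootForm n m i j k')) * ζ j) ^ s) = 0 := by
  intro s hs
  have h := hF i j hij s hs (mergeIdx i j k)
  rw [Finsupp.sum, ← Finset.sum_filter] at h
  rw [← h]
  symm
  refine Finset.sum_subset (fun k' hk' => ?_) (fun k' hk' hk'' => ?_)
  · rw [Finset.mem_filter] at hk'
    exact hL' k' hk'.1 hk'.2
  · have : F k' = 0 := by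
      by_contra h0
      exact hk'' (Finset.mem_filter.2 ⟨Finsupp.mem_support_iff.2 h0, hL k' hk'⟩)
    rw [this, zero_mul]

/-- The nodes `q^d x + q^{-d} y` differ by a constant times a linear factor `x - q^k y`. Genericity
of the ratio thus separates the nodes, and their differences are the factors in the edge relations.
-/
theorem node_sub {q : ℂ} (hq0 : q ≠ 0) (x y : A) (d d' : ℤ) :
    algebraMap ℂ A (q ^ d) * x + algebraMap ℂ A (q ^ (-d)) * y -
      (algebraMap ℂ A (q ^ d') * x + algebraMap ℂ A (q ^ (-d')) * y) =
    algebraMap ℂ A (q ^ d - q ^ d') * (x - algebraMap ℂ A (q ^ (-d - d')) * y) := by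
  have h1 : (q ^ d - q ^ d') * q ^ (-d - d') = q ^ (-d') - q ^ (-d) := by
    rw [sub_mul, ← zpow_add₀ hq0, ← zpow_add₀ hq0]; congr 2 <;> ring
  have h2 := congrArg (algebraMap ℂ A) h1
  simp only [map_sub, map_mul] at h2 ⊢
  linear_combination y * h2

theorem node_diff {q : ℂ} (hq0 : q ≠ 0) (x y : A) (d : ℤ) :
    algebraMap ℂ A (q ^ d) * x - algebraMap ℂ A (q ^ (-d)) * y =
    algebraMap ℂ A (q ^ d) * (x - algebraMap ℂ A (q ^ (-d - d)) * y) := by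
  have h1 : q ^ d * q ^ (-d - d) = q ^ (-d) := by
    rw [← zpow_add₀ hq0]; congr 1; ring
  have h2 := congrArg (algebraMap ℂ A) h1
  simp only [map_mul] at h2
  linear_combination y * h2

theorem node_mul {q : ℂ} (hq0 : q ≠ 0) (x y : A) (d : ℤ) :
    algebraMap ℂ A (q ^ d) * x * (algebraMap ℂ A (q ^ (-d)) * y) = x * y := by
  have h1 : q ^ d * q ^ (-d) = 1 := by
    rw [← zpow_add₀ hq0]; simp
  have h2 := congrArg (algebraMap ℂ A) h1
  simp only [map_mul, map_one] at h2
  linear_combination x * y * h2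

/-- A line of width below `m_α` carries at most `m_α` points. Their nodes are distinct for generic
parameters, so the `m_α` conditions would make all coefficients on the line vanish. -/
theorem QuasiInv.hasWideStrings [IsDomain A] {q : ℂ} (hq0 : q ≠ 0)
    (hq : ∀ k : ℕ, 0 < k → q ^ k ≠ 1) {n m : ℕ} (hm : 0 < m) {ζ : Fin (n + 1) → A}
    {F : (Fin (n + 1) → ℤ) →₀ A} (hF : QuasiInv q n m ζ F) {i j : Fin (n + 1)} (hij : i < j)
    (hg : GenericPair q ζ i j) : HasWideStrings F.support i j (rootMult n m j) := by
  classical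
  intro k hk
  by_contra! hcon
  let L := F.support.filter fun k' => mergeIdx i j k' = mergeIdx i j k
  have hkL : k ∈ L := by simpa [L] using hk
  have hmem : ∀ k' ∈ L, k' = k + (k' i - k i) • rootVec i j := fun k' hk' =>
    eq_add_of_mergeIdx_eq hij.ne (Finset.mem_filter.1 hk').2
  have hdiff : ∀ k' ∈ L, ∀ k'' ∈ L, k' i - k'' i < rootMult n m j := by
    intro k' hk' k'' hk''
    have h1 := (Finset.mem_filter.1 hk').1
    have h2 := (Finset.mem_filter.1 hk'').1
    rw [hmem k' hk'] at h1
    rw [hmem k'' hk''] at h2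
    have := hcon _ _ h1 h2
    omega
  have hinj : ∀ k' ∈ L, ∀ k'' ∈ L, k' i = k'' i → k' = k'' := by
    intro k' hk' k'' hk'' he
    rw [hmem k' hk', hmem k'' hk'', he]
  have hcard : L.card ≤ rootMult n m j := by
    obtain ⟨k₀, hk₀, hmin⟩ := L.exists_min_image (fun k' => k' i) ⟨k, hkL⟩
    have : L.card ≤ (Finset.Ico (k₀ i) (k₀ i + rootMult n m j)).card := by
      refine Finset.card_le_card_of_injOn (fun k' => k' i) (fun k' hk' => ?_)
        (fun k' hk' k'' hk'' he => hinj k' hk' k'' hk'' he)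
      have h1 := hmin k' hk'
      have h2 := hdiff k' hk' k₀ hk₀
      simp only [Finset.coe_Ico, Set.mem_Ico]
      exact ⟨h1, by omega⟩
    simpa using this
  have hzinj := zpow_injective_of_pow_ne_one hq0 hq
  have hF0 := eq_zero_of_card_le L F
    (fun k' => algebraMap ℂ A (q ^ rootForm n m i j k') * ζ i)
    (fun k' => algebraMap ℂ A (q ^ (-rootForm n m i j k')) * ζ j) (ζ i * ζ j)
    (fun k' _ => node_mul hq0 _ _ _) (rootMult n m j) hcard
    (hF.sum_eq_zero hij k L (fun k' hk' => (Finset.mem_filter.1 hk').2)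
      (fun k' h1 h2 => Finset.mem_filter.2 ⟨h1, h2⟩))
    (by
      intro k' _ he
      rw [← sub_eq_zero, node_diff hq0, mul_eq_zero, sub_eq_zero] at he
      rcases he with he | he
      · exact zpow_ne_zero _ hq0 ((map_eq_zero _).1 he)
      · exact hg _ he)
    (by
      intro k' hk' k'' hk'' hne he
      rw [← sub_eq_zero, node_sub hq0, mul_eq_zero, sub_eq_zero (a := ζ i)] at he
      rcases he with he | he
      · have h1 := hzinj (sub_eq_zero.1 ((map_eq_zero _).1 he))
        rw [hmem k' hk', hmem k'' hk'', rootForm_rootVec n m hij.ne,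
          rootForm_rootVec n m hij.ne] at h1
        have h2 := latScale_pos hm i
        have h3 := latScale_pos hm j
        have h4 := mul_right_cancel₀ (by omega) (add_left_cancel h1)
        exact hne (hinj k' hk' k'' hk'' (by omega))
      · exact hg _ he)
  exact (Finsupp.mem_support_iff.1 hk) (hF0 k hkL)

/-- Uniqueness: a quasi-invariant supported in the zonotope without its extreme coefficient
vanishes. -/
theorem QuasiInv.eq_zero [IsDomain A] {q : ℂ} (hq0 : q ≠ 0)
    (hq : ∀ k : ℕ, 0 < k → q ^ k ≠ 1) {n m : ℕ} (hm : 0 < m) {ζ : Fin (n + 1) → A}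
    {F : (Fin (n + 1) → ℤ) →₀ A} (hF : QuasiInv q n m ζ F)
    (hg : ∀ i j, i < j → GenericPair q ζ i j) (hZ : ∀ k ∈ F.support, k ∈ zonotope n m)
    {c : Fin (n + 1) → ℝ} (hc : Function.Injective c) (h0 : F (vtx n m c) = 0) : F = 0 := by
  by_contra hne
  -- The face exposed by an injective weight is a single vertex, and the coefficient there vanishes
  -- by hypothesis.
  obtain ⟨k, hk, he⟩ := exists_wt_eq_suppFn F.support (Finsupp.support_nonempty_iff.2 hne) hZ c
    (fun i j hij _ => hF.hasWideStrings hq0 hq hm hij (hg i j hij))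
  rw [eq_vtx_of_wt_eq hc (hZ k hk) he] at hk
  exact (Finsupp.mem_support_iff.1 hk) h0

end

end

noncomputable section

/-! ### Edges of the zonotope -/

/-- The multiplicity of the root through `a` and `b` in either order. -/
def symMult (n m : ℕ) (a b : Fin (n + 1)) : ℕ := rootMult n m (max a b)

theorem sum_rootVec {R : Type*} [CommRing R] {n : ℕ} (f : Fin (n + 1) → Fin (n + 1) → R)
    (a : Fin (n + 1)) :
    ∑ i : Fin (n + 1), ∑ j ∈ Finset.Ioi i, f i j * ((rootVec i j a : ℤ) : R) =
      ∑ x, ((if a < x then f a x else 0) - (if x < a then f x a else 0)) := by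
  have h : ∀ i : Fin (n + 1), ∑ j ∈ Finset.Ioi i, f i j * ((rootVec i j a : ℤ) : R) =
      (if a = i then ∑ j, (if i < j then f i j else 0) else 0) -
        (if i < a then f i a else 0) := by
    intro i
    rw [← Finset.filter_lt_eq_Ioi, Finset.sum_filter]
    have : ∀ j, (if i < j then f i j * ((rootVec i j a : ℤ) : R) else 0) =
        (if a = i then (if i < j then f i j else 0) else 0) -
          (if j = a then (if i < a then f i a else 0) else 0) := by
      intro j
      by_cases hij : i < j
      · by_cases hai : a = i
        · subst hai
          have : j ≠ a := hij.ne'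
          simp [hij, rootVec_apply_left hij.ne, this]
        · by_cases haj : j = a
          · subst haj; simp [hij, hai, rootVec_apply_right hij.ne]
          · simp [hij, hai, haj, rootVec_apply_of_ne hai (Ne.symm haj)]
      · by_cases haj : j = a
        · subst haj; simp [hij]
        · simp [hij, haj]
    simp only [this, Finset.sum_sub_distrib]
    congr 1
    · split_ifs <;> simp
    · simp
  simp only [h, Finset.sum_sub_distrib]
  congr 1
  simp

theorem vtx_apply (n m : ℕ) (c : Fin (n + 1) → ℝ) (a : Fin (n + 1)) :
    vtx n m c a = ∑ x, ((if a < x then (if c x < c a then (rootMult n m x : ℤ) else 0) else 0) -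
      (if x < a then (if c a < c x then (rootMult n m a : ℤ) else 0) else 0)) := by
  rw [← sum_rootVec (fun i j => if c j < c i then (rootMult n m j : ℤ) else 0) a]
  simp only [vtx, Finset.sum_apply, Pi.smul_apply, smul_eq_mul, Int.cast_id]

/-- Strictly decreasing weights; the vertex they expose is `2ρ`. -/
def stdWt (n : ℕ) (i : Fin (n + 1)) : ℝ := -((i : ℕ) : ℝ)

theorem stdWt_lt {n : ℕ} {i j : Fin (n + 1)} : stdWt n j < stdWt n i ↔ i < j := by
  simp [stdWt]

theorem stdWt_injective (n : ℕ) : Function.Injective (stdWt n) := by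
  intro i j h
  simp only [stdWt, neg_inj, Nat.cast_inj] at h
  exact Fin.ext h

/-- Centred at `ρ`, half of the vertex exposed by `stdWt`, a vertex is a half-sum of signed
multiplicities. In this form the order of the indices no longer matters. -/
theorem two_mul_vtx (n m : ℕ) {c : Fin (n + 1) → ℝ} (hc : Function.Injective c)
    (a : Fin (n + 1)) : 2 * vtx n m c a = vtx n m (stdWt n) a +
      ∑ x, (SignType.sign (c a - c x) : ℤ) * symMult n m a x := by
  rw [vtx_apply, vtx_apply, Finset.mul_sum, ← Finset.sum_add_distrib]
  refine Finset.sum_congr rfl fun x _ => ?_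
  rcases lt_trichotomy a x with h | h | h
  · have hs := stdWt_lt.2 h
    have hmax : max a x = x := max_eq_right h.le
    rcases lt_or_gt_of_ne (hc.ne h.ne) with h' | h'
    · simp [h, hs, h'.not_gt, h.not_gt, symMult, hmax, sign_neg (sub_neg.2 h')]
    · simp [h, hs, h', h.not_gt, symMult, hmax, sign_pos (sub_pos.2 h')]
      ring
  · subst h; simp
  · have hs := stdWt_lt.2 h
    have hmax : max a x = a := max_eq_left h.le
    rcases lt_or_gt_of_ne (hc.ne h.ne) with h' | h'
    · simp [h, hs, h'.not_gt, h.not_gt, symMult, hmax, sign_pos (sub_pos.2 h')]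
    · simp [h, hs, h', h.not_gt, symMult, hmax, sign_neg (sub_neg.2 h')]
      ring

/-- This compatibility of norms and multiplicities replaces reflection invariance in the deformed
configuration: in the pairing with `ε_a - ε_b` it makes the contributions of a third index cancel.
-/
theorem latScale_mul_symMult (n m : ℕ) {a b x : Fin (n + 1)} (hab : a ≠ b) (ha : x ≠ a)
    (hb : x ≠ b) : latScale n m a * symMult n m a x = latScale n m b * symMult n m b x := by
  have key : ∀ y z : Fin (n + 1), max y z = Fin.last n ↔ y = Fin.last n ∨ z = Fin.last n := by
    intro y z
    rcases le_total y z with h | h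
    · rw [max_eq_right h]
      exact ⟨Or.inr, fun h' => h'.elim (fun h1 => le_antisymm (Fin.le_last z) (h1 ▸ h)) id⟩
    · rw [max_eq_left h]
      exact ⟨Or.inl, fun h' => h'.elim id (fun h1 => le_antisymm (Fin.le_last y) (h1 ▸ h))⟩
  simp only [latScale, symMult, rootMult, key]
  by_cases h1 : a = Fin.last n <;> by_cases h2 : b = Fin.last n <;> by_cases h3 : x = Fin.last n <;>
    simp_all

/-- `c a` and `c b` are neighbours among the values of `c`, with `c b < c a`. -/
def IsNeighbour {n : ℕ} (c : Fin (n + 1) → ℝ) (a b : Fin (n + 1)) : Prop :=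
  c b < c a ∧ ∀ x, c x ≤ c b ∨ c a ≤ c x

/-- Every third index lies on the same side of both neighbours, so its contribution cancels by
`latScale_mul_symMult`. What remains says that the midpoint of the edge pairs with the root as `ρ`
does. -/
theorem rootForm_vtx (n m : ℕ) {c : Fin (n + 1) → ℝ} (hc : Function.Injective c)
    {a b : Fin (n + 1)} (hab : a < b) (hN : IsNeighbour c a b) :
    2 * rootForm n m a b (vtx n m c) = rootForm n m a b (vtx n m (stdWt n)) +
      rootMult n m b * (latScale n m a + latScale n m b) := by
  have h1 := two_mul_vtx n m hc a
  have h2 := two_mul_vtx n m hc b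
  have hS : latScale n m a * ∑ x, (SignType.sign (c a - c x) : ℤ) * symMult n m a x -
      latScale n m b * ∑ x, (SignType.sign (c b - c x) : ℤ) * symMult n m b x =
      rootMult n m b * (latScale n m a + latScale n m b) := by
    rw [Finset.mul_sum, Finset.mul_sum, ← Finset.sum_sub_distrib]
    rw [← Finset.add_sum_erase _ _ (Finset.mem_univ a),
      ← Finset.add_sum_erase _ _ (Finset.mem_erase.2 ⟨hab.ne', Finset.mem_univ b⟩),
      Finset.sum_eq_zero, add_zero]
    · have e1 : symMult n m a b = rootMult n m b := by simp [symMult, max_eq_right hab.le]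
      have e2 : symMult n m b a = rootMult n m b := by simp [symMult, max_eq_left hab.le]
      simp only [sub_self, sign_zero, e1, e2, sign_pos (sub_pos.2 hN.1), sign_neg (sub_neg.2 hN.1)]
      simp
      ring
    · intro x hx
      simp only [Finset.mem_erase, Finset.mem_univ, and_true] at hx
      have hl := latScale_mul_symMult n m hab.ne hx.2 hx.1
      have hsg : SignType.sign (c a - c x) = SignType.sign (c b - c x) := by
        rcases hN.2 x with h | h
        · have h' := lt_of_le_of_ne h (hc.ne hx.1)
          rw [sign_pos (by linarith [hN.1]), sign_pos (by linarith)]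
        · have h' := lt_of_le_of_ne h (hc.ne (Ne.symm hx.2))
          rw [sign_neg (by linarith [hN.1]), sign_neg (by linarith [hN.1])]
      rw [hsg]
      linear_combination (SignType.sign (c b - c x) : ℤ) * hl
  simp only [rootForm]
  linear_combination latScale n m a * h1 - latScale n m b * h2 + hS

/-- No value of `c` lies strictly between neighbours, so exchanging them changes only their mutual
comparison. -/
theorem IsNeighbour.swap_lt_iff {n : ℕ} {c : Fin (n + 1) → ℝ} {a b : Fin (n + 1)}
    (hN : IsNeighbour c a b) (hc : Function.Injective c) {x y : Fin (n + 1)}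
    (h1 : ¬(x = a ∧ y = b)) (h2 : ¬(x = b ∧ y = a)) :
    c (Equiv.swap a b x) < c (Equiv.swap a b y) ↔ c x < c y := by
  have hab := hN.1
  have key : ∀ z, z ≠ a → z ≠ b → (c z < c a ↔ c z < c b) ∧ (c a < c z ↔ c b < c z) := by
    intro z hza hzb
    have e1 := hc.ne hza
    have e2 := hc.ne hzb
    rcases hN.2 z with h | h
    · have := lt_of_le_of_ne h e2
      constructor <;> constructor <;> intro <;> linarith
    · have := lt_of_le_of_ne h e1.symm
      constructor <;> constructor <;> intro <;> linarith
  by_cases hxa : x = a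
  · subst hxa
    by_cases hyx : y = x
    · subst hyx; simp
    · have hyb : y ≠ b := fun h => h1 ⟨rfl, h⟩
      rw [Equiv.swap_apply_left, Equiv.swap_apply_of_ne_of_ne hyx hyb]
      exact (key y hyx hyb).2.symm
  · by_cases hxb : x = b
    · subst hxb
      by_cases hyx : y = x
      · subst hyx; simp
      · have hya : y ≠ a := fun h => h2 ⟨rfl, h⟩
        rw [Equiv.swap_apply_right, Equiv.swap_apply_of_ne_of_ne hya hyx]
        exact (key y hya hyx).2
    · rw [Equiv.swap_apply_of_ne_of_ne hxa hxb]
      by_cases hya : y = a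
      · subst hya; rw [Equiv.swap_apply_left]; exact (key x hxa hxb).1.symm
      · by_cases hyb : y = b
        · subst hyb; rw [Equiv.swap_apply_right]; exact (key x hxa hxb).1
        · rw [Equiv.swap_apply_of_ne_of_ne hya hyb]

/-- Only the summand of the pair `a, b` changes, so the two vertices are the ends of an edge of
length `m_α` in the direction of the root. -/
theorem IsNeighbour.vtx_swap {n m : ℕ} {c : Fin (n + 1) → ℝ} {a b : Fin (n + 1)}
    (hN : IsNeighbour c a b) (hc : Function.Injective c) (hab : a < b) :
    vtx n m c = vtx n m (c ∘ Equiv.swap a b) + (rootMult n m b : ℤ) • rootVec a b := by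
  have hterm : ∀ i, ∀ j ∈ Finset.Ioi i,
      (if c j < c i then (rootMult n m j : ℤ) else 0) • rootVec i j =
      (if (c ∘ Equiv.swap a b) j < (c ∘ Equiv.swap a b) i then (rootMult n m j : ℤ) else 0) •
        rootVec i j + (if j = b then (if i = a then (rootMult n m b : ℤ) • rootVec a b else 0)
          else 0) := by
    intro i j hj
    have hij : i < j := by simpa using hj
    by_cases h : i = a ∧ j = b
    · obtain ⟨rfl, rfl⟩ := h
      simp [hN.1, hN.1.not_gt]
    · have h' : (if j = b then (if i = a then (rootMult n m b : ℤ) • rootVec a b else 0)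
          else 0) = 0 := by
        split_ifs with h1 h2
        · exact absurd ⟨h2, h1⟩ h
        · rfl
        · rfl
      rw [h', add_zero]
      have := hN.swap_lt_iff hc (x := j) (y := i) (fun hh => absurd hij (by
        rw [hh.1, hh.2]; exact hab.not_gt)) (fun hh => h ⟨hh.2, hh.1⟩)
      simp only [Function.comp_apply, this]
  rw [vtx, Finset.sum_congr rfl fun i _ => Finset.sum_congr rfl (hterm i)]
  simp only [Finset.sum_add_distrib]
  congr 1
  rw [Finset.sum_eq_single a]
  · simp [hab]
  · intro i _ hi
    exact Finset.sum_eq_zero fun j _ => by simp [hi]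
  · simp

/-- The points of the zonotope on the face exposed by weights with a single tie. -/
theorem eq_vtx_sub_of_tie {n m : ℕ} {c : Fin (n + 1) → ℝ} (hc : Function.Injective c)
    {a b : Fin (n + 1)} (hab : a < b) (hN : IsNeighbour c a b) {k : Fin (n + 1) → ℤ}
    (hk : k ∈ zonotope n m)
    (he : wt (Function.update c a (c b)) k = suppFn n m (Function.update c a (c b))) :
    ∃ t : ℕ, t ≤ rootMult n m b ∧ k = vtx n m (c ∘ Equiv.swap a b) + (t : ℤ) • rootVec a b := by
  obtain ⟨l, hl⟩ := hk
  -- The tie is the only one, so all coefficients of the representation except `l a b` are pinned.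
  have hdet : ∀ i j, i < j → ¬(i = a ∧ j = b) →
      l i j = if c j < c i then (rootMult n m j : ℝ) else 0 := by
    intro i j hij hne
    have hcmp : Function.update c a (c b) j < Function.update c a (c b) i ↔ c j < c i := by
      have key : ∀ z, z ≠ a → z ≠ b → (c z < c b ↔ c z < c a) ∧ (c b < c z ↔ c a < c z) := by
        intro z hza hzb
        have e1 := hc.ne hza
        have e2 := hc.ne hzb
        have := hN.1
        rcases hN.2 z with h | h
        · have := lt_of_le_of_ne h e2
          constructor <;> constructor <;> intro <;> linarith
        · have := lt_of_le_of_ne h e1.symm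
          constructor <;> constructor <;> intro <;> linarith
      by_cases hi : i = a
      · subst hi
        have hj : j ≠ i := hij.ne'
        simp only [Function.update_self, Function.update_of_ne hj]
        exact (key j hj (fun h => hne ⟨rfl, h⟩)).1
      · rw [Function.update_of_ne hi]
        by_cases hj : j = a
        · subst hj
          simp only [Function.update_self]
          exact (key i hi (fun h => by subst h; exact absurd hij hab.not_gt)).2
        · rw [Function.update_of_ne hj]
    have hne' : Function.update c a (c b) i ≠ Function.update c a (c b) j := by
      by_cases hi : i = a
      · subst hi
        have hj : j ≠ i := hij.ne'
        simp only [Function.update_self, Function.update_of_ne hj]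
        exact hc.ne (fun h => hne ⟨rfl, h.symm⟩)
      · rw [Function.update_of_ne hi]
        by_cases hj : j = a
        · subst hj
          simp only [Function.update_self]
          exact hc.ne (fun h => by subst h; exact absurd hij hab.not_gt)
        · rw [Function.update_of_ne hj]; exact hc.ne hij.ne
    rw [hl.eq_of_wt_eq _ he hij hne']
    simp only [hcmp]
  have hcoord : ∀ x, (k x : ℝ) = vtx n m c x + (l a b - rootMult n m b) * (rootVec a b x : ℤ) := by
    intro x
    rw [hl.2, (isZonoRep_vtx n m c).2]
    have : ∀ i, ∀ j ∈ Finset.Ioi i, l i j * ((rootVec i j x : ℤ) : ℝ) =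
        (if c j < c i then (rootMult n m j : ℝ) else 0) * (rootVec i j x : ℤ) +
        (if j = b then (if i = a then (l a b - rootMult n m b) * ((rootVec a b x : ℤ) : ℝ) else 0)
          else 0) := by
      intro i j hj
      have hij : i < j := by simpa using hj
      by_cases h : i = a ∧ j = b
      · obtain ⟨rfl, rfl⟩ := h
        simp [hN.1]; ring
      · have h' : (if j = b then (if i = a then
            (l a b - rootMult n m b) * ((rootVec a b x : ℤ) : ℝ) else 0) else 0) = 0 := by
          split_ifs with h1 h2
          · exact absurd ⟨h2, h1⟩ h
          · rfl
          · rfl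
        rw [h', add_zero, hdet i j hij h]
    rw [Finset.sum_congr rfl fun i _ => Finset.sum_congr rfl (this i)]
    simp only [Finset.sum_add_distrib]
    congr 1
    rw [Finset.sum_eq_single a]
    · simp [hab]
    · intro i _ hi
      exact Finset.sum_eq_zero fun j _ => by simp [hi]
    · simp
  have hla := hl.1 a b hab
  have hta : ((k a - vtx n m c a + rootMult n m b : ℤ) : ℝ) = l a b := by
    have := hcoord a
    rw [rootVec_apply_left hab.ne] at this
    push_cast at this ⊢
    linarith
  have h0 : (0 : ℤ) ≤ k a - vtx n m c a + rootMult n m b := by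
    have : (0 : ℝ) ≤ ((k a - vtx n m c a + rootMult n m b : ℤ) : ℝ) := by rw [hta]; exact hla.1
    exact_mod_cast this
  have h1 : k a - vtx n m c a + rootMult n m b ≤ rootMult n m b := by
    have : ((k a - vtx n m c a + rootMult n m b : ℤ) : ℝ) ≤ ((rootMult n m b : ℤ) : ℝ) := by
      rw [hta]; exact_mod_cast hla.2
    exact_mod_cast this
  refine ⟨(k a - vtx n m c a + rootMult n m b).toNat, by omega, ?_⟩
  rw [Int.toNat_of_nonneg h0]
  have hv := hN.vtx_swap (m := m) hc hab
  ext x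
  have h2 := hcoord x
  rw [← hta] at h2
  have h3 : k x = vtx n m c x + (k a - vtx n m c a) * rootVec a b x := by
    have : ((k x : ℤ) : ℝ) = ((vtx n m c x + (k a - vtx n m c a) * rootVec a b x : ℤ) : ℝ) := by
      push_cast at h2 ⊢; rw [h2]; ring
    exact_mod_cast this
  have h4 := congrFun hv x
  simp only [Pi.add_apply, Pi.smul_apply, smul_eq_mul] at h4 ⊢
  rw [h3, h4]
  ring

theorem wt_update_rootVec {n : ℕ} {c : Fin (n + 1) → ℝ} {a b : Fin (n + 1)} (hab : a ≠ b) :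
    wt (Function.update c a (c b)) (rootVec a b) = 0 := by
  rw [wt_rootVec, Function.update_self, Function.update_of_ne hab.symm, sub_self]

/-- Lowering `c a` to `c b` creates a tie without reversing any comparison, so the vertex lies on
the face exposed by the new weights, which is the edge. -/
theorem wt_update_vtx {n m : ℕ} {c : Fin (n + 1) → ℝ} (hc : Function.Injective c)
    {a b : Fin (n + 1)} (hN : IsNeighbour c a b) :
    wt (Function.update c a (c b)) (vtx n m c) = suppFn n m (Function.update c a (c b)) := by
  refine wt_vtx n m hc fun i j hij => ?_
  have h := hN.1
  by_cases hi : i = a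
  · subst hi
    rw [Function.update_self]
    by_cases hj : j = i
    · subst hj; exact absurd hij (lt_irrefl _)
    · rw [Function.update_of_ne hj]; linarith
  · rw [Function.update_of_ne hi]
    by_cases hj : j = a
    · subst hj
      rw [Function.update_self]
      rcases hN.2 i with h' | h' <;> linarith
    · rw [Function.update_of_ne hj]; exact hij.le

end

/-! ### Relations between the coefficients along an edge. -/

noncomputable section

section

variable {A : Type*} [CommRing A] [Algebra ℂ A]

/-- The linear factor `x - q^t y`. -/
def linFac (q : ℂ) (x y : A) (t : ℤ) : A := x - algebraMap ℂ A (q ^ t) * y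

/-- An edge carries `M + 1` points subject to `M` conditions. Keeping the points `l` and `M` in
`two_node`, each difference of nodes becomes a scalar times a linear factor. -/
theorem edge_relation {q : ℂ} (hq0 : q ≠ 0) (g : ℕ → A) (d e : ℤ) (x y : A) (M : ℕ)
    (hs : ∀ s ∈ Finset.Icc 1 M, ∑ l ∈ Finset.range (M + 1), g l *
      ((algebraMap ℂ A (q ^ (d + l * e)) * x) ^ s -
        (algebraMap ℂ A (q ^ (-(d + l * e))) * y) ^ s) = 0) {l : ℕ} (hl : l < M) :
    algebraMap ℂ A (q ^ (d + l * e) * ∏ l' ∈ ((Finset.range (M + 1)).erase l).erase M,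
        (q ^ (d + l * e) - q ^ (d + l' * e))) * g l *
        ∏ l' ∈ Finset.range M, linFac q x y (-2 * d - (l + l') * e) +
      algebraMap ℂ A (q ^ (d + M * e) * ∏ l' ∈ ((Finset.range (M + 1)).erase l).erase M,
        (q ^ (d + M * e) - q ^ (d + l' * e))) * g M *
        ∏ l' ∈ (Finset.range (M + 1)).erase l, linFac q x y (-2 * d - (M + l') * e) = 0 := by
  have h := two_node (Finset.range (M + 1)) g
    (fun l : ℕ => algebraMap ℂ A (q ^ (d + l * e)) * x)
    (fun l : ℕ => algebraMap ℂ A (q ^ (-(d + l * e))) * y) (x * y)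
    (fun l _ => node_mul hq0 _ _ _) M (by simp) hs l M (by simp; omega) (by simp) hl.ne
  simp only [node_sub hq0, node_diff hq0, Finset.prod_mul_distrib] at h
  have hr : Finset.range M = insert l (((Finset.range (M + 1)).erase l).erase M) := by
    ext t; simp; omega
  have hr' : (Finset.range (M + 1)).erase l =
      insert M (((Finset.range (M + 1)).erase l).erase M) := by
    ext t; simp; omega
  have e1 : ∏ l' ∈ Finset.range M, linFac q x y (-2 * d - (l + l') * e) =
      (x - algebraMap ℂ A (q ^ (-(d + l * e) - (d + l * e))) * y) *
      ∏ l' ∈ ((Finset.range (M + 1)).erase l).erase M,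
        (x - algebraMap ℂ A (q ^ (-(d + l * e) - (d + l' * e))) * y) := by
    rw [hr, Finset.prod_insert (by simp)]
    simp only [linFac]
    congr 1
    · congr 4; ring
    · refine Finset.prod_congr rfl fun t _ => ?_
      congr 4; ring
  have e2 : ∏ l' ∈ (Finset.range (M + 1)).erase l, linFac q x y (-2 * d - (M + l') * e) =
      (x - algebraMap ℂ A (q ^ (-(d + M * e) - (d + M * e))) * y) *
      ∏ l' ∈ ((Finset.range (M + 1)).erase l).erase M,
        (x - algebraMap ℂ A (q ^ (-(d + M * e) - (d + l' * e))) * y) := by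
    rw [hr', Finset.prod_insert (by simp)]
    simp only [linFac]
    congr 1
    · congr 4; ring
    · refine Finset.prod_congr (by rw [← hr']) fun t _ => ?_
      congr 4; ring
  rw [e1, e2]
  simp only [map_mul, map_prod]
  linear_combination h

/-- The substitution `l ↦ M - l` matches the differences at the lower end with those at the upper
end. This gives the exact ratio of the two scalars in `edge_relation` for `l = 0`, including the
sign. -/
theorem edge_const {q : ℂ} (hq0 : q ≠ 0) (d e : ℤ) (M : ℕ) (hM : 0 < M) :
    (-1) ^ M * (q ^ d * ∏ l' ∈ Finset.Ico 1 M, (q ^ d - q ^ (d + l' * e))) =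
      -(q ^ (d + M * e) * ∏ l' ∈ Finset.Ico 1 M, (q ^ (d + M * e) - q ^ (d + l' * e))) *
        ∏ u ∈ Finset.Icc 1 M, q ^ (-(u * e)) := by
  have h1 : ∏ l' ∈ Finset.Ico 1 M, (q ^ d - q ^ (d + l' * e)) =
      ∏ l' ∈ Finset.Ico 1 M, -(q ^ (-(l' * e)) * (q ^ (d + M * e) - q ^ (d + l' * e))) := by
    refine Finset.prod_nbij' (fun l => M - l) (fun l => M - l) ?_ ?_ ?_ ?_ ?_
    · intro l hl; simp only [Finset.mem_Ico] at hl ⊢; omega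
    · intro l hl; simp only [Finset.mem_Ico] at hl ⊢; omega
    · intro l hl; simp only [Finset.mem_Ico] at hl; omega
    · intro l hl; simp only [Finset.mem_Ico] at hl; omega
    · intro l hl
      simp only [Finset.mem_Ico] at hl
      rw [Nat.cast_sub hl.2.le, mul_sub, ← zpow_add₀ hq0, ← zpow_add₀ hq0, neg_sub]
      congr 2 <;> ring
  have h2 : Finset.Icc 1 M = insert M (Finset.Ico 1 M) := by
    ext t; simp only [Finset.mem_Icc, Finset.mem_insert, Finset.mem_Ico]; omega
  rw [h1, Finset.prod_neg, Finset.prod_mul_distrib, h2, Finset.prod_insert (by simp)]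
  obtain ⟨M, rfl⟩ : ∃ M', M = M' + 1 := ⟨M - 1, by omega⟩
  have h3 : q ^ d = q ^ (d + (M + 1 : ℕ) * e) * q ^ (-((M + 1 : ℕ) * e)) := by
    rw [← zpow_add₀ hq0]; congr 1; ring
  have h4 : ((-1 : ℂ) ^ M) * (-1) ^ M = 1 := by rw [← mul_pow]; simp
  rw [Nat.card_Ico, Nat.add_sub_cancel, pow_succ]
  generalize ∏ l' ∈ Finset.Ico 1 (M + 1), (q ^ (d + (M + 1 : ℕ) * e) - q ^ (d + l' * e)) = p₁
  generalize ∏ l' ∈ Finset.Ico 1 (M + 1), q ^ (-(l' * e)) = p₂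
  rw [h3]
  linear_combination (-(q ^ (d + (M + 1 : ℕ) * e) * q ^ (-((M + 1 : ℕ) * e))) * p₁ * p₂) * h4

/-- `∏_{l=1}^{m_α} (q^{l(α,α)} ξ_j - ξ_i)` for `α = ε_i - ε_j`. -/
def posFac (q : ℂ) (n m : ℕ) (ξ : Fin (n + 1) → A) (i j : Fin (n + 1)) : A :=
  ∏ l ∈ Finset.Icc 1 (rootMult n m j),
    (algebraMap ℂ A (q ^ (l * (latScale n m i + latScale n m j))) * ξ j - ξ i)

/-- `∏_{l=1}^{m_α} (q^{l(α,α)} ξ_i - ξ_j)` for `α = ε_i - ε_j`. -/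
def negFac (q : ℂ) (n m : ℕ) (ξ : Fin (n + 1) → A) (i j : Fin (n + 1)) : A :=
  ∏ l ∈ Finset.Icc 1 (rootMult n m j),
    (algebraMap ℂ A (q ^ (l * (latScale n m i + latScale n m j))) * ξ i - ξ j)

/-- The coefficient of a normalized quasi-invariant at the vertex exposed by `c`. -/
def vtxProd (q : ℂ) (n m : ℕ) (ξ : Fin (n + 1) → A) (c : Fin (n + 1) → ℝ) : A :=
  ∏ i : Fin (n + 1), ∏ j ∈ Finset.Ioi i,
    if c j < c i then posFac q n m ξ i j else negFac q n m ξ i j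

/-- The spectral parameters centred at `ρ`. -/
def shiftedPar (q : ℂ) (n m : ℕ) (ξ : Fin (n + 1) → A) (i : Fin (n + 1)) : A :=
  algebraMap ℂ A (q ^ (-(latScale n m i * vtx n m (stdWt n) i))) * ξ i

theorem genericPair_shiftedPar {q : ℂ} (hq0 : q ≠ 0) {n m : ℕ} {ξ : Fin (n + 1) → A}
    {i j : Fin (n + 1)} :
    GenericPair q (shiftedPar q n m ξ) i j ↔ GenericPair q ξ i j := by
  have key : ∀ u v a : ℤ, algebraMap ℂ A (q ^ u) * ξ i = algebraMap ℂ A (q ^ a) *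
      (algebraMap ℂ A (q ^ v) * ξ j) ↔ ξ i = algebraMap ℂ A (q ^ (a + v - u)) * ξ j := by
    intro u v a
    have h1 : algebraMap ℂ A (q ^ u) * algebraMap ℂ A (q ^ (-u)) = 1 := by
      rw [← map_mul, ← zpow_add₀ hq0]; simp
    have h2 : algebraMap ℂ A (q ^ (a + v - u)) =
        algebraMap ℂ A (q ^ a) * algebraMap ℂ A (q ^ v) * algebraMap ℂ A (q ^ (-u)) := by
      rw [← map_mul, ← map_mul, ← zpow_add₀ hq0, ← zpow_add₀ hq0]; rfl
    rw [h2]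
    constructor
    · intro h
      linear_combination algebraMap ℂ A (q ^ (-u)) * h - ξ i * h1
    · intro h
      linear_combination algebraMap ℂ A (q ^ u) * h +
        algebraMap ℂ A (q ^ a) * algebraMap ℂ A (q ^ v) * ξ j * h1
  constructor
  · intro h a ha
    refine h (a + (-(latScale n m i * vtx n m (stdWt n) i)) -
      (-(latScale n m j * vtx n m (stdWt n) j))) ?_
    rw [shiftedPar, shiftedPar, key, ha]
    congr 3; ring
  · intro h a ha
    rw [shiftedPar, shiftedPar, key] at ha
    exact h _ ha

theorem linFac_shiftedPar {q : ℂ} (hq0 : q ≠ 0) {n m : ℕ} (ξ : Fin (n + 1) → A)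
    (a b : Fin (n + 1)) (t u : ℤ)
    (htu : t = u - rootForm n m a b (vtx n m (stdWt n))) :
    linFac q (shiftedPar q n m ξ a) (shiftedPar q n m ξ b) t =
      algebraMap ℂ A (q ^ (-(latScale n m a * vtx n m (stdWt n) a))) * linFac q (ξ a) (ξ b) u := by
  simp only [linFac, shiftedPar, mul_sub, ← mul_assoc, ← map_mul, ← zpow_add₀ hq0]
  congr 4
  rw [htu, rootForm]; ring

/-- The line through an edge is a level line of weights that attain their maximum on the zonotope
there. It meets the zonotope in the edge only, so the conditions involve exactly the `m_α + 1`
lattice points of the edge. -/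
theorem edge_sum {q : ℂ} {n m : ℕ} {ζ : Fin (n + 1) → A}
    {F : (Fin (n + 1) → ℤ) →₀ A} (hF : QuasiInv q n m ζ F)
    (hZ : ∀ k ∈ F.support, k ∈ zonotope n m) {c : Fin (n + 1) → ℝ} (hc : Function.Injective c)
    {a b : Fin (n + 1)} (hab : a < b) (hN : IsNeighbour c a b) (v : Fin (n + 1) → ℤ)
    (hv : v = vtx n m (c ∘ Equiv.swap a b)) :
    ∀ s ∈ Finset.Icc 1 (rootMult n m b), ∑ l ∈ Finset.range (rootMult n m b + 1),
      F (v + (l : ℤ) • rootVec a b) *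
      ((algebraMap ℂ A (q ^ (rootForm n m a b v + l * (latScale n m a + latScale n m b))) * ζ a) ^ s
        - (algebraMap ℂ A (q ^ (-(rootForm n m a b v + l * (latScale n m a + latScale n m b)))) *
          ζ b) ^ s) = 0 := by
  classical
  intro s hs
  have hinj : Set.InjOn (fun l : ℕ => v + (l : ℤ) • rootVec a b)
      (Finset.range (rootMult n m b + 1)) := by
    intro l _ l' _ he
    have := congrFun he a
    simp only [Pi.add_apply, Pi.smul_apply, smul_eq_mul, rootVec_apply_left hab.ne] at this
    omega
  have h := hF.sum_eq_zero hab v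
    ((Finset.range (rootMult n m b + 1)).image fun l : ℕ => v + (l : ℤ) • rootVec a b)
    (by
      intro k' hk'
      obtain ⟨l, _, rfl⟩ := Finset.mem_image.1 hk'
      exact mergeIdx_rootVec hab.ne _ _)
    (by
      intro k' hk' he
      have h1 := eq_add_of_mergeIdx_eq hab.ne he
      have h2 : wt (Function.update c a (c b)) k' = suppFn n m (Function.update c a (c b)) := by
        rw [h1, wt_add, wt_zsmul, wt_update_rootVec hab.ne, mul_zero, add_zero]
        have h3 := wt_update_vtx (m := m) hc hN
        rw [hN.vtx_swap hc hab, wt_add, wt_zsmul, wt_update_rootVec hab.ne, mul_zero,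
          add_zero] at h3
        rw [hv, h3]
      obtain ⟨t, ht, rfl⟩ := eq_vtx_sub_of_tie hc hab hN (hZ k' hk') h2
      exact Finset.mem_image.2 ⟨t, by simp; omega, by rw [hv]⟩) s hs
  rw [Finset.sum_image hinj] at h
  simpa only [rootForm_rootVec n m hab.ne] using h

/-- By `rootForm_vtx` the centring of the parameters at `ρ` absorbs the position of the edge: the
linear factors in `ξ` depend only on the multiplicity and the squared length `e` of the root. -/
theorem edge_relation_linFac [IsDomain A] {q : ℂ} (hq0 : q ≠ 0) {n m : ℕ}
    {ξ : Fin (n + 1) → A}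
    {F : (Fin (n + 1) → ℤ) →₀ A} (hF : QuasiInv q n m (shiftedPar q n m ξ) F)
    (hZ : ∀ k ∈ F.support, k ∈ zonotope n m) {c : Fin (n + 1) → ℝ} (hc : Function.Injective c)
    {a b : Fin (n + 1)} (hab : a < b) (hN : IsNeighbour c a b) (v : Fin (n + 1) → ℤ)
    (hv : v = vtx n m (c ∘ Equiv.swap a b)) (M : ℕ) (hM : M = rootMult n m b) (e : ℤ)
    (he : e = latScale n m a + latScale n m b) (d : ℤ) (hd : d = rootForm n m a b v)
    {l : ℕ} (hl : l < M) :
    algebraMap ℂ A (q ^ (d + l * e) * ∏ l' ∈ ((Finset.range (M + 1)).erase l).erase M,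
        (q ^ (d + l * e) - q ^ (d + l' * e))) * F (v + (l : ℤ) • rootVec a b) *
        ∏ l' ∈ Finset.range M, linFac q (ξ a) (ξ b) ((M - l - l') * e) +
      algebraMap ℂ A (q ^ (d + M * e) * ∏ l' ∈ ((Finset.range (M + 1)).erase l).erase M,
        (q ^ (d + M * e) - q ^ (d + l' * e))) * F (v + (M : ℤ) • rootVec a b) *
        ∏ l' ∈ (Finset.range (M + 1)).erase l, linFac q (ξ a) (ξ b) (-l' * e) = 0 := by
  have h := edge_relation hq0 (fun l : ℕ => F (v + (l : ℤ) • rootVec a b)) d e _ _ M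
    (by rw [hd, he, hM]; exact edge_sum hF hZ hc hab hN v hv) hl
  have h2d : 2 * d = rootForm n m a b (vtx n m (stdWt n)) - M * e := by
    have h1 := rootForm_vtx n m hc hab hN
    rw [hN.vtx_swap hc hab, rootForm_rootVec n m hab.ne, ← hv, ← hd, ← he, ← hM] at h1
    linarith
  have e1 : ∀ u : ℤ, linFac q (shiftedPar q n m ξ a) (shiftedPar q n m ξ b) (-2 * d - u * e) =
      algebraMap ℂ A (q ^ (-(latScale n m a * vtx n m (stdWt n) a))) *
        linFac q (ξ a) (ξ b) ((M - u) * e) :=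
    fun u => linFac_shiftedPar hq0 ξ a b _ _ (by linear_combination -h2d)
  have hcard : ((Finset.range (M + 1)).erase l).card = M := by
    rw [Finset.card_erase_of_mem (by simp; omega)]; simp
  simp only [e1, Finset.prod_mul_distrib, Finset.prod_const, hcard, Finset.card_range] at h
  have hne : (algebraMap ℂ A (q ^ (-(latScale n m a * vtx n m (stdWt n) a)))) ^ M ≠ 0 := by
    refine pow_ne_zero _ fun h0 => ?_
    exact zpow_ne_zero _ hq0 ((map_eq_zero _).1 h0)
  refine (mul_eq_zero.1 (Eq.trans ?_ h)).resolve_left hne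
  have e2 : ∀ l' : ℕ, ((M : ℤ) - l - l') * e = (M - (l + l')) * e := fun l' => by ring
  have e3 : ∀ l' : ℕ, (-(l' : ℤ)) * e = (M - (M + l')) * e := fun l' => by ring
  simp only [e2, e3]
  ring

theorem edge_const_ne_zero {q : ℂ} (hq0 : q ≠ 0) (hq : ∀ k : ℕ, 0 < k → q ^ k ≠ 1) (d e : ℤ)
    (he : e ≠ 0) (l : ℕ) (L : Finset ℕ) (hl : l ∉ L) :
    q ^ (d + l * e) * ∏ l' ∈ L, (q ^ (d + l * e) - q ^ (d + l' * e)) ≠ 0 := by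
  refine mul_ne_zero (zpow_ne_zero _ hq0) (Finset.prod_ne_zero_iff.2 fun l' hl' h0 => ?_)
  have h1 := zpow_injective_of_pow_ne_one hq0 hq (sub_eq_zero.1 h0)
  have h2 := mul_right_cancel₀ he (add_left_cancel h1)
  have h3 : l = l' := by exact_mod_cast h2
  exact hl (h3 ▸ hl')

theorem posFac_eq (q : ℂ) {n m : ℕ} (ξ : Fin (n + 1) → A) (a b : Fin (n + 1)) (M : ℕ)
    (hM : M = rootMult n m b) (e : ℤ) (he : e = latScale n m a + latScale n m b) :
    posFac q n m ξ a b = (-1) ^ M * ∏ u ∈ Finset.Icc 1 M, linFac q (ξ a) (ξ b) (u * e) := by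
  have : ∀ u ∈ Finset.Icc 1 M, algebraMap ℂ A (q ^ ((u : ℤ) * e)) * ξ b - ξ a =
      -linFac q (ξ a) (ξ b) (u * e) := fun u _ => by simp only [linFac]; ring
  rw [posFac, ← hM, ← he, Finset.prod_congr rfl this, Finset.prod_neg, Nat.card_Icc,
    Nat.add_sub_cancel]

/-- The linear factors multiplying the coefficient at `t` have exponents `1 - t, …, M - t`. All of
them occur among the factors of `posFac` together with those multiplying the top coefficient, so
they cancel and `G` passes to every point of the edge. -/
theorem edge_dvd [IsDomain A] {q : ℂ} (hq0 : q ≠ 0)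
    (hq : ∀ k : ℕ, 0 < k → q ^ k ≠ 1) {n m : ℕ} (hm : 0 < m) {ξ : Fin (n + 1) → A}
    {F : (Fin (n + 1) → ℤ) →₀ A} (hF : QuasiInv q n m (shiftedPar q n m ξ) F)
    (hZ : ∀ k ∈ F.support, k ∈ zonotope n m) {c : Fin (n + 1) → ℝ} (hc : Function.Injective c)
    {a b : Fin (n + 1)} (hab : a < b) (hN : IsNeighbour c a b) (hg : GenericPair q ξ a b)
    (G : A) (hG : G * posFac q n m ξ a b ∣ F (vtx n m c)) (t : ℕ) (ht : t ≤ rootMult n m b) :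
    G ∣ F (vtx n m (c ∘ Equiv.swap a b) + (t : ℤ) • rootVec a b) := by
  have htop := hN.vtx_swap (m := m) hc hab
  rcases ht.eq_or_lt with rfl | hlt
  · rw [← htop]; exact dvd_of_mul_right_dvd hG
  obtain ⟨W, hW⟩ := hG
  rw [htop] at hW
  set M := rootMult n m b with hM
  set e := latScale n m a + latScale n m b with he
  have he0 : e ≠ 0 := by
    have h2 := latScale_pos hm a
    have h3 := latScale_pos hm b
    omega
  have h := edge_relation_linFac hq0 hF hZ hc hab hN _ rfl M hM e he _ rfl hlt
  have hC1 := edge_const_ne_zero hq0 hq (rootForm n m a b (vtx n m (c ∘ Equiv.swap a b))) e he0 t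
    (((Finset.range (M + 1)).erase t).erase M) (by simp)
  rw [hW, posFac_eq q ξ a b M hM e he] at h
  have hs : ∏ l' ∈ Finset.range M, linFac q (ξ a) (ξ b) ((M - t - l') * e) =
      ∏ u ∈ Finset.Icc (1 - t : ℤ) (M - t), linFac q (ξ a) (ξ b) (u * e) := by
    refine Finset.prod_nbij' (fun l' => (M - t - l' : ℤ)) (fun u => (M - t - u).toNat)
      ?_ ?_ ?_ ?_ ?_
    · intro l hl; simp only [Finset.mem_range, Finset.mem_Icc] at hl ⊢; omega
    · intro l hl; simp only [Finset.mem_range, Finset.mem_Icc] at hl ⊢; omega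
    · intro l hl; simp only [Finset.mem_range] at hl; omega
    · intro l hl; simp only [Finset.mem_Icc] at hl; omega
    · intro l hl; rfl
  -- The exponents `1, …, M` of `posFac` and `-M, …, 0` without `-t` together fill `[-M, M]` without
  -- `-t`.
  have hb : (∏ u ∈ Finset.Icc 1 M, linFac q (ξ a) (ξ b) (u * e)) *
      ∏ l' ∈ (Finset.range (M + 1)).erase t, linFac q (ξ a) (ξ b) (-l' * e) =
      ∏ u ∈ (Finset.Icc (-M : ℤ) M).erase (-t), linFac q (ξ a) (ξ b) (u * e) := by
    have hu : (Finset.Icc (-M : ℤ) M).erase (-t) =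
        Finset.Icc (1 : ℤ) M ∪ (Finset.Icc (-M : ℤ) 0).erase (-t) := by
      ext u; simp only [Finset.mem_erase, Finset.mem_Icc, Finset.mem_union]; omega
    rw [hu, Finset.prod_union (Finset.disjoint_left.2 fun u h1 h2 => by
      simp only [Finset.mem_erase, Finset.mem_Icc] at h1 h2; omega)]
    congr 1
    · refine Finset.prod_nbij' (fun l' => (l' : ℤ)) (fun u => u.toNat) ?_ ?_ ?_ ?_ ?_
      · intro l hl; simp only [Finset.mem_Icc] at hl ⊢; omega
      · intro l hl; simp only [Finset.mem_Icc] at hl ⊢; omega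
      · intro l hl; simp
      · intro l hl; simp only [Finset.mem_Icc] at hl; omega
      · intro l hl; rfl
    · refine Finset.prod_nbij' (fun l' => (-l' : ℤ)) (fun u => (-u).toNat) ?_ ?_ ?_ ?_ ?_
      · intro l hl
        simp only [Finset.mem_erase, Finset.mem_range, Finset.mem_Icc] at hl ⊢; omega
      · intro l hl
        simp only [Finset.mem_erase, Finset.mem_range, Finset.mem_Icc] at hl ⊢; omega
      · intro l hl; simp
      · intro l hl
        simp only [Finset.mem_erase, Finset.mem_Icc] at hl; omega
      · intro l hl; rfl
  have hsub : Finset.Icc (1 - t : ℤ) (M - t) ⊆ (Finset.Icc (-M : ℤ) M).erase (-t) := by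
    intro u hu; simp only [Finset.mem_erase, Finset.mem_Icc] at hu ⊢; omega
  have hne : ∏ u ∈ Finset.Icc (1 - t : ℤ) (M - t), linFac q (ξ a) (ξ b) (u * e) ≠ 0 :=
    Finset.prod_ne_zero_iff.2 fun u _ h0 => hg _ (sub_eq_zero.1 h0)
  have hsplit := Finset.prod_sdiff hsub (f := fun u : ℤ => linFac q (ξ a) (ξ b) (u * e))
  rw [← hb] at hsplit
  rw [hs] at h
  set C1 := q ^ (rootForm n m a b (vtx n m (c ∘ Equiv.swap a b)) + t * e) *
    ∏ l' ∈ ((Finset.range (M + 1)).erase t).erase M,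
      (q ^ (rootForm n m a b (vtx n m (c ∘ Equiv.swap a b)) + t * e) -
        q ^ (rootForm n m a b (vtx n m (c ∘ Equiv.swap a b)) + l' * e))
  set C2 := q ^ (rootForm n m a b (vtx n m (c ∘ Equiv.swap a b)) + M * e) *
    ∏ l' ∈ ((Finset.range (M + 1)).erase t).erase M,
      (q ^ (rootForm n m a b (vtx n m (c ∘ Equiv.swap a b)) + M * e) -
        q ^ (rootForm n m a b (vtx n m (c ∘ Equiv.swap a b)) + l' * e))
  have h3 : algebraMap ℂ A C1 * F (vtx n m (c ∘ Equiv.swap a b) + (t : ℤ) • rootVec a b) =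
      G * (-algebraMap ℂ A C2 * (-1) ^ M * W * ∏ u ∈ (Finset.Icc (-M : ℤ) M).erase (-t) \
        Finset.Icc (1 - t : ℤ) (M - t), linFac q (ξ a) (ξ b) (u * e)) := by
    apply mul_right_cancel₀ hne
    linear_combination h + (algebraMap ℂ A C2 * (-1) ^ M * W * G) * hsplit
  have h4 : algebraMap ℂ A C1⁻¹ * algebraMap ℂ A C1 = 1 := by
    rw [← map_mul, inv_mul_cancel₀ hC1, map_one]
  refine ⟨algebraMap ℂ A C1⁻¹ * (-algebraMap ℂ A C2 * (-1) ^ M * W *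
    ∏ u ∈ (Finset.Icc (-M : ℤ) M).erase (-t) \
        Finset.Icc (1 - t : ℤ) (M - t), linFac q (ξ a) (ξ b) (u * e)), ?_⟩
  linear_combination algebraMap ℂ A C1⁻¹ * h3 -
    F (vtx n m (c ∘ Equiv.swap a b) + (t : ℤ) • rootVec a b) * h4

theorem rootMult_pos {n m : ℕ} (hm : 0 < m) (j : Fin (n + 1)) : 0 < rootMult n m j := by
  unfold rootMult; split_ifs <;> omega

/-- For `l = 0` the two products of linear factors are `posFac` and `negFac` up to scalars, and
`edge_const` shows that these scalars cancel. -/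
theorem edge_ends [IsDomain A] {q : ℂ} (hq0 : q ≠ 0) (hq : ∀ k : ℕ, 0 < k → q ^ k ≠ 1)
    {n m : ℕ} (hm : 0 < m) {ξ : Fin (n + 1) → A}
    {F : (Fin (n + 1) → ℤ) →₀ A} (hF : QuasiInv q n m (shiftedPar q n m ξ) F)
    (hZ : ∀ k ∈ F.support, k ∈ zonotope n m) {c : Fin (n + 1) → ℝ} (hc : Function.Injective c)
    {a b : Fin (n + 1)} (hab : a < b) (hN : IsNeighbour c a b) :
    F (vtx n m (c ∘ Equiv.swap a b)) * posFac q n m ξ a b =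
      F (vtx n m c) * negFac q n m ξ a b := by
  have htop := hN.vtx_swap (m := m) hc hab
  have hM0 := rootMult_pos (n := n) hm b
  rw [htop]
  set M := rootMult n m b with hM
  set e := latScale n m a + latScale n m b with he
  set v := vtx n m (c ∘ Equiv.swap a b) with hv
  have he0 : e ≠ 0 := by
    have h2 := latScale_pos hm a
    have h3 := latScale_pos hm b
    omega
  have h := edge_relation_linFac hq0 hF hZ hc hab hN v hv M hM e he _ rfl hM0
  have hL : ((Finset.range (M + 1)).erase 0).erase M = Finset.Ico 1 M := by
    ext u; simp only [Finset.mem_erase, Finset.mem_range, Finset.mem_Ico]; omega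
  have hC1 := edge_const_ne_zero hq0 hq (rootForm n m a b v) e he0 0 (Finset.Ico 1 M) (by simp)
  have hcst := edge_const hq0 (rootForm n m a b v) e M hM0
  have hs : ∏ l' ∈ Finset.range M, linFac q (ξ a) (ξ b) ((M - (0 : ℕ) - l') * e) =
      ∏ u ∈ Finset.Icc 1 M, linFac q (ξ a) (ξ b) (u * e) := by
    refine Finset.prod_nbij' (fun l' => M - l') (fun l' => M - l') ?_ ?_ ?_ ?_ ?_
    · intro l hl; simp only [Finset.mem_range, Finset.mem_Icc] at hl ⊢; omega
    · intro l hl; simp only [Finset.mem_range, Finset.mem_Icc] at hl ⊢; omega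
    · intro l hl; simp only [Finset.mem_range] at hl; omega
    · intro l hl; simp only [Finset.mem_Icc] at hl; omega
    · intro l hl
      simp only [Finset.mem_range] at hl
      rw [Nat.cast_sub hl.le]; simp
  have hn : ∏ l' ∈ (Finset.range (M + 1)).erase 0, linFac q (ξ a) (ξ b) (-l' * e) =
      algebraMap ℂ A (∏ u ∈ Finset.Icc 1 M, q ^ (-(u * e))) * negFac q n m ξ a b := by
    have : (Finset.range (M + 1)).erase 0 = Finset.Icc 1 M := by
      ext u; simp only [Finset.mem_erase, Finset.mem_range, Finset.mem_Icc]; omega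
    rw [this, negFac, map_prod, ← hM, ← he, ← Finset.prod_mul_distrib]
    refine Finset.prod_congr rfl fun u _ => ?_
    have h1 : algebraMap ℂ A (q ^ (-(u * e))) * algebraMap ℂ A (q ^ (u * e)) = 1 := by
      rw [← map_mul, ← zpow_add₀ hq0]; simp
    simp only [linFac, neg_mul]
    linear_combination -ξ a * h1
  have hp := posFac_eq q ξ a b M hM e he
  rw [hs, hn, hL] at h
  simp only [Nat.cast_zero, zero_mul, add_zero, zero_smul] at h hC1
  have hcst' := congrArg (algebraMap ℂ A) hcst
  rw [map_mul, map_mul (algebraMap ℂ A) (-_), map_neg, map_pow, map_neg, map_one] at hcst'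
  have h1 : ((-1 : A) ^ M) * (-1) ^ M = 1 := by rw [← mul_pow]; simp
  set C1 := algebraMap ℂ A (q ^ rootForm n m a b v *
    ∏ l' ∈ Finset.Ico 1 M, (q ^ rootForm n m a b v - q ^ (rootForm n m a b v + l' * e))) with hC1d
  have hC1' : C1 ≠ 0 := by
    intro h0
    exact hC1 ((map_eq_zero _).1 h0)
  apply mul_left_cancel₀ hC1'
  rw [hp]
  linear_combination (-1) ^ M * h -
    (F (v + (M : ℤ) • rootVec a b) * negFac q n m ξ a b) * (-1) ^ M * hcst' +
    (F (v + (M : ℤ) • rootVec a b) * negFac q n m ξ a b) * C1 * h1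

open Classical in
/-- The pairs `i < j` with `c i < c j`. -/
def inversions {n : ℕ} (c : Fin (n + 1) → ℝ) : Finset (Fin (n + 1) × Fin (n + 1)) :=
  Finset.univ.filter fun p => p.1 < p.2 ∧ c p.1 < c p.2

/-- Take an inversion with the smallest gap. An index whose value lies strictly between would form,
with one of the two, an inversion with a smaller gap. -/
theorem exists_neighbour {n : ℕ} {c : Fin (n + 1) → ℝ}
    (hI : (inversions c).Nonempty) :
    ∃ a b, a < b ∧ c a < c b ∧ ∀ x, c x ≤ c a ∨ c b ≤ c x := by
  obtain ⟨⟨a, b⟩, hp, hmin⟩ := (inversions c).exists_min_image (fun p => c p.2 - c p.1) hI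
  simp only [inversions, Finset.mem_filter, Finset.mem_univ, true_and] at hp
  refine ⟨a, b, hp.1, hp.2, fun x => ?_⟩
  by_contra! hx
  rcases lt_trichotomy a x with h | h | h
  · have := hmin (a, x) (by simp [inversions, h, hx.1])
    simp only at this; linarith [hx.2]
  · subst h; exact lt_irrefl _ hx.1
  · have := hmin (x, b) (by simp [inversions, h.trans hp.1, hx.2])
    simp only at this; linarith [hx.1]

theorem posFac_ne_zero [IsDomain A] {q : ℂ} {n m : ℕ} {ξ : Fin (n + 1) → A} {i j : Fin (n + 1)}
    (hg : GenericPair q ξ i j) : posFac q n m ξ i j ≠ 0 :=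
  Finset.prod_ne_zero_iff.2 fun _ _ h0 => hg _ (sub_eq_zero.1 h0).symm

/-- The explicit products obey the same relation along an edge as the vertex coefficients in
`edge_ends`. -/
theorem vtxProd_swap {q : ℂ} {n m : ℕ} (ξ : Fin (n + 1) → A) {c : Fin (n + 1) → ℝ}
    {a b : Fin (n + 1)} (hN : IsNeighbour c a b) (hc : Function.Injective c) (hab : a < b) :
    vtxProd q n m ξ (c ∘ Equiv.swap a b) * posFac q n m ξ a b =
      vtxProd q n m ξ c * negFac q n m ξ a b := by
  simp only [vtxProd]
  rw [← Finset.mul_prod_erase _ _ (Finset.mem_univ a),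
    ← Finset.mul_prod_erase _ _ (Finset.mem_univ a),
    ← Finset.mul_prod_erase (Finset.Ioi a) _ (Finset.mem_Ioi.2 hab),
    ← Finset.mul_prod_erase (Finset.Ioi a) _ (Finset.mem_Ioi.2 hab)]
  have h1 : ∏ x ∈ (Finset.Ioi a).erase b, (if (c ∘ Equiv.swap a b) x < (c ∘ Equiv.swap a b) a then
      posFac q n m ξ a x else negFac q n m ξ a x) = ∏ x ∈ (Finset.Ioi a).erase b,
      (if c x < c a then posFac q n m ξ a x else negFac q n m ξ a x) := by
    refine Finset.prod_congr rfl fun x hx => ?_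
    simp only [Finset.mem_erase, Finset.mem_Ioi] at hx
    simp only [Function.comp_apply, hN.swap_lt_iff hc (x := x) (y := a)
      (fun h => hab.ne h.2) (fun h => hx.1 h.1)]
  have h2 : ∏ i ∈ Finset.univ.erase a, ∏ j ∈ Finset.Ioi i,
      (if (c ∘ Equiv.swap a b) j < (c ∘ Equiv.swap a b) i then
      posFac q n m ξ i j else negFac q n m ξ i j) = ∏ i ∈ Finset.univ.erase a,
      ∏ j ∈ Finset.Ioi i, (if c j < c i then posFac q n m ξ i j else negFac q n m ξ i j) := by
    refine Finset.prod_congr rfl fun i hi => Finset.prod_congr rfl fun j hj => ?_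
    simp only [Finset.mem_erase, Finset.mem_univ, and_true, Finset.mem_Ioi] at hi hj
    simp only [Function.comp_apply, hN.swap_lt_iff hc (x := j) (y := i)
      (fun h => by rw [h.1, h.2] at hj; exact hj.not_gt hab) (fun h => hi h.2)]
  rw [h1, h2]
  simp only [Function.comp_apply, Equiv.swap_apply_left, Equiv.swap_apply_right, hN.1,
    hN.1.not_gt, if_true, if_false]
  ring

/-- Any ordering is sorted by exchanging neighbours that are inverted. Each exchange is an edge,
along which coefficient and product change by the same ratio, so induction on the number of
inversions shows that they are proportional. -/
theorem vtx_mul_vtxProd [IsDomain A] {q : ℂ} (hq0 : q ≠ 0)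
    (hq : ∀ k : ℕ, 0 < k → q ^ k ≠ 1) {n m : ℕ} (hm : 0 < m) {ξ : Fin (n + 1) → A}
    (hg : ∀ i j, i < j → GenericPair q ξ i j)
    {F : (Fin (n + 1) → ℤ) →₀ A} (hF : QuasiInv q n m (shiftedPar q n m ξ) F)
    (hZ : ∀ k ∈ F.support, k ∈ zonotope n m) (c : Fin (n + 1) → ℝ) (hc : Function.Injective c) :
    F (vtx n m c) * vtxProd q n m ξ (stdWt n) =
      F (vtx n m (stdWt n)) * vtxProd q n m ξ c := by
  induction hN : (inversions c).card using Nat.strong_induction_on generalizing c with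
  | _ N ih =>
  subst hN
  rcases (inversions c).eq_empty_or_nonempty with h0 | h0
  · have hlt : ∀ i j, i < j → (c j < c i) := by
      intro i j hij
      by_contra hn
      have : (i, j) ∈ inversions c := by
        simp [inversions, hij, lt_of_le_of_ne (not_lt.1 hn) (hc.ne hij.ne)]
      rw [h0] at this; simp at this
    have e1 : vtx n m c = vtx n m (stdWt n) := by
      simp only [vtx]
      refine Finset.sum_congr rfl fun i _ => Finset.sum_congr rfl fun j hj => ?_
      have hij := Finset.mem_Ioi.1 hj
      simp only [hlt i j hij, stdWt_lt, hij]
    have e2 : vtxProd q n m ξ c = vtxProd q n m ξ (stdWt n) := by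
      simp only [vtxProd]
      refine Finset.prod_congr rfl fun i _ => Finset.prod_congr rfl fun j hj => ?_
      have hij := Finset.mem_Ioi.1 hj
      simp only [hlt i j hij, stdWt_lt, hij]
    rw [e1, e2]
  · obtain ⟨a, b, hab, hlt, hx⟩ := exists_neighbour h0
    set c' := c ∘ Equiv.swap a b with hc'
    have hc'i : Function.Injective c' := hc.comp (Equiv.swap a b).injective
    have hcc : c' ∘ Equiv.swap a b = c := by
      ext x; simp [hc']
    have hN' : IsNeighbour c' a b := by
      refine ⟨by simp [hc', hlt], fun x => ?_⟩
      simp only [hc', Function.comp_apply, Equiv.swap_apply_left, Equiv.swap_apply_right]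
      exact hx _
    have hsub : inversions c' ⊂ inversions c := by
      rw [Finset.ssubset_iff_of_subset]
      · refine ⟨(a, b), by simp [inversions, hab, hlt], ?_⟩
        simp [inversions, hN'.1.not_gt]
      · rintro ⟨i, j⟩ hp
        simp only [inversions, Finset.mem_filter, Finset.mem_univ, true_and] at hp ⊢
        refine ⟨hp.1, ?_⟩
        have := hN'.swap_lt_iff hc'i (x := i) (y := j)
          (fun h => by rw [h.1, h.2] at hp; exact hp.2.not_gt hN'.1)
          (fun h => by rw [h.1, h.2] at hp; exact hp.1.not_gt hab)
        rw [← this] at hp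
        rw [← hcc]; exact hp.2
    have hI := ih _ (Finset.card_lt_card hsub) c' hc'i rfl
    have h1 := edge_ends hq0 hq hm hF hZ hc'i hab hN'
    have h2 := vtxProd_swap (q := q) (m := m) ξ hN' hc'i hab
    rw [hcc] at h1 h2
    apply mul_right_cancel₀ (posFac_ne_zero (m := m) (hg a b hab))
    linear_combination vtxProd q n m ξ (stdWt n) * h1 + negFac q n m ξ a b * hI -
      F (vtx n m (stdWt n)) * h2

end

end

/-! ### Binomial linear forms as prime elements. -/

noncomputable section

open MvPolynomial in
/-- The linear form `u X_a - v X_b`. -/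
def linForm {K σ : Type*} [Field K] (u v : K) (a b : σ) : MvPolynomial σ K :=
  C u * X a - C v * X b

section LinForm

open MvPolynomial

variable {K σ : Type*} [Field K]

theorem eval_linForm (u v : K) (a b : σ) (w : σ → K) :
    eval w (linForm u v a b) = u * w a - v * w b := by
  simp [linForm]

/-- The substitution of `(v / u) X_b` for `X_a` changes a polynomial by a multiple of the form. Over
an infinite field, vanishing on the hyperplane means that the substituted polynomial is zero. -/
theorem linForm_dvd_iff [Infinite K] {u v : K} (hu : u ≠ 0) {a b : σ} (hab : a ≠ b)
    (p : MvPolynomial σ K) :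
    linForm u v a b ∣ p ↔ ∀ w : σ → K, u * w a = v * w b → eval w p = 0 := by
  classical
  constructor
  · rintro ⟨r, rfl⟩ w hw
    rw [map_mul, eval_linForm, hw, sub_self, zero_mul]
  · intro h
    let φ : MvPolynomial σ K →ₐ[K] MvPolynomial σ K :=
      aeval (fun i => if i = a then C (v / u) * X b else X i)
    have hsub : ∀ r : MvPolynomial σ K, linForm u v a b ∣ r - φ r := by
      intro r
      induction r using MvPolynomial.induction_on with
      | C x => simp [φ]
      | add r r' h1 h2 =>
        rw [map_add, add_sub_add_comm]; exact dvd_add h1 h2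
      | mul_X r i h1 =>
        have : r * X i - φ (r * X i) = (r - φ r) * X i + φ r * (X i - φ (X i)) := by
          rw [map_mul]; ring
        rw [this]
        refine dvd_add (dvd_mul_of_dvd_left h1 _) (dvd_mul_of_dvd_right ?_ _)
        by_cases hi : i = a
        · subst hi
          refine ⟨C u⁻¹, ?_⟩
          have h1 : (C u * C u⁻¹ : MvPolynomial σ K) = 1 := by
            rw [← C_mul, mul_inv_cancel₀ hu, C_1]
          simp only [φ, aeval_X, if_true, linForm, div_eq_mul_inv, C_mul]
          linear_combination -(X i : MvPolynomial σ K) * h1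
        · simp [φ, hi]
    have h0 : φ p = 0 := by
      apply MvPolynomial.funext
      intro w
      have : eval w (φ p) = eval (fun i => if i = a then v / u * w b else w i) p := by
        have : (eval w).comp (φ : MvPolynomial σ K →+* MvPolynomial σ K) =
            eval (fun i => if i = a then v / u * w b else w i) := by
          apply MvPolynomial.ringHom_ext
          · intro r; simp [φ]
          · intro i
            by_cases hi : i = a
            · simp [φ, hi]
            · simp [φ, hi]
        exact RingHom.congr_fun this p
      rw [this, h _ (by simp [hab.symm]; field_simp), map_zero]
    have := hsub p
    rwa [h0, sub_zero] at this

theorem linForm_ne_zero {u v : K} (hu : u ≠ 0) {a b : σ} (hab : a ≠ b) : linForm u v a b ≠ 0 := by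
  classical
  intro h
  have := congrArg (eval (fun i => if i = a then (1 : K) else 0)) h
  rw [eval_linForm] at this
  simp [hab.symm, hu] at this

/-- The multiples of the form are the kernel of a substitution into a domain. -/
theorem prime_linForm [Infinite K] {u v : K} (hu : u ≠ 0) {a b : σ} (hab : a ≠ b) :
    Prime (linForm u v a b) := by
  classical
  refine ⟨linForm_ne_zero hu hab, ?_, ?_⟩
  · intro hunit
    have h1 := (hunit.map (eval (fun _ => (0 : K)))).ne_zero
    rw [eval_linForm] at h1
    simp at h1
  · intro p r hpr
    by_contra! hcon
    let φ : MvPolynomial σ K →ₐ[K] MvPolynomial σ K :=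
      aeval (fun i => if i = a then C (v / u) * X b else X i)
    have hφ : ∀ p : MvPolynomial σ K, linForm u v a b ∣ p ↔ φ p = 0 := by
      intro p
      have hev : ∀ w, eval w (φ p) = eval (fun i => if i = a then v / u * w b else w i) p := by
        intro w
        have : (eval w).comp (φ : MvPolynomial σ K →+* MvPolynomial σ K) =
            eval (fun i => if i = a then v / u * w b else w i) := by
          apply MvPolynomial.ringHom_ext
          · intro r; simp [φ]
          · intro i
            by_cases hi : i = a
            · simp [φ, hi]
            · simp [φ, hi]
        exact RingHom.congr_fun this p
      rw [linForm_dvd_iff hu hab]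
      constructor
      · intro h
        apply MvPolynomial.funext
        intro w
        rw [hev, h _ (by simp [hab.symm]; field_simp), map_zero]
      · intro h w hw
        have := hev w
        rw [h, map_zero] at this
        rw [this]
        congr 1
        congr 1
        ext i
        split_ifs with hi
        · subst hi; field_simp; linear_combination hw
        · rfl
    rw [hφ, map_mul, mul_eq_zero, ← hφ, ← hφ] at hpr
    exact hpr.elim hcon.1 hcon.2

/-- Two linear forms in different pairs of variables do not divide each other. -/
theorem not_linForm_dvd_linForm [Infinite K] {u v u' v' : K} (hu : u ≠ 0) (hv : v ≠ 0)
    (hu' : u' ≠ 0) (hv' : v' ≠ 0) {a b a' b' : σ} (hab : a ≠ b) (hab' : a' ≠ b')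
    (h1 : ¬(a = a' ∧ b = b')) (h2 : ¬(a = b' ∧ b = a')) :
    ¬linForm u v a b ∣ linForm u' v' a' b' := by
  classical
  rw [linForm_dvd_iff hu hab]
  push Not
  by_cases ha : a' = a ∨ a' = b
  · by_cases hb : b' = a ∨ b' = b
    · exfalso
      rcases ha with rfl | rfl <;> rcases hb with rfl | rfl <;> simp_all
    · push Not at hb
      refine ⟨fun i => if i = a then v else if i = b then u else 0, by simp [hab.symm, mul_comm], ?_⟩
      rw [eval_linForm]
      rcases ha with rfl | rfl
      · simp [hb.1, hb.2, hu', hv]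
      · simp [hb.1, hb.2, hu', hu, hab.symm]
  · push Not at ha
    refine ⟨fun i => if i = a then v else if i = b then u else if i = a' then
      (if b' = a ∨ b' = b then 0 else 1) else 0, by simp [hab.symm, mul_comm], ?_⟩
    rw [eval_linForm]
    by_cases hb : b' = a ∨ b' = b
    · rcases hb with rfl | rfl
      · simp [ha.1, ha.2, hv', hv]
      · simp [ha.1, ha.2, hv', hu, hab.symm]
    · push Not at hb
      simp [ha.1, ha.2, hb.1, hb.2, hab'.symm, hu']

/-- The same pair of variables with a different ratio. -/
theorem not_linForm_dvd_of_ratio [Infinite K] {u v u' v' : K} (hu : u ≠ 0)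
    {a b : σ} (hab : a ≠ b) (h : u' * v ≠ v' * u) :
    ¬linForm u v a b ∣ linForm u' v' a b := by
  classical
  rw [linForm_dvd_iff hu hab]
  push Not
  refine ⟨fun i => if i = a then v else if i = b then u else 0, by simp [hab.symm, mul_comm], ?_⟩
  rw [eval_linForm]
  simp [hab.symm, sub_ne_zero, h]

end LinForm

/-! ### Leading parts with respect to real weights -/

section Top

open MvPolynomial

variable {K σ : Type*} [Field K]

/-- All monomials of `F` have weight at most `t`. -/
def WtLE (c : σ → ℝ) (t : ℝ) (F : MvPolynomial σ K) : Prop :=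
  ∀ k ∈ F.support, Finsupp.weight c k ≤ t

theorem WtLE.mono {c : σ → ℝ} {t t' : ℝ} (h : t ≤ t') {F : MvPolynomial σ K} (hF : WtLE c t F) :
    WtLE c t' F := fun k hk => (hF k hk).trans h

theorem WtLE.add {c : σ → ℝ} {t : ℝ} {F G : MvPolynomial σ K} (hF : WtLE c t F)
    (hG : WtLE c t G) : WtLE c t (F + G) := by
  classical
  intro k hk
  rcases Finset.mem_union.1 (MvPolynomial.support_add hk) with h | h
  exacts [hF k h, hG k h]

theorem WtLE.sum {ι : Type*} {c : σ → ℝ} {t : ℝ} (s : Finset ι) {F : ι → MvPolynomial σ K}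
    (hF : ∀ i ∈ s, WtLE c t (F i)) : WtLE c t (∑ i ∈ s, F i) := by
  classical
  intro k hk
  obtain ⟨i, hi, h⟩ := Finset.mem_biUnion.1 (MvPolynomial.support_sum hk)
  exact hF i hi k h

theorem WtLE.mul {c : σ → ℝ} {t t' : ℝ} {F G : MvPolynomial σ K} (hF : WtLE c t F)
    (hG : WtLE c t' G) : WtLE c (t + t') (F * G) := by
  classical
  intro k hk
  obtain ⟨x, hx, y, hy, rfl⟩ := Finset.mem_add.1 (MvPolynomial.support_mul F G hk)
  rw [map_add]
  exact add_le_add (hF x hx) (hG y hy)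

theorem WtLE.C_mul {c : σ → ℝ} {t : ℝ} {F : MvPolynomial σ K} (hF : WtLE c t F) (x : K) :
    WtLE c t (C x * F) := by
  intro k hk
  refine hF k ?_
  rw [MvPolynomial.mem_support_iff] at hk ⊢
  rw [coeff_C_mul] at hk
  exact right_ne_zero_of_mul hk

theorem wtLE_one (c : σ → ℝ) : WtLE c 0 (1 : MvPolynomial σ K) := by
  classical
  intro k hk
  rw [MvPolynomial.mem_support_iff, coeff_one] at hk
  have : k = 0 := by by_contra h; exact hk (if_neg (Ne.symm h))
  simp [this]

theorem WtLE.prod {ι : Type*} {c : σ → ℝ} (s : Finset ι) {t : ι → ℝ} {F : ι → MvPolynomial σ K}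
    (hF : ∀ i ∈ s, WtLE c (t i) (F i)) : WtLE c (∑ i ∈ s, t i) (∏ i ∈ s, F i) := by
  classical
  induction s using Finset.induction_on with
  | empty => simpa using wtLE_one c
  | insert i s hi ih =>
    rw [Finset.sum_insert hi, Finset.prod_insert hi]
    exact (hF i (by simp)).mul (ih fun j hj => hF j (by simp [hj]))

/-- The part of `F` of weight exactly `t`. -/
def topPart (c : σ → ℝ) (t : ℝ) (F : MvPolynomial σ K) : MvPolynomial σ K :=
  weightedHomogeneousComponent c t F

open Classical in
theorem coeff_topPart (c : σ → ℝ) (t : ℝ) (F : MvPolynomial σ K) (k : σ →₀ ℕ) :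
    coeff k (topPart c t F) = if Finsupp.weight c k = t then coeff k F else 0 := by
  rw [topPart, coeff_weightedHomogeneousComponent]

theorem topPart_add (c : σ → ℝ) (t : ℝ) (F G : MvPolynomial σ K) :
    topPart c t (F + G) = topPart c t F + topPart c t G := map_add _ _ _

theorem topPart_sum {ι : Type*} (c : σ → ℝ) (t : ℝ) (s : Finset ι) (F : ι → MvPolynomial σ K) :
    topPart c t (∑ i ∈ s, F i) = ∑ i ∈ s, topPart c t (F i) := map_sum _ _ _

theorem topPart_C_mul (c : σ → ℝ) (t : ℝ) (x : K) (F : MvPolynomial σ K) :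
    topPart c t (C x * F) = C x * topPart c t F := by
  ext k; simp only [coeff_topPart, coeff_C_mul]; split_ifs <;> simp

theorem topPart_mul {c : σ → ℝ} {t t' : ℝ} {F G : MvPolynomial σ K} (hF : WtLE c t F)
    (hG : WtLE c t' G) : topPart c (t + t') (F * G) = topPart c t F * topPart c t' G := by
  classical
  ext k
  rw [coeff_topPart, coeff_mul, coeff_mul]
  split_ifs with hk
  · refine Finset.sum_congr rfl fun p hp => ?_
    have hp' := Finset.HasAntidiagonal.mem_antidiagonal.1 hp
    rw [coeff_topPart, coeff_topPart]
    by_cases h1 : coeff p.1 F = 0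
    · simp [h1]
    by_cases h2 : coeff p.2 G = 0
    · simp [h2]
    have e1 := hF p.1 (MvPolynomial.mem_support_iff.2 h1)
    have e2 := hG p.2 (MvPolynomial.mem_support_iff.2 h2)
    have e3 : Finsupp.weight c p.1 + Finsupp.weight c p.2 = t + t' := by
      rw [← map_add, hp', hk]
    rw [if_pos (by linarith), if_pos (by linarith)]
  · symm
    refine Finset.sum_eq_zero fun p hp => ?_
    have hp' := Finset.HasAntidiagonal.mem_antidiagonal.1 hp
    rw [coeff_topPart, coeff_topPart]
    by_contra h0
    apply hk
    rw [← hp', map_add]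
    split_ifs at h0 with h1 h2 <;> simp_all

theorem topPart_eq_zero_of_lt {c : σ → ℝ} {t t' : ℝ} {F : MvPolynomial σ K} (hF : WtLE c t F)
    (h : t < t') : topPart c t' F = 0 := by
  classical
  ext k
  rw [coeff_topPart, coeff_zero]
  split_ifs with hk
  · by_contra h0
    have := hF k (MvPolynomial.mem_support_iff.2 h0)
    linarith
  · rfl

theorem topPart_one (c : σ → ℝ) : topPart c 0 (1 : MvPolynomial σ K) = 1 := by
  classical
  ext k
  rw [coeff_topPart, coeff_one]
  split_ifs with h1 h2 h2
  · rfl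
  · rfl
  · exact absurd (by simp [← h2]) h1
  · rfl

theorem topPart_prod {ι : Type*} {c : σ → ℝ} (s : Finset ι) {t : ι → ℝ}
    {F : ι → MvPolynomial σ K} (hF : ∀ i ∈ s, WtLE c (t i) (F i)) :
    topPart c (∑ i ∈ s, t i) (∏ i ∈ s, F i) = ∏ i ∈ s, topPart c (t i) (F i) := by
  classical
  induction s using Finset.induction_on with
  | empty => simpa using topPart_one c
  | insert i s hi ih =>
    rw [Finset.sum_insert hi, Finset.prod_insert hi, Finset.prod_insert hi,
      topPart_mul (hF i (by simp)) (WtLE.prod s fun j hj => hF j (by simp [hj])),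
      ih fun j hj => hF j (by simp [hj])]

theorem wtLE_X (c : σ → ℝ) (a : σ) : WtLE c (c a) (X a : MvPolynomial σ K) := by
  classical
  intro k hk
  rw [MvPolynomial.support_X, Finset.mem_singleton] at hk
  simp [hk, Finsupp.weight_single]

theorem topPart_X (c : σ → ℝ) (a : σ) (t : ℝ) :
    topPart c t (X a : MvPolynomial σ K) = if c a = t then X a else 0 := by
  classical
  ext k
  rw [coeff_topPart]
  by_cases hk : Finsupp.single a 1 = k
  · subst hk; simp [Finsupp.weight_single]; split_ifs <;> simp
  · rw [coeff_X, if_neg hk]; split_ifs <;> simp [coeff_X, hk]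

theorem wtLE_linForm (c : σ → ℝ) (u v : K) (a b : σ) :
    WtLE c (max (c a) (c b)) (linForm u v a b) := by
  have : linForm u v a b = C u * X a + C (-v) * X b := by simp [linForm, sub_eq_add_neg]
  rw [this]
  exact (((wtLE_X c a).mono (le_max_left _ _)).C_mul u).add
    (((wtLE_X c b).mono (le_max_right _ _)).C_mul (-v))

theorem topPart_linForm {c : σ → ℝ} (u v : K) {a b : σ} (hab : c a ≠ c b) :
    topPart c (max (c a) (c b)) (linForm u v a b) =
      if c b < c a then C u * X a else C (-v) * X b := by
  have : linForm u v a b = C u * X a + C (-v) * X b := by simp [linForm, sub_eq_add_neg]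
  rw [this, topPart_add, topPart_C_mul, topPart_C_mul, topPart_X, topPart_X]
  rcases lt_or_gt_of_ne hab with h | h
  · rw [max_eq_right h.le, if_neg hab, if_pos rfl, if_neg (not_lt.2 h.le), mul_zero, zero_add]
  · rw [max_eq_left h.le, if_pos rfl, if_neg hab.symm, if_pos h, mul_zero, add_zero]

end Top

end

noncomputable section

/-! ### The dual difference operator acting on polynomials -/

section DualOp

open MvPolynomial Finset

variable {K : Type*} [Field K] {n : ℕ}

/-- The pairs `i < j` of indices. -/
def indexPairs (n : ℕ) : Finset (Fin (n + 1) × Fin (n + 1)) := univ.filter fun p => p.1 < p.2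

theorem mem_indexPairs {p : Fin (n + 1) × Fin (n + 1)} : p ∈ indexPairs n ↔ p.1 < p.2 := by
  simp [indexPairs]

/-- The pairs that contain `e` correspond to the indices other than `e`. -/
theorem prod_indexPairs {M : Type*} [CommMonoid M] (e : Fin (n + 1)) (g : Fin (n + 1) → M) :
    ∏ p ∈ indexPairs n, (if p.1 = e then g p.2 else if p.2 = e then g p.1 else 1) =
      ∏ x ∈ univ.erase e, g x := by
  rw [indexPairs, prod_filter, ← univ_product_univ, prod_product]
  have h : ∀ a : Fin (n + 1), ∏ b : Fin (n + 1), (if a < b then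
      (if a = e then g b else if b = e then g a else 1) else 1) =
      (if a = e then ∏ b, (if e < b then g b else 1) else 1) * if a < e then g a else 1 := by
    intro a
    by_cases ha : a = e
    · subst ha; simp
    · simp only [if_neg ha, one_mul]
      rw [Finset.prod_eq_single e]
      · simp
      · intro b _ hb; simp [hb]
      · simp
  simp only [h, prod_mul_distrib, prod_ite_eq', mem_univ, if_true]
  rw [← prod_mul_distrib, ← Finset.mul_prod_erase _ _ (mem_univ e)]
  simp only [lt_irrefl, if_false, one_mul]
  refine prod_congr rfl fun x hx => ?_
  rcases lt_or_gt_of_ne (ne_of_mem_erase hx) with h | h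
  · simp [h, h.not_gt]
  · simp [h, h.not_gt]

/-- The scale of the last variable for which the wall of every pair becomes equality of the rescaled
coordinates. -/
def dCoefL (q t : K) (b : Fin (n + 1)) : K := if b = Fin.last n then q / t else 1

/-- With this value the numerator vanishes on `X_a = t² X_b`, or on `X_a = q t X_b` if the last
index occurs. There the shifted point is covered by no condition of its own. -/
def dCoefN (q t : K) (a b : Fin (n + 1)) : K := if a = Fin.last n ∨ b = Fin.last n then q else t

/-- The linear form in the denominator, vanishing on the wall of the pair `a, b`. -/
def dFormL (q t : K) (a b : Fin (n + 1)) : MvPolynomial (Fin (n + 1)) K :=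
  linForm (dCoefL q t b) (dCoefL q t a) a b

/-- The linear form in the numerator. -/
def dFormN (q t : K) (a b : Fin (n + 1)) : MvPolynomial (Fin (n + 1)) K :=
  linForm t⁻¹ (dCoefN q t a b) a b

theorem dFormL_swap (q t : K) (a b : Fin (n + 1)) : dFormL q t b a = -dFormL q t a b := by
  simp [dFormL, linForm]

/-- The common denominator of the coefficients of the dual operator. -/
def dDen (n : ℕ) (q t : K) : MvPolynomial (Fin (n + 1)) K :=
  ∏ p ∈ indexPairs n, dFormL q t p.1 p.2

/-- The factors of the numerators of the coefficients of the dual operator. -/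
def dFactor (q t : K) (e a b : Fin (n + 1)) : MvPolynomial (Fin (n + 1)) K :=
  if a = e then dFormN q t a b else if b = e then -dFormN q t b a else dFormL q t a b

/-- The coefficient of the shift in the variable `e`, multiplied by the common denominator. -/
def dNum (q t : K) (e : Fin (n + 1)) : MvPolynomial (Fin (n + 1)) K :=
  ∏ p ∈ indexPairs n, dFactor q t e p.1 p.2

/-- The weight `[1] / [m]` of the last term balances the residues on the walls involving the last
index; see `wall_numerators`. -/
def dGam (q t : K) (e : Fin (n + 1)) : K := if e = Fin.last n then (q - q⁻¹) / (t - t⁻¹) else 1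

/-- For `t = q^m` this is `q` to twice the squared unit length of the coordinate. -/
def dScale (q t : K) (e : Fin (n + 1)) : K := if e = Fin.last n then t ^ 2 else q ^ 2

/-- The shift `X_e ↦ q^{2 d_e} X_e` on points. -/
def dPoint (q t : K) (e : Fin (n + 1)) (w : Fin (n + 1) → K) : Fin (n + 1) → K :=
  Function.update w e (dScale q t e * w e)

/-- The substitution `X_a ↦ c_a X_a`. -/
def scaleHom (c : Fin (n + 1) → K) :
    MvPolynomial (Fin (n + 1)) K →ₐ[K] MvPolynomial (Fin (n + 1)) K :=
  aeval fun a => C (c a) * X a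

theorem eval_scaleHom (c w : Fin (n + 1) → K) (F : MvPolynomial (Fin (n + 1)) K) :
    eval w (scaleHom c F) = eval (c * w) F := by
  have : (eval w).comp (scaleHom c : MvPolynomial (Fin (n + 1)) K →+* _) = eval (c * w) := by
    apply MvPolynomial.ringHom_ext
    · intro r; simp [scaleHom]
    · intro i; simp [scaleHom]
  exact RingHom.congr_fun this F

theorem coeff_scaleHom (c : Fin (n + 1) → K) (F : MvPolynomial (Fin (n + 1)) K)
    (k : Fin (n + 1) →₀ ℕ) : coeff k (scaleHom c F) = (∏ a, c a ^ k a) * coeff k F := by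
  classical
  induction F using MvPolynomial.induction_on' with
  | monomial u a =>
    have : scaleHom c (monomial u a) = monomial u ((∏ x, c x ^ u x) * a) := by
      rw [scaleHom, aeval_monomial, Finsupp.prod_fintype _ _ (by simp)]
      simp only [mul_pow, prod_mul_distrib, ← C_pow, ← map_prod]
      rw [monomial_eq, Finsupp.prod_fintype _ _ (by simp), mul_comm _ a, C_mul, mul_assoc]
      rfl
    rw [this, coeff_monomial, coeff_monomial]
    split_ifs with h
    · rw [h]
    · simp
  | add p r hp hr => rw [map_add, coeff_add, coeff_add, hp, hr, mul_add]

def dShift (q t : K) (e : Fin (n + 1)) :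
    MvPolynomial (Fin (n + 1)) K →ₐ[K] MvPolynomial (Fin (n + 1)) K :=
  scaleHom (Function.update 1 e (dScale q t e))

theorem eval_dShift (q t : K) (e : Fin (n + 1)) (w : Fin (n + 1) → K)
    (F : MvPolynomial (Fin (n + 1)) K) : eval w (dShift q t e F) = eval (dPoint q t e w) F := by
  rw [dShift, eval_scaleHom]
  congr 2
  ext a
  by_cases h : a = e
  · subst h; simp [dPoint]
  · simp [dPoint, h]

/-- The numerator of the image of `F` under the dual operator. -/
def dImage (q t : K) (ζ : Fin (n + 1) → K) (F : MvPolynomial (Fin (n + 1)) K) :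
    MvPolynomial (Fin (n + 1)) K :=
  ∑ e, C (dGam q t e * ζ e) * (dNum q t e * dShift q t e F)

/-- The quasi-invariance conditions for a polynomial. -/
def PolyQuasiInv (q t : K) (m : ℕ) (ζ : Fin (n + 1) → K) (F : MvPolynomial (Fin (n + 1)) K) :
    Prop :=
  (∀ i j, i < j → j ≠ Fin.last n → ∀ s ∈ Icc 1 m, ∀ w : Fin (n + 1) → K,
    w j = q ^ (2 * s) * w i → ζ j ^ s * eval w F = ζ i ^ s * eval (w ∘ Equiv.swap i j) F) ∧
  (∀ i, i ≠ Fin.last n → ∀ w : Fin (n + 1) → K, w (Fin.last n) = q * t * w i →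
    ζ (Fin.last n) * eval w F = ζ i * eval (Function.update (Function.update w i (q ^ 2 * w i))
      (Fin.last n) (w (Fin.last n) / t ^ 2)) F)

/-- The value of the coefficient at a point where no denominator vanishes. -/
def dCoef (q t : K) (w : Fin (n + 1) → K) (e : Fin (n + 1)) : K :=
  ∏ x ∈ univ.erase e, eval w (dFormN q t e x) / eval w (dFormL q t e x)

variable {q t : K}

theorem dCoefL_ne_zero (hq : q ≠ 0) (ht : t ≠ 0) (b : Fin (n + 1)) : dCoefL q t b ≠ 0 := by
  unfold dCoefL; split_ifs
  exacts [div_ne_zero hq ht, one_ne_zero]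

theorem eval_dNum_aux {w : Fin (n + 1) → K} (e : Fin (n + 1))
    (S : Finset (Fin (n + 1) × Fin (n + 1)))
    (hS : ∀ p ∈ S, eval w (dFormL q t p.1 p.2) ≠ 0) :
    ∏ p ∈ S, eval w (dFactor q t e p.1 p.2) = (∏ p ∈ S, eval w (dFormL q t p.1 p.2)) *
      ∏ p ∈ S, (if p.1 = e then eval w (dFormN q t e p.2) / eval w (dFormL q t e p.2) else
        if p.2 = e then eval w (dFormN q t e p.1) / eval w (dFormL q t e p.1) else 1) := by
  rw [← prod_mul_distrib]
  refine prod_congr rfl fun p hp => ?_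
  have h := hS p hp
  unfold dFactor
  split_ifs with h1 h2
  · rw [h1] at h ⊢; field_simp
  · rw [dFormL_swap q t p.1 e, ← h2, map_neg, map_neg]; field_simp
  · rw [mul_one]

theorem eval_dNum {w : Fin (n + 1) → K} (hw : eval w (dDen n q t) ≠ 0) (e : Fin (n + 1)) :
    eval w (dNum q t e) = eval w (dDen n q t) * dCoef q t w e := by
  rw [dDen, map_prod, prod_ne_zero_iff] at hw
  rw [dNum, map_prod, eval_dNum_aux e _ hw, dDen, map_prod, dCoef,
    prod_indexPairs e fun x => eval w (dFormN q t e x) / eval w (dFormL q t e x)]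

theorem eval_of_dImage {ζ : Fin (n + 1) → K} {F F' : MvPolynomial (Fin (n + 1)) K}
    (h : dDen n q t * F' = dImage q t ζ F) {w : Fin (n + 1) → K}
    (hw : eval w (dDen n q t) ≠ 0) :
    eval w F' = ∑ e, dGam q t e * ζ e * (dCoef q t w e * eval (dPoint q t e w) F) := by
  apply mul_left_cancel₀ hw
  rw [← map_mul, h, dImage, map_sum, mul_sum]
  refine sum_congr rfl fun e _ => ?_
  simp only [map_mul, eval_C]
  rw [eval_dNum hw, eval_dShift]
  ring

/-- By primality of the form, vanishing on the hyperplane may be checked away from any hypersurface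
that does not contain it. -/
theorem linForm_dvd_of_generic [Infinite K] {u v : K} (hu : u ≠ 0) {a b : Fin (n + 1)}
    (hab : a ≠ b) {p H : MvPolynomial (Fin (n + 1)) K} (hH : ¬linForm u v a b ∣ H)
    (h : ∀ w : Fin (n + 1) → K, u * w a = v * w b → eval w H ≠ 0 → eval w p = 0) :
    linForm u v a b ∣ p := by
  refine ((prime_linForm hu hab).dvd_or_dvd (?_ : linForm u v a b ∣ p * H)).resolve_right hH
  rw [linForm_dvd_iff hu hab]
  intro w hw
  rw [map_mul]
  by_cases h0 : eval w H = 0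
  · rw [h0, mul_zero]
  · rw [h w hw h0, zero_mul]

theorem not_dFormL_dvd [Infinite K] (hq : q ≠ 0) (ht : t ≠ 0) {u v : K} (hu : u ≠ 0) (hv : v ≠ 0)
    {i j a b : Fin (n + 1)} (hij : i < j) (hab : a < b) (h : ¬(a = i ∧ b = j)) :
    ¬linForm u v i j ∣ dFormL q t a b := by
  refine not_linForm_dvd_linForm hu hv (dCoefL_ne_zero hq ht _) (dCoefL_ne_zero hq ht _) hij.ne
    hab.ne (fun h' => h ⟨h'.1.symm, h'.2.symm⟩) (fun h' => ?_)
  rw [h'.1, h'.2] at hij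
  exact lt_asymm hij hab

theorem prod_indexPairs_erase {w : Fin (n + 1) → K} {i j e e' : Fin (n + 1)}
    (hij : i < j) (he : (e = i ∧ e' = j) ∨ (e = j ∧ e' = i))
    (hw : eval w (∏ p ∈ (indexPairs n).erase (i, j), dFormL q t p.1 p.2) ≠ 0) :
    ∏ p ∈ (indexPairs n).erase (i, j), eval w (dFactor q t e p.1 p.2) =
      eval w (∏ p ∈ (indexPairs n).erase (i, j), dFormL q t p.1 p.2) *
      ∏ x ∈ (univ.erase e).erase e', eval w (dFormN q t e x) / eval w (dFormL q t e x) := by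
  rw [map_prod, prod_ne_zero_iff] at hw
  rw [eval_dNum_aux e _ hw, map_prod]
  congr 1
  have hmem : (i, j) ∈ indexPairs n := mem_indexPairs.2 hij
  have hmem' : e' ∈ univ.erase e := by
    rcases he with ⟨rfl, rfl⟩ | ⟨rfl, rfl⟩
    · simp [hij.ne']
    · simp [hij.ne]
  have h1 := prod_indexPairs e (fun x => if x = e' then (1 : K) else
    eval w (dFormN q t e x) / eval w (dFormL q t e x))
  rw [← mul_prod_erase _ _ hmem, ← mul_prod_erase _ _ hmem', if_pos rfl, one_mul] at h1
  have h2 : ∀ x ∈ (univ.erase e).erase e', (if x = e' then (1 : K) else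
    eval w (dFormN q t e x) / eval w (dFormL q t e x)) =
      eval w (dFormN q t e x) / eval w (dFormL q t e x) :=
    fun x hx => if_neg (ne_of_mem_erase hx)
  rw [← prod_congr rfl h2, ← h1]
  have h3 : (if (i, j).1 = e then if (i, j).2 = e' then (1 : K) else
      eval w (dFormN q t e (i, j).2) / eval w (dFormL q t e (i, j).2) else
      if (i, j).2 = e then if (i, j).1 = e' then (1 : K) else
      eval w (dFormN q t e (i, j).1) / eval w (dFormL q t e (i, j).1) else 1) = 1 := by
    rcases he with ⟨rfl, rfl⟩ | ⟨rfl, rfl⟩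
    · simp
    · simp [hij.ne]
  rw [h3, one_mul]
  refine prod_congr rfl fun p hp => ?_
  obtain ⟨hp1, hp2⟩ := mem_erase.1 hp
  rw [mem_indexPairs] at hp2
  obtain ⟨a, b⟩ := p
  simp only at hp2 ⊢
  rcases he with ⟨rfl, rfl⟩ | ⟨rfl, rfl⟩
  · split_ifs with h1 h2 h3 h4
    · exact absurd (by rw [h1, h2]) hp1
    · rfl
    · subst h3; subst h4; exact absurd hp2 hij.not_gt
    · rfl
    · rfl
  · split_ifs with h1 h2 h3 h4
    · rw [h1, h2] at hp2; exact absurd hp2 hij.not_gt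
    · rfl
    · exact absurd (by rw [h3, h4]) hp1
    · rfl
    · rfl

/-- The factors of a third index agree on a wall. -/
theorem ratio_eq_of_wall (hq : q ≠ 0) (ht : t ≠ 0) {w : Fin (n + 1) → K} {i j : Fin (n + 1)}
    (hij : i < j) (hw : dCoefL q t j * w i = dCoefL q t i * w j) {x : Fin (n + 1)}
    (hxj : x ≠ j) : eval w (dFormN q t i x) / eval w (dFormL q t i x) =
      eval w (dFormN q t j x) / eval w (dFormL q t j x) := by
  have hi : i ≠ Fin.last n := (hij.trans_le (Fin.le_last j)).ne
  simp only [dFormN, dFormL, eval_linForm]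
  by_cases hj : j = Fin.last n
  · subst hj
    simp only [dCoefL, dCoefN, if_true, one_mul, hi, hxj, false_or,
      true_or, if_false] at hw ⊢
    rw [← hw]
    have e1 : t⁻¹ * (q / t * w i) - q * w x = q / t * (t⁻¹ * w i - t * w x) := by
      field_simp
    rw [e1, ← mul_sub, mul_div_mul_left _ _ (div_ne_zero hq ht)]
  · simp only [dCoefL, dCoefN, hi, hj, false_or, if_false, one_mul] at hw ⊢
    rw [hw]

/-- Starting on the wall, the two shifted points are reflections of each other in the sense of the
first quasi-invariance condition. -/
theorem dPoint_wall {ζ : Fin (n + 1) → K} {m : ℕ} (hm : 0 < m) (ht : t ≠ 0)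
    {F : MvPolynomial (Fin (n + 1)) K} (hF : PolyQuasiInv q t m ζ F)
    {w : Fin (n + 1) → K} {i j : Fin (n + 1)} (hij : i < j)
    (hw : dCoefL q t j * w i = dCoefL q t i * w j) :
    ζ j * eval (dPoint q t j w) F = ζ i * eval (dPoint q t i w) F := by
  have hi : i ≠ Fin.last n := (hij.trans_le (Fin.le_last j)).ne
  by_cases hj : j = Fin.last n
  · subst hj
    simp only [dCoefL, if_neg hi, if_true, one_mul] at hw
    have h := hF.2 i hi (dPoint q t (Fin.last n) w) (by
      simp only [dPoint, Function.update_self, Function.update_of_ne hi, dScale, if_true, ← hw]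
      field_simp)
    rw [h]
    congr 3
    ext a
    by_cases ha : a = Fin.last n
    · subst ha
      simp only [dPoint, Function.update_self, dScale, if_true, Function.update_of_ne hij.ne']
      field_simp
    · by_cases hai : a = i
      · subst hai; simp [dPoint, hi, dScale]
      · simp [dPoint, ha, hai]
  · simp only [dCoefL, if_neg hi, if_neg hj, one_mul] at hw
    have h := hF.1 i j hij hj 1 (by simp; omega) (dPoint q t j w) (by
      simp only [dPoint, Function.update_self, Function.update_of_ne hij.ne, dScale, if_neg hj, hw])
    rw [pow_one, pow_one] at h
    rw [h]
    congr 3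
    ext a
    by_cases ha : a = i
    · subst ha; simp [dPoint, dScale, hi, hj, hw]
    · by_cases haj : a = j
      · subst haj; simp [dPoint, hij.ne, hw, ha]
      · simp [dPoint, ha, haj, Equiv.swap_apply_of_ne_of_ne ha haj]

/-- The factors of the pair itself give opposite residues on its wall; for the last index this uses
the value of `dGam`. -/
theorem wall_numerators (hq : q ≠ 0) (ht : t ≠ 0) (ht2 : t - t⁻¹ ≠ 0) {w : Fin (n + 1) → K}
    {i j : Fin (n + 1)} (hij : i < j) (hw : dCoefL q t j * w i = dCoefL q t i * w j) :
    dGam q t i * eval w (dFormN q t i j) = dGam q t j * eval w (dFormN q t j i) := by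
  have hi : i ≠ Fin.last n := (hij.trans_le (Fin.le_last j)).ne
  simp only [dFormN, eval_linForm]
  by_cases hj : j = Fin.last n
  · subst hj
    simp only [dCoefL, dCoefN, dGam, if_neg hi, if_true, one_mul, or_true, true_or] at hw ⊢
    rw [← hw, eq_comm, div_mul_eq_mul_div, div_eq_iff ht2]
    field_simp
    ring
  · simp only [dCoefL, dCoefN, dGam, one_mul, hi, hj, or_self,
      if_false] at hw ⊢
    rw [hw]

/-- On the wall of `i, j` only the terms `e = i` and `e = j` survive. They cancel by three
comparisons: the factors of third indices (`ratio_eq_of_wall`), the values of `F` (`dPoint_wall`),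
and the factors of the pair (`wall_numerators`). -/
theorem dFormL_dvd_dImage [Infinite K] (hq : q ≠ 0) (ht : t ≠ 0) (ht2 : t - t⁻¹ ≠ 0)
    {ζ : Fin (n + 1) → K} {m : ℕ} (hm : 0 < m)
    {F : MvPolynomial (Fin (n + 1)) K} (hF : PolyQuasiInv q t m ζ F) {i j : Fin (n + 1)}
    (hij : i < j) : dFormL q t i j ∣ dImage q t ζ F := by
  have hmem : (i, j) ∈ indexPairs n := mem_indexPairs.2 hij
  have hu := dCoefL_ne_zero (n := n) hq ht
  refine linForm_dvd_of_generic (hu j) hij.ne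
    (H := ∏ p ∈ (indexPairs n).erase (i, j), dFormL q t p.1 p.2) ?_ ?_
  · rw [(prime_linForm (hu j) hij.ne).dvd_finsetProd_iff]
    rintro ⟨⟨a, b⟩, hp, hdvd⟩
    obtain ⟨hp1, hp2⟩ := mem_erase.1 hp
    rw [mem_indexPairs] at hp2
    exact not_dFormL_dvd hq ht (hu j) (hu i) hij hp2 (fun h => hp1 (Prod.ext h.1 h.2)) hdvd
  · intro w hw hH
    have hL : eval w (dFormL q t i j) = 0 := by
      rw [dFormL, eval_linForm, hw, sub_self]
    have hnum : ∀ e, eval w (dNum q t e) = eval w (dFactor q t e i j) *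
        ∏ p ∈ (indexPairs n).erase (i, j), eval w (dFactor q t e p.1 p.2) := by
      intro e
      rw [dNum, map_prod, ← mul_prod_erase _ _ hmem]
    rw [dImage, map_sum]
    have hsub : ∑ e, eval w (C (dGam q t e * ζ e) * (dNum q t e * dShift q t e F)) =
        ∑ e ∈ {i, j}, eval w (C (dGam q t e * ζ e) * (dNum q t e * dShift q t e F)) := by
      symm
      refine sum_subset (subset_univ _) fun e _ he => ?_
      simp only [mem_insert, mem_singleton, not_or] at he
      rw [map_mul, map_mul (eval w) (dNum q t e), hnum, dFactor, if_neg (Ne.symm he.1),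
        if_neg (Ne.symm he.2), hL]
      simp
    rw [hsub, sum_pair hij.ne]
    simp only [map_mul, eval_C]
    rw [hnum, hnum, prod_indexPairs_erase hij (Or.inl ⟨rfl, rfl⟩) hH,
      prod_indexPairs_erase hij (Or.inr ⟨rfl, rfl⟩) hH, erase_right_comm (a := j) (b := i),
      eval_dShift, eval_dShift]
    have hr : ∏ x ∈ (univ.erase i).erase j, eval w (dFormN q t i x) / eval w (dFormL q t i x) =
        ∏ x ∈ (univ.erase i).erase j, eval w (dFormN q t j x) / eval w (dFormL q t j x) :=
      prod_congr rfl fun x hx => ratio_eq_of_wall hq ht hij hw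
        (ne_of_mem_erase hx)
    have h1 := dPoint_wall hm ht hF hij hw
    have h2 := wall_numerators hq ht ht2 hij hw
    rw [hr, dFactor, if_pos rfl, dFactor, if_neg hij.ne, if_pos rfl, map_neg]
    linear_combination ζ i * (eval w (∏ p ∈ (indexPairs n).erase (i, j), dFormL q t p.1 p.2) *
      ∏ x ∈ (univ.erase i).erase j, eval w (dFormN q t j x) / eval w (dFormL q t j x)) *
      eval (dPoint q t i w) F * h2 - dGam q t j * eval w (dFormN q t j i) *
      (eval w (∏ p ∈ (indexPairs n).erase (i, j), dFormL q t p.1 p.2) *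
      ∏ x ∈ (univ.erase i).erase j, eval w (dFormN q t j x) / eval w (dFormL q t j x)) * h1

/-- The dual operator preserves polynomiality on quasi-invariants. -/
theorem dDen_dvd_dImage [Infinite K] (hq : q ≠ 0) (ht : t ≠ 0) (ht2 : t - t⁻¹ ≠ 0)
    {ζ : Fin (n + 1) → K} {m : ℕ} (hm : 0 < m)
    {F : MvPolynomial (Fin (n + 1)) K} (hF : PolyQuasiInv q t m ζ F) :
    dDen n q t ∣ dImage q t ζ F := by
  have hu := dCoefL_ne_zero (n := n) hq ht
  refine Finset.prod_dvd_of_isRelPrime ?_ fun p hp =>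
    dFormL_dvd_dImage hq ht ht2 hm hF (mem_indexPairs.1 hp)
  intro p hp p' hp' hne
  rw [mem_coe, mem_indexPairs] at hp hp'
  refine ((prime_linForm (hu _) hp.ne).irreducible.isRelPrime_iff_not_dvd).2 ?_
  exact not_dFormL_dvd hq ht (hu _) (hu _) hp hp' fun h => hne (Prod.ext h.1.symm h.2.symm)

theorem linForm_swap (u v : K) (i j : Fin (n + 1)) : linForm v u j i = -linForm u v i j := by
  simp [linForm]

theorem not_linForm_dvd_dDen [Infinite K] (hq : q ≠ 0) (ht : t ≠ 0) {u v : K} (hu : u ≠ 0)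
    (hv : v ≠ 0) {i j : Fin (n + 1)} (hij : i ≠ j)
    (h : dCoefL q t j * v ≠ dCoefL q t i * u) : ¬linForm u v i j ∣ dDen n q t := by
  wlog hlt : i < j generalizing i j u v
  · rw [← neg_dvd, ← linForm_swap]
    exact this hv hu hij.symm h.symm (lt_of_le_of_ne (not_lt.1 hlt) hij.symm)
  rw [dDen, (prime_linForm hu hij).dvd_finsetProd_iff]
  rintro ⟨⟨a, b⟩, hp, hdvd⟩
  rw [mem_indexPairs] at hp
  by_cases hab : a = i ∧ b = j
  · obtain ⟨rfl, rfl⟩ := hab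
    exact not_linForm_dvd_of_ratio hu hij h hdvd
  · exact not_dFormL_dvd hq ht hu hv hlt hp hab hdvd

theorem dCoef_comp_swap (w : Fin (n + 1) → K) {i j : Fin (n + 1)} (hi : i ≠ Fin.last n)
    (hj : j ≠ Fin.last n) (e : Fin (n + 1)) :
    dCoef q t (w ∘ Equiv.swap i j) e = dCoef q t w (Equiv.swap i j e) := by
  have hl : ∀ b, Equiv.swap i j b = Fin.last n ↔ b = Fin.last n := fun b => by
    rw [Equiv.swap_apply_eq_iff, Equiv.swap_apply_of_ne_of_ne hi.symm hj.symm]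
  unfold dCoef
  refine prod_equiv (Equiv.swap i j) (by simp) fun x _ => ?_
  simp only [dFormN, dFormL, eval_linForm, dCoefL, dCoefN, hl, Function.comp]

theorem dPoint_comp_swap (w : Fin (n + 1) → K) {i j : Fin (n + 1)} (hi : i ≠ Fin.last n)
    (hj : j ≠ Fin.last n) (e : Fin (n + 1)) :
    dPoint q t (Equiv.swap i j e) (w ∘ Equiv.swap i j) = dPoint q t e w ∘ Equiv.swap i j := by
  have hl : ∀ b, Equiv.swap i j b = Fin.last n ↔ b = Fin.last n := fun b => by
    rw [Equiv.swap_apply_eq_iff, Equiv.swap_apply_of_ne_of_ne hi.symm hj.symm]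
  ext a
  by_cases h : a = Equiv.swap i j e
  · subst h; simp [dPoint, dScale, hl]
  · have h' : Equiv.swap i j a ≠ e := fun h' => h (by rw [← h', Equiv.swap_apply_self])
    simp [dPoint, h, h']

/-- The dual operator preserves quasi-invariance for a pair of undeformed variables. -/
theorem dImage_quasiInv_swap {m : ℕ} (ht : t = q ^ m) {ζ : Fin (n + 1) → K}
    {F F' : MvPolynomial (Fin (n + 1)) K} (hF : PolyQuasiInv q t m ζ F)
    (h : dDen n q t * F' = dImage q t ζ F) {i j : Fin (n + 1)} (hij : i < j)
    (hj : j ≠ Fin.last n) {s : ℕ} (hs : s ∈ Icc 1 m) {w : Fin (n + 1) → K}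
    (hw : w j = q ^ (2 * s) * w i) (hd : eval w (dDen n q t) ≠ 0)
    (hd' : eval (w ∘ Equiv.swap i j) (dDen n q t) ≠ 0) :
    ζ j ^ s * eval w F' = ζ i ^ s * eval (w ∘ Equiv.swap i j) F' := by
  have hi : i ≠ Fin.last n := (hij.trans_le (Fin.le_last j)).ne
  rw [mem_Icc] at hs
  rw [eval_of_dImage h hd, eval_of_dImage h hd', ← Equiv.sum_comp (Equiv.swap i j) (fun e =>
    dGam q t e * ζ e * (dCoef q t (w ∘ Equiv.swap i j) e *
      eval (dPoint q t e (w ∘ Equiv.swap i j)) F)), mul_sum, mul_sum]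
  refine sum_congr rfl fun e _ => ?_
  rw [dCoef_comp_swap w hi hj, dPoint_comp_swap w hi hj, Equiv.swap_apply_self]
  -- Shifting the variable `i` lowers the index `s` of the wall by one, shifting `j` raises it by
  -- one, and any other shift keeps it. For `s = 1` the shift in `i` reaches a point fixed by the
  -- swap, where nothing is to be checked.
  by_cases hei : e = i
  · subst hei
    have hpt : dPoint q t e w j = q ^ (2 * (s - 1)) * dPoint q t e w e := by
      simp only [dPoint, Function.update_self, Function.update_of_ne hij.ne', dScale, if_neg hi]
      obtain ⟨s, rfl⟩ : ∃ s', s = s' + 1 := ⟨s - 1, by omega⟩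
      rw [hw, Nat.add_sub_cancel]; ring
    have key : ζ j ^ (s - 1) * eval (dPoint q t e w) F =
        ζ e ^ (s - 1) * eval (dPoint q t e w ∘ Equiv.swap e j) F := by
      rcases hs.1.eq_or_lt with h1 | h1
      · subst h1
        simp only [Nat.sub_self, mul_zero, pow_zero, one_mul] at hpt ⊢
        congr 2
        ext a
        by_cases ha : a = e
        · subst ha; simp [hpt]
        · by_cases haj : a = j
          · subst haj; simp [hpt]
          · simp [Equiv.swap_apply_of_ne_of_ne ha haj]
      · exact hF.1 e j hij hj (s - 1) (by rw [mem_Icc]; omega) _ hpt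
    obtain ⟨s, rfl⟩ : ∃ s', s = s' + 1 := ⟨s - 1, by omega⟩
    rw [Nat.add_sub_cancel] at key
    rw [Equiv.swap_apply_left, dGam, dGam, if_neg hi, if_neg hj]
    linear_combination ζ j * ζ e * dCoef q t w e * key
  by_cases hej : e = j
  · subst hej
    have hpt : dPoint q t e w e = q ^ (2 * (s + 1)) * dPoint q t e w i := by
      simp only [dPoint, Function.update_self, Function.update_of_ne hij.ne, dScale, if_neg hj]
      rw [hw]; ring
    rw [Equiv.swap_apply_right, dGam, dGam, if_neg hi, if_neg hj]
    rcases hs.2.eq_or_lt with h1 | h1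
    -- For `s = m` there is no condition of index `m + 1`, but the coefficient vanishes because `w j
    -- = t² w i`.
    · have : dCoef q t w e = 0 := by
        refine prod_eq_zero (mem_erase.2 ⟨hij.ne, mem_univ i⟩) ?_
        simp only [dFormN, eval_linForm, dCoefN, hi, hj, or_self, if_false, hw, ht, h1]
        rw [mul_comm 2 m, pow_mul]
        field_simp
        simp
      simp [this]
    · have key := hF.1 i e hij hj (s + 1) (by rw [mem_Icc]; omega) _ hpt
      linear_combination dCoef q t w e * key
  · rw [Equiv.swap_apply_of_ne_of_ne hei hej]
    have key := hF.1 i j hij hj s (by rw [mem_Icc]; exact hs) (dPoint q t e w) (by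
      simp [dPoint, Ne.symm hei, Ne.symm hej, hw])
    linear_combination dGam q t e * ζ e * dCoef q t w e * key

theorem eval_dFormL_ne_zero {w : Fin (n + 1) → K} (hd : eval w (dDen n q t) ≠ 0)
    {a b : Fin (n + 1)} (hab : a ≠ b) : eval w (dFormL q t a b) ≠ 0 := by
  rw [dDen, map_prod, prod_ne_zero_iff] at hd
  rcases lt_or_gt_of_ne hab with h | h
  · exact hd (a, b) (mem_indexPairs.2 h)
  · rw [dFormL_swap, map_neg, neg_ne_zero]
    exact hd (b, a) (mem_indexPairs.2 h)

/-- The reflected point for the deformed root of index `i`. -/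
def reflLast (q t : K) (i : Fin (n + 1)) (w : Fin (n + 1) → K) : Fin (n + 1) → K :=
  Function.update (Function.update w i (q ^ 2 * w i)) (Fin.last n) (w (Fin.last n) / t ^ 2)

/-- The separate factors for `i` and for the last index change under the reflection; only their
product is preserved. -/
theorem dCoef_refl_of_ne (hq : q ≠ 0) (ht : t ≠ 0) {i e : Fin (n + 1)} (hi : i ≠ Fin.last n)
    (hei : e ≠ i) (hel : e ≠ Fin.last n) {w : Fin (n + 1) → K}
    (hw : w (Fin.last n) = q * t * w i) (hd : eval w (dDen n q t) ≠ 0)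
    (hd' : eval (reflLast q t i w) (dDen n q t) ≠ 0) :
    dCoef q t (reflLast q t i w) e = dCoef q t w e := by
  have h1 := eval_dFormL_ne_zero hd hei
  have h2 := eval_dFormL_ne_zero hd hel
  have h3 := eval_dFormL_ne_zero hd' hei
  have h4 := eval_dFormL_ne_zero hd' hel
  have hmem : i ∈ univ.erase e := by simp [hei.symm]
  have hmem' : Fin.last n ∈ (univ.erase e).erase i := by simp [hel.symm, hi.symm]
  simp only [dCoef]
  rw [← mul_prod_erase _ _ hmem, ← mul_prod_erase _ _ hmem', ← mul_prod_erase _ _ hmem,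
    ← mul_prod_erase _ _ hmem', ← mul_assoc, ← mul_assoc]
  congr 1
  · rw [div_mul_div_comm, div_mul_div_comm, div_eq_div_iff (mul_ne_zero h3 h4) (mul_ne_zero h1 h2)]
    simp only [dFormN, dFormL, eval_linForm, dCoefL, dCoefN, reflLast, hi, hel, or_self, or_true,
      if_false, if_true, Function.update_self, Function.update_of_ne hi, Function.update_of_ne hei,
      Function.update_of_ne hel, hw]
    field_simp
  · refine prod_congr rfl fun x hx => ?_
    have hxl := ne_of_mem_erase hx
    have hxi := ne_of_mem_erase (mem_of_mem_erase hx)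
    simp only [dFormN, dFormL, eval_linForm, reflLast, Function.update_of_ne hei,
      Function.update_of_ne hel, Function.update_of_ne hxi, Function.update_of_ne hxl]

theorem dCoef_refl_last (hq : q ≠ 0) (ht : t ≠ 0) (ht2 : t - t⁻¹ ≠ 0) {i : Fin (n + 1)}
    (hi : i ≠ Fin.last n) {w : Fin (n + 1) → K}
    (hw : w (Fin.last n) = q * t * w i) (hd : eval w (dDen n q t) ≠ 0)
    (hd' : eval (reflLast q t i w) (dDen n q t) ≠ 0) :
    dGam q t (Fin.last n) * dCoef q t (reflLast q t i w) (Fin.last n) = dCoef q t w i := by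
  have h1 := eval_dFormL_ne_zero hd hi
  have h2 := eval_dFormL_ne_zero hd' hi.symm
  have hmem : i ∈ univ.erase (Fin.last n) := by simp [hi]
  have hmem' : Fin.last n ∈ univ.erase i := by simp [hi.symm]
  simp only [dCoef]
  rw [← mul_prod_erase _ _ hmem, ← mul_prod_erase _ _ hmem', ← mul_assoc, erase_right_comm]
  congr 1
  · rw [mul_div_assoc', div_eq_div_iff h2 h1, dGam, if_pos rfl, div_mul_eq_mul_div,
      div_mul_eq_mul_div, div_eq_iff ht2]
    simp only [dFormN, dFormL, eval_linForm, dCoefL, dCoefN, reflLast, hi, or_true, true_or,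
      if_false, if_true, Function.update_self, Function.update_of_ne hi, hw]
    field_simp
    ring
  · refine prod_congr rfl fun x hx => ?_
    have hxi := ne_of_mem_erase (mem_of_mem_erase hx)
    have hxl := ne_of_mem_erase hx
    simp only [dFormN, dFormL, eval_linForm, dCoefL, dCoefN, reflLast, hi, hxl, or_self, true_or,
      if_false, if_true, Function.update_self, Function.update_of_ne hxi,
      Function.update_of_ne hxl, hw, one_mul]
    have e1 : t⁻¹ * (q * t * w i / t ^ 2) - q * w x = q / t * (t⁻¹ * w i - t * w x) := by
      field_simp
    have e2 : q * t * w i / t ^ 2 - q / t * w x = q / t * (w i - w x) := by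
      field_simp
    rw [e1, e2, mul_div_mul_left _ _ (div_ne_zero hq ht)]

/-- At the wall point the term of the last index vanishes, and at the reflected point the term of
`i` vanishes. The two that remain correspond, since shifting the last variable of the reflected
point gives the same point as shifting the variable `i` of the original one. All other terms agree
one by one. -/
theorem dImage_quasiInv_last (hq : q ≠ 0) (ht : t ≠ 0) (ht2 : t - t⁻¹ ≠ 0) {m : ℕ}
    {ζ : Fin (n + 1) → K} {F F' : MvPolynomial (Fin (n + 1)) K} (hF : PolyQuasiInv q t m ζ F)
    (h : dDen n q t * F' = dImage q t ζ F) {i : Fin (n + 1)} (hi : i ≠ Fin.last n)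
    {w : Fin (n + 1) → K} (hw : w (Fin.last n) = q * t * w i) (hd : eval w (dDen n q t) ≠ 0)
    (hd' : eval (reflLast q t i w) (dDen n q t) ≠ 0) :
    ζ (Fin.last n) * eval w F' = ζ i * eval (reflLast q t i w) F' := by
  have hmem : Fin.last n ∈ univ.erase i := by simp [hi.symm]
  rw [eval_of_dImage h hd, eval_of_dImage h hd', ← add_sum_erase _ _ (mem_univ i),
    ← add_sum_erase _ _ (mem_univ i), ← add_sum_erase _ _ hmem, ← add_sum_erase _ _ hmem]
  have h1 : dCoef q t w (Fin.last n) = 0 := by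
    refine prod_eq_zero (mem_erase.2 ⟨hi, mem_univ i⟩) ?_
    simp only [dFormN, eval_linForm, dCoefN, true_or, if_true, hw]
    field_simp
    simp
  have h2 : dCoef q t (reflLast q t i w) i = 0 := by
    refine prod_eq_zero hmem ?_
    simp only [dFormN, eval_linForm, dCoefN, or_true, if_true, reflLast,
      Function.update_self, Function.update_of_ne hi, hw]
    field_simp
    simp
  have h3 : dPoint q t (Fin.last n) (reflLast q t i w) = dPoint q t i w := by
    ext a
    by_cases ha : a = Fin.last n
    · subst ha
      simp only [dPoint, Function.update_self, dScale, if_true, reflLast,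
        Function.update_of_ne hi.symm]
      field_simp
    · by_cases hai : a = i
      · subst hai; simp [dPoint, hi, dScale, reflLast]
      · simp [dPoint, ha, hai, reflLast]
  have h4 : ∀ e ∈ (univ.erase i).erase (Fin.last n),
      ζ (Fin.last n) * (dGam q t e * ζ e * (dCoef q t w e * eval (dPoint q t e w) F)) =
      ζ i * (dGam q t e * ζ e * (dCoef q t (reflLast q t i w) e *
        eval (dPoint q t e (reflLast q t i w)) F)) := by
    intro e he
    have hel := ne_of_mem_erase he
    have hei := ne_of_mem_erase (mem_of_mem_erase he)
    rw [dCoef_refl_of_ne hq ht hi hei hel hw hd hd']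
    have key := hF.2 i hi (dPoint q t e w) (by
      simp [dPoint, hei.symm, hel.symm, hw])
    have : dPoint q t e (reflLast q t i w) = Function.update (Function.update (dPoint q t e w) i
        (q ^ 2 * dPoint q t e w i)) (Fin.last n) (dPoint q t e w (Fin.last n) / t ^ 2) := by
      ext a
      by_cases ha : a = Fin.last n
      · subst ha
        simp [dPoint, reflLast, hel.symm]
      · by_cases hai : a = i
        · subst hai; simp [dPoint, hi, reflLast, hei.symm]
        · by_cases hae : a = e
          · subst hae; simp [dPoint, reflLast, hai, ha]
          · simp [dPoint, ha, hai, reflLast, hae]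
    rw [this]
    linear_combination dGam q t e * ζ e * dCoef q t w e * key
  rw [h1, h2, h3]
  have h5 := sum_congr rfl h4
  rw [← mul_sum, ← mul_sum] at h5
  have h6 := dCoef_refl_last hq ht ht2 hi hw hd hd'
  have h7 : dGam q t i = 1 := if_neg hi
  linear_combination h5 - ζ (Fin.last n) * ζ i * eval (dPoint q t i w) F * h6 +
    ζ (Fin.last n) * ζ i * dCoef q t w i * eval (dPoint q t i w) F * h7

theorem scaleHom_linForm (c : Fin (n + 1) → K) (u v : K) (i j : Fin (n + 1)) :
    scaleHom c (linForm u v i j) = linForm (u * c i) (v * c j) i j := by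
  simp [scaleHom, linForm, mul_assoc]

/-- The dual operator preserves quasi-invariance. -/
theorem polyQuasiInv_dImage [Infinite K] (hq : q ≠ 0) (hq1 : ∀ k : ℕ, 0 < k → q ^ k ≠ 1) {m : ℕ}
    (hm : 0 < m) (ht : t = q ^ m) {ζ : Fin (n + 1) → K}
    {F F' : MvPolynomial (Fin (n + 1)) K} (hF : PolyQuasiInv q t m ζ F)
    (h : dDen n q t * F' = dImage q t ζ F) : PolyQuasiInv q t m ζ F' := by
  have ht0 : t ≠ 0 := ht ▸ pow_ne_zero _ hq
  have htt : t ^ 2 ≠ 1 := by rw [ht, ← pow_mul]; exact hq1 _ (by omega)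
  have ht2 : t - t⁻¹ ≠ 0 := by
    intro h0
    apply htt
    field_simp at h0
    linear_combination h0
  have hL : ∀ i, i ≠ Fin.last n → dCoefL q t i = 1 := fun i hi => if_neg hi
  have hLl : dCoefL q t (Fin.last n) = q / t := if_pos rfl
  constructor
  · intro i j hij hj s hs
    have hi : i ≠ Fin.last n := (hij.trans_le (Fin.le_last j)).ne
    have hqs : q ^ (2 * s) ≠ 1 := hq1 _ (by rw [mem_Icc] at hs; omega)
    have hqs0 : q ^ (2 * s) ≠ 0 := pow_ne_zero _ hq
    have hdvd : linForm (q ^ (2 * s)) 1 i j ∣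
        C (ζ j ^ s) * F' - C (ζ i ^ s) * rename (Equiv.swap i j) F' := by
      -- The termwise comparison needs nonzero denominators at the point and at its reflection.
      -- Neither denominator vanishes identically on the wall because `q` is not a root of unity.
      refine linForm_dvd_of_generic hqs0 hij.ne
        (H := dDen n q t * rename (Equiv.swap i j) (dDen n q t)) (fun hdvd => ?_) fun w hw hH => ?_
      · rcases (prime_linForm hqs0 hij.ne).dvd_or_dvd hdvd with h1 | h1
        · exact not_linForm_dvd_dDen hq ht0 hqs0 one_ne_zero hij.ne
            (by rw [hL i hi, hL j hj]; simpa using hqs.symm) h1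
        · have h2 := map_dvd (rename (Equiv.swap i j) : MvPolynomial (Fin (n + 1)) K →ₐ[K] _) h1
          rw [rename_rename, (funext (Equiv.swap_apply_self i j) :
            Equiv.swap i j ∘ Equiv.swap i j = id), rename_id_apply] at h2
          have h3 : rename (Equiv.swap i j) (linForm (q ^ (2 * s)) 1 i j) =
              linForm (q ^ (2 * s)) 1 j i := by
            simp [linForm]
          rw [h3] at h2
          exact not_linForm_dvd_dDen hq ht0 hqs0 one_ne_zero hij.ne'
            (by rw [hL i hi, hL j hj]; simpa using hqs.symm) h2
      · rw [map_mul, eval_rename] at hH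
        rw [map_sub, map_mul, map_mul, eval_C, eval_C, eval_rename, sub_eq_zero]
        exact dImage_quasiInv_swap ht hF h hij hj hs (by rw [hw, one_mul])
          (left_ne_zero_of_mul hH) (right_ne_zero_of_mul hH)
    intro w hw
    have := (linForm_dvd_iff hqs0 hij.ne _).1 hdvd w (by rw [hw, one_mul])
    rw [map_sub, map_mul, map_mul, eval_C, eval_C, eval_rename, sub_eq_zero] at this
    exact this
  · intro i hi
    -- The deformed reflection acts by rescaling coordinates, so its inverse is the rescaling by
    -- `c⁻¹`.
    let c : Fin (n + 1) → K := Function.update (Function.update 1 i (q ^ 2)) (Fin.last n) (t ^ 2)⁻¹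
    have hci : c i = q ^ 2 := by simp [c, hi]
    have hcl : c (Fin.last n) = (t ^ 2)⁻¹ := by simp [c]
    have hc0 : c * c⁻¹ = 1 := by
      ext a
      refine mul_inv_cancel₀ ?_
      by_cases ha : a = Fin.last n
      · subst ha; rw [hcl]; exact inv_ne_zero (pow_ne_zero _ ht0)
      · by_cases hai : a = i
        · subst hai; rw [hci]; exact pow_ne_zero _ hq
        · simp [c, ha, hai]
    have hev : ∀ w G, eval w (scaleHom c G) = eval (reflLast q t i w) G := by
      intro w G
      rw [eval_scaleHom]
      congr 2
      ext a
      by_cases ha : a = Fin.last n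
      · subst ha; simp [hcl, reflLast, div_eq_inv_mul]
      · by_cases hai : a = i
        · subst hai; simp [hci, reflLast, hi]
        · simp [c, reflLast, ha, hai]
    have hu : q * t ≠ 0 := mul_ne_zero hq ht0
    have hdvd : linForm (q * t) 1 i (Fin.last n) ∣
        C (ζ (Fin.last n)) * F' - C (ζ i) * scaleHom c F' := by
      refine linForm_dvd_of_generic hu hi
        (H := dDen n q t * scaleHom c (dDen n q t)) (fun hdvd => ?_) fun w hw hH => ?_
      · rcases (prime_linForm hu hi).dvd_or_dvd hdvd with h1 | h1
        · refine not_linForm_dvd_dDen hq ht0 hu one_ne_zero hi ?_ h1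
          rw [hL i hi, hLl, mul_one, one_mul]
          intro h0
          rw [div_eq_iff ht0] at h0
          exact htt (mul_left_cancel₀ hq (by linear_combination -h0))
        · have h2 := map_dvd (scaleHom c⁻¹) h1
          have h3 : scaleHom c⁻¹ (scaleHom c (dDen n q t)) = dDen n q t := by
            apply MvPolynomial.funext
            intro w
            rw [eval_scaleHom, eval_scaleHom, ← mul_assoc, hc0, one_mul]
          rw [h3, scaleHom_linForm, Pi.inv_apply, Pi.inv_apply, hci, hcl, inv_inv, one_mul] at h2
          refine not_linForm_dvd_dDen hq ht0 ?_ (pow_ne_zero _ ht0) hi ?_ h2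
          · exact mul_ne_zero hu (inv_ne_zero (pow_ne_zero _ hq))
          · rw [hL i hi, hLl, one_mul]
            intro h0
            field_simp at h0
            exact hq1 2 (by norm_num) h0
      · rw [map_mul, hev] at hH
        rw [map_sub, map_mul, map_mul, eval_C, eval_C, hev, sub_eq_zero]
        exact dImage_quasiInv_last hq ht0 ht2 hF h hi (by rw [hw, one_mul])
          (left_ne_zero_of_mul hH) (right_ne_zero_of_mul hH)
    intro w hw
    have := (linForm_dvd_iff hu hi _).1 hdvd w (by rw [hw, one_mul])
    rw [map_sub, map_mul, map_mul, eval_C, eval_C, hev, sub_eq_zero] at this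
    exact this

end DualOp

end

/-! ### Leading terms of the dual operator. -/

noncomputable section

section Triangular

open MvPolynomial Finset

variable {K : Type*} [Field K] {n : ℕ}

theorem topPart_linForm_ne_zero {σ : Type*} (c : σ → ℝ) {u v : K} (hu : u ≠ 0) (hv : v ≠ 0)
    {a b : σ} (hab : a ≠ b) : topPart c (max (c a) (c b)) (linForm u v a b) ≠ 0 := by
  classical
  have hne : Finsupp.single a 1 ≠ Finsupp.single b 1 :=
    fun h => hab ((Finsupp.single_left_inj one_ne_zero).1 h)
  rcases le_total (c a) (c b) with h | h
  · intro h0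
    have := congrArg (coeff (Finsupp.single b 1)) h0
    simp [coeff_topPart, Finsupp.weight_single, h, linForm, coeff_C_mul, coeff_X, hne, hv] at this
  · intro h0
    have := congrArg (coeff (Finsupp.single a 1)) h0
    simp [coeff_topPart, Finsupp.weight_single, h, linForm, coeff_C_mul, coeff_X,
      hne.symm, hu] at this

/-- The leading weight of the denominator of the dual operator. -/
def dWeight {n : ℕ} (c : Fin (n + 1) → ℝ) : ℝ := ∑ p ∈ indexPairs n, max (c p.1) (c p.2)

variable {q t : K}

theorem wtLE_dFormL (c : Fin (n + 1) → ℝ) (a b : Fin (n + 1)) :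
    WtLE c (max (c a) (c b)) (dFormL q t a b) := wtLE_linForm _ _ _ _ _

theorem wtLE_dDen (c : Fin (n + 1) → ℝ) : WtLE c (dWeight c) (dDen n q t) :=
  WtLE.prod _ fun _ _ => wtLE_linForm _ _ _ _ _

theorem topPart_dDen_ne_zero (hq : q ≠ 0) (ht : t ≠ 0) (c : Fin (n + 1) → ℝ) :
    topPart c (dWeight c) (dDen n q t) ≠ 0 := by
  rw [dDen, dWeight, topPart_prod _ fun _ _ => wtLE_dFormL _ _ _]
  refine prod_ne_zero_iff.2 fun p hp => topPart_linForm_ne_zero _ (dCoefL_ne_zero hq ht _)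
    (dCoefL_ne_zero hq ht _) (mem_indexPairs.1 hp).ne

theorem wtLE_dFactor (c : Fin (n + 1) → ℝ) (e a b : Fin (n + 1)) :
    WtLE c (max (c a) (c b)) (dFactor q t e a b) := by
  unfold dFactor
  split_ifs
  · exact wtLE_linForm _ _ _ _ _
  · rw [max_comm, neg_eq_neg_one_mul, ← C_1, ← C_neg]
    exact (wtLE_linForm _ _ _ _ _).C_mul _
  · exact wtLE_linForm _ _ _ _ _

theorem wtLE_dNum (c : Fin (n + 1) → ℝ) (e : Fin (n + 1)) :
    WtLE c (dWeight c) (dNum q t e) :=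
  WtLE.prod _ fun _ _ => wtLE_dFactor _ _ _ _

theorem wtLE_dShift {c : Fin (n + 1) → ℝ} {T : ℝ} {F : MvPolynomial (Fin (n + 1)) K}
    (hF : WtLE c T F) (e : Fin (n + 1)) : WtLE c T (dShift q t e F) := by
  intro k hk
  rw [MvPolynomial.mem_support_iff, dShift, coeff_scaleHom] at hk
  exact hF k (MvPolynomial.mem_support_iff.2 (right_ne_zero_of_mul hk))

theorem wtLE_dImage {c : Fin (n + 1) → ℝ} {T : ℝ} {F : MvPolynomial (Fin (n + 1)) K}
    (hF : WtLE c T F) (ζ : Fin (n + 1) → K) : WtLE c (dWeight c + T) (dImage q t ζ F) :=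
  WtLE.sum _ fun e _ => ((wtLE_dNum c e).mul (wtLE_dShift hF e)).C_mul _

theorem exists_wtLE (c : Fin (n + 1) → ℝ) {F : MvPolynomial (Fin (n + 1)) K} (hF : F ≠ 0) :
    ∃ k ∈ F.support, WtLE c (Finsupp.weight c k) F :=
  F.support.exists_max_image _ (support_nonempty.2 hF)

/-- The dual operator does not increase weights. -/
theorem wtLE_of_dImage (hq : q ≠ 0) (ht : t ≠ 0) {ζ : Fin (n + 1) → K}
    {F F' : MvPolynomial (Fin (n + 1)) K} (h : dDen n q t * F' = dImage q t ζ F)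
    {c : Fin (n + 1) → ℝ} {T : ℝ} (hF : WtLE c T F) : WtLE c T F' := by
  by_cases h0 : F' = 0
  · intro k hk; simp [h0] at hk
  obtain ⟨k, hk, hk'⟩ := exists_wtLE c h0
  by_contra hcon
  have hlt : T < Finsupp.weight c k := by
    by_contra h1
    exact hcon (hk'.mono (not_lt.1 h1))
  have h1 := topPart_mul (wtLE_dDen (q := q) (t := t) c) hk'
  rw [h, topPart_eq_zero_of_lt (wtLE_dImage hF ζ) (by linarith), zero_eq_mul] at h1
  rcases h1 with h1 | h1
  · exact topPart_dDen_ne_zero hq ht c h1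
  · have := congrArg (coeff k) h1
    rw [coeff_topPart, if_pos rfl, coeff_zero] at this
    exact MvPolynomial.mem_support_iff.1 hk this

/-- The quotient of the leading coefficients of `dFormN` and `dFormL` is this number or its inverse,
depending on which variable dominates. -/
def dRatio (q t : K) (x : Fin (n + 1)) : K := if x = Fin.last n then q else t

/-- The leading coefficient of a coefficient of the dual operator. -/
def dTop (q t : K) (c : Fin (n + 1) → ℝ) (e : Fin (n + 1)) : K :=
  ∏ x ∈ univ.erase e, if c x < c e then (dRatio q t x)⁻¹ else dRatio q t x

theorem topPart_dFormN (hq : q ≠ 0) (ht : t ≠ 0) {c : Fin (n + 1) → ℝ} {e x : Fin (n + 1)}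
    (hex : e ≠ x) (hc : c e ≠ c x) : topPart c (max (c e) (c x)) (dFormN q t e x) =
      C (if c x < c e then (dRatio q t x)⁻¹ else dRatio q t x) *
        topPart c (max (c e) (c x)) (dFormL q t e x) := by
  rw [dFormN, dFormL, topPart_linForm _ _ hc, topPart_linForm _ _ hc]
  split_ifs with h
  · rw [← mul_assoc, ← C_mul]
    congr 2
    unfold dRatio dCoefL
    split_ifs <;> field_simp
  · rw [← mul_assoc, ← C_mul]
    congr 2
    unfold dRatio dCoefN dCoefL
    split_ifs with h1 h2 h3 h4 <;> simp_all
    field_simp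

/-- For weights without ties the numerator and the denominator factors of each pair have the same
leading monomial, so the leading parts of the full products are proportional. -/
theorem topPart_dNum (hq : q ≠ 0) (ht : t ≠ 0) {c : Fin (n + 1) → ℝ} (hc : Function.Injective c)
    (e : Fin (n + 1)) : topPart c (dWeight c) (dNum q t e) =
      C (dTop q t c e) * topPart c (dWeight c) (dDen n q t) := by
  rw [dNum, dDen, dWeight, topPart_prod _ fun _ _ => wtLE_dFactor _ _ _ _,
    topPart_prod _ fun _ _ => wtLE_dFormL _ _ _, dTop,
    ← prod_indexPairs e fun x => if c x < c e then (dRatio q t x)⁻¹ else dRatio q t x,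
    map_prod, ← prod_mul_distrib]
  refine prod_congr rfl fun p hp => ?_
  have hne := (mem_indexPairs.1 hp).ne
  obtain ⟨a, b⟩ := p
  simp only at hne ⊢
  by_cases h1 : a = e
  · subst h1
    rw [dFactor, if_pos rfl, if_pos rfl, topPart_dFormN hq ht hne (hc.ne hne)]
  by_cases h2 : b = e
  · subst h2
    rw [dFactor, if_neg h1, if_pos rfl, if_neg h1, if_pos rfl, max_comm, dFormL_swap q t b a,
      neg_eq_neg_one_mul, neg_eq_neg_one_mul (dFormL q t b a), ← C_1, ← C_neg,
      topPart_C_mul, topPart_C_mul, topPart_dFormN hq ht hne.symm (hc.ne hne.symm)]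
    ring
  · rw [dFactor, if_neg h1, if_neg h2, if_neg h1, if_neg h2, C_1, one_mul]

/-- The coefficients of the eigenvalue of the dual operator on a leading monomial. -/
def dMu (q t : K) (c : Fin (n + 1) → ℝ) (k : Fin (n + 1) →₀ ℕ) (e : Fin (n + 1)) : K :=
  dGam q t e * dTop q t c e * dScale q t e ^ k e

/-- The eigenvalue of the dual operator on a leading monomial. -/
def dEigen (q t : K) (ζ : Fin (n + 1) → K) (c : Fin (n + 1) → ℝ) (k : Fin (n + 1) →₀ ℕ) : K :=
  ∑ e, ζ e * dMu q t c k e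

/-- The leading part of the denominator cancels from the leading parts of both sides. What remains
acts diagonally on monomials of maximal weight, because each shift only rescales variables. -/
theorem coeff_of_dImage (hq : q ≠ 0) (ht : t ≠ 0) {ζ : Fin (n + 1) → K}
    {F F' : MvPolynomial (Fin (n + 1)) K} (h : dDen n q t * F' = dImage q t ζ F)
    {c : Fin (n + 1) → ℝ} (hc : Function.Injective c) {k : Fin (n + 1) →₀ ℕ}
    (hF : WtLE c (Finsupp.weight c k) F) :
    coeff k F' = dEigen q t ζ c k * coeff k F := by
  have hF' := wtLE_of_dImage hq ht h hF
  set T := Finsupp.weight c k with hT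
  have h1 := topPart_mul (wtLE_dDen (q := q) (t := t) c) hF'
  have h2 : topPart c (dWeight c + T) (dImage q t ζ F) =
      topPart c (dWeight c) (dDen n q t) *
        ∑ e, C (dGam q t e * ζ e * dTop q t c e) * topPart c T (dShift q t e F) := by
    rw [dImage, topPart_sum, mul_sum]
    refine sum_congr rfl fun e _ => ?_
    rw [topPart_C_mul, topPart_mul (wtLE_dNum c e) (wtLE_dShift hF e), topPart_dNum hq ht hc, C_mul,
      C_mul, C_mul]
    ring
  rw [h, h2] at h1
  have h3 := congrArg (coeff k) (mul_left_cancel₀ (topPart_dDen_ne_zero hq ht c) h1)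
  rw [coeff_topPart, if_pos hT.symm, coeff_sum] at h3
  rw [← h3, dEigen, sum_mul]
  refine sum_congr rfl fun e _ => ?_
  have h4 : ∏ a, (Function.update (1 : Fin (n + 1) → K) e (dScale q t e) a) ^ k a =
      dScale q t e ^ k e := by
    rw [Finset.prod_eq_single e]
    · simp
    · intro a _ ha; simp [ha]
    · simp
  rw [coeff_C_mul, coeff_topPart, if_pos hT.symm, dShift, coeff_scaleHom, h4, dMu]
  ring

end Triangular

/-! ### Eigenfunctions of the dual operator. -/

section Eigen

open MvPolynomial Finset

variable {K : Type*} [Field K] {n : ℕ} {q t : K}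

theorem PolyQuasiInv.add {m : ℕ} {ζ : Fin (n + 1) → K} {F G : MvPolynomial (Fin (n + 1)) K}
    (hF : PolyQuasiInv q t m ζ F) (hG : PolyQuasiInv q t m ζ G) : PolyQuasiInv q t m ζ (F + G) := by
  refine ⟨fun i j hij hj s hs w hw => ?_, fun i hi w hw => ?_⟩
  · rw [map_add, map_add, mul_add, mul_add, hF.1 i j hij hj s hs w hw, hG.1 i j hij hj s hs w hw]
  · rw [map_add, map_add, mul_add, mul_add, hF.2 i hi w hw, hG.2 i hi w hw]

theorem PolyQuasiInv.C_mul {m : ℕ} {ζ : Fin (n + 1) → K} {F : MvPolynomial (Fin (n + 1)) K}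
    (hF : PolyQuasiInv q t m ζ F) (x : K) : PolyQuasiInv q t m ζ (C x * F) := by
  refine ⟨fun i j hij hj s hs w hw => ?_, fun i hi w hw => ?_⟩
  · rw [map_mul, map_mul, eval_C, mul_left_comm, hF.1 i j hij hj s hs w hw, mul_left_comm, eval_C]
  · rw [map_mul, map_mul, eval_C, mul_left_comm, hF.2 i hi w hw, mul_left_comm, eval_C]

theorem dImage_add (ζ : Fin (n + 1) → K) (F G : MvPolynomial (Fin (n + 1)) K) :
    dImage q t ζ (F + G) = dImage q t ζ F + dImage q t ζ G := by
  simp only [dImage, map_add, mul_add, sum_add_distrib]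

theorem dImage_C_mul (ζ : Fin (n + 1) → K) (x : K) (F : MvPolynomial (Fin (n + 1)) K) :
    dImage q t ζ (C x * F) = C x * dImage q t ζ F := by
  simp only [dImage, map_mul, mul_sum]
  refine sum_congr rfl fun e _ => ?_
  have : dShift q t e (C x) = C x := by simp [dShift, scaleHom]
  rw [this]; ring

/-- Real weights are not well-founded on exponents; the elimination below terminates because the
total degree stays bounded. -/
theorem finite_weight_le (d : ℝ) :
    {k : Fin (n + 1) →₀ ℕ | Finsupp.weight (1 : Fin (n + 1) → ℝ) k ≤ d}.Finite := by
  have hinj : Function.Injective fun k : Fin (n + 1) →₀ ℕ => (k : Fin (n + 1) → ℕ) :=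
    DFunLike.coe_injective
  refine Set.Finite.of_finite_image (f := fun k : Fin (n + 1) →₀ ℕ => (k : Fin (n + 1) → ℕ)) ?_
    hinj.injOn
  refine (Set.finite_Iic (fun _ : Fin (n + 1) => ⌈d⌉₊)).subset ?_
  rintro _ ⟨k, hk, rfl⟩ a
  have h1 : (k a : ℝ) ≤ Finsupp.weight (1 : Fin (n + 1) → ℝ) k := by
    rw [Finsupp.weight_apply, Finsupp.sum_fintype _ _ (by simp)]
    simp only [Pi.one_apply, nsmul_eq_mul, mul_one]
    exact single_le_sum (f := fun a => (k a : ℝ)) (fun _ _ => Nat.cast_nonneg _) (mem_univ a)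
  have h2 : (k a : ℝ) ≤ (⌈d⌉₊ : ℝ) := (h1.trans hk).trans (Nat.le_ceil d)
  exact_mod_cast h2

/-- A quasi-invariant with a dominant monomial can be deformed into an eigenfunction of the dual
operator. -/
theorem exists_eigen [Infinite K] (hq : q ≠ 0) (hq1 : ∀ k : ℕ, 0 < k → q ^ k ≠ 1) {m : ℕ}
    (hm : 0 < m) (ht : t = q ^ m) {ζ : Fin (n + 1) → K} {c : Fin (n + 1) → ℝ}
    (hc : Function.Injective c) {v : Fin (n + 1) →₀ ℕ}
    (hev : ∀ k, k ≠ v → dEigen q t ζ c k ≠ dEigen q t ζ c v)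
    {F : MvPolynomial (Fin (n + 1)) K} (hF : PolyQuasiInv q t m ζ F)
    (hv : coeff v F ≠ 0) (htop : ∀ k ∈ F.support, k ≠ v → Finsupp.weight c k < Finsupp.weight c v) :
    ∃ G, PolyQuasiInv q t m ζ G ∧ coeff v G ≠ 0 ∧ 
      dDen n q t * (C (dEigen q t ζ c v) * G) = dImage q t ζ G := by
  classical
  have ht0 : t ≠ 0 := ht ▸ pow_ne_zero _ hq
  have ht2 : t - t⁻¹ ≠ 0 := by
    intro h0
    refine hq1 (m * 2) (by omega) ?_
    rw [pow_mul, ← ht]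
    field_simp at h0
    linear_combination h0
  obtain ⟨d, hd⟩ : ∃ d, WtLE (1 : Fin (n + 1) → ℝ) d F := by
    obtain ⟨k, _, hk⟩ := exists_wtLE 1 (show F ≠ 0 by rintro rfl; simp at hv)
    exact ⟨_, hk⟩
  set ev := dEigen q t ζ c with hevdef
  let B := (finite_weight_le (n := n) d).toFinset
  have hB : ∀ k, k ∈ B ↔ Finsupp.weight (1 : Fin (n + 1) → ℝ) k ≤ d := by simp [B]
  obtain ⟨F', hF'⟩ := dDen_dvd_dImage hq ht0 ht2 hm hF
  -- Induction is on the number of exponents of bounded degree that lie in the support of the error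
  -- or strictly below one of its elements. The error is the image of `F` minus the eigenvalue at
  -- `v` times `F`.
  let μ : MvPolynomial (Fin (n + 1)) K → Finset (Fin (n + 1) →₀ ℕ) := fun E =>
    B.filter fun k => ∃ k' ∈ E.support, Finsupp.weight c k < Finsupp.weight c k' ∨ k = k'
  have hR : ∀ F F', WtLE 1 d F → dDen n q t * F' = dImage q t ζ F → WtLE 1 d F' :=
    fun F F' h1 h2 => wtLE_of_dImage hq ht0 h2 h1
  induction hN : (μ (F' + C (-ev v) * F)).card using Nat.strong_induction_on generalizing F F' with
  | _ N ih =>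
  subst hN
  have hFv : WtLE c (Finsupp.weight c v) F := by
    intro k hk
    by_cases h : k = v
    · rw [h]
    · exact (htop k hk h).le
  have hR' := hR F F' hd hF'.symm
  have hF'v := wtLE_of_dImage hq ht0 hF'.symm hFv
  set E := F' + C (-ev v) * F with hE
  have hQ' := polyQuasiInv_dImage hq hq1 hm ht hF hF'.symm
  obtain ⟨F'', hF''⟩ := dDen_dvd_dImage hq ht0 ht2 hm hQ'
  by_cases hE0 : E = 0
  · refine ⟨F, hF, hv, ?_⟩
    have : F' = C (ev v) * F := by
      rw [hE, C_neg, neg_mul, ← sub_eq_add_neg] at hE0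
      exact sub_eq_zero.1 hE0
    rw [← this, hF']
  obtain ⟨u, hu, humax⟩ := exists_wtLE c hE0
  have hEv : WtLE c (Finsupp.weight c v) E := hF'v.add (hFv.C_mul _)
  have hEtop : ∀ k ∈ E.support, Finsupp.weight c k < Finsupp.weight c v := by
    intro k hk
    refine lt_of_le_of_ne (hEv k hk) fun he => ?_
    have h1 := coeff_of_dImage hq ht0 hF'.symm hc (k := k) (he ▸ hFv)
    rw [MvPolynomial.mem_support_iff, hE, coeff_add, coeff_C_mul, h1] at hk
    by_cases hkv : k = v
    · subst hkv; apply hk; ring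
    · by_cases hk0 : coeff k F = 0
      · simp [hk0] at hk
      · have := htop k (MvPolynomial.mem_support_iff.2 hk0) hkv
        linarith
  have huv : u ≠ v := fun h => lt_irrefl _ (h ▸ hEtop u hu)
  have hne : ev v - ev u ≠ 0 := sub_ne_zero.2 (hev u huv).symm
  have hRE : dDen n q t * (F'' + C (-ev v) * F') = dImage q t ζ E := by
    rw [hE, dImage_add, dImage_C_mul, hF', hF'']; ring
  have hEd : WtLE 1 d E := hR'.add (hd.C_mul _)
  have hEd' := hR _ _ hEd hRE
  -- With `u` a leading exponent of the error, `F` is replaced by the image of `F` minus `ev u`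
  -- times `F`, divided by `ev v - ev u`. This keeps the coefficient at `v`.
  set r := (ev v - ev u)⁻¹ with hr
  have hcv' := coeff_of_dImage hq ht0 hF'.symm hc hFv
  have hcv : coeff v (C r * (F' + C (-ev u) * F)) = coeff v F := by
    rw [coeff_C_mul, coeff_add, coeff_C_mul, hcv', ← hevdef, hr]
    field_simp
    ring
  -- The new error is obtained from the old one by the same operation, which annihilates its
  -- coefficient at `u` and creates only strictly lower terms.
  have hE2 : C r * (F'' + C (-ev u) * F') + C (-ev v) * (C r * (F' + C (-ev u) * F)) =
      C r * ((F'' + C (-ev v) * F') + C (-ev u) * E) := by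
    rw [hE]; simp only [C_neg]; ring
  refine ih _ ?_ ((hQ'.add (hF.C_mul (-ev u))).C_mul r) ?_ ?_ ?_
    (C r * (F'' + C (-ev u) * F')) ?_ rfl
  · rw [hE2]
    apply Finset.card_lt_card
    have hu2 := coeff_of_dImage hq ht0 hRE hc humax
    have hle2 := wtLE_of_dImage hq ht0 hRE humax
    have hsupp : ∀ k ∈ (C r * ((F'' + C (-ev v) * F') + C (-ev u) * E)).support,
        Finsupp.weight c k < Finsupp.weight c u ∨ (k ∈ E.support ∧ k ≠ u) := by
      intro k hk
      have hle := ((hle2.add (humax.C_mul (-ev u))).C_mul r) k hk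
      rcases hle.lt_or_eq with h | h
      · exact Or.inl h
      · right
        have h1 := coeff_of_dImage hq ht0 hRE hc (k := k) (by rw [h]; exact humax)
        rw [MvPolynomial.mem_support_iff, coeff_C_mul, coeff_add, coeff_C_mul, h1] at hk
        constructor
        · rw [MvPolynomial.mem_support_iff]
          intro h0; apply hk; rw [h0]; ring
        · rintro rfl; apply hk; ring
    rw [Finset.ssubset_iff_of_subset]
    · refine ⟨u, ?_, ?_⟩
      · simp only [μ, mem_filter]
        exact ⟨(hB u).2 (hEd u hu), u, hu, Or.inr rfl⟩
      · simp only [μ, mem_filter, not_and, not_exists]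
        intro _ k hk
        push Not
        rcases hsupp k hk with h | h
        · exact ⟨h.le, fun he => by rw [he] at h; exact lt_irrefl _ h⟩
        · exact ⟨humax k h.1, fun he => h.2 he.symm⟩
    · intro k hk
      simp only [μ, mem_filter] at hk ⊢
      refine ⟨hk.1, ?_⟩
      obtain ⟨-, k', hk', h⟩ := hk
      rcases hsupp k' hk' with h1 | h1
      · refine ⟨u, hu, Or.inl ?_⟩
        rcases h with h | rfl
        · exact h.trans h1
        · exact h1
      · exact ⟨k', h1.1, h⟩
  · rw [hcv]; exact hv
  · intro k hk hkv
    have hle := ((hF'v.add (hFv.C_mul (-ev u))).C_mul r) k hk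
    refine lt_of_le_of_ne hle fun he => ?_
    have h1 := coeff_of_dImage hq ht0 hF'.symm hc (k := k) (he ▸ hFv)
    rw [MvPolynomial.mem_support_iff, coeff_C_mul, coeff_add, coeff_C_mul, h1] at hk
    by_cases hk0 : coeff k F = 0
    · simp [hk0] at hk
    · have := htop k (MvPolynomial.mem_support_iff.2 hk0) hkv
      linarith
  · exact (hR'.add (hd.C_mul _)).C_mul r
  · rw [dImage_C_mul, dImage_add, dImage_C_mul, hF', hF'']; ring

end Eigen

end

/-! ### A quasi-invariant to start from. -/

noncomputable section

section Start

open MvPolynomial Finset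

variable {K : Type*} [Field K] {n : ℕ} {q t : K}

/-- `F` has the single leading monomial `v`. -/
def HasTop {σ : Type*} (c : σ → ℝ) (F : MvPolynomial σ K) (v : σ →₀ ℕ) : Prop :=
  ∃ a : K, a ≠ 0 ∧ WtLE c (Finsupp.weight c v) F ∧
    topPart c (Finsupp.weight c v) F = monomial v a

theorem HasTop.mul {σ : Type*} {c : σ → ℝ} {F G : MvPolynomial σ K} {v w : σ →₀ ℕ}
    (hF : HasTop c F v) (hG : HasTop c G w) : HasTop c (F * G) (v + w) := by
  obtain ⟨a, ha, h1, h2⟩ := hF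
  obtain ⟨b, hb, h3, h4⟩ := hG
  refine ⟨a * b, mul_ne_zero ha hb, ?_, ?_⟩
  · rw [map_add]; exact h1.mul h3
  · rw [map_add, topPart_mul h1 h3, h2, h4, monomial_mul]

theorem HasTop.prod {σ ι : Type*} {c : σ → ℝ} (s : Finset ι) {F : ι → MvPolynomial σ K}
    (hF : ∀ i ∈ s, ∃ v, HasTop c (F i) v) : ∃ v, HasTop c (∏ i ∈ s, F i) v := by
  classical
  induction s using Finset.induction_on with
  | empty =>
    refine ⟨0, 1, one_ne_zero, ?_, ?_⟩
    · rw [map_zero, prod_empty]; exact wtLE_one c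
    · rw [map_zero, prod_empty, topPart_one]; rfl
  | insert i s hi ih =>
    obtain ⟨v, hv⟩ := hF i (by simp)
    obtain ⟨w, hw⟩ := ih fun j hj => hF j (by simp [hj])
    exact ⟨v + w, by rw [prod_insert hi]; exact hv.mul hw⟩

theorem hasTop_linForm {σ : Type*} {c : σ → ℝ} {u v : K} (hu : u ≠ 0) (hv : v ≠ 0) {a b : σ}
    (hab : c a ≠ c b) : ∃ k, HasTop c (linForm u v a b) k := by
  classical
  have hX : ∀ (x : K) (i : σ), C x * X i = monomial (Finsupp.single i 1) x := fun x i => by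
    rw [C_mul_X_eq_monomial]
  have hw := wtLE_linForm c u v a b
  have ht := topPart_linForm u v hab
  rcases lt_or_gt_of_ne hab with h | h
  · rw [max_eq_right h.le] at hw ht
    rw [if_neg (not_lt.2 h.le), hX] at ht
    refine ⟨Finsupp.single b 1, -v, neg_ne_zero.2 hv, ?_, ?_⟩ <;>
      simp only [Finsupp.weight_single, one_smul]
    · exact hw
    · exact ht
  · rw [max_eq_left h.le] at hw ht
    rw [if_pos h, hX] at ht
    refine ⟨Finsupp.single a 1, u, hu, ?_, ?_⟩ <;>
      simp only [Finsupp.weight_single, one_smul]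
    · exact hw
    · exact ht

theorem HasTop.coeff_ne_zero {σ : Type*} {c : σ → ℝ} {F : MvPolynomial σ K} {v : σ →₀ ℕ}
    (hF : HasTop c F v) : coeff v F ≠ 0 := by
  classical
  obtain ⟨a, ha, -, h⟩ := hF
  have := congrArg (coeff v) h
  rw [coeff_topPart, if_pos rfl, coeff_monomial, if_pos rfl] at this
  rwa [this]

theorem HasTop.weight_lt {σ : Type*} {c : σ → ℝ} {F : MvPolynomial σ K} {v k : σ →₀ ℕ}
    (hF : HasTop c F v) (hk : k ∈ F.support) (hkv : k ≠ v) :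
    Finsupp.weight c k < Finsupp.weight c v := by
  classical
  obtain ⟨a, ha, h1, h⟩ := hF
  refine lt_of_le_of_ne (h1 k hk) fun he => ?_
  have := congrArg (coeff k) h
  rw [coeff_topPart, if_pos he, coeff_monomial, if_neg hkv.symm] at this
  exact MvPolynomial.mem_support_iff.1 hk this

/-- The value of `X_j / X_i` on the wall where the condition of index `s` is imposed. -/
def wallRatio (q t : K) (j : Fin (n + 1)) (s : ℕ) : K :=
  if j = Fin.last n then q * t else q ^ (2 * s)

/-- A polynomial that satisfies the quasi-invariance conditions trivially. -/
def wallProd (n m : ℕ) (q t : K) : MvPolynomial (Fin (n + 1)) K :=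
  ∏ p ∈ indexPairs n, ∏ s ∈ Icc 1 (rootMult n m p.2),
    (linForm (wallRatio q t p.2 s) 1 p.1 p.2 * linForm (wallRatio q t p.2 s)⁻¹ 1 p.1 p.2)

theorem exists_hasTop_wallProd {m : ℕ} (hq : q ≠ 0) (ht : t ≠ 0) {c : Fin (n + 1) → ℝ}
    (hc : Function.Injective c) : ∃ v, HasTop c (wallProd n m q t) v := by
  refine HasTop.prod _ fun p hp => HasTop.prod _ fun s _ => ?_
  have hne := hc.ne (mem_indexPairs.1 hp).ne
  have hr : wallRatio q t p.2 s ≠ 0 := by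
    unfold wallRatio
    split_ifs
    exacts [mul_ne_zero hq ht, pow_ne_zero _ hq]
  obtain ⟨v, hv⟩ := hasTop_linForm hr one_ne_zero hne
  obtain ⟨w, hw⟩ := hasTop_linForm (inv_ne_zero hr) one_ne_zero hne
  exact ⟨_, hv.mul hw⟩

theorem eval_wallProd_eq_zero {m : ℕ} {i j : Fin (n + 1)} (hij : i < j) {s : ℕ}
    (hs : s ∈ Icc 1 (rootMult n m j)) {w : Fin (n + 1) → K}
    (hw : wallRatio q t j s * w i = w j ∨ (wallRatio q t j s)⁻¹ * w i = w j) :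
    eval w (wallProd n m q t) = 0 := by
  rw [wallProd, map_prod]
  refine prod_eq_zero (mem_indexPairs.2 hij : (i, j) ∈ _) ?_
  rw [map_prod]
  refine prod_eq_zero hs ?_
  rw [map_mul, eval_linForm, eval_linForm]
  rcases hw with h | h <;> simp [h]

/-- A condition compares a point of a wall with its reflection, where the ratio of the two
coordinates is inverted. The product contains a factor for each of the two ratios, so both sides are
zero for any parameters. -/
theorem polyQuasiInv_wallProd {m : ℕ} (hq : q ≠ 0) (ht : t ≠ 0) (ζ : Fin (n + 1) → K) :
    PolyQuasiInv q t m ζ (wallProd n m q t) := by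
  constructor
  · intro i j hij hj s hs w hw
    have hs' : s ∈ Icc 1 (rootMult n m j) := by rwa [rootMult, if_neg hj]
    have hr : wallRatio q t j s = q ^ (2 * s) := if_neg hj
    rw [eval_wallProd_eq_zero hij hs' (Or.inl (by rw [hr, hw])),
      eval_wallProd_eq_zero hij hs' (Or.inr (by
        rw [hr]
        simp only [Function.comp, Equiv.swap_apply_left, Equiv.swap_apply_right, hw]
        rw [← mul_assoc, inv_mul_cancel₀ (pow_ne_zero _ hq), one_mul]))]
    simp
  · intro i hi w hw
    have hs' : 1 ∈ Icc 1 (rootMult n m (Fin.last n)) := by simp [rootMult]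
    have hr : wallRatio q t (Fin.last n) 1 = q * t := if_pos rfl
    have hlt : i < Fin.last n := lt_of_le_of_ne (Fin.le_last i) hi
    rw [eval_wallProd_eq_zero hlt hs' (Or.inl (by rw [hr, hw])),
      eval_wallProd_eq_zero hlt hs' (Or.inr (by
        rw [hr, Function.update_self, Function.update_of_ne hi, Function.update_self, hw]
        field_simp))]
    simp

end Start

/-! ### The zonotope as an intersection of half-spaces. -/

section Zonotope

open Finset

/-- Adding a small positive multiple of `stdWt` removes all ties, and both sides are continuous in
the weights. -/
theorem wt_le_of_injective {n m : ℕ} {k : Fin (n + 1) → ℤ}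
    (h : ∀ c : Fin (n + 1) → ℝ, Function.Injective c → wt c k ≤ suppFn n m c)
    (c : Fin (n + 1) → ℝ) : wt c k ≤ suppFn n m c := by
  open Filter Topology in
  let g : ℝ → Fin (n + 1) → ℝ := fun ε => c + ε • stdWt n
  have hg : Continuous g := by fun_prop
  have hinj : ∀ᶠ ε in 𝓝[>] (0 : ℝ), Function.Injective (g ε) := by
    have : ∀ᶠ ε in 𝓝[>] (0 : ℝ), ∀ a b, a ≠ b → g ε a ≠ g ε b := by
      rw [eventually_all]; intro a
      rw [eventually_all]; intro b
      rw [eventually_imp_distrib_left]; intro hab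
      by_cases hc : c a = c b
      · filter_upwards [self_mem_nhdsWithin] with ε hε
        simp only [g, Pi.add_apply, Pi.smul_apply, smul_eq_mul, hc]
        intro h
        exact (stdWt_injective n).ne hab (mul_left_cancel₀ (ne_of_gt hε) (add_left_cancel h))
      · have h1 : Tendsto (fun ε => g ε a - g ε b) (𝓝[>] 0) (𝓝 (c a - c b)) := by
          have h2 : Continuous fun ε => g ε a - g ε b := by fun_prop
          have := (h2.tendsto 0).mono_left (nhdsWithin_le_nhds (s := Set.Ioi 0))
          simpa [g] using this
        filter_upwards [h1.eventually_ne (sub_ne_zero.2 hc)] with ε hε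
        exact sub_ne_zero.1 hε
    filter_upwards [this] with ε hε a b hab
    by_contra hne
    exact hε a b hne hab
  have hcont1 : Continuous fun c : Fin (n + 1) → ℝ => wt c k := by unfold wt; fun_prop
  have hcont2 : Continuous fun c : Fin (n + 1) → ℝ => suppFn n m c := by unfold suppFn; fun_prop
  have h0 : g 0 = c := by simp [g]
  have t1 := ((hcont1.comp hg).tendsto 0).mono_left (nhdsWithin_le_nhds (s := Set.Ioi 0))
  have t2 := ((hcont2.comp hg).tendsto 0).mono_left (nhdsWithin_le_nhds (s := Set.Ioi 0))
  simp only [Function.comp, h0] at t1 t2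
  exact le_of_tendsto_of_tendsto t1 t2 (hinj.mono fun ε hε => h _ hε)

/-- The real zonotope is a linear image of a box, hence compact and convex, so a point outside is
separated from it by a functional. The vertex exposed by that functional contradicts the hypothesis.
-/
theorem mem_zonotope_of_wt_le {n m : ℕ} {k : Fin (n + 1) → ℤ}
    (h : ∀ c : Fin (n + 1) → ℝ, wt c k ≤ suppFn n m c) : k ∈ zonotope n m := by
  let L : (Fin (n + 1) → Fin (n + 1) → ℝ) →ₗ[ℝ] (Fin (n + 1) → ℝ) :=
    { toFun := fun l a => ∑ i : Fin (n + 1), ∑ j ∈ Finset.Ioi i, l i j * (rootVec i j a : ℤ)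
      map_add' := fun l l' => by
        ext a
        simp only [Pi.add_apply, add_mul, sum_add_distrib]
      map_smul' := fun r l => by
        ext a
        simp only [Pi.smul_apply, smul_eq_mul, mul_assoc, mul_sum, RingHom.id_apply] }
  let B : Set (Fin (n + 1) → Fin (n + 1) → ℝ) :=
    Set.Icc 0 fun i j => if i < j then (rootMult n m j : ℝ) else 0
  have hB : IsCompact (L '' B) := isCompact_Icc.image L.continuous_of_finiteDimensional
  have hconv : Convex ℝ (L '' B) := (convex_Icc _ _).linear_image L
  have hmem : ∀ l ∈ B, ∀ i j, i < j → 0 ≤ l i j ∧ l i j ≤ (rootMult n m j : ℝ) := by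
    intro l hl i j hij
    have h1 := hl.1 i j
    have h2 := hl.2 i j
    simp only [hij, if_true] at h2
    exact ⟨h1, h2⟩
  by_cases hk : (fun a => (k a : ℝ)) ∈ L '' B
  · obtain ⟨l, hl, he⟩ := hk
    exact ⟨l, hmem l hl, fun a => (congrFun he a).symm⟩
  · exfalso
    obtain ⟨f, u, hf1, hf2⟩ := geometric_hahn_banach_closed_point hconv hB.isClosed hk
    let c : Fin (n + 1) → ℝ := fun a => f (Pi.single a 1)
    have hfc : ∀ x, f x = ∑ a, c a * x a := by
      intro x
      have := LinearMap.pi_apply_eq_sum_univ (f : (Fin (n + 1) → ℝ) →ₗ[ℝ] ℝ) x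
      simp only [smul_eq_mul] at this
      refine Eq.trans this (sum_congr rfl fun a _ => ?_)
      rw [mul_comm]
      have he : (fun b => if a = b then (1 : ℝ) else 0) = Pi.single a 1 := by
        ext b
        simp [Pi.single_apply, eq_comm]
      simp only [c, ← he]
      rfl
    have hv : (fun a => (vtx n m c a : ℝ)) ∈ L '' B := by
      refine ⟨fun i j => if i < j then (if c j < c i then (rootMult n m j : ℝ) else 0) else 0,
        ⟨fun i j => ?_, fun i j => ?_⟩, ?_⟩
      · simp only [Pi.zero_apply]; split_ifs <;> simp
      · simp only; split_ifs <;> simp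
      · ext a
        rw [(isZonoRep_vtx n m c).2 a]
        refine Eq.trans (b := ∑ i : Fin (n + 1), ∑ j ∈ Finset.Ioi i, (if i < j then
          (if c j < c i then (rootMult n m j : ℝ) else 0) else 0) * (rootVec i j a : ℤ)) rfl ?_
        refine sum_congr rfl fun i _ => sum_congr rfl fun j hj => ?_
        rw [if_pos (mem_Ioi.1 hj)]
    have h1 := hf1 _ hv
    rw [hfc] at h1 hf2
    have h2 := h c
    rw [← wt_vtx_self] at h2
    unfold wt at h2
    linarith

end Zonotope

end

/-! ### From polynomial eigenfunctions to quasi-invariants supported in the zonotope. -/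

noncomputable section

section Convert

open MvPolynomial Finset

variable {K : Type*} [Field K] [Algebra ℂ K] {n m : ℕ}

theorem dScale_eq (q : ℂ) (e : Fin (n + 1)) :
    dScale q (q ^ m) e = q ^ (2 * latScale n m e) := by
  unfold dScale latScale
  split_ifs
  · rw [← pow_mul, ← zpow_natCast]; congr 1; push_cast; ring
  · norm_cast

/-- Each other index contributes `q` to a signed multiplicity times the scale; these signed
multiplicities are those of `two_mul_vtx`. -/
theorem dTop_eq {q : ℂ} (hq0 : q ≠ 0) {c : Fin (n + 1) → ℝ} (hc : Function.Injective c)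
    (e : Fin (n + 1)) : dTop q (q ^ m) c e =
      q ^ (latScale n m e * (vtx n m (stdWt n) e - 2 * vtx n m c e)) := by
  have h : latScale n m e * (vtx n m (stdWt n) e - 2 * vtx n m c e) =
      ∑ x ∈ univ.erase e, -(latScale n m e * ((SignType.sign (c e - c x) : ℤ) * symMult n m e x)) := by
    rw [two_mul_vtx n m hc, sum_neg_distrib, ← mul_sum, ← add_sum_erase _ _ (mem_univ e)]
    simp
  rw [h, dTop]
  have hz : ∀ (s : Finset (Fin (n + 1))) (f : Fin (n + 1) → ℤ),
      q ^ (∑ x ∈ s, f x) = ∏ x ∈ s, q ^ f x := by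
    intro s f
    induction s using Finset.induction_on with
    | empty => simp
    | insert a s ha ih => rw [sum_insert ha, prod_insert ha, zpow_add₀ hq0, ih]
  rw [hz]
  refine prod_congr rfl fun x hx => ?_
  have hne := ne_of_mem_erase hx
  have hr : dRatio q (q ^ m) x = q ^ (latScale n m e * symMult n m e x) := by
    unfold dRatio latScale symMult rootMult
    by_cases hxl : x = Fin.last n
    · have he : e ≠ Fin.last n := fun h => hne (hxl.trans h.symm)
      have : max e x = Fin.last n := by rw [hxl]; exact max_eq_right (Fin.le_last e)
      rw [if_pos hxl, if_neg he, if_pos this]; simp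
    · rw [if_neg hxl]
      by_cases he : e = Fin.last n
      · have : max e x = Fin.last n := by rw [he]; exact max_eq_left (Fin.le_last x)
        rw [if_pos he, if_pos this]; simp
      · have : max e x ≠ Fin.last n := by
          rcases max_choice e x with h | h <;> rw [h] <;> assumption
        rw [if_neg he, if_neg this]; simp
  rw [hr]
  rcases lt_or_gt_of_ne (hc.ne hne) with h1 | h1
  · rw [if_pos h1, sign_pos (sub_pos.2 h1), ← zpow_neg]; simp
  · rw [if_neg h1.not_gt, sign_neg (sub_neg.2 h1)]; simp

theorem algebraMap_dMu (q : ℂ) (c : Fin (n + 1) → ℝ) (k : Fin (n + 1) →₀ ℕ) (e : Fin (n + 1)) :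
    algebraMap ℂ K (dMu q (q ^ m) c k e) =
      dMu (algebraMap ℂ K q) (algebraMap ℂ K q ^ m) c k e := by
  simp only [dMu, dGam, dTop, dScale, dRatio, map_mul, map_prod, map_pow,
    apply_ite (algebraMap ℂ K), map_div₀, map_sub, map_inv₀, map_one]

/-- Eigenvalues are combinations of the `ζ e` with complex coefficients, so linear independence
compares the coefficients separately. Each is a fixed nonzero constant times a power of `q` whose
exponent determines `k e - vtx n m c e`. An eigenvalue thus fixes the leading exponent relative to
the exposed vertex. -/
theorem eq_of_dEigen_eq {q : ℂ} (hq0 : q ≠ 0) (hq : ∀ k : ℕ, 0 < k → q ^ k ≠ 1) (hm : 0 < m)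
    {ζ : Fin (n + 1) → K} (hζ : LinearIndependent ℂ ζ) {c c' : Fin (n + 1) → ℝ}
    (hc : Function.Injective c) (hc' : Function.Injective c') {k k' : Fin (n + 1) →₀ ℕ}
    (h : dEigen (algebraMap ℂ K q) (algebraMap ℂ K q ^ m) ζ c k =
      dEigen (algebraMap ℂ K q) (algebraMap ℂ K q ^ m) ζ c' k') (e : Fin (n + 1)) :
    (k e : ℤ) - vtx n m c e = k' e - vtx n m c' e := by
  have h1 : ∑ e, (dMu q (q ^ m) c k e - dMu q (q ^ m) c' k' e) • ζ e = 0 := by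
    simp only [Algebra.smul_def, map_sub, sub_mul, sum_sub_distrib, algebraMap_dMu]
    rw [sub_eq_zero]
    simpa only [dEigen, mul_comm] using h
  have h2 := sub_eq_zero.1 (Fintype.linearIndependent_iff.1 hζ _ h1 e)
  have hg : dGam q (q ^ m) e ≠ 0 := by
    have key : ∀ N : ℕ, 0 < N → q ^ N - (q ^ N)⁻¹ ≠ 0 := by
      intro N hN h0
      have hN0 : q ^ N ≠ 0 := pow_ne_zero _ hq0
      refine hq (N * 2) (by omega) ?_
      rw [pow_mul]
      field_simp at h0
      linear_combination h0
    unfold dGam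
    split_ifs
    · have := key 1 one_pos
      rw [pow_one] at this
      exact div_ne_zero this (key m hm)
    · exact one_ne_zero
  rw [dMu, dMu, mul_assoc, mul_assoc] at h2
  have h3 := mul_left_cancel₀ hg h2
  rw [dTop_eq hq0 hc, dTop_eq hq0 hc', dScale_eq, ← zpow_natCast, ← zpow_natCast, ← zpow_mul,
    ← zpow_mul, ← zpow_add₀ hq0, ← zpow_add₀ hq0] at h3
  have h4 := zpow_injective_of_pow_ne_one hq0 hq h3
  have h5 := latScale_pos (n := n) hm e
  have h6 : 2 * latScale n m e * ((k e : ℤ) - vtx n m c e) =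
      2 * latScale n m e * (k' e - vtx n m c' e) := by linear_combination h4
  exact mul_left_cancel₀ (by omega) h6

/-- The exponents of `G` lie in a translate of the zonotope. -/
theorem support_of_eigen {q : ℂ} (hq0 : q ≠ 0) (hq : ∀ k : ℕ, 0 < k → q ^ k ≠ 1) (hm : 0 < m)
    {ζ : Fin (n + 1) → K} (hζ : LinearIndependent ℂ ζ) {v : Fin (n + 1) →₀ ℕ}
    {G : MvPolynomial (Fin (n + 1)) K}
    (hG : dDen n (algebraMap ℂ K q) (algebraMap ℂ K q ^ m) *
      (C (dEigen (algebraMap ℂ K q) (algebraMap ℂ K q ^ m) ζ (stdWt n) v) * G) =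
      dImage (algebraMap ℂ K q) (algebraMap ℂ K q ^ m) ζ G) {k : Fin (n + 1) →₀ ℕ}
    (hk : k ∈ G.support) :
    (fun a => (k a : ℤ) - (v a - vtx n m (stdWt n) a)) ∈ zonotope n m := by
  have hQ0 : algebraMap ℂ K q ≠ 0 := by simpa using hq0
  apply mem_zonotope_of_wt_le
  apply wt_le_of_injective
  intro c hc
  -- A leading exponent `u` for the weights `c` carries the same eigenvalue as `v` does for `stdWt`.
  -- So it is the translate of the vertex exposed by `c`, which bounds all exponents by the support
  -- function.
  obtain ⟨u, hu, hmax⟩ := exists_wtLE c (show G ≠ 0 by rintro rfl; simp at hk)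
  have h1 := coeff_of_dImage hQ0 (pow_ne_zero _ hQ0) hG hc hmax
  rw [coeff_C_mul] at h1
  have h2 := eq_of_dEigen_eq hq0 hq hm hζ (stdWt_injective n) hc
    (mul_right_cancel₀ (MvPolynomial.mem_support_iff.1 hu) h1)
  have hw : ∀ k : Fin (n + 1) →₀ ℕ, Finsupp.weight c k = ∑ a, c a * (k a : ℝ) := by
    intro k
    rw [Finsupp.weight_apply, Finsupp.sum_fintype _ _ (by simp)]
    exact sum_congr rfl fun a _ => by rw [nsmul_eq_mul, mul_comm]
  have h3 := hmax k hk
  rw [hw, hw] at h3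
  rw [← wt_vtx_self]
  simp only [wt]
  have h4 : ∀ a, (u a : ℝ) = vtx n m c a + (v a - vtx n m (stdWt n) a) := by
    intro a
    have h5 := h2 a
    have : (u a : ℤ) = vtx n m c a + (v a - vtx n m (stdWt n) a) := by linarith
    exact_mod_cast this
  simp only [h4, mul_add, sum_add_distrib] at h3
  push_cast
  simp only [mul_sub, sum_sub_distrib] at h3 ⊢
  linarith

/-- With the scales of the coordinates inserted, the ordinary and the deformed conditions take the
same form on the wall, parametrised by eliminating the coordinate `j`. -/
theorem PolyQuasiInv.eval_eq {K : Type*} [Field K] {q : K} (hq : q ≠ 0) {ζ : Fin (n + 1) → K}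
    {G : MvPolynomial (Fin (n + 1)) K} (hG : PolyQuasiInv q (q ^ m) m ζ G) {i j : Fin (n + 1)}
    (hij : i < j) {s : ℕ} (hs : s ∈ Icc 1 (rootMult n m j)) (x : Fin (n + 1) → K) :
    ζ j ^ s * eval (Function.update x j (q ^ (s * (latScale n m i + latScale n m j)) * x i)) G =
    ζ i ^ s * eval (Function.update (Function.update x i (q ^ (2 * s * latScale n m i) * x i)) j
      (q ^ (s * (latScale n m i - latScale n m j)) * x i)) G := by
  have hi : i ≠ Fin.last n := (hij.trans_le (Fin.le_last j)).ne
  have hdi : latScale n m i = 1 := if_neg hi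
  by_cases hj : j = Fin.last n
  · subst hj
    have hs1 : s = 1 := by simpa [rootMult] using hs
    subst hs1
    have hdj : latScale n m (Fin.last n) = m := if_pos rfl
    have e1 : q ^ (((1 : ℕ) : ℤ) * (1 + (m : ℤ))) = q * q ^ m := by
      rw [← pow_succ', ← zpow_natCast]; congr 1; push_cast; ring
    have h := hG.2 i hi (Function.update x (Fin.last n) (q * q ^ m * x i)) (by simp [hij.ne])
    rw [pow_one, pow_one, hdi, hdj, e1, h]
    congr 3
    ext a
    by_cases ha : a = Fin.last n
    · subst ha
      simp only [Function.update_self]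
      have e2 : q ^ (((1 : ℕ) : ℤ) * (1 - (m : ℤ))) = q * (q ^ m)⁻¹ := by
        rw [← zpow_natCast, ← zpow_neg, ← zpow_one_add₀ hq]; congr 1; push_cast; ring
      rw [e2]
      field_simp
    · by_cases hai : a = i
      · subst hai
        simp only [Function.update_of_ne ha, Function.update_self]
        norm_cast
      · simp [ha, hai]
  · have hdj : latScale n m j = 1 := if_neg hj
    have e1 : q ^ ((s : ℤ) * (1 + 1)) = q ^ (2 * s) := by
      rw [← zpow_natCast]; congr 1; push_cast; ring
    rw [rootMult, if_neg hj] at hs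
    have h := hG.1 i j hij hj s hs (Function.update x j (q ^ (2 * s) * x i)) (by simp [hij.ne])
    rw [hdi, hdj, e1, h]
    congr 3
    ext a
    by_cases ha : a = j
    · subst ha; simp [hij.ne]
    · by_cases hai : a = i
      · subst hai
        simp only [Function.update_of_ne ha, Function.update_self, Function.comp,
          Equiv.swap_apply_left]
        norm_cast; simp
      · simp [ha, hai, Equiv.swap_apply_of_ne_of_ne hai ha]

open Classical in
/-- Coefficientwise form of the polynomial conditions. -/
theorem PolyQuasiInv.sum_coeff {q : ℂ} (hq0 : q ≠ 0) {ζ : Fin (n + 1) → K}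
    {G : MvPolynomial (Fin (n + 1)) K}
    (hG : PolyQuasiInv (algebraMap ℂ K q) (algebraMap ℂ K q ^ m) m ζ G) {i j : Fin (n + 1)}
    (hij : i < j) {s : ℕ} (hs : s ∈ Icc 1 (rootMult n m j)) (c : Fin (n + 1) → ℤ) :
    ∑ k ∈ G.support, (if mergeIdx i j (fun a => (k a : ℤ)) = c then coeff k G *
      strWeight q n m ζ i j s (fun a => (k a : ℤ)) else 0) = 0 := by
  have : Infinite K := Infinite.of_injective _ (algebraMap ℂ K).injective
  set Q := algebraMap ℂ K q with hQ
  have hQ0 : Q ≠ 0 := by simpa [hQ] using hq0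
  -- On the wall `X_j` is a multiple of `X_i`, so the monomials on one lattice line in direction
  -- `ε_i - ε_j` become the same monomial `mg k`. Comparing coefficients then gives one relation per
  -- line.
  let mg : (Fin (n + 1) →₀ ℕ) → (Fin (n + 1) →₀ ℕ) := fun k =>
    Finsupp.equivFunOnFinite.symm fun a => if a = j then 0 else if a = i then k i + k j else k a
  let A : (Fin (n + 1) →₀ ℕ) → K := fun k =>
    ζ j ^ s * Q ^ ((s * (latScale n m i + latScale n m j)) * k j) -
    ζ i ^ s * (Q ^ ((2 * s * latScale n m i) * k i) *
      Q ^ ((s * (latScale n m i - latScale n m j)) * k j))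
  have hmg : ∀ (x : Fin (n + 1) → K) (k : Fin (n + 1) →₀ ℕ), ∏ a, x a ^ mg k a =
      x i ^ (k i + k j) * ∏ a ∈ (univ.erase j).erase i, x a ^ k a := by
    intro x k
    have hm1 : i ∈ univ.erase j := by simp [hij.ne]
    rw [← mul_prod_erase _ _ (mem_univ j), ← mul_prod_erase _ _ hm1]
    simp only [mg, Finsupp.equivFunOnFinite_symm_apply_apply, if_true, pow_zero, one_mul, hij.ne,
      if_false]
    congr 1
    refine prod_congr rfl fun a ha => ?_
    rw [if_neg (ne_of_mem_erase (mem_of_mem_erase ha)), if_neg (ne_of_mem_erase ha)]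
  have hP : ∑ k ∈ G.support, monomial (mg k) (coeff k G * A k) = 0 := by
    apply MvPolynomial.funext
    intro x
    have h := hG.eval_eq hQ0 hij hs x
    rw [eval_eq', eval_eq', ← sub_eq_zero, mul_sum, mul_sum, ← sum_sub_distrib] at h
    rw [map_sum, map_zero]
    refine Eq.trans (sum_congr rfl fun k _ => ?_) h
    rw [eval_monomial, Finsupp.prod_fintype _ _ (by simp), hmg]
    have hm1 : i ∈ univ.erase j := by simp [hij.ne]
    rw [← mul_prod_erase _ _ (mem_univ j), ← mul_prod_erase _ _ hm1,
      ← mul_prod_erase univ (fun a => (Function.update (Function.update x i _) j _ a) ^ k a)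
        (mem_univ j), ← mul_prod_erase _ _ hm1]
    simp only [Function.update_self, Function.update_of_ne hij.ne]
    have e1 : ∀ y z, ∏ a ∈ (univ.erase j).erase i,
        (Function.update (Function.update x i y) j z a) ^ k a =
        ∏ a ∈ (univ.erase j).erase i, x a ^ k a := by
      intro y z
      refine prod_congr rfl fun a ha => ?_
      rw [Function.update_of_ne (ne_of_mem_erase (mem_of_mem_erase ha)),
        Function.update_of_ne (ne_of_mem_erase ha)]
    have e2 : ∀ z, ∏ a ∈ (univ.erase j).erase i, (Function.update x j z a) ^ k a =
        ∏ a ∈ (univ.erase j).erase i, x a ^ k a := by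
      intro z
      refine prod_congr rfl fun a ha => ?_
      rw [Function.update_of_ne (ne_of_mem_erase (mem_of_mem_erase ha))]
    rw [e1, e2]
    simp only [A, mul_pow, zpow_mul Q _ ((k j : ℕ) : ℤ), zpow_mul Q _ ((k i : ℕ) : ℤ), zpow_natCast,
      pow_add]
    ring
  by_cases hc : ∃ k0 ∈ G.support, mergeIdx i j (fun a => (k0 a : ℤ)) = c
  swap
  · push Not at hc
    exact sum_eq_zero fun k hk => if_neg (hc k hk)
  obtain ⟨k0, -, rfl⟩ := hc
  have hmi : ∀ k, mergeIdx i j (fun a => (k a : ℤ)) = mergeIdx i j (fun a => (k0 a : ℤ)) ↔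
      mg k = mg k0 := by
    intro k
    have : ∀ k, mergeIdx i j (fun a => (k a : ℤ)) = fun a => (mg k a : ℤ) := by
      intro k
      ext a
      simp only [mergeIdx, mg, Finsupp.equivFunOnFinite_symm_apply_apply]
      split_ifs <;> push_cast <;> rfl
    rw [this, this]
    constructor
    · intro h
      ext a
      exact_mod_cast congrFun h a
    · intro h; rw [h]
  have h1 := congrArg (coeff (mg k0)) hP
  rw [coeff_sum, coeff_zero] at h1
  simp only [coeff_monomial] at h1
  -- This power of `Q` depends only on the line; it turns the asymmetric factors `A k` into the
  -- symmetric weights `strWeight`.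
  have h2 := congrArg (fun y => -(Q ^ (-(s * latScale n m i * (mg k0 i : ℤ)))) * y) h1
  simp only [mul_zero, mul_sum] at h2
  refine Eq.trans (sum_congr rfl fun k _ => ?_) h2
  simp only [hmi]
  split_ifs with hk
  · rw [← hk]
    have e3 : (mg k i : ℤ) = k i + k j := by
      simp [mg, hij.ne]
    rw [e3]
    have hpow : ∀ z : ℤ, (Q ^ z) ^ s = Q ^ (z * s) := fun z => by rw [zpow_mul, zpow_natCast]
    simp only [A, strWeight, rootForm, map_zpow₀, ← hQ, mul_pow, hpow]
    have e4 : ∀ u v w : ℤ, w = u + v → Q ^ w = Q ^ u * Q ^ v := fun u v w h => by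
      rw [h, zpow_add₀ hQ0]
    rw [e4 (-(s * latScale n m i * (k i + k j)))
        (2 * s * latScale n m i * k i + s * (latScale n m i - latScale n m j) * k j) _ (by ring),
      zpow_add₀ hQ0 (2 * s * latScale n m i * k i),
      e4 (-(s * latScale n m i * (k i + k j))) (s * (latScale n m i + latScale n m j) * k j)
        (-(latScale n m i * k i - latScale n m j * k j) * s) (by ring)]
    ring
  · ring

/-- Existence of a nonzero quasi-invariant supported in the zonotope. -/
theorem exists_quasiInv {q : ℂ} (hq0 : q ≠ 0) (hq : ∀ k : ℕ, 0 < k → q ^ k ≠ 1) (hm : 0 < m)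
    {ζ : Fin (n + 1) → K} (hζ : LinearIndependent ℂ ζ) :
    ∃ F : (Fin (n + 1) → ℤ) →₀ K, QuasiInv q n m ζ F ∧ (∀ k ∈ F.support, k ∈ zonotope n m) ∧
      F (vtx n m (stdWt n)) ≠ 0 := by
  classical
  have : Infinite K := Infinite.of_injective _ (algebraMap ℂ K).injective
  have hQ0 : algebraMap ℂ K q ≠ 0 := by simpa using hq0
  have hQ1 : ∀ k : ℕ, 0 < k → algebraMap ℂ K q ^ k ≠ 1 := fun k hk h => hq k hk (by
    rw [← map_pow, ← map_one (algebraMap ℂ K)] at h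
    exact (algebraMap ℂ K).injective h)
  obtain ⟨v, hv⟩ := exists_hasTop_wallProd (m := m) hQ0 (pow_ne_zero m hQ0) (stdWt_injective n)
  -- The translation that carries the leading exponent `v` to the vertex `2ρ`.
  let κ : Fin (n + 1) → ℤ := fun a => v a - vtx n m (stdWt n) a
  let u : Fin (n + 1) → ℂˣ := fun a => Units.mk0 (q ^ (-(2 * latScale n m a * κ a)))
    (zpow_ne_zero _ hq0)
  -- Translating the support by `κ` rescales the spectral parameters, so the eigenfunction is built
  -- for parameters that become `ζ` afterwards.
  let ζ' : Fin (n + 1) → K := fun a => algebraMap ℂ K (q ^ (-(2 * latScale n m a * κ a))) * ζ a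
  have hζ' : LinearIndependent ℂ ζ' := by
    have := hζ.units_smul u
    convert this using 1
    ext a
    simp only [ζ', u, Pi.smul_apply', Units.smul_mk0, Algebra.smul_def]
  obtain ⟨G, hG, hGv, hev⟩ := exists_eigen hQ0 hQ1 hm rfl (stdWt_injective n) (v := v)
    (fun k hk he => hk (by
      ext a
      have := eq_of_dEigen_eq hq0 hq hm hζ' (stdWt_injective n) (stdWt_injective n) he a
      omega)) (polyQuasiInv_wallProd hQ0 (pow_ne_zero m hQ0) ζ') hv.coeff_ne_zero
    (fun k hk hkv => hv.weight_lt hk hkv)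
  let emb : (Fin (n + 1) →₀ ℕ) → Fin (n + 1) → ℤ := fun k a => k a - κ a
  have hemb : Function.Injective emb := by
    intro k k' h
    ext a
    have := congrFun h a
    simp only [emb] at this
    omega
  let F : (Fin (n + 1) → ℤ) →₀ K := ∑ k ∈ G.support, Finsupp.single (emb k) (coeff k G)
  refine ⟨F, ?_, ?_, ?_⟩
  · intro i j hij s hs c
    have hsum := hG.sum_coeff hq0 hij hs (c + mergeIdx i j κ)
    have hF : F.sum (fun k a => if mergeIdx i j k = c then a * strWeight q n m ζ i j s k else 0) =
        ∑ k ∈ G.support, (if mergeIdx i j (emb k) = c then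
          coeff k G * strWeight q n m ζ i j s (emb k) else 0) := by
      rw [← Finsupp.sum_finsetSum_index (by intros; simp) (by intros; split_ifs <;> ring)]
      refine sum_congr rfl fun k _ => ?_
      rw [Finsupp.sum_single_index (by simp)]
    rw [hF]
    set r := algebraMap ℂ K (q ^ (latScale n m i * κ i + latScale n m j * κ j)) ^ s with hr
    have h2 := congrArg (fun y => r * y) hsum
    simp only [mul_zero, mul_sum] at h2
    refine Eq.trans (sum_congr rfl fun k _ => ?_) h2
    have hk : (fun a => (k a : ℤ)) = emb k + κ := by ext a; simp [emb]
    simp only [hk, mergeIdx_add, add_left_inj]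
    split_ifs
    · have e5 : strWeight q n m ζ i j s (emb k) = r * strWeight q n m ζ' i j s (emb k + κ) := by
        simp only [strWeight, hr, mul_sub, ← mul_pow, ζ', ← mul_assoc, ← map_mul,
          ← zpow_add₀ hq0, rootForm, Pi.add_apply]
        congr 5 <;> ring
      rw [e5]; ring
    · ring
  · intro k hk
    obtain ⟨k', hk', he⟩ := Finsupp.mem_support_finsetSum k hk
    rw [Finsupp.mem_support_iff, Finsupp.single_apply] at he
    have : emb k' = k := by by_contra h; exact he (if_neg h)
    rw [← this]
    exact support_of_eigen hq0 hq hm hζ' hev hk'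
  · have h1 : vtx n m (stdWt n) = emb v := by ext a; simp [emb, κ]
    have h2 : F (emb v) = coeff v G := by
      simp only [F, Finsupp.finsetSum_apply, Finsupp.single_apply, hemb.eq_iff]
      rw [sum_ite_eq', if_pos (MvPolynomial.mem_support_iff.2 hGv)]
    rw [h1, h2]
    exact hGv

end Convert

end

/-! ### Primitive quasi-invariants over the polynomial ring. -/

noncomputable section

section Primitive

open MvPolynomial Finset

variable {n m : ℕ} {q : ℂ}

/-- The squares of the variables. -/
def sqVar (n : ℕ) (i : Fin (n + 1)) : MvPolynomial (Fin (n + 1)) ℂ := X i ^ 2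

theorem genericPair_sqVar (q : ℂ) {i j : Fin (n + 1)} (hij : i ≠ j) :
    GenericPair q (sqVar n) i j := by
  intro a h
  have := congrArg (eval (fun x => if x = i then (1 : ℂ) else 0)) h
  simp [sqVar, algebraMap_eq, hij.symm] at this

/-- A prime divisor of `X_i² - c X_j²` cuts out a hyperplane. -/
theorem exists_hyperplane {p : MvPolynomial (Fin (n + 1)) ℂ} (hp : Prime p) {i j : Fin (n + 1)}
    (hij : i ≠ j) {c : ℂ} (hc : c ≠ 0) (h : p ∣ sqVar n i - C c * sqVar n j) :
    ∃ r : ℂ, r ≠ 0 ∧ r ^ 2 = c ∧ ∀ f, p ∣ f → ∀ w : Fin (n + 1) → ℂ, w i = r * w j →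
      eval w f = 0 := by
  obtain ⟨r, hr⟩ := IsAlgClosed.exists_pow_nat_eq c (n := 2) two_pos
  replace hr := hr.symm
  have hr0 : r ≠ 0 := by rintro rfl; simp at hr; exact hc hr
  have hfac : sqVar n i - C c * sqVar n j = linForm 1 r i j * linForm 1 (-r) i j := by
    simp only [sqVar, linForm, hr, C_1, C_neg, C_pow]; ring
  rw [hfac] at h
  have key : ∀ r' : ℂ, p ∣ linForm 1 r' i j → ∀ f, p ∣ f → ∀ w : Fin (n + 1) → ℂ,
      w i = r' * w j → eval w f = 0 := by
    intro r' h1 f hf w hw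
    have h2 := (hp.irreducible.associated_of_dvd (prime_linForm one_ne_zero hij).irreducible h1)
    exact (linForm_dvd_iff one_ne_zero hij f).1 (h2.symm.dvd.trans hf) w (by rw [one_mul, hw])
  rcases hp.dvd_or_dvd h with h1 | h1
  · exact ⟨r, hr0, hr.symm, key r h1⟩
  · exact ⟨-r, neg_ne_zero.2 hr0, by rw [hr]; ring, key _ h1⟩

/-- A common prime divisor cuts out a hyperplane `w_i = r w_j`. Test points on it show that the
second quadratic form vanishes there only for the same pair of indices and the same constant. -/
theorem pair_eq_of_dvd {p : MvPolynomial (Fin (n + 1)) ℂ} (hp : Prime p) {i j a b : Fin (n + 1)}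
    (hij : i < j) (hab : a < b) {c d : ℂ} (hc : c ≠ 0) (hd : d ≠ 0)
    (h : p ∣ sqVar n i - C c * sqVar n j) (h' : p ∣ sqVar n a - C d * sqVar n b) :
    (i = a ∧ j = b) ∧ c = d := by
  obtain ⟨r, hr0, hr, hev⟩ := exists_hyperplane hp hij.ne hc h
  have key := hev _ h'
  simp only [sqVar, map_sub, map_mul, map_pow, eval_X, eval_C] at key
  have hsame : i = a ∧ j = b := by
    by_contra hne
    by_cases ha : a = i ∨ a = j
    · by_cases hb : b = i ∨ b = j
      · rcases ha with rfl | rfl <;> rcases hb with rfl | rfl <;>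
          first
          | exact lt_irrefl _ hab
          | exact lt_asymm hab hij
          | exact hne ⟨rfl, rfl⟩
      · push Not at hb
        have := key (fun x => if x = i then r else if x = j then 1 else 0) (by simp [hij.ne'])
        rcases ha with rfl | rfl
        · simp [hb.1, hb.2, hr0] at this
        · simp [hb.1, hb.2, hij.ne'] at this
    · push Not at ha
      have := key (fun x => if x = i then r else if x = j then 1 else if x = a then
        (if b = i ∨ b = j then 0 else 1) else 0) (by simp [hij.ne'])
      by_cases hb : b = i ∨ b = j
      · rcases hb with rfl | rfl
        · simp [ha.1, ha.2, hr0, hd] at this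
        · simp [ha.1, ha.2, hij.ne', hd] at this
      · push Not at hb
        simp [ha.1, ha.2, hb.1, hb.2, hab.ne'] at this
  refine ⟨hsame, ?_⟩
  obtain ⟨rfl, rfl⟩ := hsame
  have := key (fun x => if x = i then r else 1) (by simp [hij.ne'])
  simp only [if_true, if_neg hij.ne', hr] at this
  linear_combination this

/-- A prime common to two factors forces the same pair of indices and the same power of `q`. The
factors of `posFac` have positive exponents and those of `negFac`, normalised in the same way,
negative ones. -/
theorem isRelPrime_vtxProd (hq0 : q ≠ 0) (hq : ∀ k : ℕ, 0 < k → q ^ k ≠ 1) (hm : 0 < m) :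
    IsRelPrime (vtxProd q n m (sqVar n) (stdWt n))
      (vtxProd q n m (sqVar n) (fun x => -stdWt n x)) := by
  have e1 : vtxProd q n m (sqVar n) (stdWt n) =
      ∏ i : Fin (n + 1), ∏ j ∈ Ioi i, posFac q n m (sqVar n) i j :=
    prod_congr rfl fun i _ => prod_congr rfl fun j hj => if_pos (stdWt_lt.2 (mem_Ioi.1 hj))
  have e2 : vtxProd q n m (sqVar n) (fun x => -stdWt n x) =
      ∏ i : Fin (n + 1), ∏ j ∈ Ioi i, negFac q n m (sqVar n) i j :=
    prod_congr rfl fun i _ => prod_congr rfl fun j hj => if_neg (by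
      have := (stdWt_lt (n := n)).2 (mem_Ioi.1 hj)
      linarith)
  rw [e1, e2]
  refine IsRelPrime.prod_left fun i _ => IsRelPrime.prod_left fun j hj =>
    IsRelPrime.prod_left fun l hl => IsRelPrime.prod_right fun a _ =>
    IsRelPrime.prod_right fun b hb => IsRelPrime.prod_right fun l' hl' => ?_
  rw [mem_Ioi] at hj hb
  rw [mem_Icc] at hl hl'
  have hi := latScale_pos (n := n) hm i
  have hj' := latScale_pos (n := n) hm j
  set u : ℤ := l * (latScale n m i + latScale n m j) with hu
  set v : ℤ := l' * (latScale n m a + latScale n m b) with hv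
  refine UniqueFactorizationMonoid.isRelPrime_iff_no_prime_factors ?_ |>.2 ?_
  · intro h0
    exact genericPair_sqVar q hj.ne u (sub_eq_zero.1 h0).symm
  · intro p h1 h2 hp
    have h1' : p ∣ sqVar n i - C (q ^ u) * sqVar n j := by
      rw [← dvd_neg, neg_sub]; exact h1
    have h2' : p ∣ sqVar n a - C (q ^ (-v)) * sqVar n b := by
      have e : sqVar n a - C (q ^ (-v)) * sqVar n b =
          C (q ^ (-v)) * (algebraMap ℂ _ (q ^ v) * sqVar n a - sqVar n b) := by
        rw [algebraMap_eq, mul_sub, ← mul_assoc, ← C_mul, ← zpow_add₀ hq0]; simp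
      rw [e]; exact h2.mul_left _
    obtain ⟨⟨rfl, rfl⟩, he⟩ := pair_eq_of_dvd hp hj hb (zpow_ne_zero _ hq0) (zpow_ne_zero _ hq0)
      h1' h2'
    have h3 := zpow_injective_of_pow_ne_one hq0 hq he
    have h4 : ((l : ℤ) + l') * (latScale n m i + latScale n m j) = 0 := by
      rw [add_mul, ← hu, ← hv, h3]; ring
    rcases mul_eq_zero.1 h4 with h5 | h5 <;> omega

/-- Weights for which `a` and `b` are neighbours. -/
theorem exists_isNeighbour {a b : Fin (n + 1)} (hab : a < b) :
    ∃ c : Fin (n + 1) → ℝ, Function.Injective c ∧ IsNeighbour c a b := by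
  have hhalf : ∀ x y : Fin (n + 1), (-((x : ℕ) : ℝ)) ≠ -((y : ℕ) : ℝ) + 1 / 2 := by
    intro x y h
    have h1 : (2 * (x : ℕ) + 1 : ℝ) = 2 * (y : ℕ) := by linarith
    have h2 : 2 * (x : ℕ) + 1 = 2 * (y : ℕ) := by exact_mod_cast h1
    omega
  refine ⟨fun x => if x = a then -((b : ℕ) : ℝ) + 1 / 2 else -((x : ℕ) : ℝ), ?_, ?_, ?_⟩
  · intro x y hxy
    simp only at hxy
    split_ifs at hxy with h1 h2 h2
    · rw [h1, h2]
    · exact absurd hxy.symm (hhalf _ _)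
    · exact absurd hxy (hhalf _ _)
    · exact Fin.ext (by exact_mod_cast neg_inj.1 hxy)
  · simp [hab.ne']
  · intro x
    by_cases hx : x = a
    · right; rw [hx]
    · simp only [if_neg hx, if_neg hab.ne', if_true]
      rcases le_or_gt (b : ℕ) (x : ℕ) with h | h
      · left; have : ((b : ℕ) : ℝ) ≤ (x : ℕ) := by exact_mod_cast h
        linarith
      · right; have : ((x : ℕ) : ℝ) + 1 ≤ (b : ℕ) := by exact_mod_cast h
        linarith

theorem vtx_eq_mul_vtxProd (hq0 : q ≠ 0) (hq : ∀ k : ℕ, 0 < k → q ^ k ≠ 1) (hm : 0 < m)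
    {F : (Fin (n + 1) → ℤ) →₀ MvPolynomial (Fin (n + 1)) ℂ}
    (hF : QuasiInv q n m (shiftedPar q n m (sqVar n)) F) (hZ : ∀ k ∈ F.support, k ∈ zonotope n m)
    {G : MvPolynomial (Fin (n + 1)) ℂ}
    (hG : F (vtx n m (stdWt n)) = vtxProd q n m (sqVar n) (stdWt n) * G)
    {c : Fin (n + 1) → ℝ} (hc : Function.Injective c) :
    F (vtx n m c) = G * vtxProd q n m (sqVar n) c := by
  have h := vtx_mul_vtxProd hq0 hq hm (fun i j hij => genericPair_sqVar q hij.ne) hF hZ c hc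
  rw [hG] at h
  have h0 : vtxProd q n m (sqVar n) (stdWt n) ≠ 0 := by
    refine prod_ne_zero_iff.2 fun i _ => prod_ne_zero_iff.2 fun j hj => ?_
    rw [if_pos (stdWt_lt.2 (mem_Ioi.1 hj))]
    exact posFac_ne_zero (genericPair_sqVar q (mem_Ioi.1 hj).ne)
  refine mul_right_cancel₀ h0 ?_
  rw [h]; ring

/-- Modulo `p` the coefficient at `2ρ` vanishes. If all pairs of parameters stay generic, uniqueness
over the quotient domain gives the claim. Otherwise genericity fails for exactly one pair, by
`pair_eq_of_dvd`. The strings in the other directions remain wide, so a nonzero reduction would meet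
an edge in the exceptional direction, and `edge_dvd` excludes this. -/
theorem prime_dvd_of_quasiInv (hq0 : q ≠ 0) (hq : ∀ k : ℕ, 0 < k → q ^ k ≠ 1) (hm : 0 < m)
    {F : (Fin (n + 1) → ℤ) →₀ MvPolynomial (Fin (n + 1)) ℂ}
    (hF : QuasiInv q n m (shiftedPar q n m (sqVar n)) F) (hZ : ∀ k ∈ F.support, k ∈ zonotope n m)
    {p G : MvPolynomial (Fin (n + 1)) ℂ} (hp : Prime p)
    (hG : F (vtx n m (stdWt n)) = vtxProd q n m (sqVar n) (stdWt n) * (p * G))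
    (k : Fin (n + 1) → ℤ) : p ∣ F k := by
  let I := Ideal.span {p}
  have hI : I.IsPrime := (Ideal.span_singleton_prime hp.ne_zero).2 hp
  let π : MvPolynomial (Fin (n + 1)) ℂ →ₐ[ℂ] MvPolynomial (Fin (n + 1)) ℂ ⧸ I :=
    Ideal.Quotient.mkₐ ℂ I
  have hπ : ∀ f, π f = 0 ↔ p ∣ f := fun f => by
    rw [← Ideal.mem_span_singleton]; exact Ideal.Quotient.eq_zero_iff_mem
  let F' := F.mapRange π (map_zero π)
  have hF'v : ∀ k, F' k = π (F k) := fun k => Finsupp.mapRange_apply ..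
  have hF' := quasiInv_map π hF
  have hpar : (fun i => π (shiftedPar q n m (sqVar n) i)) =
      shiftedPar q n m (fun i => π (sqVar n i)) := by
    ext i; simp only [shiftedPar, map_mul, AlgHom.commutes]
  rw [hpar] at hF'
  have hZ' : ∀ k ∈ F'.support, k ∈ zonotope n m := fun k hk =>
    hZ k (Finsupp.support_mapRange hk)
  rw [← hπ, ← hF'v]
  suffices h : F' = 0 by rw [h]; rfl
  have hbad : ∀ i j, ¬GenericPair q (fun i => π (sqVar n i)) i j →
      ∃ c : ℂ, c ≠ 0 ∧ p ∣ sqVar n i - C c * sqVar n j := by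
    intro i j h
    unfold GenericPair at h
    push Not at h
    obtain ⟨a, ha⟩ := h
    refine ⟨q ^ a, zpow_ne_zero _ hq0, ?_⟩
    rw [← hπ, map_sub, map_mul, ha, sub_eq_zero, ← algebraMap_eq, AlgHom.commutes]
  by_cases hgen : ∀ i j, i < j → GenericPair q (fun i => π (sqVar n i)) i j
  · refine hF'.eq_zero hq0 hq hm (fun i j hij => (genericPair_shiftedPar hq0).2 (hgen i j hij)) hZ'
      (stdWt_injective n) ?_
    rw [hF'v, hπ, hG]
    exact (Dvd.intro _ rfl).mul_left _
  push Not at hgen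
  obtain ⟨a, b, hab, hnab⟩ := hgen
  obtain ⟨d, hd, hdvd⟩ := hbad a b hnab
  by_contra hne
  obtain ⟨c, hc, hN⟩ := exists_isNeighbour hab
  -- The weights with the tie `a`, `b` require wide strings only in the directions where genericity
  -- persists.
  obtain ⟨k, hk, he⟩ := exists_wt_eq_suppFn F'.support (Finsupp.support_nonempty_iff.2 hne) hZ'
    (Function.update c a (c b)) (by
      intro i j hij hne
      refine hF'.hasWideStrings hq0 hq hm hij ((genericPair_shiftedPar hq0).2 ?_)
      by_contra hnij
      obtain ⟨d', hd', hdvd'⟩ := hbad i j hnij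
      obtain ⟨⟨rfl, rfl⟩, -⟩ := pair_eq_of_dvd hp hij hab hd' hd hdvd' hdvd
      rw [Function.update_self, Function.update_of_ne hij.ne'] at hne
      exact hne rfl)
  obtain ⟨t, ht, rfl⟩ := eq_vtx_sub_of_tie hc hab hN (hZ' k hk) he
  rw [Finsupp.mem_support_iff, hF'v, ne_eq, hπ] at hk
  refine hk (edge_dvd hq0 hq hm hF hZ hc hab hN (genericPair_sqVar q hab.ne) p ?_ t ht)
  rw [vtx_eq_mul_vtxProd hq0 hq hm hF hZ hG hc, mul_assoc]
  refine mul_dvd_mul_left p (Dvd.dvd.mul_left ?_ G)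
  have h1 : (if c b < c a then posFac q n m (sqVar n) a b else negFac q n m (sqVar n) a b) =
      posFac q n m (sqVar n) a b := if_pos hN.1
  rw [← h1]
  exact (dvd_prod_of_mem (fun j => if c j < c a then posFac q n m (sqVar n) a j else
    negFac q n m (sqVar n) a j) (mem_Ioi.2 hab)).trans (dvd_prod_of_mem (fun i => ∏ j ∈ Ioi i,
      if c j < c i then posFac q n m (sqVar n) i j else negFac q n m (sqVar n) i j) (mem_univ a))

theorem linearIndependent_shiftedPar (hq0 : q ≠ 0) :
    LinearIndependent ℂ fun i => algebraMap (MvPolynomial (Fin (n + 1)) ℂ)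
      (FractionRing (MvPolynomial (Fin (n + 1)) ℂ)) (shiftedPar q n m (sqVar n) i) := by
  rw [Fintype.linearIndependent_iff]
  intro g hg i
  have h1 : ∑ i, C (g i) * shiftedPar q n m (sqVar n) i = 0 := by
    apply IsFractionRing.injective (MvPolynomial (Fin (n + 1)) ℂ)
      (FractionRing (MvPolynomial (Fin (n + 1)) ℂ))
    rw [map_sum, map_zero, ← hg]
    refine sum_congr rfl fun i _ => ?_
    rw [map_mul, Algebra.smul_def, ← algebraMap_eq, ← IsScalarTower.algebraMap_apply]
  have h2 := congrArg (eval (fun x => if x = i then (1 : ℂ) else 0)) h1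
  rw [map_sum, map_zero, Finset.sum_eq_single i] at h2
  · simp only [shiftedPar, sqVar, map_mul, map_pow, eval_C, eval_X, if_true, algebraMap_eq] at h2
    simpa [zpow_ne_zero (latScale n m i * vtx n m (stdWt n) i) hq0] using h2
  · intro b _ hb
    simp [shiftedPar, sqVar, hb]
  · simp

/-- The Baker–Akhiezer polynomial: the primitive quasi-invariant supported in the zonotope. -/
theorem exists_primitive (hq0 : q ≠ 0) (hq : ∀ k : ℕ, 0 < k → q ^ k ≠ 1) (hm : 0 < m) :
    ∃ F : (Fin (n + 1) → ℤ) →₀ MvPolynomial (Fin (n + 1)) ℂ,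
      QuasiInv q n m (shiftedPar q n m (sqVar n)) F ∧ (∀ k ∈ F.support, k ∈ zonotope n m) ∧
      ∀ c : Fin (n + 1) → ℝ, Function.Injective c →
        F (vtx n m c) = vtxProd q n m (sqVar n) c := by
  classical
  let R := MvPolynomial (Fin (n + 1)) ℂ
  let K := FractionRing R
  obtain ⟨F₁, h1, h2, h3⟩ := exists_quasiInv hq0 hq hm (linearIndependent_shiftedPar (n := n)
    (m := m) hq0)
  -- Denominators are cleared; the coefficient at `2ρ` may then contain superfluous factors.
  obtain ⟨b, hb⟩ := IsLocalization.exist_integer_multiples_of_finset (nonZeroDivisors R)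
    (F₁.support.image F₁)
  have hb0 : (b : R) ≠ 0 := nonZeroDivisors.coe_ne_zero b
  have hb' : ∀ k, ∃ r : R, algebraMap R K r = algebraMap R K b * F₁ k ∧ (F₁ k = 0 → r = 0) := by
    intro k
    by_cases hk : F₁ k = 0
    · exact ⟨0, by simp [hk], fun _ => rfl⟩
    · obtain ⟨r, hr⟩ := hb (F₁ k) (mem_image_of_mem _ (Finsupp.mem_support_iff.2 hk))
      refine ⟨r, ?_, fun h => absurd h hk⟩
      rw [hr, Algebra.smul_def]
  choose f hf hf0 using hb'
  let F₀ : (Fin (n + 1) → ℤ) →₀ R := Finsupp.onFinset F₁.support f fun k hk => by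
    rw [Finsupp.mem_support_iff]; exact fun h => hk (hf0 k h)
  have hinj : Function.Injective (Algebra.algHom ℂ R K) := IsFractionRing.injective R K
  have hQ0 : QuasiInv q n m (shiftedPar q n m (sqVar n)) F₀ := by
    refine quasiInv_of_injective (Algebra.algHom ℂ R K) hinj ?_
    have : F₀.mapRange (Algebra.algHom ℂ R K) (map_zero _) = algebraMap R K b • F₁ := by
      ext k
      exact hf k
    rw [this]
    exact h1.smul _
  have hZ0 : ∀ k ∈ F₀.support, k ∈ zonotope n m := fun k hk =>
    h2 k (Finsupp.support_onFinset_subset hk)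
  have hv0 : F₀ (vtx n m (stdWt n)) ≠ 0 := by
    intro h
    have h4 : f (vtx n m (stdWt n)) = 0 := h
    have h5 := hf (vtx n m (stdWt n))
    rw [h4, map_zero, zero_eq_mul] at h5
    rcases h5 with h5 | h5
    · exact hb0 (hinj (h5.trans (map_zero _).symm))
    · exact h3 h5
  -- Comparing `2ρ` with the opposite vertex, whose product is coprime to that of `2ρ`, shows that
  -- the coefficient at `2ρ` is divisible by its own product.
  have hrel := vtx_mul_vtxProd hq0 hq hm (fun i j hij => genericPair_sqVar q hij.ne) hQ0 hZ0
    (fun x => -stdWt n x) (fun x y h => stdWt_injective n (neg_inj.1 h))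
  obtain ⟨G, hG⟩ := (isRelPrime_vtxProd (n := n) hq0 hq hm).dvd_of_dvd_mul_right
    (Dvd.intro_left _ hrel)
  have hG0 : G ≠ 0 := by rintro rfl; exact hv0 (by rw [hG, mul_zero])
  clear_value F₀
  clear hrel hf hf0 hb hv0
  suffices H : ∃ F : (Fin (n + 1) → ℤ) →₀ R, QuasiInv q n m (shiftedPar q n m (sqVar n)) F ∧
      (∀ k ∈ F.support, k ∈ zonotope n m) ∧
      F (vtx n m (stdWt n)) = vtxProd q n m (sqVar n) (stdWt n) * 1 by
    obtain ⟨F, hF1, hF2, hF3⟩ := H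
    refine ⟨F, hF1, hF2, fun c hc => ?_⟩
    rw [vtx_eq_mul_vtxProd hq0 hq hm hF1 hF2 hF3 hc, one_mul]
  -- The primes of the remaining cofactor are divided out of all coefficients one at a time.
  induction G using UniqueFactorizationMonoid.induction_on_prime generalizing F₀ with
  | h₁ => exact absurd rfl hG0
  | h₂ u hu =>
    obtain ⟨u, rfl⟩ := hu
    refine ⟨(↑u⁻¹ : R) • F₀, hQ0.smul _, fun k hk => hZ0 k (Finsupp.support_smul hk), ?_⟩
    rw [Finsupp.smul_apply, hG, smul_eq_mul, mul_left_comm, Units.inv_mul]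
  | h₃ a p ha hp ih =>
    have hdvd := prime_dvd_of_quasiInv hq0 hq hm hQ0 hZ0 hp hG
    have : ∀ k, ∃ r, F₀ k = p * r ∧ (F₀ k = 0 → r = 0) := by
      intro k
      obtain ⟨r, hr⟩ := hdvd k
      refine ⟨r, hr, fun h => ?_⟩
      rw [h, zero_eq_mul] at hr
      exact hr.resolve_left hp.ne_zero
    choose g hg hg0 using this
    let F₂ : (Fin (n + 1) → ℤ) →₀ R := Finsupp.onFinset F₀.support g fun k hk => by
      rw [Finsupp.mem_support_iff]; exact fun h => hk (hg0 k h)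
    have hF2 : F₀ = p • F₂ := by
      ext1 k
      exact hg k
    refine ih F₂ (quasiInv_of_smul hp.ne_zero (hF2 ▸ hQ0))
      (fun k hk => hZ0 k (Finsupp.support_onFinset_subset hk)) ?_ ha
    apply mul_left_cancel₀ hp.ne_zero
    have : p * F₂ (vtx n m (stdWt n)) = F₀ (vtx n m (stdWt n)) := by rw [hF2]; rfl
    rw [this, hG]; ring

end Primitive

end

noncomputable section

open MvPolynomial

/-! ### Difference operators and their coefficients -/

namespace CoeffField

variable {n : ℕ} {h m : ℂ}

instance : Algebra ℂ (CoeffField n h m) :=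
  inferInstanceAs (Algebra ℂ (FractionRing (MvPolynomial (Fin (n + 1)) ℂ)))

instance : IsScalarTower ℂ (MvPolynomial (Fin (n + 1)) ℂ) (CoeffField n h m) :=
  inferInstanceAs (IsScalarTower ℂ (MvPolynomial (Fin (n + 1)) ℂ)
    (FractionRing (MvPolynomial (Fin (n + 1)) ℂ)))

theorem algebraMap_C (c : ℂ) :
    algebraMap (MvPolynomial (Fin (n + 1)) ℂ) (CoeffField n h m) (C c) =
      algebraMap ℂ (CoeffField n h m) c :=
  (IsScalarTower.algebraMap_apply ℂ (MvPolynomial (Fin (n + 1)) ℂ) (CoeffField n h m) c).symm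

theorem qpow_eq (a : ℂ) :
    (qpow a : CoeffField n h m) = algebraMap ℂ (CoeffField n h m) (Complex.exp (h * a)) :=
  algebraMap_C _

theorem algebraMap_injective :
    Function.Injective (algebraMap (MvPolynomial (Fin (n + 1)) ℂ) (CoeffField n h m)) :=
  IsFractionRing.injective _ _

theorem var_ne_zero (i : Fin (n + 1)) : (var i : CoeffField n h m) ≠ 0 := fun h0 =>
  X_ne_zero (R := ℂ) i (algebraMap_injective (h0.trans (map_zero _).symm))

theorem smul_algebraMap (ν : Fin (n + 1) → ℤ) (f : MvPolynomial (Fin (n + 1)) ℂ) :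
    Multiplicative.ofAdd ν • algebraMap (MvPolynomial (Fin (n + 1)) ℂ) (CoeffField n h m) f =
      algebraMap _ _ (shiftHom n h m ν f) :=
  IsFractionRing.ringEquivOfRingEquiv_algebraMap _ _

theorem smul_const (ν : Fin (n + 1) → ℤ) (c : ℂ) :
    Multiplicative.ofAdd ν • algebraMap ℂ (CoeffField n h m) c = algebraMap ℂ _ c := by
  rw [← algebraMap_C, smul_algebraMap]
  simp [shiftHom]

theorem smul_var (ν : Fin (n + 1) → ℤ) (i : Fin (n + 1)) :
    Multiplicative.ofAdd ν • (var i : CoeffField n h m) =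
      algebraMap ℂ _ (shiftFactor n h m ν i) * var i := by
  rw [var, smul_algebraMap, shiftHom, aeval_X, map_mul, algebraMap_C]

theorem smul_div' (ν : Fin (n + 1) → ℤ) (a b : CoeffField n h m) :
    Multiplicative.ofAdd ν • (a / b) =
      (Multiplicative.ofAdd ν • a) / (Multiplicative.ofAdd ν • b) :=
  map_div₀ (MulSemiringAction.toRingHom _ (CoeffField n h m) (Multiplicative.ofAdd ν)) a b

end CoeffField

namespace DiffOp

variable {n : ℕ} {h m : ℂ}

theorem term_zero (ν : Fin (n + 1) → ℤ) : term (0 : CoeffField n h m) ν = 0 :=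
  SkewMonoidAlgebra.single_zero _

theorem term_add (a b : CoeffField n h m) (ν : Fin (n + 1) → ℤ) :
    term (a + b) ν = term a ν + term b ν :=
  SkewMonoidAlgebra.single_add _ _ _

theorem term_mul_term (a b : CoeffField n h m) (μ ν : Fin (n + 1) → ℤ) :
    term a μ * term b ν = term (a * (Multiplicative.ofAdd μ • b)) (μ + ν) :=
  SkewMonoidAlgebra.single_mul_single

theorem one_eq : (1 : DiffOp n h m) = term 1 0 := rfl

theorem natCast_eq (s : ℕ) : (s : DiffOp n h m) = term (s : CoeffField n h m) 0 := by
  induction s with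
  | zero => simp [term_zero]
  | succ s ih => rw [Nat.cast_succ, ih, one_eq, ← term_add, Nat.cast_succ]

theorem induction {p : DiffOp n h m → Prop} (A : DiffOp n h m) (h0 : p 0)
    (hterm : ∀ a ν, p (term a ν)) (hadd : ∀ A B, p A → p B → p (A + B)) : p A :=
  SkewMonoidAlgebra.induction_on A h0 (fun g a => hterm a g.toAdd) (fun A B => hadd A B)

/-- The coefficients of a difference operator. -/
def coeffs : DiffOp n h m →+ ((Fin (n + 1) → ℤ) →₀ CoeffField n h m) :=
  (Finsupp.domCongr Multiplicative.toAdd).toAddMonoidHom.comp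
    (SkewMonoidAlgebra.coeffAddEquiv (k := CoeffField n h m)
      (G := Multiplicative (Fin (n + 1) → ℤ))).toAddMonoidHom

theorem coeffs_apply (A : DiffOp n h m) (ν : Fin (n + 1) → ℤ) :
    coeffs A ν = A.coeff (Multiplicative.ofAdd ν) := rfl

theorem coeffs_term (a : CoeffField n h m) (ν : Fin (n + 1) → ℤ) :
    coeffs (term a ν) = Finsupp.single ν a := by
  classical
  ext μ
  rw [coeffs_apply, term, SkewMonoidAlgebra.coeff_single_apply, Finsupp.single_apply]
  rfl

theorem coeffs_injective :
    Function.Injective (coeffs : DiffOp n h m →+ ((Fin (n + 1) → ℤ) →₀ CoeffField n h m)) := by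
  intro A B hAB
  ext ν
  exact DFunLike.congr_fun hAB ν.toAdd

theorem coeffs_term_mul (a : CoeffField n h m) (ν : Fin (n + 1) → ℤ) (P : DiffOp n h m)
    (k : Fin (n + 1) → ℤ) :
    coeffs (term a ν * P) k = a * (Multiplicative.ofAdd ν • coeffs P (k - ν)) := by
  induction P using DiffOp.induction with
  | h0 => simp
  | hterm b μ =>
    rw [term_mul_term, coeffs_term, coeffs_term]
    by_cases hk : ν + μ = k
    · subst hk; simp
    · rw [Finsupp.single_eq_of_ne' hk, Finsupp.single_eq_of_ne' fun h => hk (by rw [h]; abel)]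
      simp
  | hadd P Q hP hQ => rw [mul_add, map_add, map_add, Finsupp.add_apply, Finsupp.add_apply, hP, hQ,
      smul_add, mul_add]

theorem coeffs_mul_const_term (c : ℂ) (ν : Fin (n + 1) → ℤ) (P : DiffOp n h m)
    (k : Fin (n + 1) → ℤ) :
    coeffs (P * term (algebraMap ℂ _ c) ν) k = algebraMap ℂ _ c * coeffs P (k - ν) := by
  induction P using DiffOp.induction with
  | h0 => simp
  | hterm b μ =>
    rw [term_mul_term, coeffs_term, coeffs_term, CoeffField.smul_const]
    by_cases hk : μ + ν = k
    · subst hk; simp [mul_comm]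
    · rw [Finsupp.single_eq_of_ne' hk, Finsupp.single_eq_of_ne' fun h => hk (by rw [h]; abel)]
      simp
  | hadd P Q hP hQ => rw [add_mul, map_add, map_add, Finsupp.add_apply, Finsupp.add_apply, hP, hQ,
      mul_add]

theorem sum_term_coeffs (A : DiffOp n h m) : A = (coeffs A).sum fun ν a => term a ν := by
  induction A using DiffOp.induction with
  | h0 => simp
  | hterm b μ => rw [coeffs_term, Finsupp.sum_single_index (h := fun ν a => term a ν) (term_zero _)]
  | hadd P Q hP hQ =>
    rw [map_add, Finsupp.sum_add_index' (h := fun ν a => term a ν) (fun _ => term_zero _)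
      (fun _ _ _ => term_add _ _ _),
      ← hP, ← hQ]

/-- The lattice has unique sums: some exponent of the product arises from only one pair of
exponents, and its coefficient is a product of nonzero elements of a field. -/
theorem mul_ne_zero' {A B : DiffOp n h m} (hA : A ≠ 0) (hB : B ≠ 0) : A * B ≠ 0 := by
  classical
  have hA' : (coeffs A).support.Nonempty :=
    Finsupp.support_nonempty_iff.2 fun h0 => hA (coeffs_injective (h0.trans (map_zero _).symm))
  have hB' : (coeffs B).support.Nonempty :=
    Finsupp.support_nonempty_iff.2 fun h0 => hB (coeffs_injective (h0.trans (map_zero _).symm))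
  obtain ⟨μ, hμ, ν, hν, hu⟩ := UniqueSums.uniqueAdd_of_nonempty hA' hB'
  intro h0
  have key : coeffs (A * B) (μ + ν) = coeffs A μ * (Multiplicative.ofAdd μ • coeffs B ν) := by
    conv_lhs => rw [sum_term_coeffs A, Finsupp.sum, Finset.sum_mul, map_sum,
      Finsupp.finsetSum_apply]
    rw [Finset.sum_eq_single μ]
    · rw [coeffs_term_mul, add_sub_cancel_left]
    · intro μ' hμ' hne
      rw [coeffs_term_mul]
      by_cases hB0 : μ + ν - μ' ∈ (coeffs B).support
      · exact absurd (hu hμ' hB0 (by abel)).1 hne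
      · rw [Finsupp.notMem_support_iff.1 hB0, smul_zero, mul_zero]
    · intro h; exact absurd hμ h
  rw [h0, map_zero, Finsupp.coe_zero, Pi.zero_apply] at key
  rcases mul_eq_zero.1 key.symm with h1 | h1
  · exact (Finsupp.mem_support_iff.1 hμ) h1
  · exact (Finsupp.mem_support_iff.1 hν) ((smul_eq_zero_iff_eq _).1 h1)

/-- The constant-coefficient difference operators. -/
def ofPoly : MvPolynomial (Fin (n + 1)) ℂ →+* DiffOp n h m := by
  refine AddMonoidAlgebra.liftNCRingHom
    { toFun := fun c => term (algebraMap ℂ _ c) 0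
      map_one' := by rw [map_one]; rfl
      map_mul' := fun a b => by rw [term_mul_term, CoeffField.smul_const, map_mul, add_zero]
      map_zero' := by rw [map_zero, term_zero]
      map_add' := fun a b => by rw [map_add, term_add] }
    { toFun := fun k => term 1 (fun i => ((k.toAdd i : ℕ) : ℤ))
      map_one' := by simp only [toAdd_one, Finsupp.coe_zero, Pi.zero_apply, Nat.cast_zero, one_eq]; rfl
      map_mul' := fun a b => by
        rw [term_mul_term, smul_one, mul_one]; congr 1 } ?_
  intro c k
  simp only [Commute, SemiconjBy, RingHom.coe_mk, MonoidHom.coe_mk, OneHom.coe_mk, term_mul_term,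
    CoeffField.smul_const, smul_one, mul_one, one_mul, zero_add, add_zero]

theorem ofPoly_C_mul_monomial (c : ℂ) (k : Fin (n + 1) →₀ ℕ) :
    (ofPoly (monomial k c) : DiffOp n h m) = term (algebraMap ℂ _ c) (fun i => (k i : ℤ)) := by
  refine (AddMonoidAlgebra.liftNCRingHom_single _ _ _ _ _).trans ?_
  simp only [RingHom.coe_mk, MonoidHom.coe_mk, OneHom.coe_mk, term_mul_term, smul_one, mul_one,
    zero_add, toAdd_ofAdd]

theorem commute_ofPoly (f g : MvPolynomial (Fin (n + 1)) ℂ) :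
    Commute (ofPoly f : DiffOp n h m) (ofPoly g) := (Commute.all f g).map ofPoly

end DiffOp

end

noncomputable section

open MvPolynomial

/-! ### Quasi-invariant difference operators -/

theorem shiftFactor_natCast (n : ℕ) (h : ℂ) (m : ℕ) (ν : Fin (n + 1) → ℤ) (i : Fin (n + 1)) :
    shiftFactor n h m ν i = Complex.exp h ^ (latScale n m i * ν i) := by
  rw [shiftFactor, ← Complex.exp_int_mul, latScale]
  congr 1
  split_ifs <;> push_cast <;> ring

/-- The spectral parameters in the coefficient field. -/
def fieldPar (n : ℕ) (h : ℂ) (m : ℕ) (i : Fin (n + 1)) : CoeffField n h m :=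
  algebraMap (MvPolynomial (Fin (n + 1)) ℂ) _ (shiftedPar (Complex.exp h) n m (sqVar n) i)

theorem fieldPar_eq (n : ℕ) (h : ℂ) (m : ℕ) (i : Fin (n + 1)) :
    fieldPar n h m i = algebraMap ℂ _ (Complex.exp h ^ (-(latScale n m i * vtx n m (stdWt n) i))) *
      CoeffField.var i ^ 2 := by
  rw [fieldPar, shiftedPar, map_mul, ← IsScalarTower.algebraMap_apply, sqVar, map_pow]; rfl

theorem smul_var_sq {n : ℕ} {h : ℂ} {m : ℕ} (ν : Fin (n + 1) → ℤ) (i : Fin (n + 1)) :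
    Multiplicative.ofAdd ν • (CoeffField.var i ^ 2 : CoeffField n h m) =
      algebraMap ℂ _ (Complex.exp h ^ (2 * (latScale n m i * ν i))) * CoeffField.var i ^ 2 := by
  rw [smul_pow', CoeffField.smul_var, shiftFactor_natCast, mul_pow, ← map_pow, mul_comm 2, zpow_mul _ _ 2]
  rfl

theorem smul_fieldPar {n : ℕ} {h : ℂ} {m : ℕ} (ν : Fin (n + 1) → ℤ) (i : Fin (n + 1)) :
    Multiplicative.ofAdd ν • fieldPar n h m i =
      algebraMap ℂ _ (Complex.exp h ^ (2 * (latScale n m i * ν i))) * fieldPar n h m i := by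
  rw [fieldPar_eq, smul_mul', CoeffField.smul_const, smul_var_sq]
  ring

/-- Shifting `x` by `ν` acts on the weights as translation of the index by `ν`, up to a scalar
independent of the index. Hence left multiplication by any difference operator preserves
quasi-invariance. -/
theorem strWeight_add {n : ℕ} {h : ℂ} {m : ℕ} (i j : Fin (n + 1)) (s : ℕ)
    (ν k : Fin (n + 1) → ℤ) :
    strWeight (Complex.exp h) n m (fieldPar n h m) i j s (ν + k) =
      algebraMap ℂ _ (Complex.exp h ^ (-(latScale n m i * ν i + latScale n m j * ν j))) ^ s *
        (Multiplicative.ofAdd ν •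
          strWeight (Complex.exp h) n m (fieldPar n h m) i j s k) := by
  have hq0 := Complex.exp_ne_zero h
  simp only [strWeight, smul_sub, smul_pow', smul_mul', CoeffField.smul_const, smul_fieldPar,
    mul_sub, ← mul_pow, ← mul_assoc, ← map_mul, ← zpow_add₀ hq0, rootForm_add]
  refine congrArg₂ _
    (congrArg (fun e => (algebraMap ℂ _ (Complex.exp h ^ e) * fieldPar n h m i) ^ s) ?_)
    (congrArg (fun e => (algebraMap ℂ _ (Complex.exp h ^ e) * fieldPar n h m j) ^ s) ?_) <;>
  simp only [rootForm] <;> ring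

theorem strWeight_add_const {A : Type*} [CommRing A] [Algebra ℂ A] {q : ℂ} (hq0 : q ≠ 0)
    {n m : ℕ} (ζ : Fin (n + 1) → A) (i j : Fin (n + 1)) (s : ℕ) (ν k : Fin (n + 1) → ℤ) :
    strWeight q n m ζ i j s (k + ν) =
      algebraMap ℂ A (q ^ rootForm n m i j ν) ^ s * (algebraMap ℂ A (q ^ rootForm n m i j k) * ζ i) ^ s
      - algebraMap ℂ A (q ^ (-rootForm n m i j ν)) ^ s *
        (algebraMap ℂ A (q ^ (-rootForm n m i j k)) * ζ j) ^ s := by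
  simp only [strWeight, rootForm_add, neg_add, zpow_add₀ hq0, map_mul, ← mul_pow]
  ring

namespace DiffOp

variable {n : ℕ} {h : ℂ} {m : ℕ}

open Classical in
/-- The left-hand side of a quasi-invariance condition. -/
def strSum (i j : Fin (n + 1)) (s : ℕ) (c : Fin (n + 1) → ℤ) : DiffOp n h m →+ CoeffField n h m where
  toFun P := (coeffs P).sum fun k a => if mergeIdx i j k = c then
    a * strWeight (Complex.exp h) n m (fieldPar n h m) i j s k else 0
  map_zero' := by simp
  map_add' P Q := by
    rw [map_add]
    refine Finsupp.sum_add_index' (h := fun k a => if mergeIdx i j k = c then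
      a * strWeight (Complex.exp h) n m (fieldPar n h m) i j s k else 0) (fun k => by simp)
      (fun k a b => ?_)
    split_ifs
    · ring
    · simp

/-- Quasi-invariance of the coefficients. -/
def IsQuasiInv (P : DiffOp n h m) : Prop :=
  QuasiInv (Complex.exp h) n m (fieldPar n h m) (coeffs P)

theorem isQuasiInv_iff {P : DiffOp n h m} : IsQuasiInv P ↔
    ∀ i j, i < j → ∀ s ∈ Finset.Icc 1 (rootMult n m j), ∀ c, strSum i j s c P = 0 := Iff.rfl

open Classical in
theorem strSum_term (i j : Fin (n + 1)) (s : ℕ) (c : Fin (n + 1) → ℤ) (a : CoeffField n h m)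
    (k : Fin (n + 1) → ℤ) : strSum i j s c (term a k) = if mergeIdx i j k = c then
      a * strWeight (Complex.exp h) n m (fieldPar n h m) i j s k else 0 := by
  change (coeffs (term a k)).sum (fun k a => if mergeIdx i j k = c then
    a * strWeight (Complex.exp h) n m (fieldPar n h m) i j s k else 0) = _
  rw [coeffs_term, Finsupp.sum_single_index]
  simp

theorem strSum_term_mul (i j : Fin (n + 1)) (s : ℕ) (c : Fin (n + 1) → ℤ) (a : CoeffField n h m)
    (ν : Fin (n + 1) → ℤ) (P : DiffOp n h m) : strSum i j s c (term a ν * P) =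
      a * (algebraMap ℂ _ (Complex.exp h ^ (-(latScale n m i * ν i + latScale n m j * ν j))) ^ s *
        (Multiplicative.ofAdd ν • strSum i j s (c - mergeIdx i j ν) P)) := by
  induction P using DiffOp.induction with
  | h0 => simp
  | hterm b k =>
    rw [term_mul_term, strSum_term, strSum_term, mergeIdx_add, strWeight_add]
    by_cases hc : mergeIdx i j ν + mergeIdx i j k = c
    · rw [if_pos hc, if_pos (by rw [← hc]; abel), smul_mul']; ring
    · rw [if_neg hc, if_neg fun h => hc (by rw [h]; abel)]; simp
  | hadd P Q hP hQ => rw [mul_add, map_add, map_add, hP, hQ, smul_add]; ring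

theorem IsQuasiInv.sub {P Q : DiffOp n h m} (hP : IsQuasiInv P) (hQ : IsQuasiInv Q) :
    IsQuasiInv (P - Q) := isQuasiInv_iff.2 fun i j hij s hs c => by
  rw [map_sub, isQuasiInv_iff.1 hP i j hij s hs, isQuasiInv_iff.1 hQ i j hij s hs, sub_zero]

theorem isQuasiInv_sum {ι : Type*} (t : Finset ι) {P : ι → DiffOp n h m}
    (hP : ∀ a ∈ t, IsQuasiInv (P a)) : IsQuasiInv (∑ a ∈ t, P a) :=
  isQuasiInv_iff.2 fun i j hij s hs c => by
    rw [map_sum]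
    exact Finset.sum_eq_zero fun a ha => isQuasiInv_iff.1 (hP a ha) i j hij s hs c

theorem IsQuasiInv.term_mul {P : DiffOp n h m} (hP : IsQuasiInv P) (a : CoeffField n h m)
    (ν : Fin (n + 1) → ℤ) : IsQuasiInv (term a ν * P) :=
  isQuasiInv_iff.2 fun i j hij s hs c => by
    rw [strSum_term_mul, isQuasiInv_iff.1 hP i j hij s hs]; simp

theorem IsQuasiInv.mul_left {P : DiffOp n h m} (hP : IsQuasiInv P) (A : DiffOp n h m) :
    IsQuasiInv (A * P) := by
  rw [sum_term_coeffs A, Finsupp.sum, Finset.sum_mul]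
  exact isQuasiInv_sum _ fun ν _ => hP.term_mul _ _

/-- The constant-coefficient operator `∑_{i<n} T_i^r + γ T_n^r`. -/
def powerOp (γ : ℂ) (r : ℕ) : DiffOp n h m :=
  ∑ a, term (algebraMap ℂ _ (if a = Fin.last n then γ else 1)) (Pi.single a (r : ℤ))

theorem mergeIdx_single_of_ne {i j a : Fin (n + 1)} (hj : a ≠ j) (r : ℤ) :
    mergeIdx i j (Pi.single a r) = Pi.single a r := by
  ext b
  simp only [mergeIdx]
  grind

theorem mergeIdx_single_right {i j : Fin (n + 1)} (hij : i ≠ j) (r : ℤ) :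
    mergeIdx i j (Pi.single j r) = Pi.single i r := by
  ext b
  simp only [mergeIdx]
  grind

/-- Right multiplication by shifts in a third variable moves one line to another. The shifts in the
variables `i` and `j` lead to the same line and multiply the two halves of the weight by two
scalars, and the condition survives if these scalars agree. For `j` below the last index this is
symmetry; for the last index it is exactly `γ [rm] = [r]`. -/
theorem strSum_mul_powerOp {i j : Fin (n + 1)} (hij : i < j) {s : ℕ}
    (hs : s ∈ Finset.Icc 1 (rootMult n m j)) {γ : ℂ} {r : ℕ}
    (hγ : γ * (Complex.exp h ^ (r * m : ℤ) - Complex.exp h ^ (-(r * m) : ℤ)) =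
      Complex.exp h ^ (r : ℤ) - Complex.exp h ^ (-r : ℤ))
    (c : Fin (n + 1) → ℤ) : ∃ u : ℂ, ∀ P : DiffOp n h m, strSum i j s c (P * powerOp γ r) =
      (∑ a ∈ (Finset.univ.erase i).erase j, algebraMap ℂ _ (if a = Fin.last n then γ else 1) *
        strSum i j s (c - Pi.single a (r : ℤ)) P) +
      algebraMap ℂ _ u * strSum i j s (c - Pi.single i (r : ℤ)) P := by
  have hq0 := Complex.exp_ne_zero h
  have hi : i ≠ Fin.last n := (hij.trans_le (Fin.le_last j)).ne
  have hdi : latScale n m i = 1 := if_neg hi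
  obtain ⟨δ, hδ⟩ : ∃ δ : ℂ, δ = if j = Fin.last n then γ else 1 := ⟨_, rfl⟩
  obtain ⟨u, hu, hu'⟩ : ∃ u : ℂ, u = (Complex.exp h ^ (r : ℤ)) ^ s + δ * (Complex.exp h ^ (-(latScale n m j * r))) ^ s ∧
      u = (Complex.exp h ^ (-(r : ℤ))) ^ s + δ * (Complex.exp h ^ (latScale n m j * r)) ^ s := by
    refine ⟨_, rfl, ?_⟩
    by_cases hj : j = Fin.last n
    -- A root through the last index has multiplicity one, so only `s = 1` occurs, and `hγ` is
    -- needed for no other power.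
    · obtain rfl : s = 1 := by simpa [rootMult, hj, Nat.le_antisymm_iff, and_comm] using hs
      simp only [hδ, latScale, if_pos hj, pow_one, mul_comm (m : ℤ)]
      linear_combination -hγ
    · simp only [hδ, latScale, if_neg hj, one_mul]
      ring
  refine ⟨u, fun P => ?_⟩
  induction P using DiffOp.induction with
  | h0 => simp
  | hadd P Q hP hQ =>
    simp only [add_mul, map_add, hP, hQ, mul_add, Finset.sum_add_distrib]
    ring
  | hterm b k =>
    have hsub : ∀ v : Fin (n + 1) → ℤ, mergeIdx i j k = c - v ↔ mergeIdx i j k + v = c :=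
      fun v => eq_sub_iff_add_eq
    rw [powerOp, Finset.mul_sum, map_sum, ← Finset.sum_erase_add _ _ (Finset.mem_univ i),
      ← Finset.sum_erase_add _ _ (Finset.mem_erase.2 ⟨hij.ne', Finset.mem_univ j⟩), add_assoc]
    simp only [term_mul_term, CoeffField.smul_const, strSum_term, mergeIdx_add, hsub]
    congr 1
    · refine Finset.sum_congr rfl fun a ha => ?_
      have haj : a ≠ j := (Finset.mem_erase.1 ha).1
      have hai : a ≠ i := (Finset.mem_erase.1 (Finset.mem_erase.1 ha).2).1
      rw [mergeIdx_single_of_ne haj, strWeight_add_const hq0]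
      have : rootForm n m i j (Pi.single a (r : ℤ)) = 0 := by
        simp [rootForm, hai.symm, haj.symm]
      simp only [this, neg_zero, zpow_zero, map_one, one_pow, one_mul, strWeight]
      by_cases hc : mergeIdx i j k + Pi.single a (r : ℤ) = c
      · rw [if_pos hc, if_pos hc]; ring
      · rw [if_neg hc, if_neg hc, mul_zero]
    · rw [mergeIdx_single_of_ne hij.ne, mergeIdx_single_right hij.ne, strWeight_add_const hq0,
        strWeight_add_const hq0]
      have h1 : rootForm n m i j (Pi.single i (r : ℤ)) = r := by
        simp [rootForm, hij.ne', hdi]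
      have h2 : rootForm n m i j (Pi.single j (r : ℤ)) = -(latScale n m j * r) := by
        simp [rootForm, hij.ne]
      by_cases hc : mergeIdx i j k + Pi.single i (r : ℤ) = c
      · have e1 := congrArg (algebraMap ℂ (CoeffField n h m)) hu
        have e2 := congrArg (algebraMap ℂ (CoeffField n h m)) hu'
        simp only [map_add, map_mul, map_pow] at e1 e2
        simp only [if_pos hc, h1, h2, neg_neg, if_neg hi, map_one, ← hδ, strWeight]
        linear_combination (-b * (algebraMap ℂ _ (Complex.exp h ^ rootForm n m i j k) * fieldPar n h m i) ^ s) *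
          e1 + (b * (algebraMap ℂ _ (Complex.exp h ^ (-rootForm n m i j k)) * fieldPar n h m j) ^ s) * e2
      · simp only [if_neg hc, add_zero, mul_zero]

theorem IsQuasiInv.mul_powerOp {P : DiffOp n h m} (hP : IsQuasiInv P) {γ : ℂ} {r : ℕ}
    (hγ : γ * (Complex.exp h ^ (r * m : ℤ) - Complex.exp h ^ (-(r * m) : ℤ)) =
      Complex.exp h ^ (r : ℤ) - Complex.exp h ^ (-r : ℤ)) : IsQuasiInv (P * powerOp γ r) :=
  isQuasiInv_iff.2 fun i j hij s hs c => by
    obtain ⟨u, hu⟩ := strSum_mul_powerOp hij hs hγ c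
    rw [hu, isQuasiInv_iff.1 hP i j hij s hs, mul_zero, add_zero]
    exact Finset.sum_eq_zero fun a _ => by rw [isQuasiInv_iff.1 hP i j hij s hs, mul_zero]

theorem IsQuasiInv.of_natCast_mul {P : DiffOp n h m} {s : ℕ} (hs : s ≠ 0)
    (hP : IsQuasiInv ((s : DiffOp n h m) * P)) : IsQuasiInv P := by
  have := hP.term_mul ((s : CoeffField n h m)⁻¹) 0
  rwa [natCast_eq, ← mul_assoc, term_mul_term, ofAdd_zero, one_smul, add_zero, inv_mul_cancel₀,
    ← one_eq, one_mul] at this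
  have : (algebraMap ℂ (CoeffField n h m) s) ≠ 0 := by
    rw [Ne, FaithfulSMul.algebraMap_eq_zero_iff]; exact_mod_cast hs
  simpa using this

end DiffOp

end

noncomputable section

open MvPolynomial

/-! ### Newton's identities -/

/-- The power sums attached to the elementary symmetric elements `e` by Newton's identities. -/
def newtonSeq {R : Type*} [Ring R] (e : ℕ → R) : ℕ → R
  | 0 => 0
  | s + 1 => (-1) ^ s * (((s + 1 : ℕ) : R) * e (s + 1) -
      ∑ i : Fin s, (-1) ^ (i : ℕ) * (e (s - i) * newtonSeq e (i + 1)))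

theorem sum_Icc_eq_fin {M : Type*} [AddCommMonoid M] (s : ℕ) (f : ℕ → M) :
    ∑ i ∈ Finset.Icc 1 s, f i = ∑ i : Fin s, f (i + 1) := by
  rw [Fin.sum_univ_eq_sum_range (fun i => f (i + 1)), Finset.range_eq_Ico,
    Finset.sum_Ico_add' f 0 s 1]
  exact Finset.sum_congr (by ext; simp) fun _ _ => rfl

theorem newtonSeq_succ {R : Type*} [Ring R] (e : ℕ → R) (s : ℕ) :
    newtonSeq e (s + 1) = (-1) ^ s * (((s + 1 : ℕ) : R) * e (s + 1) -
      ∑ i ∈ Finset.Icc 1 s, (-1) ^ (i + 1) * (e (s + 1 - i) * newtonSeq e i)) := by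
  rw [newtonSeq, sum_Icc_eq_fin]
  simp [pow_add]

theorem newton_identity {R : Type*} [Ring R] {e : ℕ → R} (he : e 0 = 1) (s : ℕ) :
    (s : R) * e s = ∑ i ∈ Finset.Icc 1 s, (-1) ^ (i + 1) * (e (s - i) * newtonSeq e i) := by
  cases s with
  | zero => simp
  | succ s =>
    rw [Finset.sum_Icc_succ_top (by omega), newtonSeq_succ]
    simp only [Nat.sub_self, he, one_mul, ← mul_assoc, ← pow_add]
    rw [show s + 1 + 1 + s = 2 * (s + 1) by ring, pow_mul]
    simp

/-- The coefficient of `p s` in the identity of degree `s` is a sign because `e 0 = 1`, so the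
identities determine `p` recursively. -/
theorem eq_newtonSeq {R : Type*} [Ring R] {e p : ℕ → R} (he : e 0 = 1)
    (h : ∀ s : ℕ, (s : R) * e s = ∑ i ∈ Finset.Icc 1 s, (-1) ^ (i + 1) * (e (s - i) * p i)) (s : ℕ)
    (hs : 1 ≤ s) : p s = newtonSeq e s := by
  induction s using Nat.strong_induction_on with
  | _ s ih =>
    obtain ⟨s, rfl⟩ : ∃ t, s = t + 1 := ⟨s - 1, by omega⟩
    rw [newtonSeq_succ, h, Finset.sum_Icc_succ_top (by omega),
      Finset.sum_congr rfl fun i hi => by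
        rw [ih i (by have := Finset.mem_Icc.1 hi; omega) (Finset.mem_Icc.1 hi).1],
      add_sub_cancel_left]
    simp only [Nat.sub_self, he, one_mul, ← mul_assoc, ← pow_add]
    rw [show s + (s + 1 + 1) = 2 * (s + 1) by ring, pow_mul]
    simp

/-- The recursion keeps the order of factors and has integer coefficients, so `P` can be moved
through it without any commutativity of the `E i`. -/
theorem newtonSeq_mul_eq {R : Type*} [Ring R] {E e : ℕ → R} {P : R} (s : ℕ)
    (h : ∀ i ≤ s, E i * P = P * e i) : newtonSeq E s * P = P * newtonSeq e s := by
  induction s using Nat.strong_induction_on with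
  | _ s ih =>
    cases s with
    | zero => simp [newtonSeq]
    | succ s =>
      have hc : ∀ i, Commute ((-1 : R) ^ i) P := fun i => (Commute.neg_one_left P).pow_left i
      have h1 : ((s + 1 : ℕ) : R) * E (s + 1) * P = P * (((s + 1 : ℕ) : R) * e (s + 1)) := by
        rw [mul_assoc, h _ le_rfl, ← mul_assoc, (Nat.cast_commute _ P).eq, mul_assoc]
      have h2 : (∑ i ∈ Finset.Icc 1 s, (-1) ^ (i + 1) * (E (s + 1 - i) * newtonSeq E i)) * P =
          P * ∑ i ∈ Finset.Icc 1 s, (-1) ^ (i + 1) * (e (s + 1 - i) * newtonSeq e i) := by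
        rw [Finset.sum_mul, Finset.mul_sum]
        refine Finset.sum_congr rfl fun i hi => ?_
        have := Finset.mem_Icc.1 hi
        rw [mul_assoc, mul_assoc, ih i (by omega) fun j hj => h j (by omega), ← mul_assoc _ P,
          h _ (by omega), ← mul_assoc P, ← (hc _).eq, mul_assoc, mul_assoc]
      rw [newtonSeq_succ, newtonSeq_succ, mul_assoc, sub_mul, h1, h2, ← mul_sub, ← mul_assoc,
        (hc s).eq, mul_assoc]

theorem map_newtonSeq {R S : Type*} [Ring R] [Ring S] (f : R →+* S) (e : ℕ → R) (s : ℕ) :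
    f (newtonSeq e s) = newtonSeq (fun i => f (e i)) s := by
  induction s using Nat.strong_induction_on with
  | _ s ih =>
    cases s with
    | zero => simp [newtonSeq]
    | succ s =>
      simp only [newtonSeq_succ, map_mul, map_sub, map_sum, map_pow, map_neg, map_one, map_natCast]
      congr 2
      refine Finset.sum_congr rfl fun i hi => ?_
      rw [ih i (by have := Finset.mem_Icc.1 hi; omega)]

/-- The sequence with `r c_r = ∑_{i=1}^r (-1)^{i-1} c_{r-i} γ_i` and `c_0 = 1`. -/
def symmSeq (γ : ℕ → ℂ) : ℕ → ℂ
  | 0 => 1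
  | r + 1 => ((r + 1 : ℕ) : ℂ)⁻¹ * ∑ i : Fin (r + 1), (-1) ^ (i : ℕ) * (symmSeq γ (r - i) * γ (i + 1))

theorem symmSeq_succ (γ : ℕ → ℂ) (r : ℕ) : symmSeq γ (r + 1) =
    ((r + 1 : ℕ) : ℂ)⁻¹ * ∑ i ∈ Finset.Icc 1 (r + 1), (-1) ^ (i + 1) * (symmSeq γ (r + 1 - i) * γ i) := by
  rw [symmSeq, sum_Icc_eq_fin]
  simp [pow_add]

theorem mul_symmSeq (γ : ℕ → ℂ) (r : ℕ) : (r : ℂ) * symmSeq γ r =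
    ∑ i ∈ Finset.Icc 1 r, (-1) ^ (i + 1) * (symmSeq γ (r - i) * γ i) := by
  cases r with
  | zero => simp
  | succ r => rw [symmSeq_succ, mul_inv_cancel_left₀ (by exact_mod_cast r.succ_ne_zero)]

theorem symmSeq_zero (γ : ℕ → ℂ) : symmSeq γ 0 = 1 := by rw [symmSeq]

theorem symmSeq_one (γ : ℕ → ℂ) : symmSeq γ 1 = γ 1 := by simp [symmSeq_succ, symmSeq_zero]

/-- These are the elementary symmetric functions of a single variable, with generating function `1 +
u`. -/
theorem symmSeq_of_one {γ : ℕ → ℂ} (hγ : ∀ i, 1 ≤ i → γ i = 1) (r : ℕ) (hr : 2 ≤ r) :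
    symmSeq γ r = 0 := by
  induction r using Nat.strong_induction_on with
  | _ r ih =>
    obtain ⟨r, rfl⟩ : ∃ t, r = t + 2 := ⟨r - 2, by omega⟩
    rw [symmSeq_succ, Finset.sum_Icc_succ_top (by omega), Finset.sum_Icc_succ_top (by omega),
      Finset.sum_eq_zero fun i hi => ?_]
    · simp [hγ, symmSeq_zero, symmSeq_one, pow_succ]
    · have := Finset.mem_Icc.1 hi
      rw [ih _ (by omega) (by omega)]; simp

open PowerSeries in
/-- Newton's identities for a product of generating functions. -/
theorem newton_convolution {R : Type*} [CommRing R] {a b p p' : ℕ → R}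
    (ha : ∀ s : ℕ, (s : R) * a s = ∑ i ∈ Finset.Icc 1 s, (-1) ^ (i + 1) * (a (s - i) * p i))
    (hb : ∀ s : ℕ, (s : R) * b s = ∑ i ∈ Finset.Icc 1 s, (-1) ^ (i + 1) * (b (s - i) * p' i)) (s : ℕ) :
    (s : R) * ∑ x ∈ Finset.HasAntidiagonal.antidiagonal s, a x.1 * b x.2 =
      ∑ i ∈ Finset.Icc 1 s, (-1) ^ (i + 1) *
        ((∑ x ∈ Finset.HasAntidiagonal.antidiagonal (s - i), a x.1 * b x.2) * (p i + p' i)) := by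
  -- In generating functions the identities state that the logarithmic derivative of `f` is the
  -- signed series of `g`; the logarithmic derivative of a product is a sum.
  have key : ∀ f g : ℕ → R,
      (∀ s : ℕ, (s : R) * f s = ∑ i ∈ Finset.Icc 1 s, (-1) ^ (i + 1) * (f (s - i) * g i)) ↔
      PowerSeries.X * d⁄dX R (PowerSeries.mk f) =
        PowerSeries.mk f * PowerSeries.mk fun i => if i = 0 then 0 else (-1) ^ (i + 1) * g i := by
    intro f g
    rw [PowerSeries.ext_iff]
    refine forall_congr' fun s => ?_
    have h1 : PowerSeries.coeff s (PowerSeries.X * d⁄dX R (PowerSeries.mk f)) = (s : R) * f s := by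
      cases s with
      | zero => simp
      | succ s => rw [PowerSeries.coeff_succ_X_mul, PowerSeries.coeff_derivative]; simp [mul_comm]
    have h2 : PowerSeries.coeff s (PowerSeries.mk f *
        PowerSeries.mk fun i => if i = 0 then 0 else (-1) ^ (i + 1) * g i) =
        ∑ i ∈ Finset.Icc 1 s, (-1) ^ (i + 1) * (f (s - i) * g i) := by
      rw [PowerSeries.coeff_mul, ← Finset.Nat.sum_antidiagonal_swap]
      simp only [Prod.fst_swap, Prod.snd_swap, PowerSeries.coeff_mk]
      rw [Finset.Nat.sum_antidiagonal_eq_sum_range_succ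
        (fun i j => f j * if i = 0 then 0 else (-1) ^ (i + 1) * g i), Finset.sum_range_succ',
        if_pos rfl, mul_zero, add_zero, sum_Icc_eq_fin,
        Fin.sum_univ_eq_sum_range (fun i => (-1) ^ (i + 1 + 1) * (f (s - (i + 1)) * g (i + 1)))]
      exact Finset.sum_congr rfl fun i _ => by rw [if_neg i.succ_ne_zero]; ring
    rw [h1, h2]
  have hab : PowerSeries.mk (fun s => ∑ x ∈ Finset.HasAntidiagonal.antidiagonal s, a x.1 * b x.2) =
      PowerSeries.mk a * PowerSeries.mk b := by
    ext s; simp [PowerSeries.coeff_mul]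
  refine (key (fun s => ∑ x ∈ Finset.HasAntidiagonal.antidiagonal s, a x.1 * b x.2)
    (fun i => p i + p' i)).2 ?_ s
  have e1 := (key a p).1 ha
  have e2 := (key b p').1 hb
  have e3 : (PowerSeries.mk fun i => if i = 0 then 0 else (-1) ^ (i + 1) * (p i + p' i)) =
      (PowerSeries.mk fun i => if i = 0 then 0 else (-1) ^ (i + 1) * p i) +
      PowerSeries.mk fun i => if i = 0 then 0 else (-1) ^ (i + 1) * p' i := by
    ext i
    simp only [PowerSeries.coeff_mk, map_add]
    split_ifs <;> ring
  rw [hab, Derivation.leibniz, e3, smul_eq_mul, smul_eq_mul]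
  linear_combination PowerSeries.mk b * e1 + PowerSeries.mk a * e2

variable {n : ℕ}

/-- The power sum `∑_{i<n} X_i^r + γ_r X_n^r`. -/
def powerPoly (n : ℕ) (γ : ℕ → ℂ) (r : ℕ) : MvPolynomial (Fin (n + 1)) ℂ :=
  rename Fin.castSucc (psum (Fin n) ℂ r) + C (γ r) * X (Fin.last n) ^ r

/-- The elementary symmetric polynomials attached to `powerPoly`. -/
def elemPoly (n : ℕ) (γ : ℕ → ℂ) (s : ℕ) : MvPolynomial (Fin (n + 1)) ℂ :=
  ∑ x ∈ Finset.HasAntidiagonal.antidiagonal s, rename Fin.castSucc (esymm (Fin n) ℂ x.1) *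
    (C (symmSeq γ x.2) * X (Fin.last n) ^ x.2)

theorem newton_elemPoly (γ : ℕ → ℂ) (s : ℕ) : (s : MvPolynomial (Fin (n + 1)) ℂ) * elemPoly n γ s =
    ∑ i ∈ Finset.Icc 1 s, (-1) ^ (i + 1) * (elemPoly n γ (s - i) * powerPoly n γ i) := by
  refine newton_convolution (a := fun j => rename Fin.castSucc (esymm (Fin n) ℂ j))
    (b := fun r => C (symmSeq γ r) * X (Fin.last n) ^ r)
    (p := fun r => rename Fin.castSucc (psum (Fin n) ℂ r))
    (p' := fun r => C (γ r) * X (Fin.last n) ^ r) (fun s => ?_) (fun s => ?_) s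
  · have := congrArg (rename (Fin.castSucc : Fin n → Fin (n + 1))) (mul_esymm_eq_sum (Fin n) ℂ s)
    rw [map_mul, map_natCast] at this
    rw [this, map_mul, map_sum, sum_Icc_eq_fin,
      Fin.sum_univ_eq_sum_range (fun i => (-1) ^ (i + 1 + 1) *
        (rename (Fin.castSucc : Fin n → Fin (n + 1)) (esymm (Fin n) ℂ (s - (i + 1))) *
          rename Fin.castSucc (psum (Fin n) ℂ (i + 1)))), Finset.mul_sum]
    refine Finset.sum_bij' (fun a _ => a.2 - 1) (fun i _ => (s - (i + 1), i + 1)) ?_ ?_ ?_ ?_ ?_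
    · intro a ha; simp at ha ⊢; omega
    · intro i hi; simp at hi ⊢; omega
    · intro a ha; simp at ha ⊢; ext <;> simp <;> omega
    · intro i hi; simp
    · rintro ⟨a, b⟩ ha
      simp only [Finset.mem_filter, Finset.HasAntidiagonal.mem_antidiagonal] at ha
      obtain ⟨b, rfl⟩ : ∃ b', b = b' + 1 := ⟨b - 1, by omega⟩
      obtain rfl : s = a + (b + 1) := by omega
      simp only [Nat.add_sub_cancel, map_mul, map_pow, map_neg, map_one, ← mul_assoc, ← pow_add]
      rw [show a + (b + 1) + 1 + a = 2 * a + (b + 1 + 1) by ring, pow_add, pow_mul]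
      simp
  · have := congrArg (C : ℂ →+* MvPolynomial (Fin (n + 1)) ℂ) (mul_symmSeq γ s)
    simp only [map_mul, map_natCast, map_sum, map_pow, map_neg, map_one] at this
    rw [← mul_assoc, this, Finset.sum_mul]
    refine Finset.sum_congr rfl fun i hi => ?_
    have e : s = (s - i) + i := by have := Finset.mem_Icc.1 hi; omega
    conv_lhs => rw [e, pow_add]
    simp only [Nat.add_sub_cancel]
    ring

theorem elemPoly_zero (γ : ℕ → ℂ) : elemPoly n γ 0 = 1 := by simp [elemPoly, symmSeq_zero]

/-- The exponent `∑_{i∈A} ε_i + r ε_n`. -/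
def shiftVec (A : Finset (Fin n)) (r : ℕ) : Fin (n + 1) → ℤ :=
  Fin.snoc (fun i => if i ∈ A then 1 else 0) (r : ℤ)

namespace DiffOp

variable {h m : ℂ}

theorem ofPoly_powerPoly (γ : ℕ → ℂ) (r : ℕ) :
    (ofPoly (powerPoly n γ r) : DiffOp n h m) =
      ∑ a, term (algebraMap ℂ _ (if a = Fin.last n then γ r else 1)) (Pi.single a (r : ℤ)) := by
  have hX : ∀ a (c : ℂ), (ofPoly (C c * X a ^ r) : DiffOp n h m) =
      term (algebraMap ℂ _ c) (Pi.single a (r : ℤ)) := by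
    intro a c
    rw [C_mul_X_pow_eq_monomial, ofPoly_C_mul_monomial]
    congr 1
    ext i
    by_cases hi : i = a
    · subst hi; simp
    · simp [hi]
  rw [Fin.sum_univ_castSucc, powerPoly, map_add, hX, psum, map_sum, map_sum]
  congr 1
  · refine Finset.sum_congr rfl fun i _ => ?_
    rw [if_neg (Fin.castSucc_lt_last i).ne, ← hX, map_pow, rename_X, C_1, one_mul]
  · rw [if_pos rfl]

theorem ofPoly_elemPoly (γ : ℕ → ℂ) (s : ℕ) :
    (ofPoly (elemPoly n γ s) : DiffOp n h m) =
      ∑ A ∈ Finset.univ.filter (fun A : Finset (Fin n) => A.card ≤ s),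
        term (algebraMap ℂ _ (symmSeq γ (s - A.card))) (shiftVec A (s - A.card)) := by
  have hX : ∀ (A : Finset (Fin n)) (r : ℕ) (c : ℂ),
      (ofPoly ((∏ i ∈ A, X i.castSucc) * (C c * X (Fin.last n) ^ r)) : DiffOp n h m) =
      term (algebraMap ℂ _ c) (shiftVec A r) := by
    intro A r c
    have : (∏ i ∈ A, X i.castSucc) * (C c * X (Fin.last n) ^ r) =
        (monomial (∑ i ∈ A, Finsupp.single i.castSucc 1 + Finsupp.single (Fin.last n) r) c :
          MvPolynomial (Fin (n + 1)) ℂ) := by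
      rw [C_mul_X_pow_eq_monomial, ← one_mul c, ← monomial_mul, monomial_sum_one, one_mul]; rfl
    rw [this, ofPoly_C_mul_monomial]
    congr 1
    ext i
    simp only [Finsupp.add_apply, Finsupp.finsetSum_apply, shiftVec]
    induction i using Fin.lastCases with
    | last => simp [(Fin.castSucc_lt_last _).ne]
    | cast i => simp [Finsupp.single_apply]
  rw [elemPoly, map_sum, Finset.Nat.sum_antidiagonal_eq_sum_range_succ
    (fun i j => (ofPoly (rename Fin.castSucc (esymm (Fin n) ℂ i) *
      (C (symmSeq γ j) * X (Fin.last n) ^ j)) : DiffOp n h m))]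
  rw [← Finset.sum_fiberwise_of_maps_to (g := Finset.card) (t := Finset.range (s + 1))
    (by intro A hA; simpa [Nat.lt_succ_iff] using hA)]
  refine Finset.sum_congr rfl fun k hk => ?_
  rw [esymm, map_sum, Finset.sum_mul, map_sum]
  have hk' : k ≤ s := by simpa [Nat.lt_succ_iff] using hk
  refine Finset.sum_congr ?_ fun A hA => ?_
  · ext A; simp [Finset.mem_powersetCard]; omega
  · simp only [Finset.mem_filter] at hA
    rw [map_prod, hA.2, ← hX]
    simp

end DiffOp

end

noncomputable section

/-! ### Corners of a union of translated zonotopes -/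

variable {n : ℕ}

/-- Weights for which the indices in `A` come first, then `n`, then the indices outside `A`. -/
def cornerWt (A : Finset (Fin n)) : Fin (n + 1) → ℝ :=
  Fin.snoc (fun i => if i ∈ A then (n : ℝ) - i else -((n : ℝ) - i)) 0

theorem abs_cornerWt (A : Finset (Fin n)) (j : Fin (n + 1)) : |cornerWt A j| = n - j := by
  induction j using Fin.lastCases with
  | last => simp [cornerWt]
  | cast i =>
    have : (i : ℝ) ≤ n := by exact_mod_cast i.is_lt.le
    simp only [cornerWt, Fin.snoc_castSucc, Fin.val_castSucc]
    split_ifs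
    · exact abs_of_nonneg (by linarith)
    · rw [abs_neg]; exact abs_of_nonneg (by linarith)

theorem cornerWt_lt_of_mem {A : Finset (Fin n)} {i : Fin n} (hi : i ∈ A) {j : Fin (n + 1)}
    (hij : i.castSucc < j) : cornerWt A j < cornerWt A i.castSucc := by
  have h1 := le_abs_self (cornerWt A j)
  rw [abs_cornerWt] at h1
  have h2 : cornerWt A i.castSucc = n - i := by simp [cornerWt, hi]
  have h3 : (i : ℝ) < j := by exact_mod_cast hij
  linarith

theorem cornerWt_lt_of_notMem {A : Finset (Fin n)} {i : Fin n} (hi : i ∉ A) {j : Fin (n + 1)}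
    (hij : i.castSucc < j) : cornerWt A i.castSucc < cornerWt A j := by
  have h1 := neg_abs_le (cornerWt A j)
  rw [abs_cornerWt] at h1
  have h2 : cornerWt A i.castSucc = -(n - i) := by simp [cornerWt, hi]
  have h3 : (i : ℝ) < j := by exact_mod_cast hij
  linarith

theorem cornerWt_lt_iff {A : Finset (Fin n)} {i : Fin n} {j : Fin (n + 1)}
    (hij : i.castSucc < j) : cornerWt A j < cornerWt A i.castSucc ↔ i ∈ A :=
  ⟨fun h => by_contra fun hi => (h.trans (cornerWt_lt_of_notMem hi hij)).false,
    fun hi => cornerWt_lt_of_mem hi hij⟩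

theorem exists_castSucc_of_lt {i j : Fin (n + 1)} (hij : i < j) : ∃ a : Fin n, a.castSucc = i :=
  Fin.exists_castSucc_eq.2 (hij.trans_le (Fin.le_last j)).ne

theorem cornerWt_injective (A : Finset (Fin n)) : Function.Injective (cornerWt A) := by
  have key : ∀ i j, i < j → cornerWt A i ≠ cornerWt A j := by
    intro i j hij
    obtain ⟨i, rfl⟩ := exists_castSucc_of_lt hij
    by_cases hi : i ∈ A
    · exact (cornerWt_lt_of_mem hi hij).ne'
    · exact (cornerWt_lt_of_notMem hi hij).ne
  intro i j h
  by_contra hne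
  rcases lt_or_gt_of_ne hne with hij | hij
  · exact key i j hij h
  · exact key j i hij h.symm

theorem wt_shiftVec (A B : Finset (Fin n)) (r : ℕ) :
    wt (cornerWt A) (shiftVec B r) =
      ∑ i : Fin n, if i ∈ B then cornerWt A i.castSucc else 0 := by
  rw [wt, Fin.sum_univ_castSucc]
  simp only [shiftVec, Fin.snoc_castSucc, Fin.snoc_last]
  have : cornerWt A (Fin.last n) = 0 := by simp [cornerWt]
  rw [this, zero_mul, add_zero]
  exact Finset.sum_congr rfl fun i _ => by split_ifs <;> simp

/-- The weights are positive on `A`, negative off `A` and zero at the last index, so the sum over a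
subset is largest only for `A`, whatever the power of the last shift. -/
theorem wt_shiftVec_lt {A B : Finset (Fin n)} (hAB : B ≠ A) (r r' : ℕ) :
    wt (cornerWt A) (shiftVec B r') < wt (cornerWt A) (shiftVec A r) := by
  have hlast : cornerWt A (Fin.last n) = 0 := by simp [cornerWt]
  have hpos : ∀ i ∈ A, 0 < cornerWt A i.castSucc := fun i hi => by
    have := cornerWt_lt_of_mem hi (Fin.castSucc_lt_last i); rwa [hlast] at this
  have hneg : ∀ i ∉ A, cornerWt A i.castSucc < 0 := fun i hi => by
    have := cornerWt_lt_of_notMem hi (Fin.castSucc_lt_last i); rwa [hlast] at this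
  obtain ⟨i, hi⟩ : ∃ i, ¬(i ∈ B ↔ i ∈ A) := by
    by_contra! h; exact hAB (Finset.ext h)
  rw [wt_shiftVec, wt_shiftVec]
  refine Finset.sum_lt_sum (fun i _ => ?_) ⟨i, Finset.mem_univ i, ?_⟩
  · by_cases hA : i ∈ A
    · have := hpos i hA
      split_ifs <;> simp [this.le]
    · have := hneg i hA
      split_ifs <;> simp [this.le]
  · by_cases hA : i ∈ A
    · have hB : i ∉ B := fun hB => hi (by simp [hA, hB])
      simpa [hA, hB] using hpos i hA
    · have hB : i ∈ B := by by_contra hB; exact hi (by simp [hA, hB])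
      simpa [hA, hB] using hneg i hA

/-- A set with wide strings in a union of translated zonotopes contains one of the corners. -/
theorem exists_corner {m : ℕ} (S : Finset (Fin (n + 1) → ℤ)) (hS : S.Nonempty)
    (𝒜 : Set (Finset (Fin n))) (r : Finset (Fin n) → ℕ)
    (hZ : ∀ k ∈ S, ∃ A ∈ 𝒜, k - shiftVec A (r A) ∈ zonotope n m)
    (hw : ∀ i j, i < j → HasWideStrings S i j (rootMult n m j)) :
    ∃ A ∈ 𝒜, vtx n m (cornerWt A) + shiftVec A (r A) ∈ S := by
  classical
  -- The coordinates are treated in increasing order. At stage `p` a nonempty part of `S` is kept on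
  -- which membership of the first `p` indices in `A` and all coefficients of roots starting at them
  -- are forced, while later strings remain wide.
  have main : ∀ p : ℕ, p ≤ n → ∃ A₀ : Finset (Fin n), ∃ S' ⊆ S, S'.Nonempty ∧
      (∀ i j : Fin (n + 1), p ≤ i → i < j → HasWideStrings S' i j (rootMult n m j)) ∧
      ∀ k ∈ S', ∀ A l, IsZonoRep n m l (k - shiftVec A (r A)) → ∀ i : Fin n, (i : ℕ) < p →
        (i ∈ A ↔ i ∈ A₀) ∧ ∀ j, i.castSucc < j →
          l i.castSucc j = if i ∈ A₀ then (rootMult n m j : ℝ) else 0 := by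
    intro p
    induction p with
    | zero => exact fun _ => ⟨∅, S, subset_rfl, hS, fun i j _ => hw i j, fun k _ A l _ i hi =>
        absurd hi (Nat.not_lt_zero _)⟩
    | succ p ih =>
      intro hp
      obtain ⟨A₀, S', hSS, hne, hws, hrep⟩ := ih (by omega)
      let i₀ : Fin n := ⟨p, hp⟩
      let I : Fin (n + 1) := i₀.castSucc
      -- `B` is what the coefficients already forced subtract from the coordinate `I`, and `M` is
      -- the most that roots starting at `I` can add; the shift adds one more if `i₀ ∈ A`.
      let B : ℤ := ∑ x : Fin n, if x < i₀ then (if x ∈ A₀ then (rootMult n m I : ℤ) else 0) else 0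
      let M : ℤ := ∑ x : Fin (n + 1), if I < x then (rootMult n m x : ℤ) else 0
      have hform : ∀ k ∈ S', ∀ A l, IsZonoRep n m l (k - shiftVec A (r A)) →
          (k I : ℝ) = (if i₀ ∈ A then 1 else 0) + (∑ x, if I < x then l I x else 0) - B := by
        intro k hk A l hl
        have h1 := hl.2 I
        rw [sum_rootVec l I, Finset.sum_sub_distrib] at h1
        have h2 : (∑ x, if x < I then l x I else 0) = B := by
          rw [Fin.sum_univ_castSucc, if_neg (Fin.le_last I).not_gt, add_zero]
          simp only [B, Int.cast_sum]
          refine Finset.sum_congr rfl fun x _ => ?_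
          by_cases hx : x < i₀
          · rw [if_pos (show x.castSucc < I from hx), if_pos hx,
              ((hrep k hk A l hl x hx).2 I hx)]
            split_ifs <;> simp
          · rw [if_neg (show ¬x.castSucc < I from hx), if_neg hx]; simp
        rw [h2] at h1
        have h3 : ((k - shiftVec A (r A)) I : ℤ) = k I - if i₀ ∈ A then 1 else 0 := by
          simp [shiftVec, I]
        rw [h3, Int.cast_sub] at h1
        have h4 : (((if i₀ ∈ A then 1 else 0 : ℤ)) : ℝ) = if i₀ ∈ A then 1 else 0 := by
          split_ifs <;> simp
        linarith
      have hle : ∀ A l k, IsZonoRep n m l (k - shiftVec A (r A)) → ∀ x ∈ Finset.univ,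
          (if I < x then l I x else 0) ≤ if I < x then (rootMult n m x : ℝ) else 0 := by
        intro A l k hl x _
        split_ifs with hx
        · exact (hl.1 I x hx).2
        · exact le_rfl
      have hge : ∀ A l k, IsZonoRep n m l (k - shiftVec A (r A)) → ∀ x ∈ Finset.univ,
          (0 : ℝ) ≤ if I < x then l I x else 0 := by
        intro A l k hl x _
        split_ifs with hx
        · exact (hl.1 I x hx).1
        · exact le_rfl
      have hM : (M : ℝ) = ∑ x : Fin (n + 1), if I < x then (rootMult n m x : ℝ) else 0 := by
        simp only [M, Int.cast_sum]
        exact Finset.sum_congr rfl fun x _ => by split_ifs <;> simp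
      have hslice : ∀ v : ℤ, ∀ i j : Fin (n + 1), p + 1 ≤ i → i < j →
          HasWideStrings (S'.filter fun k => k I = v) i j (rootMult n m j) := by
        intro v i j hi hij k hk
        obtain ⟨hk1, hk2⟩ := Finset.mem_filter.1 hk
        obtain ⟨t₁, t₂, h1, h2, h12⟩ := hws i j (by omega) hij k hk1
        have hIi : I < i := hi
        have hval : ∀ t : ℤ, (k + t • rootVec i j) I = v := fun t => by
          simp [rootVec_apply_of_ne hIi.ne (hIi.trans hij).ne, hk2]
        exact ⟨t₁, t₂, Finset.mem_filter.2 ⟨h1, hval _⟩, Finset.mem_filter.2 ⟨h2, hval _⟩, h12⟩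
      have hlast : ∀ i : Fin n, (i : ℕ) < p + 1 → i ≠ i₀ → (i : ℕ) < p := by
        intro i hi hne
        have : (i : ℕ) ≠ p := fun h => hne (Fin.ext h)
        omega
      -- The value `-B + M + 1` can be reached only if `i₀ ∈ A` and all coefficients at `I` are
      -- maximal.
      by_cases hcase : ∃ k ∈ S', k I = -B + M + 1
      · obtain ⟨k, hk, hkI⟩ := hcase
        refine ⟨insert i₀ A₀, S'.filter fun k => k I = -B + M + 1,
          (Finset.filter_subset _ _).trans hSS, ⟨k, Finset.mem_filter.2 ⟨hk, hkI⟩⟩, hslice _, ?_⟩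
        intro k hk A l hl i hi
        obtain ⟨hk1, hk2⟩ := Finset.mem_filter.1 hk
        by_cases hii : i = i₀
        · subst hii
          have h1 := hform k hk1 A l hl
          have h2 := Finset.sum_le_sum (hle A l k hl)
          have h3 : (k I : ℝ) = -B + M + 1 := by exact_mod_cast hk2
          rw [← hM] at h2
          by_cases hA : i₀ ∈ A
          · refine ⟨by simp [hA], fun j hj => ?_⟩
            rw [if_pos hA] at h1
            have h4 := (Finset.sum_eq_sum_iff_of_le (hle A l k hl)).1
              (by rw [← hM]; linarith) j (Finset.mem_univ j)
            rw [if_pos (show I < j from hj), if_pos (show I < j from hj)] at h4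
            simpa using h4
          · rw [if_neg hA] at h1
            linarith
        · have := hrep k hk1 A l hl i (hlast i hi hii)
          simpa [hii] using this
      · push Not at hcase
        -- Otherwise the coordinate is at most `-B + M`. Its range has width at least `M`, because
        -- the roots starting at `I` have distinct slopes in this pencil. So the value `-B` occurs,
        -- and it forces `i₀ ∉ A` and all coefficients at `I` to vanish.
        obtain ⟨a, ha, b, hb, hab⟩ := exists_width S' hne (fun k => (k I : ℝ))
          (wt fun a => if a = I then (0 : ℝ) else ((a : ℕ) : ℝ)) (fun j : Fin (n + 1) => ((j : ℕ) : ℝ))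
          (fun j => (rootMult n m j : ℝ)) (Finset.Ioi I)
          (fun i _ j _ hij => Fin.ext (Nat.cast_injective (R := ℝ) hij))
          (by
            intro j hj k hk
            have hIj : I < j := Finset.mem_Ioi.1 hj
            obtain ⟨t₁, t₂, h1, h2, h12⟩ := hws I j (le_refl p) hIj k hk
            have h12' : (rootMult n m j : ℝ) ≤ t₁ - t₂ := by exact_mod_cast h12
            have hκ : ∀ t : ℤ, ((k + t • rootVec I j) I : ℤ) = k I + t := fun t => by
              simp [rootVec_apply_left hIj.ne]
            have hcst : ∀ t : ℤ, ((j : ℕ) : ℝ) * ((k + t • rootVec I j) I : ℤ) +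
                wt (fun a => if a = I then (0 : ℝ) else ((a : ℕ) : ℝ)) (k + t • rootVec I j) =
                ((j : ℕ) : ℝ) * (k I : ℤ) +
                wt (fun a => if a = I then (0 : ℝ) else ((a : ℕ) : ℝ)) k := by
              intro t
              rw [hκ, wt_add, wt_zsmul, wt_rootVec, if_pos rfl, if_neg hIj.ne']
              push_cast; ring
            refine ⟨_, h1, _, h2, ?_, hcst _, hcst _⟩
            rw [hκ, hκ]; push_cast; linarith)
        have hab' : (a I : ℝ) - b I ≥ M := by
          rw [hM, ← Finset.sum_filter]
          convert hab using 2
          ext x; simp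
        have hbB : b I = -B := by
          obtain ⟨A, _, l, hl⟩ := hZ a (hSS ha)
          obtain ⟨A', _, l', hl'⟩ := hZ b (hSS hb)
          have h1 := hform a ha A l hl
          have h2 := Finset.sum_le_sum (hle A l a hl)
          rw [← hM] at h2
          have h3 : (a I : ℝ) ≤ ((-B + M + 1 : ℤ) : ℝ) := by
            push_cast
            split_ifs at h1 <;> linarith
          have h4 := lt_of_le_of_ne (Int.cast_le.1 h3) (hcase a ha)
          have h5 := hform b hb A' l' hl'
          have h6 := Finset.sum_nonneg (hge A' l' b hl')
          have h7 : ((-B : ℤ) : ℝ) ≤ b I := by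
            push_cast
            split_ifs at h5 <;> linarith
          have h8 := Int.cast_le.1 h7
          have h9 : a I - b I ≥ M := by exact_mod_cast hab'
          omega
        refine ⟨A₀.erase i₀, S'.filter fun k => k I = -B,
          (Finset.filter_subset _ _).trans hSS, ⟨b, Finset.mem_filter.2 ⟨hb, hbB⟩⟩, hslice _, ?_⟩
        intro k hk A l hl i hi
        obtain ⟨hk1, hk2⟩ := Finset.mem_filter.1 hk
        by_cases hii : i = i₀
        · subst hii
          have h1 := hform k hk1 A l hl
          have h2 := Finset.sum_nonneg (hge A l k hl)
          have h3 : (k I : ℝ) = -B := by exact_mod_cast hk2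
          by_cases hA : i₀ ∈ A
          · rw [if_pos hA] at h1
            linarith
          · refine ⟨by simp [hA], fun j hj => ?_⟩
            rw [if_neg hA] at h1
            have h4 := (Finset.sum_eq_zero_iff_of_nonneg (hge A l k hl)).1
              (by linarith) j (Finset.mem_univ j)
            rw [if_pos (show I < j from hj)] at h4
            simpa using h4
        · have := hrep k hk1 A l hl i (hlast i hi hii)
          simpa [hii] using this
  obtain ⟨A₀, S', hSS, ⟨k, hk⟩, -, hrep⟩ := main n le_rfl
  obtain ⟨A, hA, l, hl⟩ := hZ k (hSS hk)
  have hr := hrep k hk A l hl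
  obtain rfl : A = A₀ := Finset.ext fun i => (hr i i.is_lt).1
  refine ⟨A, hA, ?_⟩
  have hkv : k - shiftVec A (r A) = vtx n m (cornerWt A) := by
    ext a
    have : ((k - shiftVec A (r A)) a : ℝ) = vtx n m (cornerWt A) a := by
      rw [hl.2, (isZonoRep_vtx n m (cornerWt A)).2]
      refine Finset.sum_congr rfl fun i _ => Finset.sum_congr rfl fun j hj => ?_
      have hij : i < j := Finset.mem_Ioi.1 hj
      obtain ⟨i, rfl⟩ := exists_castSucc_of_lt hij
      rw [(hr i i.is_lt).2 j hij]
      simp only [cornerWt_lt_iff hij]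
    exact_mod_cast this
  rw [← hkv, sub_add_cancel]
  exact hSS hk

end

noncomputable section

open MvPolynomial

/-! ### The integrals at integer parameters -/

variable {n : ℕ}

section Products

theorem prod_pairs_castSucc {M : Type*} [CommMonoid M] (g : Fin (n + 1) → Fin (n + 1) → M) :
    ∏ i : Fin (n + 1), ∏ j ∈ Finset.Ioi i, g i j =
      ∏ a : Fin n, ((∏ b ∈ Finset.Ioi a, g a.castSucc b.castSucc) * g a.castSucc (Fin.last n)) := by
  rw [Fin.prod_univ_castSucc]
  have h0 : Finset.Ioi (Fin.last n) = ∅ := by ext x; simp [Fin.le_last]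
  rw [h0, Finset.prod_empty, mul_one]
  refine Finset.prod_congr rfl fun a _ => ?_
  rw [← Finset.filter_lt_eq_Ioi, Finset.prod_filter, Fin.prod_univ_castSucc,
    if_pos (Fin.castSucc_lt_last a), ← Finset.filter_lt_eq_Ioi, Finset.prod_filter]
  rfl

theorem prod_mul_swap {M : Type*} [CommMonoid M] (G : Fin n → Fin n → M) (hG : ∀ a, G a a = 1) :
    ∏ a, ∏ b ∈ Finset.Ioi a, (G a b * G b a) = ∏ a, ∏ b, G a b := by
  have h1 : ∀ a, ∏ b ∈ Finset.Ioi a, (G a b * G b a) =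
      (∏ b, if a < b then G a b else 1) * ∏ b, if a < b then G b a else 1 := by
    intro a
    rw [Finset.prod_mul_distrib, ← Finset.filter_lt_eq_Ioi, Finset.prod_filter, Finset.prod_filter]
  simp only [h1, Finset.prod_mul_distrib]
  rw [Finset.prod_comm (f := fun a b => if a < b then G b a else 1), ← Finset.prod_mul_distrib]
  refine Finset.prod_congr rfl fun a _ => ?_
  rw [← Finset.prod_mul_distrib]
  refine Finset.prod_congr rfl fun b _ => ?_
  rcases lt_trichotomy a b with h | h | h
  · simp [h, h.not_gt]
  · subst h; simp [hG]
  · simp [h, h.not_gt]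

end Products

/-- The coefficient `∏ [x_i-x_j-m]/[x_i-x_j] ⋯` of the shift by `A` and `r`, in terms of
`t = q ^ m` and of the squares `ξ` of the coordinates. -/
def cornerCoeff {L : Type*} [Field L] (q t : L) (ξ : Fin (n + 1) → L) (A : Finset (Fin n)) (r : ℕ) :
    L :=
  (∏ i ∈ A, ∏ j ∈ Aᶜ, (ξ i.castSucc - t ^ 2 * ξ j.castSucc) /
    (t * (ξ i.castSucc - ξ j.castSucc))) *
  ((∏ i ∈ A, t ^ r * (ξ i.castSucc - q * t * ξ (Fin.last n)) /
      (q * ξ i.castSucc - t ^ (2 * r + 1) * ξ (Fin.last n))) *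
    ∏ i ∈ Aᶜ, t ^ r * (ξ (Fin.last n) - q * t * ξ i.castSucc) /
      (t ^ (2 * r) * ξ (Fin.last n) - q * t * ξ i.castSucc))

theorem cornerCoeff_eq_prod {L : Type*} [Field L] (q t : L) (ξ : Fin (n + 1) → L)
    (A : Finset (Fin n)) (r : ℕ) : cornerCoeff q t ξ A r =
      ∏ a : Fin n, ((∏ b ∈ Finset.Ioi a,
        ((if a ∈ A ∧ b ∉ A then (ξ a.castSucc - t ^ 2 * ξ b.castSucc) /
            (t * (ξ a.castSucc - ξ b.castSucc)) else 1) *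
          (if b ∈ A ∧ a ∉ A then (ξ b.castSucc - t ^ 2 * ξ a.castSucc) /
            (t * (ξ b.castSucc - ξ a.castSucc)) else 1))) *
        if a ∈ A then t ^ r * (ξ a.castSucc - q * t * ξ (Fin.last n)) /
            (q * ξ a.castSucc - t ^ (2 * r + 1) * ξ (Fin.last n))
          else t ^ r * (ξ (Fin.last n) - q * t * ξ a.castSucc) /
            (t ^ (2 * r) * ξ (Fin.last n) - q * t * ξ a.castSucc)) := by
  rw [Finset.prod_mul_distrib, prod_mul_swap (fun a b => if a ∈ A ∧ b ∉ A then
    (ξ a.castSucc - t ^ 2 * ξ b.castSucc) / (t * (ξ a.castSucc - ξ b.castSucc)) else 1)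
    (fun a => by simp), cornerCoeff]
  congr 1
  · rw [← Finset.prod_subset (Finset.subset_univ A)]
    · refine Finset.prod_congr rfl fun a ha => ?_
      rw [← Finset.prod_subset (Finset.subset_univ Aᶜ)]
      · exact Finset.prod_congr rfl fun b hb => by rw [if_pos ⟨ha, by simpa using hb⟩]
      · intro b _ hb; rw [if_neg]; simp at hb; simp [hb]
    · intro a _ ha; simp [ha]
  · rw [Finset.prod_ite, Finset.filter_mem_eq_inter, Finset.univ_inter]
    congr 2
    ext a; simp

/-- Multiplying `y` by `q²` moves every factor one step, so the quotient of the two products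
telescopes to its end factors. -/
theorem prod_shift_mul {L : Type*} [CommRing L] (q x y : L) (N : ℕ) :
    (∏ l ∈ Finset.Icc 1 N, (q ^ (2 * l) * x - q ^ 2 * y)) * (q ^ (2 * N) * x - y) =
      q ^ (2 * N) * (x - y) * ∏ l ∈ Finset.Icc 1 N, (q ^ (2 * l) * x - y) := by
  induction N with
  | zero => simp
  | succ N ih =>
    rw [Finset.prod_Icc_succ_top (by omega), Finset.prod_Icc_succ_top (by omega)]
    linear_combination (q ^ 2 * (q ^ (2 * (N + 1)) * x - y)) * ih

namespace CoeffField

variable {h m : ℂ}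

theorem sub_ne_zero_of_ne {i j : Fin (n + 1)} (hij : i ≠ j) {c c' : ℂ} (hc : c ≠ 0) :
    (algebraMap ℂ (CoeffField n h m) c * var i ^ 2 - algebraMap ℂ _ c' * var j ^ 2) ≠ 0 := by
  have : algebraMap ℂ (CoeffField n h m) c * var i ^ 2 - algebraMap ℂ _ c' * var j ^ 2 =
      algebraMap (MvPolynomial (Fin (n + 1)) ℂ) _ (C c * X i ^ 2 - C c' * X j ^ 2) := by
    simp [← algebraMap_C, var]
  rw [this]
  intro h0
  have h1 := algebraMap_injective (h0.trans (map_zero _).symm)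
  have h2 := congrArg (eval fun x => if x = i then (1 : ℂ) else 0) h1
  simp [hij.symm, hc] at h2

end CoeffField

open CoeffField

section Corner

variable (n) (h : ℂ) (m : ℕ)

/-- The monomial `∏_{i<j} (X_i X_j)^{m_ij}`. -/
def pairMonomial : MvPolynomial (Fin (n + 1)) ℂ :=
  ∏ i : Fin (n + 1), ∏ j ∈ Finset.Ioi i, (X i * X j) ^ rootMult n m j

/-- The coefficient of the Baker–Akhiezer function at the vertex exposed by `c`, up to a factor
independent of `c`. -/
def vtxCoeff (c : Fin (n + 1) → ℝ) : CoeffField n h m :=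
  algebraMap (MvPolynomial (Fin (n + 1)) ℂ) _ (vtxProd (Complex.exp h) n m (sqVar n) c) /
    algebraMap _ _ (pairMonomial n m)

theorem pairMonomial_ne_zero : pairMonomial n m ≠ 0 :=
  Finset.prod_ne_zero_iff.2 fun _ _ => Finset.prod_ne_zero_iff.2 fun _ _ =>
    pow_ne_zero _ (mul_ne_zero (X_ne_zero _) (X_ne_zero _))

/-- `∏_{l=1}^{m_α} (q^{l(α,α)} ξ_b - ξ_a) / (X_a X_b)^{m_α}` for `α = ε_a - ε_b`. -/
def pairCoeff (N : ℕ) (e : ℕ) (a b : Fin (n + 1)) : CoeffField n h m :=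
  (∏ l ∈ Finset.Icc 1 N, (algebraMap ℂ _ (Complex.exp h) ^ (e * l) * var b ^ 2 - var a ^ 2)) /
    (var a * var b) ^ N

variable {n h m}

theorem vtxCoeff_eq (A : Finset (Fin n)) : vtxCoeff n h m (cornerWt A) =
    ∏ a : Fin n, ((∏ b ∈ Finset.Ioi a,
      if a ∈ A then pairCoeff n h m m 2 a.castSucc b.castSucc
        else pairCoeff n h m m 2 b.castSucc a.castSucc) *
      if a ∈ A then pairCoeff n h m 1 (m + 1) a.castSucc (Fin.last n)
        else pairCoeff n h m 1 (m + 1) (Fin.last n) a.castSucc) := by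
  rw [vtxCoeff, vtxProd, pairMonomial, map_prod, map_prod, ← Finset.prod_div_distrib]
  simp only [map_prod, ← Finset.prod_div_distrib]
  rw [prod_pairs_castSucc]
  have hz : ∀ (l : ℕ) (e : ℕ), ((algebraMap (MvPolynomial (Fin (n + 1)) ℂ) (CoeffField n h m))
      (algebraMap ℂ _ (Complex.exp h ^ ((l : ℤ) * e)))) =
      algebraMap ℂ _ (Complex.exp h) ^ (e * l) := by
    intro l e
    rw [← IsScalarTower.algebraMap_apply, ← map_pow, mul_comm e]
    norm_cast
  have hv : ∀ i, algebraMap (MvPolynomial (Fin (n + 1)) ℂ) (CoeffField n h m) (sqVar n i) =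
      var i ^ 2 := fun i => by rw [sqVar, map_pow]; rfl
  have hx : ∀ i, algebraMap (MvPolynomial (Fin (n + 1)) ℂ) (CoeffField n h m) (X i) = var i :=
    fun i => rfl
  refine Finset.prod_congr rfl fun a _ => congrArg₂ _ (Finset.prod_congr rfl fun b hb => ?_) ?_
  · have hab : a.castSucc < b.castSucc := Fin.castSucc_lt_castSucc_iff.2 (Finset.mem_Ioi.1 hb)
    have ha := (Fin.castSucc_lt_last a).ne
    have hb := (Fin.castSucc_lt_last b).ne
    have e2 : latScale n m a.castSucc + latScale n m b.castSucc = (2 : ℕ) := by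
      simp [latScale, ha, hb]
    simp only [cornerWt_lt_iff hab, apply_ite (algebraMap (MvPolynomial (Fin (n + 1)) ℂ)
      (CoeffField n h m)), posFac, negFac, pairCoeff, map_prod, map_sub, map_mul, map_pow, hv, hx,
      rootMult, if_neg hb, e2, hz]
    split_ifs
    · rfl
    · rw [mul_comm (var a.castSucc)]
  · have ha := (Fin.castSucc_lt_last a).ne
    have e2 : latScale n m a.castSucc + latScale n m (Fin.last n) = (m + 1 : ℕ) := by
      simp [latScale, add_comm]
    simp only [cornerWt_lt_iff (Fin.castSucc_lt_last a),
      apply_ite (algebraMap (MvPolynomial (Fin (n + 1)) ℂ)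
      (CoeffField n h m)), posFac, negFac, pairCoeff, map_prod, map_sub, map_mul, map_pow, hv, hx,
      rootMult, if_true, e2, hz]
    split_ifs
    · rfl
    · rw [mul_comm (var a.castSucc)]

/-- This identity is the reason for the form of `cornerCoeff`. Pair by pair, a pair of the first `n`
indices on the same side of `A` is only rescaled, numerator and denominator alike. A pair separated
by `A` telescopes by `prod_shift_mul`, and a pair with the last index has a single factor. -/
theorem cornerCoeff_mul_smul (A : Finset (Fin n)) (r : ℕ) :
    cornerCoeff (algebraMap ℂ _ (Complex.exp h)) (algebraMap ℂ _ (Complex.exp (h * m)))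
        (fun i => var i ^ 2) A r *
      (Multiplicative.ofAdd (shiftVec A r) • vtxCoeff n h m (cornerWt A)) =
      vtxCoeff n h m (cornerWt A) := by
  obtain ⟨σ, hσ⟩ : ∃ σ : CoeffField n h m →+* CoeffField n h m,
      ∀ x, Multiplicative.ofAdd (shiftVec A r) • x = σ x :=
    ⟨MulSemiringAction.toRingHom _ (CoeffField n h m) (Multiplicative.ofAdd (shiftVec A r)),
      fun _ => rfl⟩
  obtain ⟨Q, hQ⟩ : ∃ Q : CoeffField n h m, Q = algebraMap ℂ _ (Complex.exp h) := ⟨_, rfl⟩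
  have hQ0 : Q ≠ 0 := by rw [hQ]; simp
  have ht : algebraMap ℂ (CoeffField n h m) (Complex.exp (h * m)) = Q ^ m := by
    rw [hQ, ← map_pow, ← Complex.exp_nat_mul, mul_comm]
  have hσQ : σ Q = Q := by rw [hQ, ← hσ, smul_const]
  have hσv : ∀ a : Fin n, σ (var a.castSucc) = (if a ∈ A then Q else 1) * var a.castSucc := by
    intro a
    rw [← hσ, smul_var, shiftFactor_natCast, latScale, if_neg (Fin.castSucc_lt_last a).ne, shiftVec,
      Fin.snoc_castSucc]
    split_ifs <;> simp [hQ]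
  have hσl : σ (var (Fin.last n)) = Q ^ (m * r) * var (Fin.last n) := by
    rw [← hσ, smul_var, shiftFactor_natCast, latScale, if_pos rfl, shiftVec,
      Fin.snoc_last, hQ, ← map_pow]
    norm_cast
  have hne : ∀ {i j : Fin (n + 1)}, i ≠ j → ∀ u w : ℕ,
      (Q ^ u * var i ^ 2 - Q ^ w * var j ^ 2 : CoeffField n h m) ≠ 0 := by
    intro i j hij u w
    rw [hQ, ← map_pow, ← map_pow]
    exact sub_ne_zero_of_ne hij (pow_ne_zero _ (Complex.exp_ne_zero h))
  have hv0 : ∀ i, (var i : CoeffField n h m) ≠ 0 := var_ne_zero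
  rw [hσ, vtxCoeff_eq, cornerCoeff_eq_prod, map_prod, ← Finset.prod_mul_distrib, ht, ← hQ]
  -- the shift by `ε_a` for a single pair
  have hpair : ∀ a b : Fin n, a ≠ b → a ∈ A → b ∉ A →
      (var a.castSucc ^ 2 - (Q ^ m) ^ 2 * var b.castSucc ^ 2) /
        (Q ^ m * (var a.castSucc ^ 2 - var b.castSucc ^ 2)) *
        σ (pairCoeff n h m m 2 a.castSucc b.castSucc) =
      pairCoeff n h m m 2 a.castSucc b.castSucc := by
    intro a b hab ha hb
    have hab' : a.castSucc ≠ b.castSucc := fun h => hab (Fin.castSucc_injective n h)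
    have h1 := prod_shift_mul Q (var b.castSucc ^ 2) (var a.castSucc ^ 2 : CoeffField n h m) m
    have h2 := hne hab' 0 0
    simp only [pow_zero, one_mul] at h2
    simp only [pairCoeff, map_div₀, map_prod, map_sub, map_mul, map_pow, hσv, if_pos ha, if_neg hb,
      ← hQ, hσQ, one_mul, mul_pow]
    have h3 := hv0 a.castSucc
    have h4 := hv0 b.castSucc
    rw [div_mul_div_comm, div_eq_div_iff (by positivity) (by positivity)]
    rw [pow_mul'] at h1
    linear_combination (-(var a.castSucc) ^ m * (var b.castSucc) ^ m) * h1
  have hsame : ∀ a b : Fin n, (a ∈ A ↔ b ∈ A) →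
      σ (pairCoeff n h m m 2 a.castSucc b.castSucc) =
      pairCoeff n h m m 2 a.castSucc b.castSucc := by
    intro a b hab
    have h3 := hv0 a.castSucc
    have h4 := hv0 b.castSucc
    simp only [pairCoeff, map_div₀, map_prod, map_sub, map_mul, map_pow, hσv, ← hab,
      ← hQ, hσQ, mul_pow]
    split_ifs
    · simp only [mul_left_comm _ (Q ^ 2), ← mul_sub, Finset.prod_mul_distrib, Finset.prod_const,
        Nat.card_Icc]
      field_simp
      simp
      ring_nf
    · simp
  refine Finset.prod_congr rfl fun a _ => ?_
  rw [map_mul, map_prod, mul_mul_mul_comm, ← Finset.prod_mul_distrib]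
  refine congrArg₂ _ (Finset.prod_congr rfl fun b hb => ?_) ?_
  · have hab : a < b := Finset.mem_Ioi.1 hb
    by_cases ha : a ∈ A <;> by_cases hb : b ∈ A
    · simp only [ha, hb, not_true, and_false, if_false, if_true, one_mul]
      exact hsame a b (by simp [ha, hb])
    · simp only [ha, hb, not_false_eq_true, and_self, not_true, if_false, if_true, mul_one]
      exact hpair a b hab.ne ha hb
    · simp only [ha, hb, not_false_eq_true, and_self, not_true, if_false, if_true, one_mul]
      exact hpair b a hab.ne' hb ha
    · simp only [ha, hb, false_and, if_false, one_mul]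
      exact hsame b a (by simp [ha, hb])
  · have hla := (Fin.castSucc_lt_last a).ne
    have h3 := hv0 a.castSucc
    have h4 := hv0 (Fin.last n)
    split_ifs with ha
    · have h5 := hne hla 1 (m * (2 * r + 1))
      simp only [pairCoeff, map_div₀, map_sub, map_mul, map_pow, hσv, hσl, if_pos ha,
        ← hQ, hσQ, Finset.Icc_self, Finset.prod_singleton, mul_one, pow_one]
      rw [pow_one, pow_mul] at h5
      rw [div_mul_div_comm, div_eq_div_iff (mul_ne_zero h5 (by positivity)) (by positivity)]
      ring
    · have h5 := hne hla.symm (m * (2 * r)) (m + 1)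
      simp only [pairCoeff, map_div₀, map_sub, map_mul, map_pow, hσv, hσl, if_neg ha,
        ← hQ, hσQ, Finset.Icc_self, Finset.prod_singleton, mul_one, pow_one, one_mul]
      rw [pow_mul, pow_succ' Q m] at h5
      rw [div_mul_div_comm, div_eq_div_iff (mul_ne_zero h5 (by positivity)) (by positivity)]
      ring

end Corner

end

noncomputable section

open MvPolynomial CoeffField

/-! ### The integrals `E_s` and `D_s` -/

section

variable (n : ℕ) (h m : ℂ)

/-- The coefficients `[i] / [im]` of the deformed power sums. -/
def powerCoeff (h m : ℂ) (i : ℕ) : ℂ := qnum h i / qnum h (i * m)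

/-- The operator deforming the elementary symmetric polynomial of degree `s`. -/
def elemOp (s : ℕ) : DiffOp n h m :=
  ∑ A ∈ Finset.univ.filter (fun A : Finset (Fin n) => A.card ≤ s),
    DiffOp.term (algebraMap ℂ _ (symmSeq (powerCoeff h m) (s - A.card)) *
      cornerCoeff (algebraMap ℂ _ (Complex.exp h)) (algebraMap ℂ _ (Complex.exp (h * m)))
        (fun i => var i ^ 2) A (s - A.card)) (shiftVec A (s - A.card))

/-- The operator deforming the power sum of degree `s`. -/
def powerSumOp (s : ℕ) : DiffOp n h m := newtonSeq (elemOp n h m) s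

end

namespace DiffOp

variable {n : ℕ} {h : ℂ} {m : ℕ}

/-- The common properties of the Baker–Akhiezer function, as a formal series in the shifts. -/
structure IsBakerAkhiezer (P : DiffOp n h m) : Prop where
  quasiInv : IsQuasiInv P
  mem_zonotope : ∀ k, coeffs P k ≠ 0 → k ∈ zonotope n m
  coeff_vtx : ∀ A, coeffs P (vtx n m (cornerWt A)) = vtxCoeff n h m (cornerWt A)

theorem coeffs_elemOp_mul (P : DiffOp n h m) (s : ℕ) (k : Fin (n + 1) → ℤ) :
    coeffs (elemOp n h m s * P) k =
      ∑ A ∈ Finset.univ.filter (fun A : Finset (Fin n) => A.card ≤ s),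
        algebraMap ℂ _ (symmSeq (powerCoeff h m) (s - A.card)) *
        cornerCoeff (algebraMap ℂ _ (Complex.exp h)) (algebraMap ℂ _ (Complex.exp (h * m)))
          (fun i => var i ^ 2) A (s - A.card) *
        (Multiplicative.ofAdd (shiftVec A (s - A.card)) •
          coeffs P (k - shiftVec A (s - A.card))) := by
  rw [elemOp, Finset.sum_mul, map_sum, Finsupp.finsetSum_apply]
  exact Finset.sum_congr rfl fun A _ => coeffs_term_mul _ _ _ _

theorem coeffs_mul_elemPoly (P : DiffOp n h m) (γ : ℕ → ℂ) (s : ℕ) (k : Fin (n + 1) → ℤ) :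
    coeffs (P * ofPoly (elemPoly n γ s)) k =
      ∑ A ∈ Finset.univ.filter (fun A : Finset (Fin n) => A.card ≤ s),
        algebraMap ℂ _ (symmSeq γ (s - A.card)) * coeffs P (k - shiftVec A (s - A.card)) := by
  rw [ofPoly_elemPoly, Finset.mul_sum, map_sum, Finsupp.finsetSum_apply]
  exact Finset.sum_congr rfl fun A _ => coeffs_mul_const_term _ _ _ _

/-- By Newton's identities `s` times the elementary polynomial is a combination of products of lower
ones with power sums, and division by `s` is harmless. -/
theorem IsQuasiInv.mul_elemPoly {P : DiffOp n h m} (hP : IsQuasiInv P) {γ : ℕ → ℂ}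
    (hγ : ∀ r : ℕ, 0 < r → γ r * (Complex.exp h ^ (r * m : ℤ) - Complex.exp h ^ (-(r * m) : ℤ)) =
      Complex.exp h ^ (r : ℤ) - Complex.exp h ^ (-r : ℤ)) (s : ℕ) :
    IsQuasiInv (P * ofPoly (elemPoly n γ s)) := by
  induction s using Nat.strong_induction_on with
  | _ s ih =>
    rcases Nat.eq_zero_or_pos s with rfl | hs
    · simpa [elemPoly_zero] using hP
    refine IsQuasiInv.of_natCast_mul hs.ne' ?_
    have := congrArg (fun f => P * (ofPoly f : DiffOp n h m)) (newton_elemPoly (n := n) γ s)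
    simp only [map_mul, map_natCast, map_sum, map_pow, map_neg, map_one] at this
    rw [← mul_assoc, (Nat.cast_commute s P).eq, mul_assoc, this, Finset.mul_sum]
    refine isQuasiInv_sum _ fun i hi => ?_
    have hi' := Finset.mem_Icc.1 hi
    have hc : Commute P ((-1) ^ (i + 1)) := (Commute.neg_one_right P).pow_right _
    rw [← mul_assoc, hc.eq, mul_assoc, ← mul_assoc P, ofPoly_powerPoly]
    exact ((ih (s - i) (by omega)).mul_powerOp (hγ i (by omega))).mul_left _

variable {P : DiffOp n h m}

/-- The difference of the two sides is quasi-invariant and supported in the zonotopes translated by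
the shifts that occur. If it is nonzero, `exists_corner` provides a corner in its support. Only the
translate belonging to `A` reaches that corner, and its contribution cancels by
`cornerCoeff_mul_smul`. -/
theorem IsBakerAkhiezer.elemOp_mul (hP : IsBakerAkhiezer P) (hm : 0 < m)
    (hq : ∀ k : ℕ, 0 < k → Complex.exp h ^ k ≠ 1)
    (hγ : ∀ r : ℕ, 0 < r → powerCoeff h m r *
      (Complex.exp h ^ (r * m : ℤ) - Complex.exp h ^ (-(r * m) : ℤ)) =
      Complex.exp h ^ (r : ℤ) - Complex.exp h ^ (-r : ℤ)) (s : ℕ) :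
    elemOp n h m s * P = P * ofPoly (elemPoly n (powerCoeff h m) s) := by
  classical
  by_contra hne
  let R : DiffOp n h m := elemOp n h m s * P - P * ofPoly (elemPoly n (powerCoeff h m) s)
  have hR : coeffs R ≠ 0 := fun h0 =>
    hne (sub_eq_zero.1 (coeffs_injective (h0.trans (map_zero _).symm)))
  have hQ : QuasiInv (Complex.exp h) n m (fieldPar n h m) (coeffs R) :=
    (hP.quasiInv.mul_left _).sub (hP.quasiInv.mul_elemPoly hγ s)
  have hg : ∀ i j, i < j → GenericPair (Complex.exp h) (fieldPar n h m) i j := by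
    intro i j hij a h0
    refine (genericPair_shiftedPar (m := m) (Complex.exp_ne_zero h)).2 (genericPair_sqVar _ hij.ne) a
      (algebraMap_injective (h := h) (m := m) ?_)
    rw [map_mul, ← IsScalarTower.algebraMap_apply]
    exact h0
  have hcoef : ∀ k, coeffs R k =
      ∑ A ∈ Finset.univ.filter (fun A : Finset (Fin n) => A.card ≤ s),
        algebraMap ℂ (CoeffField n h m) (symmSeq (powerCoeff h m) (s - A.card)) *
        (cornerCoeff (algebraMap ℂ _ (Complex.exp h)) (algebraMap ℂ _ (Complex.exp (h * m)))
          (fun i => var i ^ 2) A (s - A.card) *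
        (Multiplicative.ofAdd (shiftVec A (s - A.card)) •
          coeffs P (k - shiftVec A (s - A.card))) - coeffs P (k - shiftVec A (s - A.card))) := by
    intro k
    simp only [R, map_sub, Finsupp.sub_apply, coeffs_elemOp_mul, coeffs_mul_elemPoly,
      ← Finset.sum_sub_distrib]
    exact Finset.sum_congr rfl fun A _ => by ring
  obtain ⟨A, hA, hmem⟩ := exists_corner (coeffs R).support (Finsupp.support_nonempty_iff.2 hR)
    {A | A.card ≤ s} (fun A => s - A.card)
    (by
      intro k hk
      rw [Finsupp.mem_support_iff, hcoef] at hk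
      obtain ⟨A, hA, hne⟩ := Finset.exists_ne_zero_of_sum_ne_zero hk
      refine ⟨A, by simpa using hA, hP.mem_zonotope _ fun h0 => hne ?_⟩
      rw [h0]; simp)
    (fun i j hij => hQ.hasWideStrings (Complex.exp_ne_zero h) hq hm hij (hg i j hij))
  rw [Finsupp.mem_support_iff, hcoef] at hmem
  refine hmem (Finset.sum_eq_zero fun B _ => ?_)
  by_cases hBA : B = A
  · subst hBA
    rw [add_sub_cancel_right, hP.coeff_vtx, cornerCoeff_mul_smul, sub_self, mul_zero]
  -- For another subset `B` the translated zonotope stays strictly below the corner with respect to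
  -- `cornerWt A`.
  · have : coeffs P (vtx n m (cornerWt A) + shiftVec A (s - A.card) -
        shiftVec B (s - B.card)) = 0 := by
      by_contra h0
      obtain ⟨l, hl⟩ := hP.mem_zonotope _ h0
      have h1 := hl.wt_le (cornerWt A)
      have h2 : wt (cornerWt A) (vtx n m (cornerWt A) + shiftVec A (s - A.card)) =
          wt (cornerWt A) (vtx n m (cornerWt A) + shiftVec A (s - A.card) -
            shiftVec B (s - B.card)) + wt (cornerWt A) (shiftVec B (s - B.card)) := by
        rw [← wt_add, sub_add_cancel]
      rw [wt_add, wt_vtx_self] at h2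
      have h3 := wt_shiftVec_lt hBA (s - A.card) (s - B.card)
      linarith
    rw [this]; simp

theorem qnum_natCast (h : ℂ) (a : ℕ) :
    qnum h a = Complex.exp h ^ (a : ℤ) - Complex.exp h ^ (-a : ℤ) := by
  rw [qnum, ← Complex.exp_int_mul, ← Complex.exp_int_mul]
  push_cast
  congr 2 <;> ring

theorem qnum_natCast_ne_zero (hq : ∀ k : ℕ, 0 < k → Complex.exp h ^ k ≠ 1) {a : ℕ} (ha : 0 < a) :
    qnum h a ≠ 0 := by
  rw [qnum_natCast, sub_ne_zero]
  intro h0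
  have := zpow_injective_of_pow_ne_one (Complex.exp_ne_zero h) hq h0
  omega

theorem powerCoeff_mul (hq : ∀ k : ℕ, 0 < k → Complex.exp h ^ k ≠ 1) (hm : 0 < m) (r : ℕ)
    (hr : 0 < r) : powerCoeff h m r *
      (Complex.exp h ^ (r * m : ℤ) - Complex.exp h ^ (-(r * m) : ℤ)) =
      Complex.exp h ^ (r : ℤ) - Complex.exp h ^ (-r : ℤ) := by
  have h1 := qnum_natCast_ne_zero hq (Nat.mul_pos hr hm)
  have h2 := qnum_natCast h (r * m)
  push_cast at h1 h2
  rw [powerCoeff, ← h2, div_mul_cancel₀ _ h1, qnum_natCast]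

/-- The recursion defining the operators is the one that recovers power sums from elementary
polynomials, and `P` intertwines the two recursions. -/
theorem IsBakerAkhiezer.powerSumOp_mul (hP : IsBakerAkhiezer P) (hm : 0 < m)
    (hq : ∀ k : ℕ, 0 < k → Complex.exp h ^ k ≠ 1) {s : ℕ} (hs : 1 ≤ s) :
    powerSumOp n h m s * P = P * ofPoly (powerPoly n (powerCoeff h m) s) := by
  rw [powerSumOp, newtonSeq_mul_eq s fun i _ => hP.elemOp_mul hm hq (powerCoeff_mul hq hm) i,
    ← map_newtonSeq, ← eq_newtonSeq (elemPoly_zero _) (newton_elemPoly _) s hs]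

theorem IsBakerAkhiezer.ne_zero (hP : IsBakerAkhiezer P) : P ≠ 0 := by
  intro h0
  have h1 := hP.coeff_vtx ∅
  rw [h0, map_zero, Finsupp.coe_zero, Pi.zero_apply, vtxCoeff, eq_comm, div_eq_zero_iff] at h1
  have h2 : vtxProd (Complex.exp h) n m (sqVar n) (cornerWt ∅) ≠ 0 := by
    refine Finset.prod_ne_zero_iff.2 fun i _ => Finset.prod_ne_zero_iff.2 fun j hj => ?_
    have hij : i ≠ j := (Finset.mem_Ioi.1 hj).ne
    split_ifs
    · exact posFac_ne_zero (genericPair_sqVar _ hij)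
    · exact Finset.prod_ne_zero_iff.2 fun l _ h0 =>
        genericPair_sqVar (Complex.exp h) hij.symm _ (sub_eq_zero.1 h0).symm
  rcases h1 with h1 | h1
  · exact h2 (algebraMap_injective (h1.trans (map_zero _).symm))
  · exact pairMonomial_ne_zero n m (algebraMap_injective (h1.trans (map_zero _).symm))

/-- Operators with the same formal eigenfunction commute. -/
theorem IsBakerAkhiezer.commute (hP : IsBakerAkhiezer P) {A B : DiffOp n h m}
    {f g : MvPolynomial (Fin (n + 1)) ℂ} (hA : A * P = P * ofPoly f) (hB : B * P = P * ofPoly g) :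
    Commute A B := by
  by_contra hne
  refine mul_ne_zero' (sub_ne_zero.2 hne) hP.ne_zero ?_
  rw [sub_mul, mul_assoc, mul_assoc, hA, hB, ← mul_assoc, ← mul_assoc, hA, hB, mul_assoc, mul_assoc,
    (commute_ofPoly f g).eq, sub_self]

theorem coeffs_surjective : Function.Surjective
    (coeffs : DiffOp n h m →+ ((Fin (n + 1) → ℤ) →₀ CoeffField n h m)) := by
  intro F
  refine ⟨F.sum fun ν a => term a ν, ?_⟩
  rw [Finsupp.sum, map_sum]
  simp only [coeffs_term]
  exact F.sum_single

theorem exists_isBakerAkhiezer (hq : ∀ k : ℕ, 0 < k → Complex.exp h ^ k ≠ 1) (hm : 0 < m) :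
    ∃ (P : DiffOp n h m) (F : (Fin (n + 1) → ℤ) →₀ MvPolynomial (Fin (n + 1)) ℂ),
      IsBakerAkhiezer P ∧
      QuasiInv (Complex.exp h) n m (shiftedPar (Complex.exp h) n m (sqVar n)) F ∧
      (∀ k ∈ F.support, k ∈ zonotope n m) ∧
      (∀ c : Fin (n + 1) → ℝ, Function.Injective c →
        F (vtx n m c) = vtxProd (Complex.exp h) n m (sqVar n) c) ∧
      ∀ k, coeffs P k =
        algebraMap (MvPolynomial (Fin (n + 1)) ℂ) (CoeffField n h m) (F k) /
          algebraMap _ _ (pairMonomial n m) := by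
  obtain ⟨F, h1, h2, h3⟩ := exists_primitive (n := n) (Complex.exp_ne_zero h) hq hm
  let f : MvPolynomial (Fin (n + 1)) ℂ →ₐ[ℂ] CoeffField n h m :=
    IsScalarTower.toAlgHom ℂ (MvPolynomial (Fin (n + 1)) ℂ) (CoeffField n h m)
  obtain ⟨P, hP⟩ := coeffs_surjective (n := n) (h := h) (m := m)
    ((algebraMap (MvPolynomial (Fin (n + 1)) ℂ) (CoeffField n h m) (pairMonomial n m))⁻¹ • F.mapRange f (map_zero f))
  have hk : ∀ k, coeffs P k =
      algebraMap (MvPolynomial (Fin (n + 1)) ℂ) (CoeffField n h m) (F k) /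
        algebraMap _ _ (pairMonomial n m) := by
    intro k
    rw [hP, div_eq_inv_mul]
    rfl
  refine ⟨P, F, ⟨?_, fun k hk0 => h2 k ?_, fun A => ?_⟩, h1, h2, h3, hk⟩
  · rw [IsQuasiInv, hP]
    exact (quasiInv_map f h1).smul _
  · rw [Finsupp.mem_support_iff]
    rintro h0
    exact hk0 (by rw [hk, h0]; simp)
  · rw [hk, h3 _ (cornerWt_injective A), vtxCoeff]

end DiffOp

end

noncomputable section

open MvPolynomial CoeffField

/-! ### Rational dependence on the parameter -/

section Rational

variable {n : ℕ} {h : ℂ}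

/-- Substitution `t = q ^ m` with values in the coefficient field. -/
def paramHom (n : ℕ) (h m : ℂ) :
    MvPolynomial (Fin (n + 1)) (Polynomial ℂ) →+* CoeffField n h m :=
  (algebraMap (MvPolynomial (Fin (n + 1)) ℂ) (CoeffField n h m)).comp
    (MvPolynomial.map (Polynomial.evalRingHom (Complex.exp (h * m))))

theorem paramHom_apply (m : ℂ) (p : MvPolynomial (Fin (n + 1)) (Polynomial ℂ)) :
    paramHom n h m p = algebraMap _ _ (DiffOpFamily.substParam h m p) := rfl

theorem paramHom_eq_zero {m : ℂ} {p : MvPolynomial (Fin (n + 1)) (Polynomial ℂ)} :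
    paramHom n h m p = 0 ↔ DiffOpFamily.substParam h m p = 0 := by
  rw [paramHom_apply]
  exact ⟨fun h0 => algebraMap_injective (h0.trans (map_zero _).symm), fun h0 => by rw [h0, map_zero]⟩

/-- `a m` is a rational function of `X` and `t = q ^ m`, regular for `m ∈ U`. -/
def IsRat (U : Set ℂ) (a : ∀ m : ℂ, CoeffField n h m) : Prop :=
  ∃ p d, ∀ m ∈ U, paramHom n h m d ≠ 0 ∧ a m = paramHom n h m p / paramHom n h m d

variable {U : Set ℂ} {a b : ∀ m : ℂ, CoeffField n h m}

theorem isRat_param (p : MvPolynomial (Fin (n + 1)) (Polynomial ℂ)) :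
    IsRat U fun m => paramHom n h m p :=
  ⟨p, 1, fun m _ => by rw [map_one, div_one]; exact ⟨one_ne_zero, rfl⟩⟩

theorem IsRat.congr (ha : IsRat U a) (hab : ∀ m ∈ U, b m = a m) : IsRat U b := by
  obtain ⟨p, d, hpd⟩ := ha
  exact ⟨p, d, fun m hm => ⟨(hpd m hm).1, (hab m hm).trans (hpd m hm).2⟩⟩

theorem isRat_const (c : ℂ) : IsRat (n := n) (h := h) U fun _ => algebraMap ℂ _ c :=
  (isRat_param (C (Polynomial.C c))).congr fun m _ => by simp [paramHom, algebraMap_C]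

theorem isRat_one : IsRat (n := n) (h := h) U fun _ => 1 :=
  (isRat_const 1).congr fun _ _ => (map_one _).symm

theorem isRat_var (i : Fin (n + 1)) : IsRat (n := n) (h := h) U fun _ => var i :=
  (isRat_param (X i)).congr fun m _ => by simp [paramHom, var]

theorem isRat_t : IsRat (n := n) (h := h) U fun m => algebraMap ℂ _ (Complex.exp (h * m)) :=
  (isRat_param (C Polynomial.X)).congr fun m _ => by simp [paramHom, algebraMap_C]

theorem IsRat.add (ha : IsRat U a) (hb : IsRat U b) : IsRat U fun m => a m + b m := by
  obtain ⟨p, d, hpd⟩ := ha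
  obtain ⟨p', d', hpd'⟩ := hb
  refine ⟨p * d' + d * p', d * d', fun m hm => ?_⟩
  obtain ⟨h1, h2⟩ := hpd m hm
  obtain ⟨h3, h4⟩ := hpd' m hm
  beta_reduce
  rw [h2, h4, div_add_div _ _ h1 h3]
  rw [map_mul, map_add, map_mul, map_mul]
  exact ⟨mul_ne_zero h1 h3, rfl⟩

theorem IsRat.mul (ha : IsRat U a) (hb : IsRat U b) : IsRat U fun m => a m * b m := by
  obtain ⟨p, d, hpd⟩ := ha
  obtain ⟨p', d', hpd'⟩ := hb
  refine ⟨p * p', d * d', fun m hm => ?_⟩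
  obtain ⟨h1, h2⟩ := hpd m hm
  obtain ⟨h3, h4⟩ := hpd' m hm
  beta_reduce
  rw [h2, h4, div_mul_div_comm]
  rw [map_mul, map_mul]
  exact ⟨mul_ne_zero h1 h3, rfl⟩

theorem IsRat.inv (ha : IsRat U a) (h0 : ∀ m ∈ U, a m ≠ 0) : IsRat U fun m => (a m)⁻¹ := by
  obtain ⟨p, d, hpd⟩ := ha
  refine ⟨d, p, fun m hm => ?_⟩
  obtain ⟨h1, h2⟩ := hpd m hm
  have h3 := h0 m hm
  rw [h2] at h3
  refine ⟨fun h4 => h3 (by rw [h4, zero_div]), ?_⟩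
  beta_reduce
  rw [h2, inv_div]

theorem IsRat.div (ha : IsRat U a) (hb : IsRat U b) (h0 : ∀ m ∈ U, b m ≠ 0) :
    IsRat U fun m => a m / b m := by
  simpa only [div_eq_mul_inv] using ha.mul (hb.inv h0)

theorem IsRat.sub (ha : IsRat U a) (hb : IsRat U b) : IsRat U fun m => a m - b m :=
  (ha.add ((isRat_const (-1)).mul hb)).congr fun m _ => by simp [sub_eq_add_neg]

theorem IsRat.pow (ha : IsRat U a) (k : ℕ) : IsRat U fun m => a m ^ k := by
  induction k with
  | zero => simpa using isRat_one
  | succ k ih => simpa only [pow_succ] using ih.mul ha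

theorem isRat_prod {ι : Type*} (s : Finset ι) {f : ι → ∀ m : ℂ, CoeffField n h m}
    (hf : ∀ i ∈ s, IsRat U (f i)) : IsRat U fun m => ∏ i ∈ s, f i m := by
  classical
  induction s using Finset.induction_on with
  | empty => simpa using isRat_one
  | insert i s hi ih =>
    simp only [Finset.prod_insert hi]
    exact (hf i (by simp)).mul (ih fun j hj => hf j (by simp [hj]))

theorem isRat_sum {ι : Type*} (s : Finset ι) {f : ι → ∀ m : ℂ, CoeffField n h m}
    (hf : ∀ i ∈ s, IsRat U (f i)) : IsRat U fun m => ∑ i ∈ s, f i m := by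
  classical
  induction s using Finset.induction_on with
  | empty => exact (isRat_const 0).congr fun m _ => by simp
  | insert i s hi ih =>
    simp only [Finset.sum_insert hi]
    exact (hf i (by simp)).add (ih fun j hj => hf j (by simp [hj]))

theorem isRat_t_zpow (k : ℤ) :
    IsRat (n := n) (h := h) U fun m => algebraMap ℂ _ (Complex.exp (h * m) ^ k) := by
  obtain ⟨k, rfl | rfl⟩ := k.eq_nat_or_neg
  · exact (isRat_t.pow k).congr fun m _ => by simp
  · exact ((isRat_t.pow k).inv fun m _ => by simp).congr fun m _ => by simp

theorem isRat_smul_param (ν : Fin (n + 1) → ℤ) (p : MvPolynomial (Fin (n + 1)) (Polynomial ℂ)) :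
    IsRat (n := n) (h := h) U fun m => Multiplicative.ofAdd ν • paramHom n h m p := by
  induction p using MvPolynomial.induction_on with
  | C c =>
    refine (isRat_param (C c)).congr fun m _ => ?_
    simp only [paramHom, RingHom.comp_apply, map_C, algebraMap_C, smul_const]
  | add p q hp hq => simpa only [map_add, smul_add] using hp.add hq
  | mul_X p i hp =>
    simp only [map_mul, smul_mul']
    refine hp.mul ?_
    have hX : ∀ m, paramHom n h m (X i) = var i := fun m => by simp [paramHom, var]
    simp only [hX, smul_var]
    refine IsRat.mul ?_ (isRat_var i)
    by_cases hi : i = Fin.last n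
    · refine (isRat_t_zpow (ν i)).congr fun m _ => ?_
      rw [shiftFactor, if_pos hi, ← Complex.exp_int_mul, mul_comm (ν i : ℂ)]
    · refine (isRat_const (Complex.exp (h * 1 * ν i))).congr fun m _ => ?_
      rw [shiftFactor, if_neg hi]

theorem IsRat.smul (ha : IsRat U a) (ν : Fin (n + 1) → ℤ) :
    IsRat U fun m => Multiplicative.ofAdd ν • a m := by
  obtain ⟨p, d, hpd⟩ := ha
  refine ((isRat_smul_param ν p).div (isRat_smul_param ν d) fun m hm => ?_).congr fun m hm => ?_
  · exact (smul_ne_zero_iff_ne _).2 (hpd m hm).1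
  · rw [(hpd m hm).2, smul_div']

/-- `A m` is a rational family of difference operators, regular for `m ∈ U`. -/
def IsFam (U : Set ℂ) (A : ∀ m : ℂ, DiffOp n h m) : Prop :=
  ∃ F : DiffOpFamily n, ∀ m ∈ U, F.RegularAt h m ∧ F.spec h m = A m

variable {A B : ∀ m : ℂ, DiffOp n h m}

theorem IsFam.congr (hA : IsFam U A) (hAB : ∀ m ∈ U, B m = A m) : IsFam U B := by
  obtain ⟨F, hF⟩ := hA
  exact ⟨F, fun m hm => ⟨(hF m hm).1, (hF m hm).2.trans (hAB m hm).symm⟩⟩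

theorem IsFam.mono (hA : IsFam U A) {V : Set ℂ} (hV : V ⊆ U) : IsFam V A := by
  obtain ⟨F, hF⟩ := hA
  exact ⟨F, fun m hm => hF m (hV hm)⟩

theorem DiffOpFamily.coeffs_spec (F : DiffOpFamily n) (m : ℂ) (ν : Fin (n + 1) → ℤ) :
    DiffOp.coeffs (F.spec h m) ν = paramHom n h m (F.num ν) / paramHom n h m F.den := by
  rw [spec, Finsupp.sum, map_sum, Finsupp.finsetSum_apply]
  simp only [DiffOp.coeffs_term, Finsupp.single_apply]
  rw [Finset.sum_ite_eq']
  split_ifs with h0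
  · rfl
  · rw [Finsupp.notMem_support_iff.1 h0, map_zero, zero_div]

/-- Finitely many coefficients may have separate denominators; their product serves as a common one
and stays nonzero at every point of `U`. -/
theorem isFam_iff : IsFam U A ↔ ∃ (S : Finset (Fin (n + 1) → ℤ))
    (a : (Fin (n + 1) → ℤ) → ∀ m, CoeffField n h m), (∀ ν ∈ S, IsRat U (a ν)) ∧
    ∀ m ∈ U, A m = ∑ ν ∈ S, DiffOp.term (a ν m) ν := by
  classical
  constructor
  · rintro ⟨F, hF⟩
    refine ⟨F.num.support, fun ν m => paramHom n h m (F.num ν) / paramHom n h m F.den,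
      fun ν _ => ?_, fun m hm => (hF m hm).2.symm⟩
    exact (isRat_param _).div (isRat_param _) fun m hm h0 => (hF m hm).1 (paramHom_eq_zero.1 h0)
  · rintro ⟨S, a, ha, hA⟩
    choose! p d hpd using ha
    refine ⟨⟨∑ ν ∈ S, Finsupp.single ν (p ν * ∏ μ ∈ S.erase ν, d μ), ∏ μ ∈ S, d μ⟩,
      fun m hm => ?_⟩
    have hd : ∀ ν ∈ S, paramHom n h m (d ν) ≠ 0 := fun ν hν => (hpd ν hν m hm).1
    constructor
    · intro h0
      have := paramHom_eq_zero.2 h0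
      rw [map_prod] at this
      exact Finset.prod_ne_zero_iff.2 hd this
    · apply DiffOp.coeffs_injective
      ext ν
      rw [DiffOpFamily.coeffs_spec, hA m hm, map_sum]
      simp only [Finsupp.finsetSum_apply, DiffOp.coeffs_term, Finsupp.single_apply]
      rw [Finset.sum_ite_eq', Finset.sum_ite_eq']
      split_ifs with hν
      · rw [(hpd ν hν m hm).2, map_mul, ← Finset.mul_prod_erase S d hν, map_mul]
        have h1 : paramHom n h m (∏ μ ∈ S.erase ν, d μ) ≠ 0 := by
          rw [map_prod]
          exact Finset.prod_ne_zero_iff.2 fun μ hμ => hd μ (Finset.mem_of_mem_erase hμ)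
        exact mul_div_mul_right _ _ h1
      · rw [map_zero, zero_div]

theorem isFam_term (ha : IsRat U a) (ν : Fin (n + 1) → ℤ) :
    IsFam U fun m => DiffOp.term (a m) ν :=
  isFam_iff.2 ⟨{ν}, fun _ => a, fun _ _ => ha, fun m _ => by simp⟩

theorem IsFam.add (hA : IsFam U A) (hB : IsFam U B) : IsFam U fun m => A m + B m := by
  classical
  obtain ⟨S, a, ha, hA⟩ := isFam_iff.1 hA
  obtain ⟨T, b, hb, hB⟩ := isFam_iff.1 hB
  have h0 : IsRat (n := n) (h := h) U fun m => 0 := (isRat_const 0).congr fun m _ => by simp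
  refine isFam_iff.2 ⟨S ∪ T, fun ν m => (if ν ∈ S then a ν m else 0) + if ν ∈ T then b ν m else 0,
    fun ν _ => IsRat.add ?_ ?_, fun m hm => ?_⟩
  · by_cases hν : ν ∈ S
    · simpa [hν] using ha ν hν
    · simpa [hν] using h0
  · by_cases hν : ν ∈ T
    · simpa [hν] using hb ν hν
    · simpa [hν] using h0
  · simp only [DiffOp.term_add, Finset.sum_add_distrib]
    rw [hA m hm, hB m hm]
    congr 1
    · rw [← Finset.sum_subset Finset.subset_union_left fun ν _ hν => by
        rw [if_neg hν, DiffOp.term_zero]]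
      exact Finset.sum_congr rfl fun ν hν => by rw [if_pos hν]
    · rw [← Finset.sum_subset Finset.subset_union_right fun ν _ hν => by
        rw [if_neg hν, DiffOp.term_zero]]
      exact Finset.sum_congr rfl fun ν hν => by rw [if_pos hν]

theorem isFam_sum {ι : Type*} (s : Finset ι) {f : ι → ∀ m : ℂ, DiffOp n h m}
    (hf : ∀ i ∈ s, IsFam U (f i)) : IsFam U fun m => ∑ i ∈ s, f i m := by
  classical
  induction s using Finset.induction_on with
  | empty => exact isFam_iff.2 ⟨∅, fun _ _ => 0, by simp, by simp⟩
  | insert i s hi ih =>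
    simp only [Finset.sum_insert hi]
    exact (hf i (by simp)).add (ih fun j hj => hf j (by simp [hj]))

theorem IsFam.mul (hA : IsFam U A) (hB : IsFam U B) : IsFam U fun m => A m * B m := by
  obtain ⟨S, a, ha, hA⟩ := isFam_iff.1 hA
  obtain ⟨T, b, hb, hB⟩ := isFam_iff.1 hB
  refine IsFam.congr (A := fun m => ∑ ν ∈ S, ∑ μ ∈ T,
    DiffOp.term (a ν m * (Multiplicative.ofAdd ν • b μ m)) (ν + μ)) ?_ fun m hm => ?_
  · exact isFam_sum _ fun ν hν => isFam_sum _ fun μ hμ =>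
      isFam_term ((ha ν hν).mul ((hb μ hμ).smul ν)) _
  · simp only [hA m hm, hB m hm, Finset.sum_mul_sum, DiffOp.term_mul_term]

theorem isFam_intCast (k : ℤ) : IsFam (n := n) (h := h) U fun m => (k : DiffOp n h m) := by
  refine (isFam_term (isRat_const (k : ℂ)) 0).congr fun m _ => ?_
  have hn : ∀ j : ℕ, (j : DiffOp n h m) = DiffOp.term (algebraMap ℂ _ (j : ℂ)) 0 := fun j => by
    rw [DiffOp.natCast_eq, map_natCast]
  obtain ⟨j, rfl | rfl⟩ := k.eq_nat_or_neg
  · rw [Int.cast_natCast, Int.cast_natCast, hn]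
  · rw [Int.cast_neg, Int.cast_natCast, Int.cast_neg, Int.cast_natCast, hn, map_neg]
    exact neg_eq_of_add_eq_zero_left (by rw [← DiffOp.term_add, neg_add_cancel, DiffOp.term_zero])

theorem IsFam.sub (hA : IsFam U A) (hB : IsFam U B) : IsFam U fun m => A m - B m :=
  (hA.add ((isFam_intCast (-1)).mul hB)).congr fun m _ => by simp [sub_eq_add_neg]

theorem isFam_newtonSeq {E : ℕ → ∀ m : ℂ, DiffOp n h m} {s : ℕ}
    (hE : ∀ i ≤ s, IsFam U (E i)) : IsFam U fun m => newtonSeq (fun i => E i m) s := by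
  induction s using Nat.strong_induction_on with
  | _ s ih =>
    cases s with
    | zero => exact (isFam_intCast 0).congr fun m _ => by simp [newtonSeq]
    | succ s =>
      have hs : ∀ k : ℕ, IsFam (n := n) (h := h) U fun m => (-1) ^ k := fun k =>
        (isFam_intCast ((-1) ^ k)).congr fun m _ => by simp
      simp only [newtonSeq_succ]
      refine (hs s).mul (IsFam.sub (((isFam_intCast (s + 1 : ℕ)).congr fun m _ => by simp).mul
        (hE _ le_rfl)) (isFam_sum _ fun i hi => (hs _).mul ?_))
      have := Finset.mem_Icc.1 hi
      exact (hE _ (by omega)).mul (ih i (by omega) fun j hj => hE j (by omega))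

/-- A rational family that vanishes at the positive integers vanishes. -/
theorem IsFam.eq_zero (hA : IsFam U A) (hq : ∀ k : ℕ, 0 < k → Complex.exp h ^ k ≠ 1)
    (h0 : ∀ m : ℕ, 0 < m → (m : ℂ) ∈ U ∧ A m = 0) : ∀ m ∈ U, A m = 0 := by
  obtain ⟨F, hF⟩ := hA
  have hnum : ∀ ν, F.num ν = 0 := by
    intro ν
    ext1 k
    rw [coeff_zero]
    -- Since `q` is not a root of unity, the values `t = q^m` at positive integers are infinitely
    -- many roots of each coefficient of the numerators.
    have hinj : Function.Injective fun m : ℕ => Complex.exp (h * ((m + 1 : ℕ) : ℂ)) := by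
      intro m m' hmm
      simp only [mul_comm h, Complex.exp_nat_mul] at hmm
      have := zpow_injective_of_pow_ne_one (Complex.exp_ne_zero h) hq
        (a₁ := ((m + 1 : ℕ) : ℤ)) (a₂ := ((m' + 1 : ℕ) : ℤ)) (by beta_reduce; rw [zpow_natCast, zpow_natCast]; exact hmm)
      omega
    refine Polynomial.eq_zero_of_infinite_isRoot _
      ((Set.infinite_range_of_injective hinj).mono ?_)
    rintro _ ⟨m, rfl⟩
    obtain ⟨h1, h2⟩ := h0 (m + 1) m.succ_pos
    obtain ⟨h3, h4⟩ := hF _ h1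
    have h5 := DiffOpFamily.coeffs_spec (h := h) F ((m + 1 : ℕ) : ℂ) ν
    rw [h4, h2, map_zero, Finsupp.coe_zero, Pi.zero_apply, eq_comm, div_eq_zero_iff] at h5
    rcases h5 with h5 | h5
    · have h6 := congrArg (coeff k) (paramHom_eq_zero.1 h5)
      rw [DiffOpFamily.substParam, coeff_map, coeff_zero] at h6
      exact h6
    · exact absurd (paramHom_eq_zero.1 h5) h3
  intro m hm
  rw [← (hF m hm).2, DiffOpFamily.spec]
  have : F.num = 0 := Finsupp.ext hnum
  rw [this, Finsupp.sum_zero_index]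

end Rational

end

noncomputable section

open MvPolynomial CoeffField

/-! ### The integrals at general parameters -/

section Explicit

variable {n : ℕ} {h m : ℂ}

theorem qpow_mul (a b : ℂ) : (qpow a * qpow b : CoeffField n h m) = qpow (a + b) := by
  rw [qpow_eq, qpow_eq, qpow_eq, ← map_mul, ← Complex.exp_add, mul_add]

theorem qpow_ne_zero (a : ℂ) : (qpow a : CoeffField n h m) ≠ 0 := by
  rw [qpow_eq]; simp

theorem qpow_neg (a : ℂ) : (qpow (-a) : CoeffField n h m) = (qpow a)⁻¹ := by
  refine eq_inv_of_mul_eq_one_left ?_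
  rw [qpow_mul, neg_add_cancel, qpow_eq]; simp

/-- `[a + x - y] / [b + x - y]` in terms of squares. -/
theorem br_div_br (a b : ℂ) {x y : CoeffField n h m} (hx : x ≠ 0) (hy : y ≠ 0) :
    br (qpow a * (x / y)) / br (qpow b * (x / y)) =
      qpow (b - a) * (qpow (2 * a) * x ^ 2 - y ^ 2) / (qpow (2 * b) * x ^ 2 - y ^ 2) := by
  have h1 : ∀ c, br (qpow c * (x / y)) =
      (qpow (2 * c) * x ^ 2 - y ^ 2) / (qpow c * (x * y)) := by
    intro c
    have hc := qpow_ne_zero (n := n) (h := h) (m := m) c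
    rw [br, two_mul, ← qpow_mul]
    field_simp
  have ha := qpow_ne_zero (n := n) (h := h) (m := m) a
  have hb := qpow_ne_zero (n := n) (h := h) (m := m) b
  rw [h1, h1, sub_eq_add_neg b a, ← qpow_mul, qpow_neg, div_div_div_eq]
  by_cases h0 : qpow (2 * b) * x ^ 2 - y ^ 2 = 0
  · simp [h0]
  · rw [div_eq_div_iff (mul_ne_zero (mul_ne_zero ha (mul_ne_zero hx hy)) h0) h0]
    field_simp

theorem qpow_sq_sub_ne_zero (a : ℂ) {i j : Fin (n + 1)} (hij : i ≠ j) :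
    (qpow a * var i ^ 2 - var j ^ 2 : CoeffField n h m) ≠ 0 := by
  have := sub_ne_zero_of_ne (h := h) (m := m) hij (c' := 1) (Complex.exp_ne_zero (h * a))
  rwa [map_one, one_mul, ← qpow_eq] at this

theorem qpow_one' : (qpow 0 : CoeffField n h m) = 1 := by rw [qpow_eq]; simp

theorem qpow_exp : (qpow 1 : CoeffField n h m) = algebraMap ℂ _ (Complex.exp h) := by
  rw [qpow_eq, mul_one]

theorem qpow_nat_mul (a : ℂ) (r : ℕ) : (qpow (a * r) : CoeffField n h m) = qpow a ^ r := by
  rw [qpow_eq, qpow_eq, ← map_pow, ← Complex.exp_nat_mul]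
  congr 2; ring

theorem elemOp_zero : elemOp n h m 0 = 1 := by
  have hf : Finset.univ.filter (fun A : Finset (Fin n) => A.card ≤ 0) = {∅} := by
    ext A; simp
  rw [elemOp, hf, Finset.sum_singleton, DiffOp.one_eq]
  congr 1
  · rw [cornerCoeff]
    simp only [Finset.prod_empty, one_mul, Finset.card_empty, Nat.sub_zero, symmSeq_zero, map_one,
      mul_zero, pow_zero]
    refine Finset.prod_eq_one fun i _ => div_self ?_
    have := sub_ne_zero_of_ne (h := h) (m := m) (Fin.castSucc_lt_last i).ne' (c := 1)
      (c' := Complex.exp h * Complex.exp (h * m)) one_ne_zero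
    rwa [map_one, one_mul, map_mul] at this
  · ext i
    induction i using Fin.lastCases with
    | last => simp [shiftVec]
    | cast i => simp [shiftVec]

/-- The factor for a pair of indices below `n`. -/
theorem br_pair (i j : Fin (n + 1)) (hij : i ≠ j) :
    br (qpow (-m) * (var i / var j)) / br (var i / var j) =
      (var i ^ 2 - algebraMap ℂ (CoeffField n h m) (Complex.exp (h * m)) ^ 2 * var j ^ 2) /
        (algebraMap ℂ _ (Complex.exp (h * m)) * (var i ^ 2 - var j ^ 2)) := by
  have h1 := br_div_br (h := h) (m := m) (-m) 0 (var_ne_zero (n := n) i) (var_ne_zero j)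
  rw [qpow_one', one_mul, mul_zero, qpow_one', one_mul, zero_sub, neg_neg, mul_neg, qpow_neg,
    qpow_neg, two_mul, ← qpow_mul] at h1
  rw [← qpow_neg] at h1
  rw [h1, ← qpow_eq]
  have h2 := qpow_ne_zero (n := n) (h := h) (m := m) m
  have h3 := qpow_sq_sub_ne_zero (h := h) (m := m) 0 hij
  rw [qpow_one', one_mul] at h3
  field_simp

/-- The factor for an index in `A` and `n`. -/
theorem br_last_mem (i : Fin n) (r : ℕ) :
    br (qpow (-((m + 1) / 2)) * (var i.castSucc / var (Fin.last n))) /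
        br (qpow (-((m - 1) / 2) - m * r) * (var i.castSucc / var (Fin.last n))) =
      algebraMap ℂ (CoeffField n h m) (Complex.exp (h * m)) ^ r *
        (var i.castSucc ^ 2 - algebraMap ℂ _ (Complex.exp h) *
          algebraMap ℂ _ (Complex.exp (h * m)) * var (Fin.last n) ^ 2) /
        (algebraMap ℂ _ (Complex.exp h) * var i.castSucc ^ 2 -
          algebraMap ℂ _ (Complex.exp (h * m)) ^ (2 * r + 1) * var (Fin.last n) ^ 2) := by
  have hl := (Fin.castSucc_lt_last i).ne
  have h1 := br_div_br (h := h) (m := m) (-((m + 1) / 2)) (-((m - 1) / 2) - m * r)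
    (var_ne_zero (n := n) i.castSucc) (var_ne_zero (Fin.last n))
  have e1 : (qpow (-((m - 1) / 2) - m * r - -((m + 1) / 2)) : CoeffField n h m) =
      qpow 1 * (qpow m ^ r)⁻¹ := by
    rw [← qpow_nat_mul, ← qpow_neg, qpow_mul]; congr 1; ring
  have e2 : (qpow (2 * -((m + 1) / 2)) : CoeffField n h m) = (qpow 1 * qpow m)⁻¹ := by
    rw [qpow_mul, ← qpow_neg]; congr 1; ring
  have e3 : (qpow (2 * (-((m - 1) / 2) - m * r)) : CoeffField n h m) =
      qpow 1 * (qpow m ^ (2 * r + 1))⁻¹ := by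
    rw [← qpow_nat_mul, ← qpow_neg, qpow_mul]; congr 1; push_cast; ring
  have h2 := qpow_sq_sub_ne_zero (h := h) (m := m) (2 * (-((m - 1) / 2) - m * r)) hl
  have hq := qpow_ne_zero (n := n) (h := h) (m := m) 1
  have ht := qpow_ne_zero (n := n) (h := h) (m := m) m
  rw [h1, e1, e2, e3, ← qpow_exp, ← qpow_eq]
  rw [e3] at h2
  have h3 : qpow 1 * var i.castSucc ^ 2 - qpow m ^ (2 * r + 1) * var (Fin.last n) ^ 2 =
      qpow m ^ (2 * r + 1) * (qpow 1 * (qpow m ^ (2 * r + 1))⁻¹ * var i.castSucc ^ 2 -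
        var (Fin.last n) ^ 2 : CoeffField n h m) := by
    field_simp
  rw [h3, div_eq_div_iff h2 (mul_ne_zero (pow_ne_zero _ ht) h2), ← sub_eq_zero]
  field_simp
  ring

/-- The factor for an index outside `A` and `n`. -/
theorem br_last_notMem (i : Fin n) (r : ℕ) :
    br (qpow (-((m + 1) / 2)) * (var (Fin.last n) / var i.castSucc)) /
        br (qpow (m * r - (m + 1) / 2) * (var (Fin.last n) / var i.castSucc)) =
      algebraMap ℂ (CoeffField n h m) (Complex.exp (h * m)) ^ r *
        (var (Fin.last n) ^ 2 - algebraMap ℂ _ (Complex.exp h) *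
          algebraMap ℂ _ (Complex.exp (h * m)) * var i.castSucc ^ 2) /
        (algebraMap ℂ _ (Complex.exp (h * m)) ^ (2 * r) * var (Fin.last n) ^ 2 -
          algebraMap ℂ _ (Complex.exp h) * algebraMap ℂ _ (Complex.exp (h * m)) *
            var i.castSucc ^ 2) := by
  have hl := (Fin.castSucc_lt_last i).ne'
  have h1 := br_div_br (h := h) (m := m) (-((m + 1) / 2)) (m * r - (m + 1) / 2)
    (var_ne_zero (n := n) (Fin.last n)) (var_ne_zero i.castSucc)
  have e1 : (qpow (m * r - (m + 1) / 2 - -((m + 1) / 2)) : CoeffField n h m) = qpow m ^ r := by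
    rw [← qpow_nat_mul]; congr 1; ring
  have e2 : (qpow (2 * -((m + 1) / 2)) : CoeffField n h m) = (qpow 1 * qpow m)⁻¹ := by
    rw [qpow_mul, ← qpow_neg]; congr 1; ring
  have e3 : (qpow (2 * (m * r - (m + 1) / 2)) : CoeffField n h m) =
      qpow m ^ (2 * r) * (qpow 1 * qpow m)⁻¹ := by
    rw [qpow_mul, ← qpow_nat_mul, ← qpow_neg, qpow_mul]; congr 1; push_cast; ring
  have h2 := qpow_sq_sub_ne_zero (h := h) (m := m) (2 * (m * r - (m + 1) / 2)) hl
  have hq := qpow_ne_zero (n := n) (h := h) (m := m) 1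
  have ht := qpow_ne_zero (n := n) (h := h) (m := m) m
  rw [h1, e1, e2, e3, ← qpow_exp, ← qpow_eq]
  rw [e3] at h2
  have h3 : qpow m ^ (2 * r) * var (Fin.last n) ^ 2 - qpow 1 * qpow m * var i.castSucc ^ 2 =
      qpow 1 * qpow m * (qpow m ^ (2 * r) * (qpow 1 * qpow m)⁻¹ * var (Fin.last n) ^ 2 -
        var i.castSucc ^ 2 : CoeffField n h m) := by
    field_simp
  rw [h3, div_eq_div_iff h2 (mul_ne_zero (mul_ne_zero hq ht) h2), ← sub_eq_zero]
  field_simp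
  ring

theorem cornerCoeff_eq_br (A : Finset (Fin n)) (r : ℕ) :
    cornerCoeff (algebraMap ℂ (CoeffField n h m) (Complex.exp h))
        (algebraMap ℂ _ (Complex.exp (h * m))) (fun i => var i ^ 2) A r =
      (∏ i ∈ A, ∏ j ∈ Aᶜ, br (qpow (-m) * (var i.castSucc / var j.castSucc)) /
        br (var i.castSucc / var j.castSucc)) *
      ((∏ i ∈ A, br (qpow (-((m + 1) / 2)) * (var i.castSucc / var (Fin.last n))) /
        br (qpow (-((m - 1) / 2) - m * r) * (var i.castSucc / var (Fin.last n)))) *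
      ∏ i ∈ Aᶜ, br (qpow (-((m + 1) / 2)) * (var (Fin.last n) / var i.castSucc)) /
        br (qpow (m * r - (m + 1) / 2) * (var (Fin.last n) / var i.castSucc))) := by
  simp only [cornerCoeff, br_last_mem, br_last_notMem]
  congr 1
  refine Finset.prod_congr rfl fun i hi => Finset.prod_congr rfl fun j hj => ?_
  rw [br_pair]
  rintro h
  rw [Fin.castSucc_injective n h] at hi
  exact (Finset.mem_compl.1 hj) hi

theorem last_factor_eq_one (i : Fin n) :
    br (qpow (-((m + 1) / 2)) * (var (Fin.last n) / var i.castSucc)) /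
      br (qpow (-((m + 1) / 2)) * (var (Fin.last n) / var i.castSucc) :
        CoeffField n h m) = 1 := by
  have h0 := br_last_notMem (h := h) (m := m) i 0
  rw [Nat.cast_zero, mul_zero, zero_sub] at h0
  rw [h0]
  simp only [mul_zero, pow_zero, one_mul]
  refine div_self ?_
  have := sub_ne_zero_of_ne (h := h) (m := m) (Fin.castSucc_lt_last i).ne' (c := 1)
    (c' := Complex.exp h * Complex.exp (h * m)) one_ne_zero
  rwa [map_one, one_mul, map_mul] at this

theorem br_qpow (a : ℂ) : br (qpow a : CoeffField n h m) = algebraMap ℂ _ (qnum h a) := by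
  rw [br, ← qpow_neg, qpow_eq, qpow_eq, ← map_sub, qnum, mul_neg]

theorem sum_card_le_one {M : Type*} [AddCommMonoid M] (f : Finset (Fin n) → M) :
    ∑ A ∈ Finset.univ.filter (fun A : Finset (Fin n) => A.card ≤ 1), f A =
      (∑ i, f {i}) + f ∅ := by
  have hf : Finset.univ.filter (fun A : Finset (Fin n) => A.card ≤ 1) =
      insert ∅ (Finset.univ.map ⟨fun i => ({i} : Finset (Fin n)), Finset.singleton_injective⟩) := by
    ext A
    simp only [Finset.mem_filter, Finset.mem_univ, true_and, Finset.mem_insert, Finset.mem_map,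
      Function.Embedding.coeFn_mk, Nat.le_one_iff_eq_zero_or_eq_one, Finset.card_eq_zero,
      Finset.card_eq_one, eq_comm (a := A)]
  rw [hf, Finset.sum_insert (by simp), Finset.sum_map, add_comm]
  rfl

theorem shiftVec_singleton (i : Fin n) : shiftVec {i} 0 = Pi.single i.castSucc 1 := by
  ext a
  induction a using Fin.lastCases with
  | last => simp [shiftVec, (Fin.castSucc_lt_last i).ne']
  | cast a => simp [shiftVec, Pi.single_apply]

theorem shiftVec_empty (r : ℕ) : shiftVec (∅ : Finset (Fin n)) r = Pi.single (Fin.last n) (r : ℤ) := by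
  ext a
  induction a using Fin.lastCases with
  | last => simp [shiftVec]
  | cast a => simp [shiftVec, (Fin.castSucc_lt_last a).ne]

theorem elemOp_one : elemOp n h m 1 = deformedOp n h m := by
  rw [elemOp, sum_card_le_one, deformedOp]
  simp only [Finset.card_singleton, Finset.card_empty, Nat.sub_self, Nat.sub_zero, shiftVec_singleton,
    shiftVec_empty, symmSeq_zero, symmSeq_one, map_one, one_mul, cornerCoeff_eq_br,
    Finset.prod_singleton, last_factor_eq_one, Finset.prod_const_one, mul_one, Finset.prod_empty,
    Nat.cast_one, powerCoeff, Nat.cast_zero, mul_zero, sub_zero, zero_sub]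
  congr 1
  · refine Finset.sum_congr rfl fun i _ => ?_
    congr 1
    rw [mul_comm]
    congr 2
    ext j; simp
  · rw [br_qpow, br_qpow, ← map_div₀]
    congr 2
    rw [Finset.compl_empty]
    refine Finset.prod_congr rfl fun i _ => ?_
    congr 4
    ring

theorem newtonSeq_one {R : Type*} [Ring R] (e : ℕ → R) : newtonSeq e 1 = e 1 := by
  rw [newtonSeq_succ]; simp

theorem powerSumOp_one : powerSumOp n h m 1 = deformedOp n h m := by
  rw [powerSumOp, newtonSeq_one, elemOp_one]

/-- Up to degree `r` the recursion divides only by positive integers and by `[m], …, [rm]`. -/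
theorem isRat_symmSeq {s r : ℕ} (hr : r ≤ s) : IsRat (n := n) (h := h)
    {m | PowerSumsDefined h m s} fun m => algebraMap ℂ _ (symmSeq (powerCoeff h m) r) := by
  have hqn : ∀ (k : ℕ), IsRat (n := n) (h := h) {m | PowerSumsDefined h m s}
      fun m => algebraMap ℂ _ (qnum h (k * m)) := fun k =>
    ((isRat_t_zpow k).sub (isRat_t_zpow (-k))).congr fun m _ => by
      rw [← map_sub, qnum, ← Complex.exp_int_mul, ← Complex.exp_int_mul]
      congr 3 <;> push_cast <;> ring
  induction r using Nat.strong_induction_on with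
  | _ r ih =>
    cases r with
    | zero => simpa [symmSeq_zero] using isRat_one
    | succ r =>
      simp only [symmSeq_succ, map_mul, map_sum]
      refine (isRat_const _).mul (isRat_sum _ fun i hi => (isRat_const _).mul ?_)
      have hi' := Finset.mem_Icc.1 hi
      refine (ih _ (by omega) (by omega)).mul ?_
      simp only [powerCoeff, map_div₀]
      refine (isRat_const _).div (hqn i) fun m hm h0 => hm i (Finset.mem_Icc.2 ⟨hi'.1, by omega⟩) ?_
      exact (FaithfulSMul.algebraMap_eq_zero_iff ℂ _).1 h0

theorem isFam_elemOp (s : ℕ) :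
    IsFam {m | PowerSumsDefined h m s} fun m => elemOp n h m s := by
  refine isFam_sum _ fun A _ => isFam_term ((isRat_symmSeq (by omega)).mul ?_) _
  have hv : ∀ i, IsRat (n := n) (h := h) {m | PowerSumsDefined h m s} fun _ => var i ^ 2 :=
    fun i => (isRat_var i).pow 2
  have hq : IsRat (n := n) (h := h) {m | PowerSumsDefined h m s}
    fun _ => algebraMap ℂ _ (Complex.exp h) := isRat_const _
  have ht : IsRat (n := n) (h := h) {m | PowerSumsDefined h m s}
    fun m => algebraMap ℂ _ (Complex.exp (h * m)) := isRat_t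
  refine (isRat_prod _ fun i hi => isRat_prod _ fun j hj => ?_).mul
    ((isRat_prod _ fun i _ => ?_).mul (isRat_prod _ fun i _ => ?_))
  · refine ((hv _).sub ((ht.pow 2).mul (hv _))).div (ht.mul ((hv _).sub (hv _))) fun m _ => ?_
    have hij : i.castSucc ≠ j.castSucc := fun h => by
      rw [Fin.castSucc_injective n h] at hi
      exact (Finset.mem_compl.1 hj) hi
    have := qpow_sq_sub_ne_zero (h := h) (m := m) 0 hij
    rw [qpow_one', one_mul] at this
    exact mul_ne_zero (by simp) this
  · refine ((ht.pow _).mul ((hv _).sub ((hq.mul ht).mul (hv _)))).div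
      ((hq.mul (hv _)).sub ((ht.pow _).mul (hv _))) fun m _ => ?_
    rw [← map_pow]
    exact sub_ne_zero_of_ne (Fin.castSucc_lt_last i).ne (Complex.exp_ne_zero _)
  · refine ((ht.pow _).mul ((hv _).sub ((hq.mul ht).mul (hv _)))).div
      (((ht.pow _).mul (hv _)).sub ((hq.mul ht).mul (hv _))) fun m _ => ?_
    rw [← map_pow, ← map_mul]
    exact sub_ne_zero_of_ne (Fin.castSucc_lt_last i).ne' (pow_ne_zero _ (Complex.exp_ne_zero _))

theorem isFam_powerSumOp (s : ℕ) :
    IsFam {m | PowerSumsDefined h m s} fun m => powerSumOp n h m s :=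
  isFam_newtonSeq fun i hi => (isFam_elemOp i).mono fun _ hm j hj =>
    hm j (Finset.Icc_subset_Icc_right hi hj)

end Explicit

end

noncomputable section

open MvPolynomial CoeffField

/-! ### The integrals at `m = 1` -/

section One

variable {n : ℕ} {h : ℂ}

theorem powersetCard_succ_fin (s : ℕ) :
    Finset.powersetCard (s + 1) (Finset.univ : Finset (Fin (n + 1))) =
      (Finset.powersetCard (s + 1) (Finset.univ : Finset (Fin n))).map
        (Finset.mapEmbedding Fin.castSuccEmb).toEmbedding ∪
      ((Finset.powersetCard s (Finset.univ : Finset (Fin n))).map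
        (Finset.mapEmbedding Fin.castSuccEmb).toEmbedding).image (insert (Fin.last n)) := by
  have hu : (Finset.univ : Finset (Fin (n + 1))) =
      insert (Fin.last n) (Finset.univ.map Fin.castSuccEmb) := by
    rw [Fin.univ_castSuccEmb, Finset.cons_eq_insert]
  rw [hu, Finset.powersetCard_succ_insert (by simp), Finset.powersetCard_map,
    Finset.powersetCard_map]

theorem sum_powersetCard_succ_fin {M : Type*} [AddCommMonoid M] (s : ℕ)
    (f : Finset (Fin (n + 1)) → M) :
    ∑ I ∈ Finset.powersetCard (s + 1) (Finset.univ : Finset (Fin (n + 1))), f I =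
      (∑ A ∈ Finset.powersetCard (s + 1) (Finset.univ : Finset (Fin n)),
        f (A.map Fin.castSuccEmb)) +
      ∑ A ∈ Finset.powersetCard s (Finset.univ : Finset (Fin n)),
        f (insert (Fin.last n) (A.map Fin.castSuccEmb)) := by
  have hl : ∀ A : Finset (Fin n), Fin.last n ∉ A.map Fin.castSuccEmb := by simp
  rw [powersetCard_succ_fin, Finset.sum_union, Finset.sum_map, Finset.sum_image, Finset.sum_map]
  · rfl
  · intro I hI J hJ hIJ
    simp only [Finset.coe_map, Set.mem_image] at hI hJ
    obtain ⟨A, -, rfl⟩ := hI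
    obtain ⟨B, -, rfl⟩ := hJ
    have := congrArg (fun I => I.erase (Fin.last n)) hIJ
    simpa [Finset.erase_insert (hl _)] using this
  · rw [Finset.disjoint_left]
    intro I hI hI'
    simp only [Finset.mem_map, Finset.mem_image] at hI hI'
    obtain ⟨A, -, rfl⟩ := hI
    obtain ⟨_, -, hB⟩ := hI'
    exact hl A (by
      have : Fin.last n ∈ (Finset.mapEmbedding Fin.castSuccEmb).toEmbedding A := by
        rw [← hB]; simp
      exact this)

theorem powerCoeff_one (hq : ∀ k : ℕ, 0 < k → Complex.exp h ^ k ≠ 1) (i : ℕ) (hi : 1 ≤ i) :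
    powerCoeff h 1 i = 1 := by
  rw [powerCoeff, mul_one]
  exact div_self (DiffOp.qnum_natCast_ne_zero hq hi)

/-- The coefficients of the Macdonald–Ruijsenaars operators, in terms of squares. -/
def ruijsenaarsFactor (i j : Fin (n + 1)) : CoeffField n h 1 :=
  br (qpow (-1) * (var i / var j)) / br (var i / var j)

theorem ruijsenaarsFactor_eq {i j : Fin (n + 1)} (hij : i ≠ j) :
    (ruijsenaarsFactor i j : CoeffField n h 1) =
      (var i ^ 2 - algebraMap ℂ (CoeffField n h 1) (Complex.exp h) ^ 2 * var j ^ 2) /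
        (algebraMap ℂ _ (Complex.exp h) * (var i ^ 2 - var j ^ 2)) := by
  rw [ruijsenaarsFactor, br_pair i j hij, mul_one]

theorem cornerCoeff_one_zero (A : Finset (Fin n)) :
    cornerCoeff (algebraMap ℂ (CoeffField n h 1) (Complex.exp h))
        (algebraMap ℂ _ (Complex.exp (h * 1))) (fun i => var i ^ 2) A 0 =
      ∏ i ∈ A.map Fin.castSuccEmb, ∏ j ∈ (A.map Fin.castSuccEmb)ᶜ, ruijsenaarsFactor i j := by
  have hc : (A.map Fin.castSuccEmb)ᶜ = insert (Fin.last n) (Aᶜ.map Fin.castSuccEmb) := by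
    ext i
    induction i using Fin.lastCases <;> simp [(Fin.castSucc_lt_last _).ne]
  rw [hc, Finset.prod_map]
  simp only [Finset.prod_insert (show Fin.last n ∉ Aᶜ.map Fin.castSuccEmb by simp),
    Finset.prod_map, Finset.prod_mul_distrib, Fin.castSuccEmb_apply]
  rw [cornerCoeff, mul_comm (∏ i ∈ A, ruijsenaarsFactor i.castSucc (Fin.last n))]
  simp only [mul_one]
  have h3 : ∏ i ∈ Aᶜ, (algebraMap ℂ (CoeffField n h 1) (Complex.exp h) ^ 0 *
      (var (Fin.last n) ^ 2 - algebraMap ℂ _ (Complex.exp h) * algebraMap ℂ _ (Complex.exp h) *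
        var i.castSucc ^ 2) / (algebraMap ℂ _ (Complex.exp h) ^ (2 * 0) * var (Fin.last n) ^ 2 -
        algebraMap ℂ _ (Complex.exp h) * algebraMap ℂ _ (Complex.exp h) * var i.castSucc ^ 2)) =
      1 := by
    refine Finset.prod_eq_one fun i _ => ?_
    simp only [mul_zero, pow_zero, one_mul]
    refine div_self ?_
    have := sub_ne_zero_of_ne (h := h) (m := 1) (Fin.castSucc_lt_last i).ne' (c := 1)
      (c' := Complex.exp h * Complex.exp h) one_ne_zero
    rwa [map_one, one_mul, map_mul] at this
  rw [h3, mul_one]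
  refine congrArg₂ _ (Finset.prod_congr rfl fun i hi => Finset.prod_congr rfl fun j hj => ?_)
    (Finset.prod_congr rfl fun i _ => ?_)
  · rw [ruijsenaarsFactor_eq]
    intro h
    rw [Fin.castSucc_injective n h] at hi
    exact (Finset.mem_compl.1 hj) hi
  · rw [ruijsenaarsFactor_eq (Fin.castSucc_lt_last i).ne]
    congr 1 <;> ring

theorem cornerCoeff_one_one (A : Finset (Fin n)) :
    cornerCoeff (algebraMap ℂ (CoeffField n h 1) (Complex.exp h))
        (algebraMap ℂ _ (Complex.exp (h * 1))) (fun i => var i ^ 2) A 1 =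
      ∏ i ∈ insert (Fin.last n) (A.map Fin.castSuccEmb),
        ∏ j ∈ (insert (Fin.last n) (A.map Fin.castSuccEmb))ᶜ, ruijsenaarsFactor i j := by
  have hc : (insert (Fin.last n) (A.map Fin.castSuccEmb))ᶜ = Aᶜ.map Fin.castSuccEmb := by
    ext i
    induction i using Fin.lastCases <;> simp [(Fin.castSucc_lt_last _).ne]
  rw [hc, Finset.prod_insert (by simp), Finset.prod_map, Finset.prod_map]
  simp only [Finset.prod_map, Fin.castSuccEmb_apply]
  rw [cornerCoeff, mul_comm (∏ i ∈ Aᶜ, ruijsenaarsFactor (Fin.last n) i.castSucc)]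
  simp only [mul_one]
  have hq0 : algebraMap ℂ (CoeffField n h 1) (Complex.exp h) ≠ 0 := by simp
  have h2 : ∏ i ∈ A, (algebraMap ℂ (CoeffField n h 1) (Complex.exp h) ^ 1 *
      (var i.castSucc ^ 2 - algebraMap ℂ _ (Complex.exp h) * algebraMap ℂ _ (Complex.exp h) *
        var (Fin.last n) ^ 2) / (algebraMap ℂ _ (Complex.exp h) * var i.castSucc ^ 2 -
        algebraMap ℂ _ (Complex.exp h) ^ (2 + 1) * var (Fin.last n) ^ 2)) = 1 := by
    refine Finset.prod_eq_one fun i _ => ?_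
    have := sub_ne_zero_of_ne (h := h) (m := 1) (Fin.castSucc_lt_last i).ne
      (c := Complex.exp h) (c' := Complex.exp h ^ 3) (Complex.exp_ne_zero h)
    rw [map_pow] at this
    rw [div_eq_one_iff_eq this]
    ring
  rw [h2, one_mul]
  refine congrArg₂ _ (Finset.prod_congr rfl fun i hi => Finset.prod_congr rfl fun j hj => ?_)
    (Finset.prod_congr rfl fun i _ => ?_)
  · rw [ruijsenaarsFactor_eq]
    intro h
    rw [Fin.castSucc_injective n h] at hi
    exact (Finset.mem_compl.1 hj) hi
  · have hl := (Fin.castSucc_lt_last i).ne'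
    rw [ruijsenaarsFactor_eq hl]
    have h4 := qpow_sq_sub_ne_zero (h := h) (m := 1) 0 hl
    rw [qpow_one', one_mul] at h4
    rw [show algebraMap ℂ (CoeffField n h 1) (Complex.exp h) ^ 2 * var (Fin.last n) ^ 2 -
      algebraMap ℂ (CoeffField n h 1) (Complex.exp h) * algebraMap ℂ _ (Complex.exp h) *
        var i.castSucc ^ 2 = algebraMap ℂ _ (Complex.exp h) ^ 2 *
        (var (Fin.last n) ^ 2 - var i.castSucc ^ 2) by ring]
    field_simp

/-- All power sum coefficients equal one, so only `r = 0` and `r = 1` contribute. A pair `(A, r)` is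
then a subset of all `n + 1` indices, with `r` recording whether the last one belongs to it. -/
theorem elemOp_at_one (hq : ∀ k : ℕ, 0 < k → Complex.exp h ^ k ≠ 1) {s : ℕ} (hs : 1 ≤ s) :
    elemOp n h 1 s = ruijsenaarsOp n h (-1) s := by
  obtain ⟨s, rfl⟩ : ∃ t, s = t + 1 := ⟨s - 1, by omega⟩
  rw [ruijsenaarsOp, sum_powersetCard_succ_fin, elemOp]
  have hγ := powerCoeff_one hq
  have hsub : Finset.powersetCard (s + 1) Finset.univ ∪ Finset.powersetCard s Finset.univ ⊆
      Finset.univ.filter (fun A : Finset (Fin n) => A.card ≤ s + 1) := by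
    intro A
    simp only [Finset.mem_union, Finset.mem_powersetCard, Finset.mem_filter, Finset.mem_univ,
      true_and, Finset.subset_univ]
    omega
  -- Subsets with fewer than `s` elements would need the last shift to a power of at least two,
  -- where the numerical factor is zero.
  rw [← Finset.sum_subset hsub, Finset.sum_union]
  · refine congrArg₂ _ (Finset.sum_congr rfl fun A hA => ?_) (Finset.sum_congr rfl fun A hA => ?_)
    · have hA' := (Finset.mem_powersetCard.1 hA).2
      rw [hA', Nat.sub_self, symmSeq_zero, map_one, one_mul, cornerCoeff_one_zero]
      congr 1
      ext i
      induction i using Fin.lastCases <;> simp [shiftVec, (Fin.castSucc_lt_last _).ne]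
    · have hA' := (Finset.mem_powersetCard.1 hA).2
      rw [hA', Nat.add_sub_cancel_left, symmSeq_one, hγ 1 le_rfl, map_one, one_mul,
        cornerCoeff_one_one]
      congr 1
      ext i
      induction i using Fin.lastCases <;> simp [shiftVec, (Fin.castSucc_lt_last _).ne]
  · rw [Finset.disjoint_left]
    intro A hA hA'
    have := (Finset.mem_powersetCard.1 hA).2
    have := (Finset.mem_powersetCard.1 hA').2
    omega
  · intro A hA hA'
    simp only [Finset.mem_union, Finset.mem_powersetCard, Finset.mem_filter, Finset.mem_univ,
      true_and, Finset.subset_univ, not_or] at hA hA'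
    rw [symmSeq_of_one hγ _ (by omega), map_zero, zero_mul, DiffOp.term_zero]

end One

end

noncomputable section

open MvPolynomial

/-! ### Geometry of the lattice -/

section Geometry

variable {n m : ℕ} {h : ℂ}

theorem unitLen_sq (n m : ℕ) (i : Fin (n + 1)) : unitLen n m i * unitLen n m i = latScale n m i := by
  rw [unitLen, latScale]
  split_ifs
  · rw [← Complex.ofReal_mul, Real.mul_self_sqrt (Nat.cast_nonneg m)]; simp
  · simp

theorem unitLen_ne_zero (hm : 0 < m) (i : Fin (n + 1)) : unitLen n m i ≠ 0 := by
  intro h0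
  have := unitLen_sq n m i
  rw [h0, zero_mul] at this
  have h1 := latScale_pos (n := n) hm i
  rw [← Int.cast_zero, Int.cast_inj] at this
  omega

theorem latticePt_add (k k' : Fin (n + 1) → ℤ) :
    latticePt n m (k + k') = latticePt n m k + latticePt n m k' := by
  ext i; simp [latticePt, add_mul]

theorem latticePt_injective (hm : 0 < m) : Function.Injective (latticePt n m) := by
  intro k k' hk
  ext i
  have := congrFun hk i
  exact_mod_cast mul_right_cancel₀ (unitLen_ne_zero hm i) this

theorem posRoot_eq (i j : Fin (n + 1)) : posRoot n m i j = latticePt n m (rootVec i j) := by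
  ext a
  simp only [posRoot, latticePt, rootVec, Pi.sub_apply, Int.cast_sub, sub_mul, Pi.single_apply]
  congr 1 <;> split_ifs with ha <;> simp [ha]

theorem sum_smul_posRoot (l : Fin (n + 1) → Fin (n + 1) → ℂ) (a : Fin (n + 1)) :
    (∑ i : Fin (n + 1), ∑ j ∈ Finset.Ioi i, l i j • posRoot n m i j) a =
      (∑ i : Fin (n + 1), ∑ j ∈ Finset.Ioi i, l i j * ((rootVec i j a : ℤ) : ℂ)) *
        unitLen n m a := by
  simp only [Finset.sum_apply, Pi.smul_apply, smul_eq_mul, posRoot_eq, latticePt, Finset.sum_mul,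
    mul_assoc]

theorem rhoVec_eq (n m : ℕ) : rhoVec n m = (1 / 2 : ℂ) • latticePt n m (vtx n m (stdWt n)) := by
  rw [rhoVec]
  congr 1
  ext a
  rw [sum_smul_posRoot, latticePt, vtx]
  simp only [Finset.sum_apply, Pi.smul_apply, smul_eq_mul, Int.cast_sum, Int.cast_mul]
  congr 1
  refine Finset.sum_congr rfl fun i _ => Finset.sum_congr rfl fun j hj => ?_
  rw [if_pos (stdWt_lt.2 (Finset.mem_Ioi.1 hj))]
  simp

theorem sub_rhoVec_mem_baPolytope (hm : 0 < m) {k : Fin (n + 1) → ℤ} :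
    latticePt n m k - rhoVec n m ∈ baPolytope n m ↔ k ∈ zonotope n m := by
  refine exists_congr fun l => and_congr Iff.rfl ?_
  rw [sub_eq_neg_add, add_right_inj, funext_iff]
  refine forall_congr' fun a => ?_
  rw [sum_smul_posRoot, latticePt, mul_left_inj' (unitLen_ne_zero hm a)]
  norm_cast

theorem sub_rhoVec_eq_rhoVec (hm : 0 < m) {k : Fin (n + 1) → ℤ} :
    latticePt n m k - rhoVec n m = rhoVec n m ↔ k = vtx n m (stdWt n) := by
  rw [sub_eq_iff_eq_add, rhoVec_eq, ← add_smul, add_halves, one_smul,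
    (latticePt_injective hm).eq_iff]

theorem dotProduct_latticePt (k : Fin (n + 1) → ℤ) (z : Fin (n + 1) → ℂ) :
    dotProduct (latticePt n m k) z = ∑ i, (k i : ℂ) * (unitLen n m i * z i) := by
  simp only [dotProduct, latticePt, mul_assoc]

theorem dotProduct_posRoot (i j : Fin (n + 1)) (z : Fin (n + 1) → ℂ) :
    dotProduct (posRoot n m i j) z = unitLen n m i * z i - unitLen n m j * z j := by
  rw [posRoot, sub_dotProduct, single_dotProduct, single_dotProduct]

theorem dotProduct_latticePt_posRoot (k : Fin (n + 1) → ℤ) (i j : Fin (n + 1)) :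
    dotProduct (latticePt n m k) (posRoot n m i j) = rootForm n m i j k := by
  rw [dotProduct_comm, dotProduct_posRoot, rootForm]
  push_cast
  rw [← unitLen_sq, ← unitLen_sq, latticePt, latticePt]
  ring

/-- The character `z ↦ q^{2(k,z)}` of the lattice. -/
def latChar (n : ℕ) (h : ℂ) (m : ℕ) (z : Fin (n + 1) → ℂ) (k : Fin (n + 1) → ℤ) : ℂ :=
  Complex.exp (h * (2 * dotProduct (latticePt n m k) z))

theorem latChar_add (z : Fin (n + 1) → ℂ) (k k' : Fin (n + 1) → ℤ) :
    latChar n h m z (k + k') = latChar n h m z k * latChar n h m z k' := by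
  rw [latChar, latticePt_add, add_dotProduct, latChar, latChar, ← Complex.exp_add]
  congr 1; ring

/-- The spectral parameters at a point. -/
def pointPar (n : ℕ) (h : ℂ) (m : ℕ) (x : Fin (n + 1) → ℂ) (i : Fin (n + 1)) : ℂ :=
  Complex.exp (h * (2 * (unitLen n m i * (x - rhoVec n m) i)))

/-- The function `∑_k f_k q^{2(k+x-ρ,z)}`. -/
def latSum (n : ℕ) (h : ℂ) (m : ℕ) (x : Fin (n + 1) → ℂ) (f : (Fin (n + 1) → ℤ) →₀ ℂ)
    (z : Fin (n + 1) → ℂ) : ℂ :=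
  Complex.exp (h * (2 * dotProduct (x - rhoVec n m) z)) * f.sum fun k a => a * latChar n h m z k

/-- The two translates multiply the `k`-th term by inverse exponentials. After a nonvanishing common
factor is extracted, their difference is the weight `strWeight`. -/
theorem latSum_shift_sub (x : Fin (n + 1) → ℂ) (f : (Fin (n + 1) → ℤ) →₀ ℂ)
    (z : Fin (n + 1) → ℂ) (i j : Fin (n + 1)) (s : ℕ) :
    latSum n h m x f (z + ((s : ℂ) / 2) • posRoot n m i j) -
      latSum n h m x f (z - ((s : ℂ) / 2) • posRoot n m i j) =
    Complex.exp (h * (2 * dotProduct (x - rhoVec n m) z)) *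
      Complex.exp (-(h * (unitLen n m i * (x - rhoVec n m) i + unitLen n m j * (x - rhoVec n m) j)))
        ^ s *
      f.sum fun k a => a * strWeight (Complex.exp h) n m (pointPar n h m x) i j s k *
        latChar n h m z k := by
  have key : ∀ ε : ℂ, latSum n h m x f (z + (ε * (s / 2)) • posRoot n m i j) =
      Complex.exp (h * (2 * dotProduct (x - rhoVec n m) z)) * f.sum fun k a => a *
        Complex.exp (s * (h * (ε * (unitLen n m i * (x - rhoVec n m) i -
          unitLen n m j * (x - rhoVec n m) j + rootForm n m i j k)))) * latChar n h m z k := by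
    intro ε
    rw [latSum, Finsupp.sum, Finsupp.sum, Finset.mul_sum, Finset.mul_sum]
    refine Finset.sum_congr rfl fun k _ => ?_
    rw [latChar, latChar, mul_left_comm, mul_left_comm (Complex.exp _), mul_assoc, ← Complex.exp_add,
      ← Complex.exp_add, ← Complex.exp_add]
    congr 2
    rw [dotProduct_add, dotProduct_add, dotProduct_smul, dotProduct_smul,
      dotProduct_latticePt_posRoot, dotProduct_comm (x - rhoVec n m) (posRoot n m i j),
      dotProduct_posRoot, smul_eq_mul, smul_eq_mul]
    ring
  have h1 := key 1
  have h2 := key (-1)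
  rw [one_mul] at h1
  rw [neg_one_mul, neg_smul, ← sub_eq_add_neg] at h2
  rw [h1, h2, ← mul_sub, mul_assoc]
  congr 1
  rw [Finsupp.sum, Finsupp.sum, Finsupp.sum, ← Finset.sum_sub_distrib, Finset.mul_sum]
  refine Finset.sum_congr rfl fun k _ => ?_
  have hb : ∀ u v r : ℂ, Complex.exp (s * (h * (1 * (u - v + r)))) -
      Complex.exp (s * (h * (-1 * (u - v + r)))) = Complex.exp (-(h * (u + v))) ^ s *
        ((Complex.exp (r * h) * Complex.exp (h * (2 * u))) ^ s -
          (Complex.exp (-r * h) * Complex.exp (h * (2 * v))) ^ s) := by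
    intro u v r
    simp only [← Complex.exp_add, ← Complex.exp_nat_mul, mul_sub]
    congr 2 <;> ring
  rw [← sub_mul, ← mul_sub, hb, strWeight]
  simp only [Algebra.algebraMap_self, RingHom.id_apply, pointPar, ← Complex.exp_int_mul,
    Int.cast_neg]
  ring

theorem latChar_merge {z : Fin (n + 1) → ℂ} {i j : Fin (n + 1)} (hij : i ≠ j)
    (hz : Complex.exp (h * (2 * dotProduct (posRoot n m i j) z)) = 1) (k : Fin (n + 1) → ℤ) :
    latChar n h m z k = latChar n h m z (mergeIdx i j k) := by
  have h1 : latChar n h m z (rootVec i j) = 1 := by rw [latChar, ← posRoot_eq, hz]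
  have hpow : ∀ t : ℤ, latChar n h m z (t • rootVec i j) = latChar n h m z (rootVec i j) ^ t := by
    intro t
    rw [latChar, latChar, ← Complex.exp_int_mul]
    have : latticePt n m (t • rootVec i j) = (t : ℂ) • latticePt n m (rootVec i j) := by
      ext a; simp [latticePt, mul_assoc]
    rw [this, smul_dotProduct, smul_eq_mul]
    congr 1; ring
  have h2 : mergeIdx i j k = k + (k j) • rootVec i j := by
    ext a
    simp only [mergeIdx, rootVec, Pi.add_apply, Pi.smul_apply, Pi.sub_apply, smul_eq_mul]
    grind
  rw [h2, latChar_add, hpow, h1, one_zpow, mul_one]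

open Classical in
-- On the hyperplane the characters on one line in the root direction coincide, so the sum collects
-- into one term per line.
theorem sum_latChar_merge {z : Fin (n + 1) → ℂ} {i j : Fin (n + 1)} (hij : i ≠ j)
    (hz : Complex.exp (h * (2 * dotProduct (posRoot n m i j) z)) = 1)
    (f : (Fin (n + 1) → ℤ) →₀ ℂ) (g : (Fin (n + 1) → ℤ) → ℂ) :
    (f.sum fun k a => a * g k * latChar n h m z k) =
      ∑ c ∈ f.support.image (mergeIdx i j),
        (f.sum fun k a => if mergeIdx i j k = c then a * g k else 0) * latChar n h m z c := by
  simp only [Finsupp.sum]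
  rw [← Finset.sum_fiberwise_of_maps_to (g := mergeIdx i j) (t := f.support.image (mergeIdx i j))
    fun k hk => Finset.mem_image_of_mem _ hk]
  refine Finset.sum_congr rfl fun c _ => ?_
  rw [← Finset.sum_filter, Finset.sum_mul]
  refine Finset.sum_congr rfl fun k hk => ?_
  rw [latChar_merge hij hz, (Finset.mem_filter.1 hk).2]

/-- The characters of the lattice are linearly independent. -/
theorem eq_zero_of_sum_latChar (hm : 0 < m) (hq : ∀ k : ℕ, 0 < k → Complex.exp h ^ k ≠ 1)
    (T : Finset (Fin (n + 1) → ℤ)) (b : (Fin (n + 1) → ℤ) → ℂ)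
    (hb : ∀ z, ∑ c ∈ T, b c * latChar n h m z c = 0) : ∀ c ∈ T, b c = 0 := by
  have hh : h ≠ 0 := fun h0 => hq 1 one_pos (by simp [h0])
  let χ : (Fin (n + 1) → ℤ) → (Multiplicative (Fin (n + 1) → ℂ) →* ℂ) := fun c =>
    { toFun := fun z => latChar n h m z.toAdd c
      map_one' := by simp [latChar]
      map_mul' := fun z z' => by
        rw [latChar, latChar, latChar, ← Complex.exp_add, toAdd_mul, dotProduct_add]
        congr 1; ring }
  have hχ : Function.Injective χ := by
    intro c c' hcc
    ext i
    have := DFunLike.congr_fun hcc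
      (Multiplicative.ofAdd (Pi.single i (2 * unitLen n m i)⁻¹ : Fin (n + 1) → ℂ))
    simp only [χ, MonoidHom.coe_mk, OneHom.coe_mk, toAdd_ofAdd, latChar, dotProduct_single,
      latticePt] at this
    have hu := unitLen_ne_zero (n := n) hm i
    have e : ∀ k : ℤ, Complex.exp (h * (2 * (k * unitLen n m i * (2 * unitLen n m i)⁻¹))) =
        Complex.exp h ^ k := by
      intro k
      rw [← Complex.exp_int_mul]
      congr 1
      field_simp
    rw [e, e] at this
    exact zpow_injective_of_pow_ne_one (Complex.exp_ne_zero h) hq this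
  have hli := (linearIndependent_monoidHom (Multiplicative (Fin (n + 1) → ℂ)) ℂ).comp χ hχ
  rw [linearIndependent_iff'] at hli
  refine hli T b ?_
  ext z
  simpa [χ] using hb z.toAdd

/-- The conditions on the hyperplanes `q^{2(α,z)} = 1` in terms of coefficients. -/
theorem quasiInv_pointPar_iff (hm : 0 < m) (hq : ∀ k : ℕ, 0 < k → Complex.exp h ^ k ≠ 1)
    (x : Fin (n + 1) → ℂ) (f : (Fin (n + 1) → ℤ) →₀ ℂ) :
    QuasiInv (Complex.exp h) n m (pointPar n h m x) f ↔
      ∀ z, ∀ i j, i < j → ∀ s ∈ Finset.Icc 1 (rootMult n m j),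
        Complex.exp (h * (2 * dotProduct (posRoot n m i j) z)) = 1 →
        latSum n h m x f (z + ((s : ℂ) / 2) • posRoot n m i j) =
          latSum n h m x f (z - ((s : ℂ) / 2) • posRoot n m i j) := by
  classical
  have hequiv : ∀ z i j (s : ℕ), latSum n h m x f (z + ((s : ℂ) / 2) • posRoot n m i j) =
          latSum n h m x f (z - ((s : ℂ) / 2) • posRoot n m i j) ↔
      (f.sum fun k a => a * strWeight (Complex.exp h) n m (pointPar n h m x) i j s k *
        latChar n h m z k) = 0 := by
    intro z i j s
    rw [← sub_eq_zero, latSum_shift_sub, mul_eq_zero, or_iff_right]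
    exact mul_ne_zero (Complex.exp_ne_zero _) (pow_ne_zero _ (Complex.exp_ne_zero _))
  constructor
  · intro hf z i j hij s hs hz
    rw [hequiv, sum_latChar_merge hij.ne hz]
    refine Finset.sum_eq_zero fun c _ => ?_
    have := hf i j hij s hs c
    rw [Finsupp.sum] at this ⊢
    refine mul_eq_zero_of_left (Eq.trans (Finset.sum_congr rfl fun k _ => ?_) this) _
    congr
  · intro hf i j hij s hs c
    by_cases hc : c ∈ f.support.image (mergeIdx i j)
    · have hcj : ∀ c ∈ f.support.image (mergeIdx i j), c j = 0 := by
        intro c hc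
        obtain ⟨k, -, rfl⟩ := Finset.mem_image.1 hc
        simp [mergeIdx]
      have := eq_zero_of_sum_latChar hm hq (f.support.image (mergeIdx i j))
        (fun c => f.sum fun k a => if mergeIdx i j k = c then
          a * strWeight (Complex.exp h) n m (pointPar n h m x) i j s k else 0) ?_ c hc
      · refine Eq.trans (Finset.sum_congr rfl fun k _ => ?_) this
        congr
      · intro z
        have hu := unitLen_ne_zero (n := n) hm j
        -- Merged exponents do not involve the coordinate `j`. That coordinate can be adjusted to
        -- put `z` on the hyperplane without changing the characters, and their independence on the
        -- whole space applies.
        let z' := Function.update z j (unitLen n m i * z i / unitLen n m j)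
        have hz' : Complex.exp (h * (2 * dotProduct (posRoot n m i j) z')) = 1 := by
          rw [dotProduct_posRoot]
          simp only [z', Function.update_self, Function.update_of_ne hij.ne]
          rw [mul_div_cancel₀ _ hu]
          simp
        have h1 := (hequiv z' i j s).1 (hf z' i j hij s hs hz')
        rw [sum_latChar_merge hij.ne hz'] at h1
        refine Eq.trans (Finset.sum_congr rfl fun c hc => ?_) h1
        congr 1
        rw [latChar, latChar, dotProduct_latticePt, dotProduct_latticePt]
        congr 3
        refine Finset.sum_congr rfl fun a _ => ?_
        by_cases ha : a = j
        · rw [ha, hcj c hc]; simp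
        · simp [z', Function.update_of_ne ha]
    · refine Finset.sum_eq_zero fun k hk => ?_
      dsimp only
      rw [if_neg]
      rintro rfl
      exact hc (Finset.mem_image_of_mem _ hk)

end Geometry

end

noncomputable section

open MvPolynomial

/-! ### Existence and uniqueness of the normalized Baker–Akhiezer function -/

section BakerAkhiezer

variable {n m : ℕ} {h : ℂ}

theorem sum_eq_latSum (ψ : (Fin (n + 1) → ℤ) →₀ ((Fin (n + 1) → ℂ) → ℂ)) (x z : Fin (n + 1) → ℂ) :
    Complex.exp (h * (2 * dotProduct x z)) * ∑ k ∈ ψ.support,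
      ψ k x * Complex.exp (h * (2 * dotProduct (latticePt n m k - rhoVec n m) z)) =
    latSum n h m x (ψ.mapRange (fun f => f x) rfl) z := by
  rw [latSum, Finsupp.sum_mapRange_index fun k => zero_mul _, Finsupp.sum, Finset.mul_sum,
    Finset.mul_sum]
  refine Finset.sum_congr rfl fun k _ => ?_
  rw [latChar, mul_left_comm, mul_left_comm (Complex.exp _), ← Complex.exp_add, ← Complex.exp_add]
  congr 2
  rw [sub_dotProduct, sub_dotProduct]
  ring

/-- On every real line in a suitable direction the parameters are generic off a countable set. -/
theorem dense_generic (hh : h ≠ 0) (hm : 0 < m) (x : Fin (n + 1) → ℂ) :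
    ∃ v : Fin (n + 1) → ℂ, Dense {t : ℝ | ∀ i j, i < j →
      GenericPair (Complex.exp h) (pointPar n h m (x + (t : ℂ) • v)) i j} := by
  -- Along this direction the parameter of index `i` is multiplied by `e^{t i}`. Comparing absolute
  -- values shows that each forbidden relation holds for at most one real `t`, and there are
  -- countably many relations.
  let v : Fin (n + 1) → ℂ := fun i => ((i : ℕ) : ℂ) / (2 * h * unitLen n m i)
  refine ⟨v, ?_⟩
  have hpar : ∀ (t : ℝ) i, pointPar n h m (x + (t : ℂ) • v) i =
      pointPar n h m x i * Complex.exp (((t * (i : ℕ) : ℝ)) : ℂ) := by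
    intro t i
    have hu := unitLen_ne_zero (n := n) hm i
    rw [pointPar, pointPar, ← Complex.exp_add]
    congr 1
    simp only [v, Pi.sub_apply, Pi.add_apply, Pi.smul_apply, smul_eq_mul]
    push_cast
    field_simp
    ring
  let B : Fin (n + 1) × Fin (n + 1) × ℤ → Set ℝ := fun p => {t | p.1 < p.2.1 ∧
    pointPar n h m (x + (t : ℂ) • v) p.1 =
      algebraMap ℂ ℂ (Complex.exp h ^ p.2.2) * pointPar n h m (x + (t : ℂ) • v) p.2.1}
  have hB : ∀ p, (B p).Subsingleton := by
    rintro ⟨i, j, a⟩ t ⟨hij, ht⟩ t' ⟨-, ht'⟩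
    simp only [hpar, Algebra.algebraMap_self, RingHom.id_apply] at hij ht ht'
    have e1 := congrArg (fun w => ‖w‖) ht
    have e2 := congrArg (fun w => ‖w‖) ht'
    simp only [norm_mul, Complex.norm_exp_ofReal] at e1 e2
    have hi : (0 : ℝ) < ‖pointPar n h m x i‖ := norm_pos_iff.2 (Complex.exp_ne_zero _)
    have hc : Real.exp (t * (i : ℕ)) * Real.exp (t' * (j : ℕ)) =
        Real.exp (t' * (i : ℕ)) * Real.exp (t * (j : ℕ)) := by
      apply mul_left_cancel₀ hi.ne'
      linear_combination Real.exp (t' * (j : ℕ)) * e1 - Real.exp (t * (j : ℕ)) * e2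
    rw [← Real.exp_add, ← Real.exp_add, Real.exp_eq_exp] at hc
    have hne : ((i : ℕ) : ℝ) - (j : ℕ) ≠ 0 := sub_ne_zero.2 (by
      have : (i : ℕ) ≠ (j : ℕ) := fun h => hij.ne (Fin.ext h)
      exact_mod_cast this)
    apply mul_right_cancel₀ hne
    linarith
  have hcount : (⋃ p, B p).Countable := Set.countable_iUnion fun p => (hB p).countable
  have hd := hcount.dense_compl ℝ
  refine Dense.mono ?_ hd
  intro t ht i j hij a h0
  exact ht (Set.mem_iUnion.2 ⟨(i, j, a), hij, h0⟩)

/-- At a generic `x` the difference of the coefficient systems is a quasi-invariant without its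
coefficient at `2ρ`, hence zero. Continuity along a line through an arbitrary `x`, on which generic
points are dense, removes the genericity assumption. -/
theorem IsNormalizedBA.unique (hm : 0 < m) (hq : ∀ k : ℕ, 0 < k → Complex.exp h ^ k ≠ 1)
    {Ψ Ψ' : (Fin (n + 1) → ℂ) → (Fin (n + 1) → ℂ) → ℂ} (hΨ : IsNormalizedBA n h m Ψ)
    (hΨ' : IsNormalizedBA n h m Ψ') : Ψ = Ψ' := by
  have hh : h ≠ 0 := fun h0 => hq 1 one_pos (by simp [h0])
  obtain ⟨⟨ψ, hs, hc, hsum, hn⟩, hz⟩ := hΨ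
  obtain ⟨⟨ψ', hs', hc', hsum', hn'⟩, hz'⟩ := hΨ'
  simp only [sum_eq_latSum] at hsum hsum'
  let f : (Fin (n + 1) → ℂ) → (Fin (n + 1) → ℤ) →₀ ℂ := fun x => ψ.mapRange (fun f => f x) rfl
  let f' : (Fin (n + 1) → ℂ) → (Fin (n + 1) → ℤ) →₀ ℂ := fun x => ψ'.mapRange (fun f => f x) rfl
  have hQ : ∀ x, QuasiInv (Complex.exp h) n m (pointPar n h m x) (f x) := fun x =>
    (quasiInv_pointPar_iff hm hq x _).2 fun z i j hij s hs he => by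
      rw [← hsum, ← hsum]; exact hz x z i j hij s hs he
  have hQ' : ∀ x, QuasiInv (Complex.exp h) n m (pointPar n h m x) (f' x) := fun x =>
    (quasiInv_pointPar_iff hm hq x _).2 fun z i j hij s hs he => by
      rw [← hsum', ← hsum']; exact hz' x z i j hij s hs he
  have hgen : ∀ x, (∀ i j, i < j → GenericPair (Complex.exp h) (pointPar n h m x) i j) →
      f x = f' x := by
    intro x hx
    rw [← sub_eq_zero]
    refine ((hQ x).sub (hQ' x)).eq_zero (Complex.exp_ne_zero h) hq hm hx (fun k hk => ?_)
      (stdWt_injective (n := n)) ?_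
    · rw [Finsupp.mem_support_iff, Finsupp.sub_apply] at hk
      rw [← sub_rhoVec_mem_baPolytope hm]
      by_cases hk1 : k ∈ ψ.support
      · exact hs k hk1
      · refine hs' k (by_contra fun hk2 => hk ?_)
        simp only [f, f', Finsupp.mapRange_apply, Finsupp.notMem_support_iff.1 hk1,
          Finsupp.notMem_support_iff.1 hk2, Pi.zero_apply, sub_zero]
    · have hρ := (sub_rhoVec_eq_rhoVec (n := n) hm).2 rfl
      simp only [f, f', Finsupp.sub_apply, Finsupp.mapRange_apply, hn _ hρ, hn' _ hρ, sub_self]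
  have hall : ∀ x, f x = f' x := by
    intro x
    obtain ⟨v, hv⟩ := dense_generic hh hm x
    ext k
    have hcont : Continuous fun t : ℝ => x + (t : ℂ) • v := by fun_prop
    have he := Continuous.ext_on hv ((hc k).comp hcont) ((hc' k).comp hcont) fun t ht =>
      DFunLike.congr_fun (hgen _ ht) k
    have h0 := congrFun he 0
    simp only [Function.comp_apply, Complex.ofReal_zero, zero_smul, add_zero] at h0
    exact h0
  ext x z
  rw [hsum, hsum']
  exact congrArg (fun g => latSum n h m x g z) (hall x)

/-- Evaluation at a point of `V`. -/
def evalHom (n : ℕ) (h : ℂ) (m : ℕ) (x : Fin (n + 1) → ℂ) : MvPolynomial (Fin (n + 1)) ℂ →ₐ[ℂ] ℂ :=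
  aeval fun i => Complex.exp (h * (unitLen n m i * x i))

theorem evalHom_apply (x : Fin (n + 1) → ℂ) (p : MvPolynomial (Fin (n + 1)) ℂ) :
    evalHom n h m x p = evalAt n h m x p := by
  rw [evalHom, evalAt, aeval_eq_eval]

theorem evalHom_shiftedPar (x : Fin (n + 1) → ℂ) (i : Fin (n + 1)) :
    evalHom n h m x (shiftedPar (Complex.exp h) n m (sqVar n) i) = pointPar n h m x i := by
  rw [shiftedPar, map_mul, AlgHom.commutes, sqVar, map_pow, evalHom, aeval_X, pointPar, rhoVec_eq,
    Algebra.algebraMap_self, RingHom.id_apply, ← Complex.exp_int_mul, ← Complex.exp_nat_mul,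
    ← Complex.exp_add]
  congr 1
  simp only [Pi.sub_apply, Pi.smul_apply, latticePt, smul_eq_mul]
  push_cast
  rw [← unitLen_sq]
  ring

theorem continuous_evalAt (p : MvPolynomial (Fin (n + 1)) ℂ) :
    Continuous fun x => evalAt n h m x p := by
  simp only [evalAt]
  have := MvPolynomial.continuous_eval p
  exact this.comp (by fun_prop)

theorem evalAt_pairMonomial_ne_zero (x : Fin (n + 1) → ℂ) :
    evalAt n h m x (pairMonomial n m) ≠ 0 := by
  simp only [evalAt, pairMonomial, map_prod, map_pow, map_mul, eval_X]
  exact Finset.prod_ne_zero_iff.2 fun _ _ => Finset.prod_ne_zero_iff.2 fun _ _ =>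
    pow_ne_zero _ (mul_ne_zero (Complex.exp_ne_zero _) (Complex.exp_ne_zero _))

/-- The constant relating the normalizations. -/
def normConst (n : ℕ) (h : ℂ) (m : ℕ) : ℂ :=
  ∏ i : Fin (n + 1), ∏ j ∈ Finset.Ioi i, ∏ l ∈ Finset.Icc 1 (rootMult n m j),
    Complex.exp (-(h * (l * (latScale n m i + latScale n m j) / 2)))

theorem normConst_mul_evalAt (x : Fin (n + 1) → ℂ) :
    normConst n h m * evalAt n h m x (vtxProd (Complex.exp h) n m (sqVar n) (stdWt n)) =
      evalAt n h m x (pairMonomial n m) *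
      ∏ i : Fin (n + 1), ∏ j ∈ Finset.Ioi i, ∏ l ∈ Finset.Icc 1 (rootMult n m j),
        qnum h (dotProduct (posRoot n m i j) (((l : ℂ) / 2) • posRoot n m i j - x)) := by
  rw [normConst, vtxProd, pairMonomial, ← evalHom_apply, ← evalHom_apply]
  simp only [map_prod, ← Finset.prod_mul_distrib]
  refine Finset.prod_congr rfl fun i _ => Finset.prod_congr rfl fun j hj => ?_
  have hij := Finset.mem_Ioi.1 hj
  have hpow : (X i * X j : MvPolynomial (Fin (n + 1)) ℂ) ^ rootMult n m j =
      ∏ l ∈ Finset.Icc 1 (rootMult n m j), (X i * X j) := by simp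
  rw [if_pos (stdWt_lt.2 hij), posFac, hpow, map_prod, map_prod, ← Finset.prod_mul_distrib,
    ← Finset.prod_mul_distrib]
  refine Finset.prod_congr rfl fun l _ => ?_
  have hd : dotProduct (posRoot n m i j) (((l : ℂ) / 2) • posRoot n m i j - x) =
      l * (latScale n m i + latScale n m j) / 2 - (unitLen n m i * x i - unitLen n m j * x j) := by
    rw [dotProduct_sub, dotProduct_smul, dotProduct_posRoot, dotProduct_posRoot, ← unitLen_sq,
      ← unitLen_sq, posRoot]
    simp only [Pi.sub_apply, Pi.single_eq_same, Pi.single_eq_of_ne hij.ne,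
      Pi.single_eq_of_ne hij.ne', smul_eq_mul]
    ring
  rw [hd, map_sub, map_mul, AlgHom.commutes, Algebra.algebraMap_self, RingHom.id_apply, sqVar,
    map_pow, sqVar, map_pow, map_mul, evalHom, aeval_X, aeval_X, qnum, ← Complex.exp_int_mul,
    ← Complex.exp_nat_mul, ← Complex.exp_nat_mul, ← Complex.exp_add, ← Complex.exp_add, mul_sub,
    mul_sub, ← Complex.exp_add, ← Complex.exp_add, ← Complex.exp_add, ← Complex.exp_add]
  congr 2 <;> push_cast <;> ring

/-- The coefficients at a point of the function attached to a polynomial quasi-invariant. -/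
def pointCoeffs (h : ℂ) (m : ℕ) (F : (Fin (n + 1) → ℤ) →₀ MvPolynomial (Fin (n + 1)) ℂ)
    (x : Fin (n + 1) → ℂ) : (Fin (n + 1) → ℤ) →₀ ℂ :=
  (normConst n h m / evalAt n h m x (pairMonomial n m)) •
    F.mapRange (evalHom n h m x) (map_zero _)

/-- The conditions specialise to every `x` by base change along evaluation. The monomial denominator
never vanishes, so the coefficients are continuous everywhere, and `normConst` corrects the
normalization at `ρ`. -/
theorem isNormalizedBA_latSum (hm : 0 < m) (hq : ∀ k : ℕ, 0 < k → Complex.exp h ^ k ≠ 1)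
    {F : (Fin (n + 1) → ℤ) →₀ MvPolynomial (Fin (n + 1)) ℂ}
    (hF : QuasiInv (Complex.exp h) n m (shiftedPar (Complex.exp h) n m (sqVar n)) F)
    (hZ : ∀ k ∈ F.support, k ∈ zonotope n m)
    (hv : F (vtx n m (stdWt n)) = vtxProd (Complex.exp h) n m (sqVar n) (stdWt n)) :
    IsNormalizedBA n h m fun x z => latSum n h m x (pointCoeffs h m F x) z := by
  let ψ : (Fin (n + 1) → ℤ) →₀ ((Fin (n + 1) → ℂ) → ℂ) := F.mapRange
    (fun p x => normConst n h m / evalAt n h m x (pairMonomial n m) * evalAt n h m x p)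
    (by ext x; simp [evalAt])
  have hψ : ∀ x, ψ.mapRange (fun f => f x) rfl = pointCoeffs h m F x := by
    intro x
    ext k
    simp only [ψ, pointCoeffs, Finsupp.mapRange_apply, Finsupp.smul_apply, smul_eq_mul,
      evalHom_apply]
  refine ⟨⟨ψ, fun k hk => ?_, fun k => ?_, fun x z => ?_, fun k hk x => ?_⟩, fun x => ?_⟩
  · exact (sub_rhoVec_mem_baPolytope hm).2 (hZ k (Finsupp.support_mapRange hk))
  · simp only [ψ, Finsupp.mapRange_apply]
    exact (continuous_const.div (continuous_evalAt _) evalAt_pairMonomial_ne_zero).mul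
      (continuous_evalAt _)
  · rw [sum_eq_latSum, hψ]
  · rw [(sub_rhoVec_eq_rhoVec hm).1 hk]
    simp only [ψ, Finsupp.mapRange_apply, hv]
    rw [div_mul_eq_mul_div, normConst_mul_evalAt,
      mul_div_cancel_left₀ _ (evalAt_pairMonomial_ne_zero x)]
  · refine (quasiInv_pointPar_iff hm hq x _).1 ?_
    have := (quasiInv_map (evalHom n h m x) hF).smul
      (normConst n h m / evalAt n h m x (pairMonomial n m))
    simp only [evalHom_shiftedPar] at this
    exact this

end BakerAkhiezer

end

noncomputable section

open MvPolynomial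

/-! ### Difference operators acting on Baker–Akhiezer functions -/

section Action

variable {n m : ℕ} {h : ℂ}

theorem evalHom_shiftHom (x : Fin (n + 1) → ℂ) (ν : Fin (n + 1) → ℤ)
    (f : MvPolynomial (Fin (n + 1)) ℂ) :
    evalHom n h m x (shiftHom n h m ν f) = evalHom n h m (x + latticePt n m ν) f := by
  have : (evalHom n h m x).comp (shiftHom n h m ν) = evalHom n h m (x + latticePt n m ν) := by
    ext1 i
    rw [AlgHom.comp_apply, shiftHom, aeval_X, map_mul, ← algebraMap_eq, AlgHom.commutes, evalHom,
      aeval_X, evalHom, aeval_X, shiftFactor_natCast, Algebra.algebraMap_self, RingHom.id_apply,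
      ← Complex.exp_int_mul, ← Complex.exp_add, Pi.add_apply, latticePt]
    congr 1
    push_cast
    rw [← unitLen_sq]
    ring
  exact DFunLike.congr_fun this f

/-- The factor by which a shift multiplies `pairMonomial`. -/
def pairFactor (n : ℕ) (h : ℂ) (m : ℕ) (ν : Fin (n + 1) → ℤ) : ℂ :=
  ∏ i : Fin (n + 1), ∏ j ∈ Finset.Ioi i,
    (shiftFactor n h m ν i * shiftFactor n h m ν j) ^ rootMult n m j

theorem pairFactor_ne_zero (ν : Fin (n + 1) → ℤ) : pairFactor n h m ν ≠ 0 :=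
  Finset.prod_ne_zero_iff.2 fun _ _ => Finset.prod_ne_zero_iff.2 fun _ _ =>
    pow_ne_zero _ (mul_ne_zero (Complex.exp_ne_zero _) (Complex.exp_ne_zero _))

theorem shiftHom_pairMonomial (ν : Fin (n + 1) → ℤ) :
    shiftHom n h m ν (pairMonomial n m) = C (pairFactor n h m ν) * pairMonomial n m := by
  rw [pairMonomial, pairFactor]
  simp only [map_prod, map_pow, map_mul, ← Finset.prod_mul_distrib]
  refine Finset.prod_congr rfl fun i _ => Finset.prod_congr rfl fun j _ => ?_
  rw [← mul_pow, shiftHom, aeval_X, aeval_X]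
  ring

/-- Coefficientwise form of an eigenvalue equation, with denominators cleared. -/
theorem DiffOp.poly_identity {A P : DiffOp n h m} {γ : ℕ → ℂ} {s : ℕ}
    (hAP : A * P = P * ofPoly (powerPoly n γ s))
    {F : (Fin (n + 1) → ℤ) →₀ MvPolynomial (Fin (n + 1)) ℂ}
    (hF : ∀ k, coeffs P k = algebraMap _ (CoeffField n h m) (F k) /
      algebraMap _ (CoeffField n h m) (pairMonomial n m))
    {d : MvPolynomial (Fin (n + 1)) ℂ}
    {p : (Fin (n + 1) → ℤ) → MvPolynomial (Fin (n + 1)) ℂ}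
    (hp : ∀ ν, algebraMap _ (CoeffField n h m) (p ν) = algebraMap _ _ d * coeffs A ν)
    (k : Fin (n + 1) → ℤ) :
    ∑ ν ∈ (coeffs A).support, p ν * (C (pairFactor n h m ν)⁻¹ * shiftHom n h m ν (F (k - ν))) =
      d * ∑ a, C (if a = Fin.last n then γ s else 1) * F (k - Pi.single a (s : ℤ)) := by
  have hpm : algebraMap _ (CoeffField n h m) (pairMonomial n m) ≠ 0 := fun h0 =>
    pairMonomial_ne_zero _ _ (CoeffField.algebraMap_injective (h0.trans (map_zero _).symm))
  have hl : coeffs (A * P) k = ∑ ν ∈ (coeffs A).support,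
      coeffs A ν * (Multiplicative.ofAdd ν • coeffs P (k - ν)) := by
    conv_lhs => rw [sum_term_coeffs A]
    rw [Finsupp.sum, Finset.sum_mul, map_sum, Finsupp.finsetSum_apply]
    simp only [coeffs_term_mul]
  have hr : coeffs (A * P) k = ∑ a, algebraMap ℂ _ (if a = Fin.last n then γ s else 1) *
      coeffs P (k - Pi.single a (s : ℤ)) := by
    rw [hAP, ofPoly_powerPoly, Finset.mul_sum, map_sum, Finsupp.finsetSum_apply]
    simp only [coeffs_mul_const_term]
  have hlr := hl.symm.trans hr
  apply CoeffField.algebraMap_injective (n := n) (h := h) (m := m)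
  rw [map_sum, map_mul, map_sum]
  have e1 : ∀ ν, algebraMap _ (CoeffField n h m)
      (p ν * (C (pairFactor n h m ν)⁻¹ * shiftHom n h m ν (F (k - ν)))) =
      algebraMap _ _ d * algebraMap _ _ (pairMonomial n m) *
        (coeffs A ν * (Multiplicative.ofAdd ν • coeffs P (k - ν))) := by
    intro ν
    have hc : algebraMap ℂ (CoeffField n h m) (pairFactor n h m ν) ≠ 0 :=
      (map_ne_zero _).2 (pairFactor_ne_zero ν)
    rw [hF, CoeffField.smul_div', CoeffField.smul_algebraMap, CoeffField.smul_algebraMap,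
      shiftHom_pairMonomial, map_mul, map_mul, map_mul, hp, CoeffField.algebraMap_C,
      CoeffField.algebraMap_C, map_inv₀]
    field_simp
  have e2 : ∀ a : Fin (n + 1), algebraMap _ (CoeffField n h m)
      (C (if a = Fin.last n then γ s else 1) * F (k - Pi.single a (s : ℤ))) =
      algebraMap _ _ (pairMonomial n m) * (algebraMap ℂ _ (if a = Fin.last n then γ s else 1) *
        coeffs P (k - Pi.single a (s : ℤ))) := by
    intro a
    rw [hF, map_mul, CoeffField.algebraMap_C]
    field_simp
  simp only [e1, e2, ← Finset.mul_sum, hlr, mul_assoc]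

theorem latSum_pointCoeffs (F : (Fin (n + 1) → ℤ) →₀ MvPolynomial (Fin (n + 1)) ℂ)
    (x z : Fin (n + 1) → ℂ) :
    latSum n h m x (pointCoeffs h m F x) z =
      Complex.exp (h * (2 * dotProduct (x - rhoVec n m) z)) *
        (normConst n h m / evalHom n h m x (pairMonomial n m) *
          Finsupp.linearCombination ℂ (latChar n h m z)
            (F.mapRange (evalHom n h m x) (map_zero _))) := by
  rw [latSum, pointCoeffs, evalHom_apply]
  congr 1
  exact map_smul (Finsupp.linearCombination ℂ (latChar n h m z)) _ _

theorem linearCombination_latChar_shift (z : Fin (n + 1) → ℂ) (ν : Fin (n + 1) → ℤ)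
    (g : (Fin (n + 1) → ℤ) →₀ ℂ) :
    Finsupp.linearCombination ℂ (latChar n h m z) (g.equivMapDomain (Equiv.addRight ν)) =
      latChar n h m z ν * Finsupp.linearCombination ℂ (latChar n h m z) g := by
  rw [Finsupp.linearCombination_equivMapDomain, Finsupp.linearCombination_apply,
    Finsupp.linearCombination_apply, Finsupp.sum, Finsupp.sum, Finset.mul_sum]
  refine Finset.sum_congr rfl fun k _ => ?_
  simp only [Function.comp_apply, Equiv.coe_addRight, latChar_add, smul_eq_mul]
  ring

theorem deformedPowerSum_eq (s : ℕ) (z : Fin (n + 1) → ℂ) :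
    deformedPowerSum n h m s z = ∑ a, (if a = Fin.last n then powerCoeff h m s else 1) *
      latChar n h m z (Pi.single a (s : ℤ)) := by
  have hch : ∀ a, latChar n h m z (Pi.single a (s : ℤ)) =
      Complex.exp (h * (2 * s * unitLen n m a * z a)) := by
    intro a
    rw [latChar, dotProduct_latticePt, Finset.sum_eq_single a]
    · simp only [Pi.single_eq_same, Int.cast_natCast]
      congr 1; ring
    · intro b _ hb; simp [Pi.single_eq_of_ne hb]
    · simp
  simp only [hch]
  rw [Fin.sum_univ_castSucc, if_pos rfl, deformedPowerSum, powerCoeff, unitLen, if_pos rfl]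
  congr 1
  refine Finset.sum_congr rfl fun i _ => ?_
  rw [if_neg (Fin.castSucc_lt_last i).ne, unitLen, if_neg (Fin.castSucc_lt_last i).ne, one_mul,
    mul_one]

theorem DiffOp.sum_support_coeff (A : DiffOp n h m)
    (g : Multiplicative (Fin (n + 1) → ℤ) → ℂ) :
    ∑ ν ∈ A.coeff.support, g ν = ∑ ν ∈ (coeffs A).support, g (Multiplicative.ofAdd ν) :=
  Finset.sum_bij' (fun ν _ => ν.toAdd) (fun ν _ => Multiplicative.ofAdd ν)
    (fun _ hν => Finsupp.mem_support_iff.2 fun h0 => Finsupp.mem_support_iff.1 hν h0)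
    (fun _ hν => Finsupp.mem_support_iff.2 fun h0 => Finsupp.mem_support_iff.1 hν h0)
    (fun _ _ => rfl) (fun _ _ => rfl) (fun _ _ => rfl)

/-- The coefficients of the formal identity are evaluated at `x` and paired with the characters in
`z`. The right factor `T^k` becomes multiplication by `q^{2(k,z)}`, so the power sum polynomial
becomes the deformed power sum. -/
theorem DiffOp.mapsTo_latSum {A P : DiffOp n h m} {s : ℕ}
    (hAP : A * P = P * ofPoly (powerPoly n (powerCoeff h m) s))
    {F : (Fin (n + 1) → ℤ) →₀ MvPolynomial (Fin (n + 1)) ℂ}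
    (hF : ∀ k, coeffs P k = algebraMap _ (CoeffField n h m) (F k) /
      algebraMap _ (CoeffField n h m) (pairMonomial n m)) (z : Fin (n + 1) → ℂ) :
    A.MapsTo (fun x => latSum n h m x (pointCoeffs h m F x) z)
      (fun x => deformedPowerSum n h m s z * latSum n h m x (pointCoeffs h m F x) z) := by
  intro d p hp x
  let L := Finsupp.linearCombination ℂ (latChar n h m z)
  let G : (Fin (n + 1) → ℂ) → (Fin (n + 1) → ℤ) →₀ ℂ := fun y =>
    F.mapRange (evalHom n h m y) (map_zero _)
  have hid := DiffOp.poly_identity (p := fun ν => p (Multiplicative.ofAdd ν)) hAP hF fun ν => hp _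
  have hG : ∑ ν ∈ (coeffs A).support, (evalHom n h m x (p (Multiplicative.ofAdd ν)) *
        (pairFactor n h m ν)⁻¹) • (G (x + latticePt n m ν)).equivMapDomain (Equiv.addRight ν) =
      evalHom n h m x d • ∑ a : Fin (n + 1), (if a = Fin.last n then powerCoeff h m s else 1) •
        (G x).equivMapDomain (Equiv.addRight (Pi.single a (s : ℤ))) := by
    ext k
    have := congrArg (evalHom n h m x) (hid k)
    simp only [map_sum, map_mul, evalHom_shiftHom] at this
    simp only [Finsupp.finsetSum_apply, Finsupp.smul_apply, Finsupp.equivMapDomain_apply, G,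
      Finsupp.mapRange_apply, smul_eq_mul, Equiv.addRight_symm, Equiv.coe_addRight, ← sub_eq_add_neg,
      mul_assoc]
    simpa only [← algebraMap_eq, AlgHom.commutes, Algebra.algebraMap_self, RingHom.id_apply]
      using this
  have hL := congrArg L hG
  simp only [map_sum, map_smul, smul_eq_mul, L, linearCombination_latChar_shift] at hL
  rw [DiffOp.sum_support_coeff]
  simp only [toAdd_ofAdd]
  have hν : ∀ ν, evalAt n h m x (p (Multiplicative.ofAdd ν)) *
      latSum n h m (x + latticePt n m ν) (pointCoeffs h m F (x + latticePt n m ν)) z =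
      Complex.exp (h * (2 * dotProduct (x - rhoVec n m) z)) *
        (normConst n h m / evalHom n h m x (pairMonomial n m)) *
      (evalHom n h m x (p (Multiplicative.ofAdd ν)) * (pairFactor n h m ν)⁻¹ *
        (latChar n h m z ν * Finsupp.linearCombination ℂ (latChar n h m z)
          (G (x + latticePt n m ν)))) := by
    intro ν
    have hexp : Complex.exp (h * (2 * dotProduct (x + latticePt n m ν - rhoVec n m) z)) =
        Complex.exp (h * (2 * dotProduct (x - rhoVec n m) z)) * latChar n h m z ν := by
      rw [latChar, ← Complex.exp_add, add_sub_right_comm, add_dotProduct]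
      congr 1; ring
    rw [latSum_pointCoeffs, ← evalHom_apply, hexp, ← evalHom_shiftHom x ν (pairMonomial n m),
      shiftHom_pairMonomial, map_mul, ← algebraMap_eq, AlgHom.commutes, Algebra.algebraMap_self,
      RingHom.id_apply, div_mul_eq_div_div, div_right_comm]
    simp only [G, div_eq_mul_inv]
    ring
  simp only [hν, ← Finset.mul_sum, hL]
  rw [deformedPowerSum_eq, latSum_pointCoeffs, ← evalHom_apply]
  simp only [G, Finset.sum_mul, Finset.mul_sum]
  refine Finset.sum_congr rfl fun a _ => ?_
  ring

end Action

end

noncomputable section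

open MvPolynomial

/-! ### Commutativity and the action on Baker–Akhiezer functions -/

section Integrability

variable {n : ℕ} {h : ℂ}

theorem PowerSumsDefined.mono {m : ℂ} {s s' : ℕ} (hs : PowerSumsDefined h m s') (hss : s ≤ s') :
    PowerSumsDefined h m s := fun j hj => hs j (Finset.Icc_subset_Icc_right hss hj)

theorem powerSumsDefined_natCast (hq : ∀ k : ℕ, 0 < k → Complex.exp h ^ k ≠ 1) {m : ℕ} (hm : 0 < m)
    (s : ℕ) : PowerSumsDefined h m s := fun j hj => by
  rw [← Nat.cast_mul]
  exact DiffOp.qnum_natCast_ne_zero hq (Nat.mul_pos (Finset.mem_Icc.1 hj).1 hm)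

/-- Rational families that commute at the positive integers commute. -/
theorem IsFam.commute (hq : ∀ k : ℕ, 0 < k → Complex.exp h ^ k ≠ 1) {s s' : ℕ}
    {A B : ∀ m : ℂ, DiffOp n h m} (hA : IsFam {m | PowerSumsDefined h m s} A)
    (hB : IsFam {m | PowerSumsDefined h m s'} B)
    (hAB : ∀ m : ℕ, 0 < m → Commute (A m) (B m)) {m : ℂ} (hm : PowerSumsDefined h m s)
    (hm' : PowerSumsDefined h m s') : Commute (A m) (B m) := by
  have hA' := hA.mono (V := {m | PowerSumsDefined h m s ∧ PowerSumsDefined h m s'}) fun _ h => h.1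
  have hB' := hB.mono (V := {m | PowerSumsDefined h m s ∧ PowerSumsDefined h m s'}) fun _ h => h.2
  exact sub_eq_zero.1 (((hA'.mul hB').sub (hB'.mul hA')).eq_zero hq (fun k hk =>
    ⟨⟨powerSumsDefined_natCast hq hk s, powerSumsDefined_natCast hq hk s'⟩,
      sub_eq_zero.2 (hAB k hk)⟩) m ⟨hm, hm'⟩)

/-- At positive integers both operators have the Baker–Akhiezer series as a common eigenfunction;
rationality in `t` extends the relation to all admissible parameters. -/
theorem commute_elemOp (hq : ∀ k : ℕ, 0 < k → Complex.exp h ^ k ≠ 1) {s s' : ℕ} {m : ℂ}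
    (hm : PowerSumsDefined h m s) (hm' : PowerSumsDefined h m s') :
    Commute (elemOp n h m s) (elemOp n h m s') :=
  (isFam_elemOp s).commute hq (isFam_elemOp s') (fun k hk => by
    obtain ⟨P, F, hP, -⟩ := DiffOp.exists_isBakerAkhiezer (n := n) hq hk
    exact hP.commute (hP.elemOp_mul hk hq (DiffOp.powerCoeff_mul hq hk) s)
      (hP.elemOp_mul hk hq (DiffOp.powerCoeff_mul hq hk) s')) hm hm'

theorem commute_powerSumOp (hq : ∀ k : ℕ, 0 < k → Complex.exp h ^ k ≠ 1) {s s' : ℕ} (hs : 1 ≤ s)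
    (hs' : 1 ≤ s') {m : ℂ} (hm : PowerSumsDefined h m s) (hm' : PowerSumsDefined h m s') :
    Commute (powerSumOp n h m s) (powerSumOp n h m s') :=
  (isFam_powerSumOp s).commute hq (isFam_powerSumOp s') (fun k hk => by
    obtain ⟨P, F, hP, -⟩ := DiffOp.exists_isBakerAkhiezer (n := n) hq hk
    exact hP.commute (hP.powerSumOp_mul hk hq hs) (hP.powerSumOp_mul hk hq hs')) hm hm'

/-- A normalized Baker–Akhiezer function exists, and each is a joint eigenfunction. -/
theorem exists_isNormalizedBA (hq : ∀ k : ℕ, 0 < k → Complex.exp h ^ k ≠ 1) {m : ℕ} (hm : 0 < m) :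
    (∃ Ψ, IsNormalizedBA n h m Ψ) ∧ ∀ Ψ, IsNormalizedBA n h m Ψ → ∀ s, 1 ≤ s → ∀ z,
      (powerSumOp n h m s).MapsTo (fun x => Ψ x z) fun x => deformedPowerSum n h m s z * Ψ x z := by
  obtain ⟨P, F, hP, hF, hZ, hv, hco⟩ := DiffOp.exists_isBakerAkhiezer (n := n) hq hm
  have hΨ := isNormalizedBA_latSum hm hq hF hZ (hv _ (stdWt_injective n))
  refine ⟨⟨_, hΨ⟩, fun Ψ' hΨ' s hs z => ?_⟩
  rw [hΨ'.unique hm hq hΨ]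
  exact DiffOp.mapsTo_latSum (hP.powerSumOp_mul hm hq hs) hco z

end Integrability

end

theorem mainTheorem12 (n : ℕ) (h : ℂ) (hq : ∀ k : ℕ, 0 < k → Complex.exp h ^ k ≠ 1) :
    ∃ D E : ℕ → DiffOpFamily n,
      -- both families are defined wherever the deformed power sums are
      (∀ s ∈ Finset.Icc 1 (n + 1), ∀ m : ℂ, PowerSumsDefined h m s →
        (D s).RegularAt h m ∧ (E s).RegularAt h m) ∧
      -- the first member is the deformed operator
      (∀ m : ℂ, PowerSumsDefined h m 1 →
        (D 1).spec h m = deformedOp n h m ∧ (E 1).spec h m = deformedOp n h m) ∧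
      -- commutativity for all values of the parameter
      (∀ s ∈ Finset.Icc 1 (n + 1), ∀ s' ∈ Finset.Icc 1 (n + 1), ∀ m : ℂ,
        PowerSumsDefined h m s → PowerSumsDefined h m s' →
        Commute ((D s).spec h m) ((D s').spec h m) ∧
        Commute ((E s).spec h m) ((E s').spec h m)) ∧
      -- at positive integers `D s` is the operator attached to the deformed power sum
      (∀ m : ℕ, 0 < m →
        (∃ Ψ, IsNormalizedBA n h m Ψ) ∧
        ∀ Ψ, IsNormalizedBA n h m Ψ → ∀ s ∈ Finset.Icc 1 (n + 1), ∀ z,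
          ((D s).spec h (m : ℂ)).MapsTo (fun x => Ψ x z)
            (fun x => deformedPowerSum n h m s z * Ψ x z)) ∧
      -- the `E s` are the elementary symmetric combinations of the power sums `D s`
      (∀ m : ℂ, (E 0).spec h m = 1) ∧
      (∀ s ∈ Finset.Icc 1 (n + 1), ∀ m : ℂ, PowerSumsDefined h m s →
        (s : DiffOp n h m) * (E s).spec h m =
          ∑ i ∈ Finset.Icc 1 s,
            (-1) ^ (i + 1) * ((E (s - i)).spec h m * (D i).spec h m)) ∧
      -- at `m = 1` they are the Macdonald–Ruijsenaars operators
      (∀ s ∈ Finset.Icc 1 (n + 1), (E s).spec h 1 = ruijsenaarsOp n h (-1) s) := by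
  -- Families are chosen for every `s`, including `s = 0`: there the regularity condition is empty,
  -- so `E 0` is the identity for all `m`.
  choose E hE using fun s => isFam_elemOp (n := n) (h := h) s
  choose D hD using fun s => isFam_powerSumOp (n := n) (h := h) s
  simp only [Set.mem_ofPred_eq] at hE hD
  refine ⟨D, E, fun s _ m hm => ⟨(hD s m hm).1, (hE s m hm).1⟩, fun m hm => ⟨?_, ?_⟩,
    fun s hs s' hs' m hm hm' => ⟨?_, ?_⟩, fun m hm => ?_, fun m => ?_, fun s _ m hm => ?_,
    fun s hs => ?_⟩
  · rw [(hD 1 m hm).2, powerSumOp_one]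
  · rw [(hE 1 m hm).2, elemOp_one]
  · rw [(hD s m hm).2, (hD s' m hm').2]
    exact commute_powerSumOp hq (Finset.mem_Icc.1 hs).1 (Finset.mem_Icc.1 hs').1 hm hm'
  · rw [(hE s m hm).2, (hE s' m hm').2]
    exact commute_elemOp hq hm hm'
  · obtain ⟨hex, hall⟩ := exists_isNormalizedBA (n := n) hq hm
    refine ⟨hex, fun Ψ hΨ s hs z => ?_⟩
    rw [(hD s m (powerSumsDefined_natCast hq hm s)).2]
    exact hall Ψ hΨ s (Finset.mem_Icc.1 hs).1 z
  · rw [(hE 0 m fun j hj => by simp at hj).2, elemOp_zero]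
  · rw [(hE s m hm).2, newton_identity elemOp_zero s]
    refine Finset.sum_congr rfl fun i hi => ?_
    rw [(hE (s - i) m (hm.mono (Nat.sub_le s i))).2, (hD i m (hm.mono (Finset.mem_Icc.1 hi).2)).2,
      powerSumOp]
  · have h1 := powerSumsDefined_natCast hq one_pos s
    rw [Nat.cast_one] at h1
    rw [(hE s 1 h1).2, elemOp_at_one hq (Finset.mem_Icc.1 hs).1]
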